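/- Let $K(x)=\frac{1-3\cos^2\theta}{|x|^3}$ on $\mathbb{R}^3$, where $\cos\theta=x_3/|x|$, and let $K*g$ denote the principal value convolution. Let $\lambda_1,\lambda_2\in\mathbb{R}$ belong to the unstable regime: $\lambda_1-\frac{4\pi}{3}\lambda_2<0$ if $\lambda_2>0$, $\lambda_1+\frac{8\pi}{3}\lambda_2<0$ if $\lambda_2<0$, and $\lambda_1<0$ if $\lambda_2=0$. For complex-valued $u\in H^1(\mathbb{R}^3)$ put $M(u)=\|u\|_{L^2}^2$, $N(u)=-\lambda_1\|u\|_{L^4}^4-\lambda_2\int_{\mathbb{R}^3}(K*|u|^2)|u|^2\,dx$, $$E(u)=\tfrac12\|\nabla u\|_{L^2}^2-\tfrac14N(u)+\tfrac16\|u\|_{L^6}^6,\qquad I(u)=\|\nabla u\|_{L^2}^2+\|u\|_{L^6}^6-\tfrac34N(u),$$ and for $m\ge0$ let $$d(m)=\inf\{E(u):u\in H^1(\mathbb{R}^3),\ M(u)=m\},\qquad m_*=\sup\{m>0:d(m)=0\}.$$ Let $Q_1$ denote an optimizer of the sharp Gagliardo–Nirenberg–Hölder inequality with $\alpha=1$,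 that is, a minimizer of $$\frac{\|f\|_{L^2}\|\nabla f\|_{L^2}^{3/2}\|f\|_{L^6}^{3/2}}{N(f)}\quad\text{over } \{f\in H^1(\mathbb{R}^3): N(f)>0\},$$ normalized so that $\|Q_1\|_{L^6}^6=\|\nabla Q_1\|_{L^2}^2$ and so that, for some $\omega\in\mathbb{R}$, $Q_1$ is a weak solution of $$-\Delta Q+\lambda_1|Q|^2Q+\lambda_2(K*|Q|^2)Q+|Q|^4Q+\omega Q=0.$$ Then such a $Q_1$ exists, $d(m)$ is finite for every $m\ge0$, and for every such $Q_1$ the following hold. (i) If $0\le m\le M(Q_1)$, then $d(m)=0$. (ii) If $m>M(Q_1)$, then $d(m)<0$. In particular, $m_*=M(Q_1)$. (iii) The function $d:[0,\infty)\to\mathbb{R}$ is non-increasing, non-positive, concave and continuous on $[0,\infty)$. If $m\ge M(Q_1)$, then there exists $v\in H^1(\mathbb{R}^3)$ with $M(v)=m$, $E(v)=d(m)$ and $I(v)=0$. -/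

import Mathlib

open MeasureTheory Filter Topology Set
open scoped ContDiff

noncomputable section

namespace DipolarNLS

/-- Physical space `ℝ³` with its Euclidean norm; the coordinate `x₃` is `x 2`. -/
abbrev Space : Type := EuclideanSpace ℝ (Fin 3)

/-- The `i`-th partial derivative of a real function on `ℝ³`. -/
def partialDeriv (i : Fin 3) (φ : Space → ℝ) (x : Space) : ℝ :=
  fderiv ℝ φ x (EuclideanSpace.single i 1)

/-- `G` is the distributional gradient of `u`. Real test functions are enough, because the identity
is complex linear in the test function. -/
def HasWeakGradient (u : Space → ℂ) (G : Space → EuclideanSpace ℂ (Fin 3)) : Prop :=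
  ∀ φ : Space → ℝ, ContDiff ℝ ∞ φ → HasCompactSupport φ → ∀ i : Fin 3,
    ∫ x, partialDeriv i φ x • u x = -∫ x, φ x • G x i

/-- The Sobolev space `H¹(ℝ³)` of complex valued functions. -/
def MemH1 (u : Space → ℂ) : Prop :=
  MemLp u 2 volume ∧
    ∃ G : Space → EuclideanSpace ℂ (Fin 3), MemLp G 2 volume ∧ HasWeakGradient u G

open Classical in
/-- The weak gradient of `u ∈ H¹(ℝ³)` (it is unique almost everywhere); zero for other `u`. -/
def weakGrad (u : Space → ℂ) : Space → EuclideanSpace ℂ (Fin 3) :=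
  if h : ∃ G : Space → EuclideanSpace ℂ (Fin 3), MemLp G 2 volume ∧ HasWeakGradient u G
  then h.choose else 0

/-- `‖∇u‖_{L²}`. -/
def gradNorm (u : Space → ℂ) : ℝ := lpNorm (weakGrad u) 2 volume

/-- The mass `M(u) = ‖u‖_{L²}²`. -/
def mass (u : Space → ℂ) : ℝ := lpNorm u 2 volume ^ 2

/-- The dipole kernel `K(x) = (1 - 3 cos² θ) / |x|³`, with `θ` the angle between `x` and the dipole
axis `(0,0,1)`, so that `cos θ = x₃ / |x|`. -/
def dipoleKernel (x : Space) : ℝ := (1 - 3 * (x 2 / ‖x‖) ^ 2) / ‖x‖ ^ 3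

/-- The convolution `K ∗ g`, as a principal value:
`(K ∗ g)(x) = lim_{ε → 0+} ∫_{|y| > ε} K(y) g(x - y) dy`. -/
def dipoleConv (g : Space → ℝ) (x : Space) : ℝ :=
  limUnder (𝓝[>] (0 : ℝ)) fun ε : ℝ => ∫ y in {y : Space | ε < ‖y‖}, dipoleKernel y * g (x - y)

/-- The dipolar interaction `∫ (K ∗ |u|²) |u|² dx`. -/
def dipoleInt (u : Space → ℂ) : ℝ :=
  ∫ x, dipoleConv (fun y => ‖u y‖ ^ 2) x * ‖u x‖ ^ 2

/-- `N(u) = -λ₁ ‖u‖_{L⁴}⁴ - λ₂ ∫ (K ∗ |u|²) |u|² dx`. -/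
def nonlin (l₁ l₂ : ℝ) (u : Space → ℂ) : ℝ :=
  -l₁ * lpNorm u 4 volume ^ 4 - l₂ * dipoleInt u

/-- The energy
`E(u) = ½ ‖∇u‖² + (λ₁/4) ‖u‖_{L⁴}⁴ + (λ₂/4) ∫ (K ∗ |u|²) |u|² dx + (1/6) ‖u‖_{L⁶}⁶`. -/
def energy (l₁ l₂ : ℝ) (u : Space → ℂ) : ℝ :=
  1 / 2 * gradNorm u ^ 2 + l₁ / 4 * lpNorm u 4 volume ^ 4 + l₂ / 4 * dipoleInt u
    + 1 / 6 * lpNorm u 6 volume ^ 6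

/-- The virial functional
`I(u) = ‖∇u‖² + ‖u‖_{L⁶}⁶ + (3/4) λ₁ ‖u‖_{L⁴}⁴ + (3/4) λ₂ ∫ (K ∗ |u|²) |u|² dx`. -/
def virial (l₁ l₂ : ℝ) (u : Space → ℂ) : ℝ :=
  gradNorm u ^ 2 + lpNorm u 6 volume ^ 6 + 3 / 4 * l₁ * lpNorm u 4 volume ^ 4
    + 3 / 4 * l₂ * dipoleInt u

/-- The unstable regime. The case `λ₂ = 0` (no dipolar term) is the focusing one, `λ₁ < 0`. -/
def UnstableRegime (l₁ l₂ : ℝ) : Prop :=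
  (0 < l₂ → l₁ - 4 * Real.pi / 3 * l₂ < 0) ∧
  (l₂ < 0 → l₁ + 8 * Real.pi / 3 * l₂ < 0) ∧
  (l₂ = 0 → l₁ < 0)

/-- The Weinstein functional
`W_α(f) = ‖f‖_{L²} ‖∇f‖_{L²}^{3/(1+α)} ‖f‖_{L⁶}^{3α/(1+α)} / N(f)`. -/
def weinstein (l₁ l₂ α : ℝ) (f : Space → ℂ) : ℝ :=
  lpNorm f 2 volume * gradNorm f ^ (3 / (1 + α)) * lpNorm f 6 volume ^ (3 * α / (1 + α))
    / nonlin l₁ l₂ f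

/-- The admissible functions of the Weinstein problem: `f ∈ H¹(ℝ³)` with `N(f) > 0`. -/
def admissible (l₁ l₂ : ℝ) : Set (Space → ℂ) := {f | MemH1 f ∧ 0 < nonlin l₁ l₂ f}

/-- `Q` is a distributional solution of
`-Δ Q + λ₁ |Q|² Q + λ₂ (K ∗ |Q|²) Q + |Q|⁴ Q + ω Q = 0`, with `ω = freq`. -/
def IsWeakSolution (l₁ l₂ freq : ℝ) (Q : Space → ℂ) : Prop :=
  ∀ φ : Space → ℝ, ContDiff ℝ ∞ φ → HasCompactSupport φ →
    (∑ i : Fin 3, ∫ x, partialDeriv i φ x • weakGrad Q x i) +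
      ∫ x, (φ x * (l₁ * ‖Q x‖ ^ 2 + l₂ * dipoleConv (fun y => ‖Q y‖ ^ 2) x
        + ‖Q x‖ ^ 4 + freq)) • Q x = 0

/-- `Q` is a normalized optimizer `Q_α` of the sharp `α`-Gagliardo-Nirenberg-Hölder inequality: it
minimizes the Weinstein functional, it is normalized by `‖Q‖_{L⁶}⁶ = α ‖∇Q‖_{L²}²`, and it solves
the stationary equation for some frequency `ω`. -/
structure IsOptimizer (l₁ l₂ α : ℝ) (Q : Space → ℂ) : Prop where
  mem : Q ∈ admissible l₁ l₂
  isMin : IsMinOn (weinstein l₁ l₂ α) (admissible l₁ l₂) Q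
  normalized : lpNorm Q 6 volume ^ 6 = α * gradNorm Q ^ 2
  stationary : ∃ freq : ℝ, IsWeakSolution l₁ l₂ freq Q

/-- The energies of the `H¹` functions of mass `m`. -/
def energyValues (l₁ l₂ m : ℝ) : Set ℝ :=
  {e | ∃ u : Space → ℂ, MemH1 u ∧ mass u = m ∧ energy l₁ l₂ u = e}

/-- `d(m) = inf {E(u) : u ∈ H¹(ℝ³), M(u) = m}`. -/
def minEnergy (l₁ l₂ m : ℝ) : ℝ := sInf (energyValues l₁ l₂ m)

/-- `m_* = sup {m > 0 : d(m) = 0}`. -/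
def criticalMass (l₁ l₂ : ℝ) : ℝ := sSup {m : ℝ | 0 < m ∧ minEnergy l₁ l₂ m = 0}

end DipolarNLS

end

open scoped FourierTransform SchwartzMap LineDeriv

noncomputable section

namespace DipolarNLS

/-! Write `A = ‖∇u‖²`, `C = ‖u‖₆⁶`, `M` for the mass and `N` for the interaction, so that `E = A/2 +
C/6 - N/4`.

The principal value is handled through `K = ∂₃(y₃/|y|³)` away from the origin. Integration by parts
against the Lipschitz kernel `y₃ / max(|y|, ε)³` gives `K ∗ f = (y₃/|y|³) ∗ ∂₃f - (4π/3) f`, and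
Gaussian subordination identifies the first term with the Fourier multiplier `4π ξ₃²/|ξ|²`
(`H1Pair.dipoleConv_ae`, `H1Pair.gradConv_ae`). Hence `N(u) = ⟨S|u|², |u|²⟩` with a bounded
symmetric operator `S = interOp` on `L²`. In the unstable regime its symbol is positive near some
directions, which yields admissible functions (`exists_nonlin_pos`).

The fourth power of the Weinstein functional is `M² A³ C / N⁴`. Let `c` be the infimum of the
functional and `T = (8c/3)²` (`thresholdMass`). By AM-GM, `A³ C ≤ (81/16)(A/2 + C/6)⁴`, with
equality only for `A = C`. So `M ≤ T` implies `N ≤ 4(A/2 + C/6)`, that is `E ≥ 0`; and `E = 0` with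
`0 < M ≤ T` forces `M = T`, `A = C`, `8A = 3N` and makes `u` a minimizer of the functional
(`energy_nonneg`, `MemH1.of_energy_eq_zero`). Spreading a function out gives `d ≤ 0`, so `d = 0` on
`[0, T]`.

Dilating the space variable gives `d(θ M(u)) ≤ θ^(1/3) A/2 + θ (C/6 - N/4)`, a concave function of
`θ` equal to `E(u)` at `θ = 1` (`minEnergy_mul_le`). Concavity of `d` follows, and from it
monotonicity and continuity.

Compactness comes from one profile. A sequence bounded in `H¹` whose `L⁴` norm stays away from zero
has, after translation and extraction, a nonzero weak limit `v` along which mass and energy split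
(`exists_profile`); for a minimizing sequence this gives `E(v) + d(m - M(v)) ≤ d(m)`. At `m = T`,
applied to a normalized minimizing sequence of the Weinstein functional, it yields `E(v) = 0`, hence
an optimizer. Dilating that optimizer gives `d(m) < 0` for `m > T`. Then `d(T) = 0 > d(m)` and
concavity make the subadditivity of `d` strict, and the whole mass `m` must sit in `v`.

For an arbitrary `Q₁` one must show `M(Q₁) = T`, which reduces to `8A = 3N`
(`IsOptimizer.eight_mul_gradNorm_sq`). Its Euler-Lagrange equation carries the interaction with
coefficient `κ = 8A/(3N)`, the prescribed equation with coefficient `1`. If `κ ≠ 1`, subtraction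
makes `S|Q₁|²` constant where `Q₁ ≠ 0`; then `Q₁` is integrable and `w = |Q₁|` solves `-Δw + w⁵ =
μw` with `μM > C`. Integrating this equation over space contradicts an elementary pointwise
inequality. Finally `I(v) = 0` for minimizers because `r = 1` is critical for the mass preserving
family `r³ v(r² x)`. -/

instance fact_two_ne_top : Fact ((2 : ENNReal) ≠ ⊤) := ⟨by simp⟩

/-! ### Weak sequential compactness in Hilbert spaces -/

/-- Sequential Banach-Alaoglu in the dual, available because `H` is separable, carried back to `H`
by the Riesz isomorphism. -/
theorem exists_subseq_tendsto_inner {H : Type*} [NormedAddCommGroup H] [InnerProductSpace ℂ H]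
    [CompleteSpace H] [TopologicalSpace.SeparableSpace H] (x : ℕ → H) (C : ℝ)
    (hx : ∀ n, ‖x n‖ ≤ C) :
    ∃ a : H, ∃ φ : ℕ → ℕ, StrictMono φ ∧
      ∀ y, Tendsto (fun n => inner ℂ (x (φ n)) y) atTop (𝓝 (inner ℂ a y)) := by
  obtain ⟨a, -, φ, hφ, h⟩ := WeakDual.isSeqCompact_closedBall ℂ H 0 C
    (x := fun n => StrongDual.toWeakDual (InnerProductSpace.toDual ℂ H (x n))) (by
      intro n; simpa using hx n)
  refine ⟨(InnerProductSpace.toDual ℂ H).symm (WeakDual.toStrongDual a), φ, hφ, fun y => ?_⟩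
  have := ((WeakDual.eval_continuous (𝕜 := ℂ) (E := H) y).tendsto a).comp h
  rw [InnerProductSpace.toDual_symm_apply]
  exact this

/-! ### Powers of Lebesgue norms -/

theorem lpNorm_natCast_pow {E : Type*} [NormedAddCommGroup E] {f : Space → E}
    (hf : AEStronglyMeasurable f volume) {n : ℕ} (hn : n ≠ 0) :
    lpNorm f n volume ^ n = ∫ x, ‖f x‖ ^ n := by
  rw [lpNorm_eq_integral_norm_rpow_toReal (by exact_mod_cast hn) (by simp) hf]
  simp only [ENNReal.toReal_natCast, Real.rpow_natCast]
  rw [← Real.rpow_natCast, ← Real.rpow_mul (integral_nonneg fun _ => by positivity)]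
  rw [inv_mul_cancel₀ (by exact_mod_cast hn), Real.rpow_one]

theorem lpNorm_two_sq {E : Type*} [NormedAddCommGroup E] {f : Space → E}
    (hf : AEStronglyMeasurable f volume) : lpNorm f 2 volume ^ 2 = ∫ x, ‖f x‖ ^ 2 := by
  simpa using lpNorm_natCast_pow hf (n := 2) (by norm_num)

theorem lpNorm_four_pow {E : Type*} [NormedAddCommGroup E] {f : Space → E}
    (hf : AEStronglyMeasurable f volume) : lpNorm f 4 volume ^ 4 = ∫ x, ‖f x‖ ^ 4 := by
  simpa using lpNorm_natCast_pow hf (n := 4) (by norm_num)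

theorem lpNorm_six_pow {E : Type*} [NormedAddCommGroup E] {f : Space → E}
    (hf : AEStronglyMeasurable f volume) : lpNorm f 6 volume ^ 6 = ∫ x, ‖f x‖ ^ 6 := by
  simpa using lpNorm_natCast_pow hf (n := 6) (by norm_num)

theorem lpNorm_congr_ae {E : Type*} [NormedAddCommGroup E] {f g : Space → E} {p : ENNReal}
    (h : f =ᵐ[volume] g) : lpNorm f p volume = lpNorm g p volume := by
  unfold lpNorm
  rw [eLpNorm_congr_ae h]
  congr 1
  exact propext (aestronglyMeasurable_congr h)

/-! ### Test functions -/

/-- Smooth compactly supported real functions. -/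
structure IsTest (φ : Space → ℝ) : Prop where
  contDiff : ContDiff ℝ ∞ φ
  hasCompactSupport : HasCompactSupport φ

theorem contDiff_partialDeriv {φ : Space → ℝ} (h : ContDiff ℝ ∞ φ) (i : Fin 3) :
    ContDiff ℝ ∞ (partialDeriv i φ) :=
  (h.fderiv_right (m := ∞) (by simp)).clm_apply contDiff_const

theorem hasCompactSupport_partialDeriv {φ : Space → ℝ} (h : HasCompactSupport φ) (i : Fin 3) :
    HasCompactSupport (partialDeriv i φ) :=
  h.fderiv_apply (𝕜 := ℝ) (EuclideanSpace.single i (1 : ℝ))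

theorem IsTest.partialDeriv {φ : Space → ℝ} (h : IsTest φ) (i : Fin 3) :
    IsTest (partialDeriv i φ) :=
  ⟨contDiff_partialDeriv h.1 i, hasCompactSupport_partialDeriv h.2 i⟩

theorem IsTest.continuous {φ : Space → ℝ} (h : IsTest φ) : Continuous φ := h.1.continuous

theorem IsTest.differentiable {φ : Space → ℝ} (h : IsTest φ) : Differentiable ℝ φ :=
  h.1.differentiable (by simp)

theorem IsTest.memLp {φ : Space → ℝ} (h : IsTest φ) (p : ENNReal) : MemLp φ p volume :=
  h.continuous.memLp_of_hasCompactSupport h.2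

theorem IsTest.integrable {φ : Space → ℝ} (h : IsTest φ) : Integrable φ volume :=
  h.continuous.integrable_of_hasCompactSupport h.2

theorem IsTest.integrable_smul {φ : Space → ℝ} (h : IsTest φ) {E : Type*} [NormedAddCommGroup E]
    [NormedSpace ℝ E] {u : Space → E} (hu : LocallyIntegrable u volume) :
    Integrable (fun x => φ x • u x) volume :=
  hu.integrable_smul_left_of_hasCompactSupport h.continuous h.2

theorem IsTest.mul_contDiff {φ χ : Space → ℝ} (h : IsTest φ) (hχ : ContDiff ℝ ∞ χ) :
    IsTest (fun x => χ x * φ x) :=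
  ⟨hχ.mul h.1, h.2.mul_left⟩

theorem IsTest.comp_add {φ : Space → ℝ} (h : IsTest φ) (a : Space) :
    IsTest (fun x => φ (x + a)) :=
  ⟨h.1.comp (contDiff_id.add contDiff_const), h.2.comp_homeomorph (Homeomorph.addRight a)⟩

theorem IsTest.comp_sub_left {φ : Space → ℝ} (h : IsTest φ) (a : Space) :
    IsTest (fun x => φ (a - x)) :=
  ⟨h.1.comp (contDiff_const.sub contDiff_id), h.2.comp_homeomorph (Homeomorph.subLeft a)⟩

theorem IsTest.comp_smul {φ : Space → ℝ} (h : IsTest φ) {s : ℝ} (hs : s ≠ 0) :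
    IsTest (fun x => φ (s • x)) :=
  ⟨h.1.comp (contDiff_id.const_smul s),
    h.2.comp_homeomorph (Homeomorph.smulOfNeZero s hs)⟩

theorem partialDeriv_mul {φ χ : Space → ℝ} {x : Space} (hφ : DifferentiableAt ℝ φ x)
    (hχ : DifferentiableAt ℝ χ x) (i : Fin 3) :
    partialDeriv i (fun y => χ y * φ y) x
      = χ x * partialDeriv i φ x + partialDeriv i χ x * φ x := by
  simp only [partialDeriv]
  rw [fderiv_fun_mul hχ hφ]
  simp [mul_comm]

theorem partialDeriv_comp_add (φ : Space → ℝ) (a x : Space) (i : Fin 3) :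
    partialDeriv i (fun y => φ (y + a)) x = partialDeriv i φ (x + a) := by
  simp only [partialDeriv]
  rw [fderiv_comp_add_right]

theorem partialDeriv_comp_sub_left {φ : Space → ℝ} (hφ : Differentiable ℝ φ) (a x : Space)
    (i : Fin 3) : partialDeriv i (fun y => φ (a - y)) x = -partialDeriv i φ (a - x) := by
  simp only [partialDeriv]
  have h : HasFDerivAt (fun y : Space => φ (a - y))
      ((fderiv ℝ φ (a - x)).comp (-ContinuousLinearMap.id ℝ Space)) x :=
    (hφ (a - x)).hasFDerivAt.comp x ((hasFDerivAt_id x).const_sub a)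
  rw [h.fderiv]
  simp

theorem partialDeriv_comp_smul {φ : Space → ℝ} (hφ : Differentiable ℝ φ) (s : ℝ) (x : Space)
    (i : Fin 3) : partialDeriv i (fun y => φ (s • y)) x = s * partialDeriv i φ (s • x) := by
  simp only [partialDeriv]
  have h : HasFDerivAt (fun y : Space => φ (s • y))
      ((fderiv ℝ φ (s • x)).comp (s • ContinuousLinearMap.id ℝ Space)) x :=
    (hφ (s • x)).hasFDerivAt.comp x ((hasFDerivAt_id x).const_smul s)
  rw [h.fderiv]
  simp

/-! ### Weak derivatives -/

/-- `g` is the weak `i`-th partial derivative of `u`. -/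
def HasWeakDeriv (i : Fin 3) (u g : Space → ℂ) : Prop :=
  ∀ φ : Space → ℝ, IsTest φ → ∫ x, partialDeriv i φ x • u x = -∫ x, φ x • g x

theorem hasWeakGradient_iff {u : Space → ℂ} {G : Space → EuclideanSpace ℂ (Fin 3)} :
    HasWeakGradient u G ↔ ∀ i, HasWeakDeriv i u (fun x => G x i) :=
  ⟨fun h i φ hφ => h φ hφ.1 hφ.2 i, fun h φ h1 h2 i => h i φ ⟨h1, h2⟩⟩

theorem HasWeakDeriv.congr {i : Fin 3} {u g u' g' : Space → ℂ} (h : HasWeakDeriv i u g)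
    (hu : u =ᵐ[volume] u') (hg : g =ᵐ[volume] g') : HasWeakDeriv i u' g' := by
  intro φ hφ
  rw [← integral_congr_ae (hu.mono fun x hx => by simp only [hx] :
      (fun x => DipolarNLS.partialDeriv i φ x • u x) =ᵐ[volume]
        fun x => DipolarNLS.partialDeriv i φ x • u' x),
    ← integral_congr_ae (hg.mono fun x hx => by simp only [hx] :
      (fun x => φ x • g x) =ᵐ[volume] fun x => φ x • g' x)]
  exact h φ hφ

theorem HasWeakDeriv.ae_eq {i : Fin 3} {u g g' : Space → ℂ} (h : HasWeakDeriv i u g)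
    (h' : HasWeakDeriv i u g') (hg : LocallyIntegrable g volume)
    (hg' : LocallyIntegrable g' volume) : g =ᵐ[volume] g' := by
  have := ae_eq_zero_of_integral_contDiff_smul_eq_zero (hg.sub hg') (fun φ h1 h2 => by
    have hφ : IsTest φ := ⟨h1, h2⟩
    simp only [Pi.sub_apply, smul_sub]
    rw [integral_sub (hφ.integrable_smul hg) (hφ.integrable_smul hg')]
    have e := h φ hφ
    rw [h' φ hφ] at e
    rw [neg_inj.1 e, sub_self])
  filter_upwards [this] with x hx
  exact sub_eq_zero.1 hx

theorem HasWeakDeriv.add {i : Fin 3} {u g u' g' : Space → ℂ} (h : HasWeakDeriv i u g)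
    (h' : HasWeakDeriv i u' g') (hu : LocallyIntegrable u volume)
    (hg : LocallyIntegrable g volume) (hu' : LocallyIntegrable u' volume)
    (hg' : LocallyIntegrable g' volume) :
    HasWeakDeriv i (fun x => u x + u' x) (fun x => g x + g' x) := by
  intro φ hφ
  simp only [smul_add]
  rw [integral_add ((hφ.partialDeriv i).integrable_smul hu)
    ((hφ.partialDeriv i).integrable_smul hu'), integral_add (hφ.integrable_smul hg)
    (hφ.integrable_smul hg'), h φ hφ, h' φ hφ]
  ring

theorem HasWeakDeriv.const_mul {i : Fin 3} {u g : Space → ℂ} (h : HasWeakDeriv i u g) (c : ℂ) :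
    HasWeakDeriv i (fun x => c * u x) (fun x => c * g x) := by
  intro φ hφ
  simp only [← smul_eq_mul]
  simp only [smul_comm (_ : ℝ) c]
  rw [integral_smul, integral_smul, h φ hφ, smul_neg]

theorem HasWeakDeriv.comp_add {i : Fin 3} {u g : Space → ℂ} (h : HasWeakDeriv i u g)
    (a : Space) : HasWeakDeriv i (fun x => u (x + a)) (fun x => g (x + a)) := by
  intro φ hφ
  have e := h _ (hφ.comp_add (-a))
  rw [← integral_add_right_eq_self _ a, ← integral_add_right_eq_self (fun x => _ • g x) a] at e
  simpa [partialDeriv_comp_add] using e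

theorem integral_comp_inv_smul {E : Type*} [NormedAddCommGroup E] [NormedSpace ℝ E]
    (f : Space → E) {s : ℝ} (hs : 0 < s) : ∫ x, f (s⁻¹ • x) = s ^ 3 • ∫ x, f x := by
  rw [Measure.integral_comp_smul]
  simp [abs_of_pos hs]

theorem HasWeakDeriv.dilate {i : Fin 3} {u g : Space → ℂ} (h : HasWeakDeriv i u g) {s : ℝ}
    (hs : 0 < s) :
    HasWeakDeriv i (fun x => u (s⁻¹ • x)) (fun x => (s⁻¹ : ℝ) • g (s⁻¹ • x)) := by
  intro φ hφ
  have e := h _ (hφ.comp_smul hs.ne')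
  have e1 : ∫ x, DipolarNLS.partialDeriv i φ x • u (s⁻¹ • x) = s ^ 3 • s⁻¹ •
      ∫ x, DipolarNLS.partialDeriv i (fun y => φ (s • y)) x • u x := by
    rw [← integral_smul, ← integral_comp_inv_smul _ hs]
    refine integral_congr_ae (Eventually.of_forall fun x => ?_)
    simp only [partialDeriv_comp_smul hφ.differentiable]
    rw [smul_smul, smul_smul, mul_inv_cancel₀ hs.ne', one_smul, inv_mul_cancel_left₀ hs.ne']
  have e2 : ∫ x, φ x • (s⁻¹ : ℝ) • g (s⁻¹ • x) = s ^ 3 • s⁻¹ • ∫ x, φ (s • x) • g x := by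
    rw [← integral_smul, ← integral_comp_inv_smul _ hs]
    refine integral_congr_ae (Eventually.of_forall fun x => ?_)
    simp only
    rw [smul_smul s, mul_inv_cancel₀ hs.ne', one_smul, smul_comm]
  rw [e1, e2, e, smul_neg, smul_neg]

/-- The factor `χ` is moved onto the test function, where the classical product rule applies. -/
theorem HasWeakDeriv.mul_contDiff {i : Fin 3} {u g : Space → ℂ} (h : HasWeakDeriv i u g)
    (hu : LocallyIntegrable u volume) (hg : LocallyIntegrable g volume)
    {χ : Space → ℝ} (hχ : ContDiff ℝ ∞ χ) :
    HasWeakDeriv i (fun x => χ x • u x) (fun x => χ x • g x + partialDeriv i χ x • u x) := by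
  intro φ hφ
  have e := h _ (hφ.mul_contDiff hχ)
  have hd : Differentiable ℝ χ := hχ.differentiable (by simp)
  have i1 := (hφ.mul_contDiff hχ).integrable_smul hg
  have i2 := ((hφ.partialDeriv i).mul_contDiff hχ).integrable_smul hu
  have i3 := (hφ.mul_contDiff (contDiff_partialDeriv hχ i)).integrable_smul hu
  simp only [partialDeriv_mul (hφ.differentiable _) (hd _), add_smul] at e
  rw [integral_add i2 i3] at e
  simp only [smul_add, smul_smul]
  rw [integral_add]
  · rw [neg_add, eq_add_neg_iff_add_eq]
    simp only [mul_comm (φ _)]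
    rw [← e]
    simp only [mul_comm]
  · simpa only [mul_comm] using i1
  · simpa only [mul_comm] using i3

/-- `u ∈ H¹` with weak gradient `G`. -/
structure H1Pair (u : Space → ℂ) (G : Space → EuclideanSpace ℂ (Fin 3)) : Prop where
  memLp : MemLp u 2 volume
  grad_memLp : MemLp G 2 volume
  weak : HasWeakGradient u G

theorem memH1_iff {u : Space → ℂ} : MemH1 u ↔ ∃ G, H1Pair u G :=
  ⟨fun h => h.2.imp fun _ hG => ⟨h.1, hG.1, hG.2⟩, fun ⟨G, h⟩ => ⟨h.1, G, h.2, h.3⟩⟩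

theorem H1Pair.memH1 {u : Space → ℂ} {G : Space → EuclideanSpace ℂ (Fin 3)} (h : H1Pair u G) :
    MemH1 u := memH1_iff.2 ⟨G, h⟩

theorem MemH1.h1Pair {u : Space → ℂ} (h : MemH1 u) : H1Pair u (weakGrad u) := by
  have := h.2
  unfold weakGrad
  rw [dif_pos this]
  exact ⟨h.1, this.choose_spec.1, this.choose_spec.2⟩

theorem memLp_euclidean_iff {G : Space → EuclideanSpace ℂ (Fin 3)} {p : ENNReal} :
    MemLp G p volume ↔ ∀ i, MemLp (fun x => G x i) p volume := by
  constructor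
  · intro h i
    exact (EuclideanSpace.proj (𝕜 := ℂ) i).comp_memLp' h
  · intro h
    have : G = fun x => ∑ i, (ContinuousLinearMap.toSpanSingleton ℂ
        (EuclideanSpace.single i (1 : ℂ))) (G x i) := by
      funext x; ext j
      simp [Finset.sum_apply, Pi.single_apply]
    rw [this]
    exact memLp_finsetSum _ fun i _ => (ContinuousLinearMap.toSpanSingleton ℂ
        (EuclideanSpace.single i (1 : ℂ))).comp_memLp' (h i)

theorem H1Pair.weakDeriv {u : Space → ℂ} {G : Space → EuclideanSpace ℂ (Fin 3)}
    (h : H1Pair u G) (i : Fin 3) : HasWeakDeriv i u (fun x => G x i) :=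
  hasWeakGradient_iff.1 h.weak i

theorem H1Pair.comp_memLp {u : Space → ℂ} {G : Space → EuclideanSpace ℂ (Fin 3)}
    (h : H1Pair u G) (i : Fin 3) : MemLp (fun x => G x i) 2 volume :=
  memLp_euclidean_iff.1 h.grad_memLp i

theorem MemLp.locInt {u : Space → ℂ} (h : MemLp u 2 volume) : LocallyIntegrable u volume :=
  h.locallyIntegrable (by norm_num)

theorem H1Pair.locInt {u : Space → ℂ} {G : Space → EuclideanSpace ℂ (Fin 3)}
    (h : H1Pair u G) : LocallyIntegrable u volume := MemLp.locInt h.memLp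

theorem H1Pair.ae_eq {u : Space → ℂ} {G G' : Space → EuclideanSpace ℂ (Fin 3)}
    (h : H1Pair u G) (h' : H1Pair u G') : G =ᵐ[volume] G' := by
  have : ∀ i, (fun x => G x i) =ᵐ[volume] fun x => G' x i := fun i =>
    (h.weakDeriv i).ae_eq (h'.weakDeriv i) (MemLp.locInt (h.comp_memLp i))
      (MemLp.locInt (h'.comp_memLp i))
  filter_upwards [ae_all_iff.2 this] with x hx
  ext i
  exact hx i

theorem H1Pair.gradNorm_eq {u : Space → ℂ} {G : Space → EuclideanSpace ℂ (Fin 3)}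
    (h : H1Pair u G) : gradNorm u = lpNorm G 2 volume :=
  lpNorm_congr_ae (h.memH1.h1Pair.ae_eq h)

theorem H1Pair.gradNorm_sq {u : Space → ℂ} {G : Space → EuclideanSpace ℂ (Fin 3)}
    (h : H1Pair u G) : gradNorm u ^ 2 = ∫ x, ‖G x‖ ^ 2 := by
  rw [h.gradNorm_eq, lpNorm_two_sq h.grad_memLp.1]

theorem H1Pair.mass_eq {u : Space → ℂ} {G : Space → EuclideanSpace ℂ (Fin 3)}
    (h : H1Pair u G) : mass u = ∫ x, ‖u x‖ ^ 2 := lpNorm_two_sq h.memLp.1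

theorem H1Pair.congr {u u' : Space → ℂ} {G G' : Space → EuclideanSpace ℂ (Fin 3)}
    (h : H1Pair u G) (hu : u =ᵐ[volume] u') (hG : G =ᵐ[volume] G') : H1Pair u' G' :=
  ⟨h.memLp.ae_eq hu, h.grad_memLp.ae_eq hG, hasWeakGradient_iff.2 fun i =>
    (h.weakDeriv i).congr hu (hG.mono fun x hx => by simp only [hx])⟩

theorem H1Pair.add {u u' : Space → ℂ} {G G' : Space → EuclideanSpace ℂ (Fin 3)}
    (h : H1Pair u G) (h' : H1Pair u' G') : H1Pair (fun x => u x + u' x) (fun x => G x + G' x) :=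
  ⟨h.memLp.add h'.memLp, h.grad_memLp.add h'.grad_memLp, hasWeakGradient_iff.2 fun i =>
    (h.weakDeriv i).add (h'.weakDeriv i) h.locInt (MemLp.locInt (h.comp_memLp i)) h'.locInt
      (MemLp.locInt (h'.comp_memLp i))⟩

theorem H1Pair.const_mul {u : Space → ℂ} {G : Space → EuclideanSpace ℂ (Fin 3)}
    (h : H1Pair u G) (c : ℂ) : H1Pair (fun x => c * u x) (fun x => c • G x) :=
  ⟨h.memLp.const_mul c, h.grad_memLp.const_smul c, hasWeakGradient_iff.2 fun i =>
    (h.weakDeriv i).const_mul c⟩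

theorem H1Pair.sub {u u' : Space → ℂ} {G G' : Space → EuclideanSpace ℂ (Fin 3)}
    (h : H1Pair u G) (h' : H1Pair u' G') :
    H1Pair (fun x => u x - u' x) (fun x => G x - G' x) := by
  refine (h.add (h'.const_mul (-1))).congr (Eventually.of_forall fun x => ?_)
    (Eventually.of_forall fun x => ?_)
  · simp only; ring
  · simp only [neg_smul, one_smul]; abel

theorem H1Pair.comp_add {u : Space → ℂ} {G : Space → EuclideanSpace ℂ (Fin 3)}
    (h : H1Pair u G) (a : Space) : H1Pair (fun x => u (x + a)) (fun x => G (x + a)) :=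
  ⟨h.memLp.comp_measurePreserving (measurePreserving_add_right _ a),
    h.grad_memLp.comp_measurePreserving (measurePreserving_add_right _ a),
    hasWeakGradient_iff.2 fun i => (h.weakDeriv i).comp_add a⟩

theorem memLp_comp_inv_smul {E : Type*} [NormedAddCommGroup E] {f : Space → E} {p : ENNReal}
    (hf : MemLp f p volume) {s : ℝ} (hs : 0 < s) :
    MemLp (fun x => f (s⁻¹ • x)) p volume := by
  have h : Measure.map (fun x : Space => s⁻¹ • x) volume
      = ENNReal.ofReal |((s⁻¹) ^ Module.finrank ℝ Space)⁻¹| • volume :=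
    Measure.map_addHaar_smul volume (inv_ne_zero hs.ne')
  have h2 : MemLp f p (Measure.map (fun x : Space => s⁻¹ • x) volume) := by
    rw [h]; exact hf.smul_measure (by simp)
  exact (memLp_map_measure_iff h2.1 (by fun_prop)).1 h2

theorem H1Pair.dilate {u : Space → ℂ} {G : Space → EuclideanSpace ℂ (Fin 3)}
    (h : H1Pair u G) {s : ℝ} (hs : 0 < s) :
    H1Pair (fun x => u (s⁻¹ • x)) (fun x => (s⁻¹ : ℝ) • G (s⁻¹ • x)) :=
  ⟨memLp_comp_inv_smul h.memLp hs, (memLp_comp_inv_smul h.grad_memLp hs).const_smul (s⁻¹ : ℝ),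
    hasWeakGradient_iff.2 fun i => (h.weakDeriv i).dilate hs⟩

/-! ### Mollification -/

/-- Nonnegative test functions of integral one. -/
structure IsMollifier (ρ : Space → ℝ) : Prop extends IsTest ρ where
  nonneg : ∀ x, 0 ≤ ρ x
  integral_eq : ∫ x, ρ x = 1

theorem exists_isMollifier {ε : ℝ} (hε : 0 < ε) :
    ∃ ρ : Space → ℝ, IsMollifier ρ ∧ ∀ x, ρ x ≠ 0 → ‖x‖ < ε := by
  let b : ContDiffBump (0 : Space) := ⟨ε / 2, ε, by positivity, by linarith⟩
  refine ⟨b.normed volume, ⟨⟨b.contDiff_normed, b.hasCompactSupport_normed⟩,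
    b.nonneg_normed, b.integral_normed⟩, fun x hx => ?_⟩
  have : x ∈ Function.support (b.normed volume) := hx
  rw [b.support_normed_eq] at this
  simpa using this

/-- The convolution `ρ ∗ u`. -/
def mollify (ρ : Space → ℝ) (u : Space → ℂ) (x : Space) : ℂ := ∫ y, ρ y • u (x - y)

theorem mollify_eq_convolution (ρ : Space → ℝ) (u : Space → ℂ) :
    mollify ρ u = convolution ρ u (ContinuousLinearMap.lsmul ℝ ℝ) volume := rfl

theorem mollify_eq (ρ : Space → ℝ) (u : Space → ℂ) (x : Space) :
    mollify ρ u x = ∫ y, ρ (x - y) • u y := by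
  unfold mollify
  rw [← integral_sub_left_eq_self _ volume x]
  simp

theorem mollify_congr {ρ : Space → ℝ} {u u' : Space → ℂ} (h : u =ᵐ[volume] u') :
    mollify ρ u = mollify ρ u' := by
  funext x
  rw [mollify_eq, mollify_eq]
  exact integral_congr_ae (h.mono fun y hy => by simp only [hy])

theorem contDiff_mollify {ρ : Space → ℝ} (hρ : IsTest ρ) {u : Space → ℂ}
    (hu : LocallyIntegrable u volume) : ContDiff ℝ ∞ (mollify ρ u) := by
  rw [mollify_eq_convolution]
  exact hρ.2.contDiff_convolution_left _ hρ.1 hu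

theorem hasCompactSupport_mollify {ρ : Space → ℝ} (hρ : IsTest ρ) {u : Space → ℂ}
    (hu : HasCompactSupport u) : HasCompactSupport (mollify ρ u) := by
  rw [mollify_eq_convolution]
  exact hρ.2.convolution _ hu

/-- Partial derivatives of complex valued functions. -/
def cpartial (i : Fin 3) (v : Space → ℂ) (x : Space) : ℂ :=
  fderiv ℝ v x (EuclideanSpace.single i 1)

/-- The derivative falls on `ρ`; with `y ↦ ρ (x - y)` as test function it is then moved onto `u`.
The sign of the reflection cancels the sign of the weak derivative. -/
theorem cpartial_mollify {ρ : Space → ℝ} (hρ : IsTest ρ) {u g : Space → ℂ}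
    (hu : LocallyIntegrable u volume) {i : Fin 3} (h : HasWeakDeriv i u g) :
    cpartial i (mollify ρ u) = mollify ρ g := by
  funext x
  have hd := hρ.2.hasFDerivAt_convolution_left (ContinuousLinearMap.lsmul ℝ ℝ)
    (hρ.1.of_le (by simp)) hu x
  rw [cpartial, mollify_eq_convolution, hd.fderiv]
  have hi : Integrable (fun t => (ContinuousLinearMap.precompL Space
      (ContinuousLinearMap.lsmul ℝ ℝ : ℝ →L[ℝ] ℂ →L[ℝ] ℂ)) (fderiv ℝ ρ t) (u (x - t))) volume :=
    (hρ.2.fderiv (𝕜 := ℝ)).convolutionExists_left _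
      (hρ.1.continuous_fderiv (by simp)) hu x
  rw [convolution_def, ContinuousLinearMap.integral_apply hi, mollify_eq]
  have e := h _ (hρ.comp_sub_left x)
  simp only [partialDeriv_comp_sub_left hρ.differentiable, neg_smul, integral_neg] at e
  rw [← neg_inj.1 e, ← integral_sub_left_eq_self _ volume x]
  simp [partialDeriv, ContinuousLinearMap.precompL_apply]

theorem lintegral_mul_sq_le {α : Type*} [MeasurableSpace α] {μ : Measure α}
    {f g : α → ENNReal} (hf : AEMeasurable f μ) (hg : AEMeasurable g μ) :
    (∫⁻ x, f x * g x ∂μ) ^ 2 ≤ (∫⁻ x, f x ^ 2 ∂μ) * ∫⁻ x, g x ^ 2 ∂μ := by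
  have h := ENNReal.lintegral_mul_le_Lp_mul_Lq μ Real.HolderConjugate.two_two hf hg
  simp only [Pi.mul_apply, ENNReal.rpow_two] at h
  calc _ ≤ _ := pow_le_pow_left₀ zero_le h 2
    _ = _ := by
      rw [mul_pow, ← ENNReal.rpow_natCast, ← ENNReal.rpow_natCast, ← ENNReal.rpow_mul,
        ← ENNReal.rpow_mul]
      norm_num

/-- Cauchy-Schwarz with the weight split as `r^(1/2) · r^(1/2)`. For a weight of total mass one this
is Jensen's inequality. -/
theorem lintegral_weight_sq_le {α : Type*} [MeasurableSpace α] {μ : Measure α}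
    {r f : α → ENNReal} (hr : AEMeasurable r μ) (hf : AEMeasurable f μ) :
    (∫⁻ x, r x * f x ∂μ) ^ 2 ≤ (∫⁻ x, r x ∂μ) * ∫⁻ x, r x * f x ^ 2 ∂μ := by
  have h := lintegral_mul_sq_le (hr.pow_const (1 / 2 : ℝ)) ((hr.pow_const (1 / 2 : ℝ)).mul hf)
  have e : ∀ x : ENNReal, x ^ (1 / 2 : ℝ) * x ^ (1 / 2 : ℝ) = x := fun x => by
    rw [← ENNReal.rpow_add_of_nonneg _ _ (by norm_num) (by norm_num)]; norm_num
  simpa only [Pi.mul_apply, ← mul_assoc, mul_pow, sq, e,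
    mul_mul_mul_comm _ _ ((_ : ENNReal) ^ (1 / 2 : ℝ)) _] using h

theorem eLpNorm_two_sq {α E : Type*} [MeasurableSpace α] {μ : Measure α} [NormedAddCommGroup E]
    (f : α → E) : eLpNorm f 2 μ ^ 2 = ∫⁻ x, ‖f x‖ₑ ^ 2 ∂μ := by
  rw [eLpNorm_eq_lintegral_rpow_enorm_toReal (by norm_num) (by norm_num)]
  simp only [ENNReal.toReal_ofNat, ENNReal.rpow_two]
  rw [← ENNReal.rpow_natCast, ← ENNReal.rpow_mul]
  norm_num

theorem locallyIntegrable_comp_sub_left {u : Space → ℂ} (hu : MemLp u 2 volume) (x : Space) :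
    LocallyIntegrable (fun y => u (x - y)) volume :=
  MemLp.locInt (hu.comp_measurePreserving (Measure.measurePreserving_sub_left volume x))

/-- The difference `ρ ∗ u - u` is the `ρ`-average of the translation differences of `u`; Jensen for
the square and Tonelli give the bound. -/
theorem eLpNorm_mollify_sub_le {ρ : Space → ℝ} (hρ : IsMollifier ρ) {u : Space → ℂ}
    (hu : MemLp u 2 volume) {δ : ENNReal}
    (h : ∀ y, ρ y ≠ 0 → eLpNorm (fun x => u (x - y) - u x) 2 volume ≤ δ) :
    eLpNorm (fun x => mollify ρ u x - u x) 2 volume ≤ δ := by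
  -- Tonelli needs joint measurability of `(x, y) ↦ u (x - y) - u x`, so `u` is replaced by a
  -- strongly measurable representative, which changes neither side.
  wlog hm : StronglyMeasurable u generalizing u with H
  · have e := hu.1.ae_eq_mk
    have := H (u := hu.1.mk) (hu.ae_eq e) (fun y hy => ?_) hu.1.stronglyMeasurable_mk
    · rw [← mollify_congr e] at this
      refine le_of_eq_of_le (eLpNorm_congr_ae ?_) this
      filter_upwards [e] with x hx
      rw [← hx]
    · have e' := (measurePreserving_sub_right volume y).quasiMeasurePreserving.ae_eq_comp e
      refine le_of_eq_of_le (eLpNorm_congr_ae ?_) (h y hy)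
      filter_upwards [e, e'] with x h1 h2
      simp only [Function.comp] at h2
      rw [h1, h2]
  have hρm : Measurable fun y => ENNReal.ofReal (ρ y) := hρ.continuous.measurable.ennreal_ofReal
  have hρ1 : ∫⁻ y, ENNReal.ofReal (ρ y) = 1 := by
    rw [← ofReal_integral_eq_lintegral_ofReal hρ.integrable
      (Eventually.of_forall hρ.nonneg), hρ.integral_eq, ENNReal.ofReal_one]
  have hF : Measurable (fun p : Space × Space => ‖u (p.1 - p.2) - u p.1‖ₑ) :=
    ((hm.measurable.comp (measurable_fst.sub measurable_snd)).sub
      (hm.measurable.comp measurable_fst)).enorm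
  rw [← ENNReal.pow_le_pow_left_iff two_ne_zero, eLpNorm_two_sq]
  calc ∫⁻ x, ‖mollify ρ u x - u x‖ₑ ^ 2
      ≤ ∫⁻ x, ∫⁻ y, ENNReal.ofReal (ρ y) * ‖u (x - y) - u x‖ₑ ^ 2 := by
        refine lintegral_mono fun x => ?_
        have e : mollify ρ u x - u x = ∫ y, ρ y • (u (x - y) - u x) := by
          simp only [smul_sub]
          rw [integral_sub (hρ.integrable_smul (locallyIntegrable_comp_sub_left hu x))
            (hρ.integrable.smul_const _), integral_smul_const, hρ.integral_eq, one_smul]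
          rfl
        calc ‖mollify ρ u x - u x‖ₑ ^ 2
            ≤ (∫⁻ y, ENNReal.ofReal (ρ y) * ‖u (x - y) - u x‖ₑ) ^ 2 := by
              rw [e]
              refine pow_le_pow_left₀ zero_le ((enorm_integral_le_lintegral_enorm _).trans ?_) 2
              refine lintegral_mono fun y => ?_
              rw [enorm_smul, Real.enorm_eq_ofReal (hρ.nonneg y)]
          _ ≤ _ := by
              have := lintegral_weight_sq_le hρm.aemeasurable
                (μ := volume) (hF.comp (measurable_const.prodMk measurable_id :
                  Measurable fun y : Space => (x, y))).aemeasurable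
              rw [hρ1, one_mul] at this
              exact this
    _ = ∫⁻ y, ∫⁻ x, ENNReal.ofReal (ρ y) * ‖u (x - y) - u x‖ₑ ^ 2 := by
        refine lintegral_lintegral_swap ?_
        exact ((hρm.comp measurable_snd).mul (hF.pow_const 2)).aemeasurable
    _ ≤ ∫⁻ y, ENNReal.ofReal (ρ y) * δ ^ 2 := by
        refine lintegral_mono fun y => ?_
        have hFy : Measurable fun x => ‖u (x - y) - u x‖ₑ ^ 2 :=
          (hF.comp (measurable_id.prodMk measurable_const :
                  Measurable fun x : Space => (x, y))).pow_const 2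
        rw [lintegral_const_mul _ hFy]
        by_cases hy : ρ y = 0
        · simp [hy]
        · gcongr
          have := pow_le_pow_left₀ zero_le (h y hy) 2
          rwa [eLpNorm_two_sq] at this
    _ = δ ^ 2 := by rw [lintegral_mul_const _ hρm, hρ1, one_mul]

/-- Continuity of the translation action on `Lp`, read at `a = 0`. -/
theorem tendsto_eLpNorm_translate_sub {u : Space → ℂ} (hu : MemLp u 2 volume) :
    Tendsto (fun a : Space => eLpNorm (fun x => u (x - a) - u x) 2 volume) (𝓝 0) (𝓝 0) := by
  have hc : Continuous (fun a : Space => (DomAddAct.mk (-a)) +ᵥ hu.toLp u) :=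
    continuous_vadd.comp ((DomAddAct.continuous_mk.comp continuous_neg).prodMk continuous_const)
  have h0 := hc.tendsto 0
  rw [neg_zero, DomAddAct.mk_zero, zero_vadd, tendsto_iff_norm_sub_tendsto_zero] at h0
  have h1 := ENNReal.tendsto_ofReal h0
  rw [ENNReal.ofReal_zero] at h1
  refine h1.congr fun a => ?_
  rw [DomAddAct.mk_vadd_toLp, ← MemLp.toLp_sub, Lp.norm_toLp, ENNReal.ofReal_toReal]
  · refine eLpNorm_congr_ae (Eventually.of_forall fun x => ?_)
    simp [sub_eq_neg_add]
  · exact (MemLp.sub (hu.comp_measurePreserving (measurePreserving_vadd (-a) volume)) hu).2.ne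

theorem exists_mollify_close {ι : Type*} [Finite ι] {u : ι → Space → ℂ}
    (hu : ∀ i, MemLp (u i) 2 volume) {ε : ENNReal} (hε : 0 < ε) :
    ∃ ρ, IsMollifier ρ ∧ ∀ i, eLpNorm (fun x => mollify ρ (u i) x - u i x) 2 volume ≤ ε := by
  have : ∀ᶠ a : Space in 𝓝 0, ∀ i, eLpNorm (fun x => u i (x - a) - u i x) 2 volume ≤ ε :=
    eventually_all.2 fun i =>
      ((tendsto_eLpNorm_translate_sub (hu i)).eventually_lt_const hε).mono fun _ h => h.le
  obtain ⟨r, hr, h⟩ := Metric.eventually_nhds_iff_ball.1 this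
  obtain ⟨ρ, hρ, hs⟩ := exists_isMollifier hr
  exact ⟨ρ, hρ, fun i => eLpNorm_mollify_sub_le hρ (hu i) fun y hy =>
    h y (by simpa using hs y hy) i⟩

/-! ### Dominated convergence in Lebesgue spaces and cutoffs -/

theorem tendsto_eLpNorm_of_dominated {α E : Type*} [MeasurableSpace α] {μ : Measure α}
    [NormedAddCommGroup E] {p : ENNReal} (hp0 : p ≠ 0) (hp : p ≠ ⊤) {F : ℕ → α → E} {b : α → ℝ}
    (hF : ∀ n, AEStronglyMeasurable (F n) μ) (hb : MemLp b p μ)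
    (hle : ∀ n, ∀ᵐ x ∂μ, ‖F n x‖ ≤ b x)
    (hlim : ∀ᵐ x ∂μ, Tendsto (fun n => F n x) atTop (𝓝 0)) :
    Tendsto (fun n => eLpNorm (F n) p μ) atTop (𝓝 0) := by
  have hpp : 0 < p.toReal := ENNReal.toReal_pos hp0 hp
  have key : Tendsto (fun n => ∫⁻ x, ‖F n x‖ₑ ^ p.toReal ∂μ) atTop (𝓝 (∫⁻ _, 0 ∂μ)) := by
    refine tendsto_lintegral_of_dominated_convergence' (fun x => ‖b x‖ₑ ^ p.toReal)
      (fun n => (hF n).enorm.pow_const _) (fun n => ?_) ?_ ?_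
    · filter_upwards [hle n] with x hx
      gcongr
      exact enorm_le_iff_norm_le.2 (hx.trans (le_abs_self _))
    · exact (lintegral_rpow_enorm_lt_top_of_eLpNorm_lt_top hp0 hp hb.2).ne
    · filter_upwards [hlim] with x hx
      have := (ENNReal.continuous_rpow_const (y := p.toReal)).tendsto _ |>.comp hx.enorm
      simpa [hpp, Function.comp_def] using this
  have := (ENNReal.continuous_rpow_const (y := 1 / p.toReal)).tendsto _ |>.comp key
  simp only [lintegral_zero] at this
  rw [ENNReal.zero_rpow_of_pos (by positivity)] at this
  refine this.congr fun n => ?_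
  rw [eLpNorm_eq_lintegral_rpow_enorm_toReal hp0 hp]
  rfl

/-- A cutoff function, equal to one near the origin. -/
def cutoffBump : ContDiffBump (0 : Space) := ⟨1, 2, by norm_num, by norm_num⟩

/-- The cutoff function `χ(x / (n + 1))`. -/
def cutoff (n : ℕ) (x : Space) : ℝ := cutoffBump (((n : ℝ) + 1)⁻¹ • x)

theorem isTest_cutoffBump : IsTest cutoffBump :=
  ⟨cutoffBump.contDiff, cutoffBump.hasCompactSupport⟩

theorem isTest_cutoff (n : ℕ) : IsTest (cutoff n) := isTest_cutoffBump.comp_smul (by positivity)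

theorem cutoff_nonneg (n : ℕ) (x : Space) : 0 ≤ cutoff n x := cutoffBump.nonneg

theorem cutoff_le_one (n : ℕ) (x : Space) : cutoff n x ≤ 1 := cutoffBump.le_one

theorem eventually_cutoff_eq_one (x : Space) : ∀ᶠ n in atTop, cutoff n x = 1 := by
  filter_upwards [eventually_ge_atTop ⌈‖x‖⌉₊] with n hn
  refine cutoffBump.one_of_mem_closedBall ?_
  have h : ‖x‖ ≤ n := (Nat.le_ceil _).trans (by exact_mod_cast hn)
  rw [mem_closedBall_zero_iff, norm_smul, norm_inv, Real.norm_of_nonneg (by positivity)]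
  change _ ≤ (1 : ℝ)
  rw [inv_mul_le_one₀ (by positivity)]
  linarith

theorem exists_abs_partialDeriv_le {φ : Space → ℝ} (h : IsTest φ) :
    ∃ B, 0 ≤ B ∧ ∀ i x, |partialDeriv i φ x| ≤ B := by
  have : ∀ i, ∃ C, ∀ x, ‖partialDeriv i φ x‖ ≤ C := fun i =>
    (h.partialDeriv i).continuous.bounded_above_of_compact_support (h.partialDeriv i).2
  choose C hC using this
  exact ⟨∑ i, |C i|, by positivity, fun i x => (hC i x).trans ((le_abs_self _).trans
    (Finset.single_le_sum (f := fun i => |C i|) (fun _ _ => abs_nonneg _) (Finset.mem_univ i)))⟩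

theorem partialDeriv_cutoff (n : ℕ) (i : Fin 3) (x : Space) :
    partialDeriv i (cutoff n) x
      = ((n : ℝ) + 1)⁻¹ * partialDeriv i cutoffBump (((n : ℝ) + 1)⁻¹ • x) :=
  partialDeriv_comp_smul isTest_cutoffBump.differentiable _ _ _

theorem exists_abs_partialDeriv_cutoff_le :
    ∃ B, 0 ≤ B ∧ ∀ n i x, |partialDeriv i (cutoff n) x| ≤ B * ((n : ℝ) + 1)⁻¹ := by
  obtain ⟨B, hB, h⟩ := exists_abs_partialDeriv_le isTest_cutoffBump
  refine ⟨B, hB, fun n i x => ?_⟩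
  rw [partialDeriv_cutoff, abs_mul, abs_of_pos (by positivity : (0 : ℝ) < ((n : ℝ) + 1)⁻¹),
    mul_comm]
  gcongr
  exact h i _

theorem tendsto_inv_add_one : Tendsto (fun n : ℕ => ((n : ℝ) + 1)⁻¹) atTop (𝓝 0) := by
  simpa [one_div] using tendsto_one_div_add_atTop_nhds_zero_nat (𝕜 := ℝ)

theorem tendsto_eLpNorm_cutoff_smul_sub {E : Type*} [NormedAddCommGroup E] [NormedSpace ℝ E]
    {u : Space → E} {p : ENNReal} (hp0 : p ≠ 0) (hp : p ≠ ⊤) (hu : MemLp u p volume) :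
    Tendsto (fun n => eLpNorm (fun x => cutoff n x • u x - u x) p volume) atTop (𝓝 0) := by
  refine tendsto_eLpNorm_of_dominated hp0 hp (b := fun x => ‖u x‖)
    (fun n => ((isTest_cutoff n).continuous.aestronglyMeasurable.smul hu.1).sub hu.1) hu.norm
    (fun n => Eventually.of_forall fun x => ?_) (Eventually.of_forall fun x => ?_)
  · have : cutoff n x • u x - u x = (cutoff n x - 1) • u x := by rw [sub_smul, one_smul]
    rw [this, norm_smul, Real.norm_eq_abs, abs_of_nonpos (by linarith [cutoff_le_one n x])]
    exact mul_le_of_le_one_left (norm_nonneg _) (by linarith [cutoff_nonneg n x])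
  · refine tendsto_const_nhds.congr' ?_
    filter_upwards [eventually_cutoff_eq_one x] with n hn
    simp [hn]

/-! ### Density of test functions in `H¹` -/

theorem eLpNorm_triangle_sub {f g h : Space → ℂ} {p : ENNReal} (hp : 1 ≤ p)
    (hf : AEStronglyMeasurable f volume) (hg : AEStronglyMeasurable g volume)
    (hh : AEStronglyMeasurable h volume) :
    eLpNorm (fun x => f x - h x) p volume
      ≤ eLpNorm (fun x => f x - g x) p volume + eLpNorm (fun x => g x - h x) p volume := by
  have := eLpNorm_add_le (hf.sub hg) (hg.sub hh) hp
  have e : (fun x => f x - h x) = (f - g) + (g - h) := by funext x; simp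
  rw [e]
  exact this

/-- Truncate, then mollify. The extra term `∂ᵢ(cutoff n) u` produced by truncation is at most `B |u|
/ (n + 1)`, and mollification commutes with weak derivatives. -/
theorem H1Pair.exists_test_close {u : Space → ℂ} {G : Space → EuclideanSpace ℂ (Fin 3)}
    (h : H1Pair u G) {ε : ENNReal} (hε : 0 < ε) :
    ∃ v : Space → ℂ, ContDiff ℝ ∞ v ∧ HasCompactSupport v ∧
      eLpNorm (fun x => v x - u x) 2 volume ≤ ε ∧
      ∀ i, eLpNorm (fun x => cpartial i v x - G x i) 2 volume ≤ ε := by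
  obtain ⟨B, hB, hBd⟩ := exists_abs_partialDeriv_cutoff_le
  have hε2 : 0 < ε / 2 := ENNReal.half_pos hε.ne'
  have t0 := tendsto_eLpNorm_cutoff_smul_sub (by norm_num) (by norm_num) h.memLp
  have t1 : ∀ i, Tendsto (fun n => eLpNorm (fun x => (cutoff n x • G x i
      + partialDeriv i (cutoff n) x • u x) - G x i) 2 volume) atTop (𝓝 0) := by
    intro i
    refine tendsto_eLpNorm_of_dominated (by norm_num) (by norm_num)
      (b := fun x => ‖G x i‖ + B * ‖u x‖) (fun n => ?_) ?_
      (fun n => Eventually.of_forall fun x => ?_) (Eventually.of_forall fun x => ?_)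
    · exact (((isTest_cutoff n).continuous.aestronglyMeasurable.smul (h.comp_memLp i).1).add
        (((isTest_cutoff n).partialDeriv i).continuous.aestronglyMeasurable.smul h.memLp.1)).sub
        (h.comp_memLp i).1
    · exact (h.comp_memLp i).norm.add (h.memLp.norm.const_mul B)
    · have : cutoff n x • G x i + partialDeriv i (cutoff n) x • u x - G x i
          = (cutoff n x - 1) • G x i + partialDeriv i (cutoff n) x • u x := by
        rw [sub_smul, one_smul]; abel
      rw [this]
      refine (norm_add_le _ _).trans ?_
      rw [norm_smul, norm_smul, Real.norm_eq_abs, Real.norm_eq_abs,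
        abs_of_nonpos (by linarith [cutoff_le_one n x])]
      refine add_le_add
        (mul_le_of_le_one_left (norm_nonneg _) (by linarith [cutoff_nonneg n x])) ?_
      gcongr
      refine (hBd n i x).trans (mul_le_of_le_one_right hB (inv_le_one_of_one_le₀ ?_))
      linarith [(Nat.cast_nonneg n : (0 : ℝ) ≤ n)]
    · have hz : Tendsto (fun n => partialDeriv i (cutoff n) x) atTop (𝓝 0) := by
        refine squeeze_zero_norm (fun n => hBd n i x) ?_
        simpa using tendsto_inv_add_one.const_mul B
      have := hz.smul_const (u x)
      rw [zero_smul] at this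
      refine this.congr' ?_
      filter_upwards [eventually_cutoff_eq_one x] with n hn
      simp [hn]
  obtain ⟨n, hn0, hn1⟩ := ((t0.eventually_lt_const hε2).and
    (eventually_all.2 fun i => (t1 i).eventually_lt_const hε2)).exists
  have hw : ∀ i, HasWeakDeriv i (fun x => cutoff n x • u x)
      (fun x => cutoff n x • G x i + partialDeriv i (cutoff n) x • u x) := fun i =>
    (h.weakDeriv i).mul_contDiff h.locInt (MemLp.locInt (h.comp_memLp i)) (isTest_cutoff n).1
  have bnd : ∀ φ, IsTest φ → ∀ f : Space → ℂ, MemLp f 2 volume →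
      MemLp (fun x => φ x • f x) 2 volume := fun φ hφ f hf => by
    have : MemLp (φ • f) 2 volume := MemLp.smul hf (hφ.memLp ⊤)
    exact this
  have m0 := bnd _ (isTest_cutoff n) _ h.memLp
  have m1 : ∀ i, MemLp (fun x => cutoff n x • G x i + partialDeriv i (cutoff n) x • u x) 2
      volume := fun i => (bnd _ (isTest_cutoff n) _ (h.comp_memLp i)).add
        (bnd _ ((isTest_cutoff n).partialDeriv i) _ h.memLp)
  -- Indexing by `Option (Fin 3)` lets one mollifier serve the function (`none`) and its three
  -- derivatives (`some i`) simultaneously.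
  obtain ⟨ρ, hρ, hc⟩ := exists_mollify_close (ι := Option (Fin 3))
    (u := fun o => o.elim (fun x => cutoff n x • u x)
      (fun i x => cutoff n x • G x i + partialDeriv i (cutoff n) x • u x))
    (fun o => by cases o; exacts [m0, m1 _]) hε2
  have hsm := contDiff_mollify hρ.toIsTest (MemLp.locInt m0)
  refine ⟨mollify ρ (fun x => cutoff n x • u x), hsm,
    hasCompactSupport_mollify hρ.toIsTest (isTest_cutoff n).2.smul_right, ?_, fun i => ?_⟩
  · refine (eLpNorm_triangle_sub (by norm_num) hsm.continuous.aestronglyMeasurable m0.1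
      h.memLp.1).trans ?_
    exact (add_le_add (hc none) hn0.le).trans_eq (ENNReal.add_halves ε)
  · rw [cpartial_mollify hρ.toIsTest (MemLp.locInt m0) (hw i)]
    refine (eLpNorm_triangle_sub (by norm_num)
      (contDiff_mollify hρ.toIsTest (MemLp.locInt (m1 i))).continuous.aestronglyMeasurable (m1 i).1
      (h.comp_memLp i).1).trans ?_
    exact (add_le_add (hc (some i)) (hn1 i).le).trans_eq (ENNReal.add_halves ε)

/-- Smooth compactly supported approximation of an `H¹` function. -/
structure TestApprox (v : ℕ → Space → ℂ) (u : Space → ℂ)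
    (G : Space → EuclideanSpace ℂ (Fin 3)) : Prop where
  contDiff : ∀ n, ContDiff ℝ ∞ (v n)
  hasCompactSupport : ∀ n, HasCompactSupport (v n)
  tendsto : Tendsto (fun n => eLpNorm (fun x => v n x - u x) 2 volume) atTop (𝓝 0)
  tendsto_grad : ∀ i,
    Tendsto (fun n => eLpNorm (fun x => cpartial i (v n) x - G x i) 2 volume) atTop (𝓝 0)

theorem H1Pair.exists_testApprox {u : Space → ℂ} {G : Space → EuclideanSpace ℂ (Fin 3)}
    (h : H1Pair u G) : ∃ v, TestApprox v u G := by
  have hpos : ∀ n : ℕ, (0 : ENNReal) < ((n : ENNReal) + 1)⁻¹ := fun n =>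
    ENNReal.inv_pos.2 (by finiteness)
  choose v h1 h2 h3 h4 using fun n => h.exists_test_close (hpos n)
  have ht : Tendsto (fun n : ℕ => ((n : ENNReal) + 1)⁻¹) atTop (𝓝 0) := by
    have := (tendsto_add_atTop_iff_nat 1).2 ENNReal.tendsto_inv_nat_nhds_zero
    simpa using this
  exact ⟨v, h1, h2, tendsto_of_tendsto_of_tendsto_of_le_of_le tendsto_const_nhds ht
    (fun _ => zero_le) h3, fun i => tendsto_of_tendsto_of_tendsto_of_le_of_le
      tendsto_const_nhds ht (fun _ => zero_le) fun n => h4 n i⟩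

/-! ### Translation estimate -/

theorem fderiv_eq_sum_cpartial (v : Space → ℂ) (x y : Space) :
    fderiv ℝ v x y = ∑ i, (y i : ℝ) • cpartial i v x := by
  have : y = ∑ i, (y i) • (EuclideanSpace.single i (1 : ℝ) : Space) := by
    ext j; simp [Finset.sum_apply, Pi.single_apply]
  conv_lhs => rw [this]
  simp [cpartial, map_sum]

theorem continuous_cpartial {v : Space → ℂ} (hv : ContDiff ℝ ∞ v) (i : Fin 3) :
    Continuous (cpartial i v) :=
  (hv.continuous_fderiv (by simp)).clm_apply continuous_const

theorem hasCompactSupport_cpartial {v : Space → ℂ} (hv : HasCompactSupport v) (i : Fin 3) :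
    HasCompactSupport (cpartial i v) :=
  hv.fderiv_apply (𝕜 := ℝ) (EuclideanSpace.single i (1 : ℝ))

theorem memLp_cpartial {v : Space → ℂ} (hv : ContDiff ℝ ∞ v) (hc : HasCompactSupport v)
    (i : Fin 3) (p : ENNReal) : MemLp (cpartial i v) p volume :=
  (continuous_cpartial hv i).memLp_of_hasCompactSupport (hasCompactSupport_cpartial hc i)

/-- The increment is the integral of the directional derivative along a segment; Cauchy-Schwarz on
`[0, 1]`, Tonelli and translation invariance remove the parameter. -/
theorem eLpNorm_translate_sub_le_fderiv {v : Space → ℂ} (hv : ContDiff ℝ ∞ v) (y : Space) :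
    eLpNorm (fun x => v (x + y) - v x) 2 volume
      ≤ eLpNorm (fun x => fderiv ℝ v x y) 2 volume := by
  have hfc : Continuous (fun x => fderiv ℝ v x y) :=
    (hv.continuous_fderiv (by simp)).clm_apply continuous_const
  rw [← ENNReal.pow_le_pow_left_iff two_ne_zero, eLpNorm_two_sq, eLpNorm_two_sq]
  have hF : Measurable (fun p : Space × ℝ => ‖fderiv ℝ v (p.1 + p.2 • y) y‖ₑ ^ 2) :=
    ((hfc.comp (by fun_prop : Continuous fun p : Space × ℝ => p.1 + p.2 • y)).measurable.enorm).pow_const 2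
  calc ∫⁻ x, ‖v (x + y) - v x‖ₑ ^ 2
      ≤ ∫⁻ x, ∫⁻ t in Ioc (0 : ℝ) 1, ‖fderiv ℝ v (x + t • y) y‖ₑ ^ 2 := by
        refine lintegral_mono fun x => ?_
        have hc : Continuous (fun t : ℝ => fderiv ℝ v (x + t • y) y) :=
          hfc.comp (by fun_prop)
        have hd : ∀ t : ℝ, HasDerivAt (fun t : ℝ => v (x + t • y)) (fderiv ℝ v (x + t • y) y) t := by
          intro t
          have h1 : HasDerivAt (fun t : ℝ => x + t • y) y t := by
            simpa using ((hasDerivAt_id t).smul_const y).const_add x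
          exact ((hv.differentiable (by simp) _).hasFDerivAt.comp_hasDerivAt t h1)
        have e : v (x + y) - v x = ∫ t in Ioc (0 : ℝ) 1, fderiv ℝ v (x + t • y) y := by
          rw [← intervalIntegral.integral_of_le zero_le_one,
            intervalIntegral.integral_eq_sub_of_hasDerivAt (fun t _ => hd t)
              (hc.intervalIntegrable _ _)]
          simp
        rw [e]
        have h2 := lintegral_weight_sq_le (μ := volume.restrict (Ioc (0 : ℝ) 1))
          (r := fun _ => 1) aemeasurable_const hc.measurable.enorm.aemeasurable
        simp only [one_mul, lintegral_const, Measure.restrict_apply_univ, Real.volume_Ioc,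
          sub_zero, ENNReal.ofReal_one, mul_one] at h2
        exact (pow_le_pow_left₀ zero_le (enorm_integral_le_lintegral_enorm _) 2).trans h2
    _ = ∫⁻ t in Ioc (0 : ℝ) 1, ∫⁻ x, ‖fderiv ℝ v (x + t • y) y‖ₑ ^ 2 :=
        lintegral_lintegral_swap hF.aemeasurable
    _ = ∫⁻ t in Ioc (0 : ℝ) 1, ∫⁻ x, ‖fderiv ℝ v x y‖ₑ ^ 2 := by
        refine lintegral_congr fun t => ?_
        exact lintegral_add_right_eq_self (fun x => ‖fderiv ℝ v x y‖ₑ ^ 2) (t • y)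
    _ = ∫⁻ x, ‖fderiv ℝ v x y‖ₑ ^ 2 := by simp

/-- Convergence in `L^q` gives an almost everywhere convergent subsequence, and Fatou transfers
bounds in another exponent `p`. With `q = 2`, `p = 6` this carries the Sobolev inequality from test
functions to `H¹`. -/
theorem eLpNorm_le_of_tendsto {α E : Type*} [MeasurableSpace α] {μ : Measure α}
    [NormedAddCommGroup E] {p q : ENNReal} (hq0 : q ≠ 0) {F : ℕ → α → E} {f : α → E} {b : ENNReal}
    (hF : ∀ n, AEStronglyMeasurable (F n) μ) (hf : AEStronglyMeasurable f μ)
    (hlim : Tendsto (fun n => eLpNorm (fun x => F n x - f x) q μ) atTop (𝓝 0))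
    {c : ℕ → ENNReal} (hc : Tendsto c atTop (𝓝 b)) (hle : ∀ n, eLpNorm (F n) p μ ≤ c n) :
    eLpNorm f p μ ≤ b := by
  have hm : TendstoInMeasure μ F atTop f := tendstoInMeasure_of_tendsto_eLpNorm hq0 hF hf hlim
  obtain ⟨ns, hns, hae⟩ := hm.exists_seq_tendsto_ae
  refine (Lp.eLpNorm_lim_le_liminf_eLpNorm (fun n => hF (ns n)) f hae).trans ?_
  have h2 : Tendsto (fun n => c (ns n)) atTop (𝓝 b) := hc.comp hns.tendsto_atTop
  rw [← h2.liminf_eq]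
  exact liminf_le_liminf (Eventually.of_forall fun n => hle (ns n))

theorem TestApprox.memLp {v : ℕ → Space → ℂ} {u : Space → ℂ}
    {G : Space → EuclideanSpace ℂ (Fin 3)} (h : TestApprox v u G) (n : ℕ) (p : ENNReal) :
    MemLp (v n) p volume :=
  (h.contDiff n).continuous.memLp_of_hasCompactSupport (h.hasCompactSupport n)

theorem H1Pair.eLpNorm_translate_sub_le {u : Space → ℂ} {G : Space → EuclideanSpace ℂ (Fin 3)}
    (h : H1Pair u G) (y : Space) :
    eLpNorm (fun x => u (x + y) - u x) 2 volume
      ≤ eLpNorm (fun x => ∑ i, (y i : ℝ) • G x i) 2 volume := by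
  obtain ⟨v, hv⟩ := h.exists_testApprox
  have hs : MemLp (fun x => ∑ i, (y i : ℝ) • G x i) 2 volume :=
    memLp_finsetSum _ fun i _ => (h.comp_memLp i).const_smul (y i : ℝ)
  have hut := h.memLp.comp_measurePreserving (measurePreserving_add_right volume y)
  have hvt := fun n => (hv.memLp n 2).comp_measurePreserving (measurePreserving_add_right volume y)
  refine eLpNorm_le_of_tendsto (p := 2) (q := 2) (by norm_num)
    (F := fun n x => v n (x + y) - v n x)
    (c := fun n => eLpNorm (fun x => ∑ i, (y i : ℝ) • G x i) 2 volume
      + ∑ i, ‖y i‖ₑ * eLpNorm (fun x => cpartial i (v n) x - G x i) 2 volume)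
    (fun n => (hvt n).1.sub (hv.memLp n 2).1) (hut.1.sub h.memLp.1) ?_ ?_ ?_
  · have ht : ∀ n, eLpNorm (fun x => v n (x + y) - u (x + y)) 2 volume
        = eLpNorm (fun x => v n x - u x) 2 volume := fun n =>
      eLpNorm_comp_measurePreserving (g := fun x => v n x - u x)
        ((hv.memLp n 2).1.sub h.memLp.1) (measurePreserving_add_right volume y)
    have h2 := hv.tendsto.add hv.tendsto
    rw [add_zero] at h2
    refine tendsto_of_tendsto_of_tendsto_of_le_of_le tendsto_const_nhds h2
      (fun _ => zero_le) fun n => ?_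
    have e : (fun x => v n (x + y) - v n x - (u (x + y) - u x))
        = (fun x => v n (x + y) - u (x + y)) - (fun x => v n x - u x) := by
      funext x; simp only [Pi.sub_apply]; ring
    rw [e]
    refine (eLpNorm_sub_le ((hvt n).1.sub hut.1) ((hv.memLp n 2).1.sub h.memLp.1)
      (by norm_num)).trans_eq ?_
    exact congrArg₂ (· + ·) (ht n) rfl
  · have h3 : Tendsto (fun n => ∑ i, ‖y i‖ₑ * eLpNorm (fun x => cpartial i (v n) x - G x i) 2 volume)
        atTop (𝓝 (∑ i : Fin 3, ‖y i‖ₑ * 0)) := tendsto_finsetSum _ fun i _ =>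
      ENNReal.Tendsto.const_mul (hv.tendsto_grad i) (Or.inr enorm_ne_top)
    simpa using h3.const_add (eLpNorm (fun x => ∑ i, (y i : ℝ) • G x i) 2 volume)
  · intro n
    refine (eLpNorm_translate_sub_le_fderiv (hv.contDiff n) y).trans ?_
    have e : (fun x => fderiv ℝ (v n) x y) = (fun x => ∑ i, (y i : ℝ) • G x i)
        + ∑ i, (y i : ℝ) • (fun x => cpartial i (v n) x - G x i) := by
      funext x
      simp only [fderiv_eq_sum_cpartial, Pi.add_apply, Finset.sum_apply, Pi.smul_apply, smul_sub,
        Finset.sum_sub_distrib]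
      abel
    have hm : ∀ i, AEStronglyMeasurable (fun x => cpartial i (v n) x - G x i) volume := fun i =>
      (continuous_cpartial (hv.contDiff n) i).aestronglyMeasurable.sub (h.comp_memLp i).1
    rw [e]
    refine (eLpNorm_add_le hs.1 (Finset.aestronglyMeasurable_sum _ fun i _ =>
      (hm i).const_smul (y i : ℝ)) (by norm_num)).trans ?_
    gcongr
    refine (eLpNorm_sum_le (fun i _ => (hm i).const_smul (y i : ℝ)) (by norm_num)).trans ?_
    gcongr with i
    rw [eLpNorm_const_smul]

/-! ### The Sobolev inequality -/

theorem eLpNorm_comp_le {G : Space → EuclideanSpace ℂ (Fin 3)} (i : Fin 3) (p : ENNReal) :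
    eLpNorm (fun x => G x i) p volume ≤ eLpNorm G p volume :=
  eLpNorm_mono fun x => PiLp.norm_apply_le (G x) i

theorem exists_sobolev_const : ∃ S : ℝ, 0 < S ∧ ∀ u G, H1Pair u G →
    MemLp u 6 volume ∧ lpNorm u 6 volume ≤ S * gradNorm u := by
  let C : NNReal := eLpNormLESNormFDerivOfEqInnerConst (volume : Measure Space) ((2 : NNReal) : ℝ)
  -- The factor `3` pays for summing over the components of the gradient; the summand `1` only makes
  -- the constant positive.
  refine ⟨C * 3 + 1, by positivity, fun u G h => ?_⟩
  obtain ⟨v, hv⟩ := h.exists_testApprox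
  have key : eLpNorm u 6 volume ≤ C * ∑ i : Fin 3, eLpNorm (fun x => G x i) 2 volume := by
    refine eLpNorm_le_of_tendsto (p := 6) (q := 2) (by norm_num) (F := v)
      (c := fun n => C * ∑ i : Fin 3, (eLpNorm (fun x => G x i) 2 volume
        + eLpNorm (fun x => cpartial i (v n) x - G x i) 2 volume))
      (fun n => (hv.memLp n 2).1) h.memLp.1 hv.tendsto ?_ fun n => ?_
    · refine ENNReal.Tendsto.const_mul (tendsto_finsetSum _ fun i _ => ?_) (Or.inr (by simp))
      simpa using (hv.tendsto_grad i).const_add (eLpNorm (fun x => G x i) 2 volume)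
    · have h1 := eLpNorm_le_eLpNorm_fderiv_of_eq_inner (μ := (volume : Measure Space)) (p := 2)
        (p' := 6) ((hv.contDiff n).of_le (by simp)) (hv.hasCompactSupport n) (by norm_num) (by simp)
        (by simp; norm_num)
      refine h1.trans ?_
      gcongr
      have hm : ∀ i, AEStronglyMeasurable (cpartial i (v n)) volume := fun i =>
        (continuous_cpartial (hv.contDiff n) i).aestronglyMeasurable
      calc eLpNorm (fderiv ℝ (v n)) (2 : NNReal) volume
          ≤ eLpNorm (∑ i, fun x => ‖cpartial i (v n) x‖) 2 volume := by
            refine eLpNorm_mono_real fun x => ?_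
            refine ContinuousLinearMap.opNorm_le_bound _
              (by rw [Finset.sum_apply]; positivity) fun y => ?_
            rw [fderiv_eq_sum_cpartial, Finset.sum_apply, Finset.sum_mul]
            refine (norm_sum_le _ _).trans (Finset.sum_le_sum fun i _ => ?_)
            rw [norm_smul, mul_comm]
            gcongr
            exact PiLp.norm_apply_le y i
        _ ≤ ∑ i, eLpNorm (fun x => ‖cpartial i (v n) x‖) 2 volume :=
            eLpNorm_sum_le (fun i _ => (hm i).norm) (by norm_num)
        _ ≤ _ := by
            gcongr with i
            rw [eLpNorm_norm]
            have e : cpartial i (v n)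
                = (fun x => G x i) + fun x => cpartial i (v n) x - G x i := by
              funext x; simp
            conv_lhs => rw [e]
            exact eLpNorm_add_le (h.comp_memLp i).1 ((hm i).sub (h.comp_memLp i).1) (by norm_num)
  have hfin : ∑ i : Fin 3, eLpNorm (fun x => G x i) 2 volume ≤ 3 * eLpNorm G 2 volume := by
    refine (Finset.sum_le_sum fun i _ => eLpNorm_comp_le i 2).trans_eq ?_
    simp
  have key2 : eLpNorm u 6 volume ≤ C * (3 * eLpNorm G 2 volume) := key.trans (by gcongr)
  have ht : C * (3 * eLpNorm G 2 volume) ≠ ⊤ := by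
    have := h.grad_memLp.2
    finiteness
  have hu : MemLp u 6 volume := ⟨h.memLp.1, key2.trans_lt ht.lt_top⟩
  refine ⟨hu, ?_⟩
  rw [h.gradNorm_eq, ← toReal_eLpNorm hu.1, ← toReal_eLpNorm h.grad_memLp.1]
  refine (ENNReal.toReal_mono ht key2).trans ?_
  simp only [ENNReal.toReal_mul, ENNReal.coe_toReal, ENNReal.toReal_ofNat]
  nlinarith [ENNReal.toReal_nonneg (a := eLpNorm G 2 volume)]

theorem H1Pair.memLp_six {u : Space → ℂ} {G : Space → EuclideanSpace ℂ (Fin 3)}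
    (h : H1Pair u G) : MemLp u 6 volume :=
  let ⟨_, _, hS⟩ := exists_sobolev_const
  (hS u G h).1

theorem memLp_four_of_two_of_six {u : Space → ℂ} (h2 : MemLp u 2 volume) (h6 : MemLp u 6 volume) :
    MemLp u 4 volume := by
  refine ⟨h2.1, ?_⟩
  rw [eLpNorm_lt_top_iff_lintegral_rpow_enorm_lt_top (by norm_num) (by norm_num)]
  have e2 := lintegral_rpow_enorm_lt_top_of_eLpNorm_lt_top (by norm_num) (by norm_num) h2.2
  have e6 := lintegral_rpow_enorm_lt_top_of_eLpNorm_lt_top (by norm_num) (by norm_num) h6.2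
  simp only [ENNReal.toReal_ofNat, ENNReal.rpow_ofNat] at e2 e6 ⊢
  have := lintegral_mul_sq_le h2.1.enorm (h2.1.enorm.pow_const 3)
  simp only [← pow_mul] at this
  have h3 := this.trans_lt (ENNReal.mul_lt_top e2 e6)
  rw [ENNReal.pow_lt_top_iff] at h3
  simpa only [← pow_succ'] using h3.resolve_right (by norm_num)

theorem H1Pair.memLp_four {u : Space → ℂ} {G : Space → EuclideanSpace ℂ (Fin 3)}
    (h : H1Pair u G) : MemLp u 4 volume := memLp_four_of_two_of_six h.memLp h.memLp_six

theorem MemLp.integrable_pow {E : Type*} [NormedAddCommGroup E] {f : Space → E} {n : ℕ}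
    (hf : MemLp f n volume) (hn : n ≠ 0) : Integrable (fun x => ‖f x‖ ^ n) volume :=
  hf.integrable_norm_pow hn

theorem H1Pair.integrable_sq {u : Space → ℂ} {G : Space → EuclideanSpace ℂ (Fin 3)}
    (h : H1Pair u G) : Integrable (fun x => ‖u x‖ ^ 2) volume :=
  MemLp.integrable_pow (n := 2) (by simpa using h.memLp) (by norm_num)

theorem H1Pair.integrable_four {u : Space → ℂ} {G : Space → EuclideanSpace ℂ (Fin 3)}
    (h : H1Pair u G) : Integrable (fun x => ‖u x‖ ^ 4) volume :=
  MemLp.integrable_pow (n := 4) (by simpa using h.memLp_four) (by norm_num)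

theorem H1Pair.integrable_six {u : Space → ℂ} {G : Space → EuclideanSpace ℂ (Fin 3)}
    (h : H1Pair u G) : Integrable (fun x => ‖u x‖ ^ 6) volume :=
  MemLp.integrable_pow (n := 6) (by simpa using h.memLp_six) (by norm_num)

theorem integral_mul_sq_le {f g : Space → ℝ} (hf : MemLp f 2 volume) (hg : MemLp g 2 volume) :
    (∫ x, f x * g x) ^ 2 ≤ (∫ x, f x ^ 2) * ∫ x, g x ^ 2 := by
  have h := abs_real_inner_le_norm (hf.toLp f) (hg.toLp g)
  have e1 : inner ℝ (hf.toLp f) (hg.toLp g) = ∫ x, f x * g x := by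
    rw [L2.inner_def]
    refine integral_congr_ae ?_
    filter_upwards [hf.coeFn_toLp, hg.coeFn_toLp] with x h1 h2
    rw [h1, h2]
    simp [mul_comm]
  have e2 : ∀ f : Space → ℝ, ∀ hf : MemLp f 2 volume, ‖hf.toLp f‖ ^ 2 = ∫ x, f x ^ 2 := by
    intro f hf
    rw [Lp.norm_toLp, toReal_eLpNorm hf.1, lpNorm_two_sq hf.1]
    simp
  rw [e1] at h
  have h2 := pow_le_pow_left₀ (abs_nonneg _) h 2
  rwa [sq_abs, mul_pow, e2 f hf, e2 g hg] at h2

/-- Cauchy-Schwarz for `|u|⁴ = |u| · |u|³`. -/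
theorem H1Pair.four_sq_le {u : Space → ℂ} {G : Space → EuclideanSpace ℂ (Fin 3)}
    (h : H1Pair u G) : (∫ x, ‖u x‖ ^ 4) ^ 2 ≤ (∫ x, ‖u x‖ ^ 2) * ∫ x, ‖u x‖ ^ 6 := by
  have h3 : MemLp (fun x => ‖u x‖ ^ 3) 2 volume := by
    refine (memLp_two_iff_integrable_sq (h.memLp.1.norm.pow 3)).2 ?_
    simpa [← pow_mul] using h.integrable_six
  have := integral_mul_sq_le h.memLp.norm h3
  simpa only [← pow_succ', ← pow_mul] using this

/-! ### Difference quotients and the modulus -/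

theorem inner_toLp_ofReal {f : Space → ℂ} (hf : MemLp f 2 volume) {φ : Space → ℝ}
    (hφ : MemLp (fun x => (φ x : ℂ)) 2 volume) :
    (starRingEnd ℂ) (inner ℂ (hf.toLp f) (hφ.toLp _)) = ∫ x, φ x • f x := by
  rw [L2.inner_def, ← integral_conj]
  refine integral_congr_ae ?_
  filter_upwards [hf.coeFn_toLp, hφ.coeFn_toLp] with x h1 h2
  rw [h1, h2]
  simp

theorem norm_toLp_sq {E : Type*} [NormedAddCommGroup E] {f : Space → E}
    (hf : MemLp f 2 volume) : ‖hf.toLp f‖ ^ 2 = ∫ x, ‖f x‖ ^ 2 := by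
  rw [Lp.norm_toLp, toReal_eLpNorm hf.1, lpNorm_two_sq hf.1]

/-- Weak lower semicontinuity of the norm; testing against the limit itself is enough. -/
theorem norm_le_of_tendsto_inner {H : Type*} [NormedAddCommGroup H] [InnerProductSpace ℂ H]
    {x : ℕ → H} {a : H} {C : ℝ} (hC : 0 ≤ C) (hx : ∀ n, ‖x n‖ ≤ C)
    (h : Tendsto (fun n => inner ℂ (x n) a) atTop (𝓝 (inner ℂ a a))) : ‖a‖ ≤ C := by
  have h1 : ‖inner ℂ a a‖ ≤ C * ‖a‖ := le_of_tendsto h.norm (Eventually.of_forall fun n =>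
    (norm_inner_le_norm _ _).trans (by gcongr; exact hx n))
  rw [inner_self_eq_norm_sq_to_K] at h1
  simp only [Complex.coe_algebraMap, norm_pow, Complex.norm_real, norm_norm] at h1
  by_contra hlt
  push Not at hlt
  nlinarith

theorem IsTest.lipschitz {φ : Space → ℝ} (h : IsTest φ) : ∃ L, LipschitzWith L φ :=
  ContDiff.lipschitzWith_of_hasCompactSupport h.2 h.1 (by simp)

/-- The quotients are bounded by the Lipschitz constant of `φ`, and for `|t| ≤ 1` they are all
supported in one ball, so local integrability of `u` suffices for dominated convergence. -/
theorem tendsto_integral_diffQuot {φ : Space → ℝ} (hφ : IsTest φ) {u : Space → ℂ}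
    (hu : LocallyIntegrable u volume) (i : Fin 3) {t : ℕ → ℝ} (ht0 : ∀ n, t n ≠ 0)
    (ht1 : ∀ n, |t n| ≤ 1) (ht : Tendsto t atTop (𝓝 0)) :
    Tendsto (fun n => ∫ x, ((t n)⁻¹ * (φ (x + t n • EuclideanSpace.single i 1) - φ x)) • u x)
      atTop (𝓝 (∫ x, partialDeriv i φ x • u x)) := by
  obtain ⟨L, hL⟩ := hφ.lipschitz
  obtain ⟨R, hR⟩ := hφ.2.isCompact.isBounded.subset_closedBall (0 : Space)
  have hz : ∀ x, R < ‖x‖ → φ x = 0 := fun x hx => by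
    by_contra hne
    have := hR (subset_tsupport φ hne)
    rw [mem_closedBall_zero_iff] at this
    linarith
  set e : Space := EuclideanSpace.single i 1 with he
  have hne : ‖e‖ = 1 := by simp [he]
  refine tendsto_integral_of_dominated_convergence
    ((Metric.closedBall (0 : Space) (R + 1)).indicator fun x => (L : ℝ) * ‖u x‖)
    (fun n => ?_) ?_ (fun n => Eventually.of_forall fun x => ?_)
    (Eventually.of_forall fun x => ?_)
  · have := hφ.continuous
    have hc : Continuous fun x => (t n)⁻¹ * (φ (x + t n • e) - φ x) := by fun_prop
    exact hc.aestronglyMeasurable.smul hu.aestronglyMeasurable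
  · refine IntegrableOn.integrable_indicator ?_ measurableSet_closedBall
    exact ((hu.integrableOn_isCompact (isCompact_closedBall _ _)).norm.const_mul _)
  · by_cases hx : x ∈ Metric.closedBall (0 : Space) (R + 1)
    · rw [indicator_of_mem hx, norm_smul]
      gcongr
      have h1 := hL.dist_le_mul (x + t n • e) x
      rw [Real.dist_eq, dist_eq_norm, add_sub_cancel_left, norm_smul, hne, mul_one] at h1
      rw [norm_mul, norm_inv, Real.norm_eq_abs, Real.norm_eq_abs] 
      rw [Real.norm_eq_abs] at h1
      rw [inv_mul_le_iff₀ (abs_pos.2 (ht0 n)), mul_comm]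
      exact h1
    · rw [indicator_of_notMem hx]
      rw [mem_closedBall_zero_iff, not_le] at hx
      have h1 : R < ‖x + t n • e‖ := by
        have := norm_sub_norm_le x (-(t n • e))
        rw [sub_neg_eq_add, norm_neg, norm_smul, hne, mul_one, Real.norm_eq_abs] at this
        linarith [ht1 n]
      rw [hz _ h1, hz x (by linarith)]
      simp
  · have hd : HasLineDerivAt ℝ φ (fderiv ℝ φ x e) x e :=
      (hφ.differentiable x).hasFDerivAt.hasLineDerivAt e
    have h1 := hd.tendsto_slope_zero
    have h2 : Tendsto t atTop (𝓝[≠] 0) :=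
      tendsto_nhdsWithin_iff.2 ⟨ht, Eventually.of_forall ht0⟩
    have h3 : Tendsto (fun n => (t n)⁻¹ * (φ (x + t n • e) - φ x)) atTop
        (𝓝 (partialDeriv i φ x)) := h1.comp h2
    exact h3.smul_const (u x)

/-- The difference quotients of `u` are bounded in `L²` by `a`, and a weak limit is the weak
derivative: moving the quotient onto the test function reverses the step. Weak lower semicontinuity
keeps the constant exactly `a`. -/
theorem exists_weakDeriv_of_translate_le {i : Fin 3} {u : Space → ℂ} (hu : MemLp u 2 volume)
    {a : ℝ} (ha : 0 ≤ a)
    (h : ∀ t : ℝ, 0 < t → eLpNorm (fun x => u (x + t • EuclideanSpace.single i 1) - u x) 2 volume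
      ≤ ENNReal.ofReal (t * a)) :
    ∃ g, MemLp g 2 volume ∧ HasWeakDeriv i u g ∧ ∫ x, ‖g x‖ ^ 2 ≤ a ^ 2 := by
  set e : Space := EuclideanSpace.single i 1 with he
  set t : ℕ → ℝ := fun n => ((n : ℝ) + 1)⁻¹ with htdef
  have ht : ∀ n, 0 < t n := fun n => by positivity
  have hut := fun n => hu.comp_measurePreserving (measurePreserving_add_right volume (t n • e))
  have hq : ∀ n, MemLp (fun x => (t n)⁻¹ • (u (x + t n • e) - u x)) 2 volume := fun n =>
    ((hut n).sub hu).const_smul (t n)⁻¹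
  have hb : ∀ n, ‖(hq n).toLp _‖ ≤ a := by
    intro n
    rw [Lp.norm_toLp]
    refine ENNReal.toReal_le_of_le_ofReal ha ?_
    change eLpNorm ((t n)⁻¹ • fun x => u (x + t n • e) - u x) 2 volume ≤ _
    rw [eLpNorm_const_smul, Real.enorm_eq_ofReal (inv_nonneg.2 (ht n).le)]
    refine (mul_le_mul_right (h (t n) (ht n)) _).trans_eq ?_
    rw [← ENNReal.ofReal_mul (inv_nonneg.2 (ht n).le), inv_mul_cancel_left₀ (ht n).ne']
  obtain ⟨g, φ, hφ, hw⟩ := exists_subseq_tendsto_inner (fun n => (hq n).toLp _) a hb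
  have hgm : MemLp g 2 volume := Lp.memLp g
  have hgg : hgm.toLp g = g := Lp.toLp_coeFn g hgm
  refine ⟨g, hgm, fun ψ hψ => ?_, ?_⟩
  · have hψc : MemLp (fun x => (ψ x : ℂ)) 2 volume := (hψ.memLp 2).ofReal
    have h1 := (Complex.continuous_conj.tendsto _).comp (hw (hψc.toLp _))
    have h1' : Tendsto (fun n => ∫ x, ψ x • ((t (φ n))⁻¹ • (u (x + t (φ n) • e) - u x))) atTop
        (𝓝 (∫ x, ψ x • g x)) := by
      rw [← hgg, inner_toLp_ofReal hgm hψc] at h1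
      refine h1.congr fun n => ?_
      exact inner_toLp_ofReal (hq (φ n)) hψc
    have h2 := tendsto_integral_diffQuot hψ (MemLp.locInt hu) i (t := fun n => -t (φ n))
      (fun n => by simpa using (ht (φ n)).ne')
      (fun n => by
        rw [abs_neg, abs_of_pos (ht _)]
        exact inv_le_one_of_one_le₀ (by linarith [(Nat.cast_nonneg (φ n) : (0 : ℝ) ≤ φ n)]))
      (by simpa using (tendsto_inv_add_one.comp hφ.tendsto_atTop).neg)
    have h3 : ∀ n, ∫ x, ((-t (φ n))⁻¹ * (ψ (x + (-t (φ n)) • e) - ψ x)) • u x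
        = -∫ x, ψ x • ((t (φ n))⁻¹ • (u (x + t (φ n) • e) - u x)) := by
      intro n
      set s := t (φ n)
      have i1 : Integrable (fun x => ψ x • u (x + s • e)) volume :=
        hψ.integrable_smul (MemLp.locInt (hut (φ n)))
      have i2 : Integrable (fun x => ψ x • u x) volume := hψ.integrable_smul (MemLp.locInt hu)
      have i3 : Integrable (fun x => ψ (x + -s • e) • u x) volume :=
        (hψ.comp_add (-s • e)).integrable_smul (MemLp.locInt hu)
      have e1 : ∫ x, ψ (x + -s • e) • u x = ∫ x, ψ x • u (x + s • e) := by
        rw [← integral_add_right_eq_self _ (s • e)]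
        simp
      have e2 : ∀ x, ((-s)⁻¹ * (ψ (x + (-s) • e) - ψ x)) • u x
          = (-s)⁻¹ • (ψ (x + (-s) • e) • u x - ψ x • u x) := fun x => by
        rw [mul_smul, sub_smul]
      have e3 : ∀ x, ψ x • (s⁻¹ • (u (x + s • e) - u x))
          = s⁻¹ • (ψ x • u (x + s • e) - ψ x • u x) := fun x => by
        rw [smul_comm, smul_sub]
      simp only [e2, e3]
      rw [integral_smul, integral_smul, integral_sub i3 i2, integral_sub i1 i2, e1, inv_neg,
        neg_smul]
    have h4 := h2.congr h3
    exact tendsto_nhds_unique h4 h1'.neg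
  · have := norm_le_of_tendsto_inner ha (fun n => hb (φ n)) (hw g)
    calc ∫ x, ‖g x‖ ^ 2 = ‖g‖ ^ 2 := by rw [← norm_toLp_sq hgm, hgg]
      _ ≤ a ^ 2 := by gcongr

theorem integral_norm_sq_eq_sum {G : Space → EuclideanSpace ℂ (Fin 3)}
    (hG : MemLp G 2 volume) : ∫ x, ‖G x‖ ^ 2 = ∑ i, ∫ x, ‖G x i‖ ^ 2 := by
  rw [← integral_finsetSum]
  · simp [EuclideanSpace.norm_sq_eq]
  · exact fun i _ => MemLp.integrable_pow (n := 2) (by simpa using memLp_euclidean_iff.1 hG i)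
      (by norm_num)

/-- Since `||a| - |b|| ≤ |a - b|`, the translation estimates pass from `u` to `|u|` direction by
direction without loss. This replaces a chain rule, which would be delicate at the zeros of `u`. -/
theorem H1Pair.exists_abs {u : Space → ℂ} {G : Space → EuclideanSpace ℂ (Fin 3)}
    (h : H1Pair u G) : ∃ G', H1Pair (fun x => ((‖u x‖ : ℝ) : ℂ)) G' ∧
      ∫ x, ‖G' x‖ ^ 2 ≤ ∫ x, ‖G x‖ ^ 2 := by
  have hw : MemLp (fun x => ((‖u x‖ : ℝ) : ℂ)) 2 volume := h.memLp.norm.ofReal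
  have key : ∀ i, ∃ g, MemLp g 2 volume ∧ HasWeakDeriv i (fun x => ((‖u x‖ : ℝ) : ℂ)) g ∧
      ∫ x, ‖g x‖ ^ 2 ≤ ∫ x, ‖G x i‖ ^ 2 := by
    intro i
    have hGi := h.comp_memLp i
    rw [← lpNorm_two_sq hGi.1]
    refine exists_weakDeriv_of_translate_le hw lpNorm_nonneg fun t ht => ?_
    have h1 := h.eLpNorm_translate_sub_le (t • EuclideanSpace.single i 1)
    have e : (fun x => ∑ j, ((t • EuclideanSpace.single i (1 : ℝ) : Space) j) • G x j)
        = t • fun x => G x i := by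
      funext x
      simp
    rw [e, eLpNorm_const_smul, Real.enorm_eq_ofReal ht.le, ← ofReal_lpNorm hGi,
      ← ENNReal.ofReal_mul ht.le] at h1
    refine (eLpNorm_mono fun x => ?_).trans h1
    rw [← Complex.ofReal_sub, Complex.norm_real]
    exact abs_norm_sub_norm_le _ _
  choose g hg1 hg2 hg3 using key
  have hG' : MemLp (fun x => (WithLp.toLp 2 fun i => g i x : EuclideanSpace ℂ (Fin 3))) 2 volume :=
    memLp_euclidean_iff.2 hg1
  refine ⟨_, ⟨hw, hG', hasWeakGradient_iff.2 hg2⟩, ?_⟩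
  rw [integral_norm_sq_eq_sum hG', integral_norm_sq_eq_sum h.grad_memLp]
  exact Finset.sum_le_sum fun i _ => hg3 i

/-! ### The regularized gradient kernel -/

/-- `y₃ / max(|y|, ε)³`, the regularization of `y₃ / |y|³`. -/
def regKernel (ε : ℝ) (y : Space) : ℝ := y 2 / (max ‖y‖ ε) ^ 3

/-- `y₃ / |y|³`, minus the third partial derivative of `1 / |y|`. -/
def gradKernel (y : Space) : ℝ := y 2 / ‖y‖ ^ 3

/-- The third coordinate vector. -/
abbrev axis : Space := EuclideanSpace.single 2 1

theorem norm_axis : ‖axis‖ = 1 := by simp [axis]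

theorem abs_coord_le (y : Space) (i : Fin 3) : |y i| ≤ ‖y‖ := PiLp.norm_apply_le y i

/-- The constant is `4 = 1 + 3`: one unit from the numerator and three from the difference of the
cubes in the denominator. -/
theorem regKernel_lipschitz {ε : ℝ} (hε : 0 < ε) :
    LipschitzWith (Real.toNNReal (4 / ε ^ 3)) (regKernel ε) := by
  refine LipschitzWith.of_dist_le_mul fun y z => ?_
  rw [Real.coe_toNNReal _ (by positivity), Real.dist_eq, dist_eq_norm, regKernel, regKernel]
  set m := max ‖y‖ ε with hm
  set n := max ‖z‖ ε with hn
  set d := ‖y - z‖ with hd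
  have hmε : ε ≤ m := le_max_right _ _
  have hnε : ε ≤ n := le_max_right _ _
  have hm0 : 0 < m := hε.trans_le hmε
  have hn0 : 0 < n := hε.trans_le hnε
  have h1 : |y 2 - z 2| ≤ d := abs_coord_le (y - z) 2
  have h2 : |z 2| ≤ n := (abs_coord_le z 2).trans (le_max_left _ _)
  have h3 : |m - n| ≤ d := by
    refine (abs_max_sub_max_le_abs _ _ _).trans (abs_norm_sub_norm_le y z)
  have hd0 : 0 ≤ d := norm_nonneg _
  have e : y 2 / m ^ 3 - z 2 / n ^ 3
      = (y 2 - z 2) / m ^ 3 + z 2 * ((n - m) * (n ^ 2 + n * m + m ^ 2)) / (m ^ 3 * n ^ 3) := by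
    field_simp; ring
  rw [e]
  have a1 : |(y 2 - z 2) / m ^ 3| ≤ d / ε ^ 3 := by
    rw [abs_div, abs_of_pos (by positivity : 0 < m ^ 3)]
    gcongr
  have a2 : |z 2 * ((n - m) * (n ^ 2 + n * m + m ^ 2)) / (m ^ 3 * n ^ 3)|
      ≤ d * (1 / m ^ 3 + 1 / (m ^ 2 * n) + 1 / (m * n ^ 2)) := by
    rw [abs_div, abs_mul, abs_mul, abs_of_pos (by positivity : 0 < m ^ 3 * n ^ 3),
      abs_of_pos (by positivity : 0 < n ^ 2 + n * m + m ^ 2), abs_sub_comm n m]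
    calc |z 2| * (|m - n| * (n ^ 2 + n * m + m ^ 2)) / (m ^ 3 * n ^ 3)
        ≤ n * (d * (n ^ 2 + n * m + m ^ 2)) / (m ^ 3 * n ^ 3) := by gcongr
      _ = _ := by field_simp
  have a3 : 1 / m ^ 3 + 1 / (m ^ 2 * n) + 1 / (m * n ^ 2) ≤ 3 / ε ^ 3 := by
    have b1 : 1 / m ^ 3 ≤ 1 / ε ^ 3 := by gcongr
    have b2 : 1 / (m ^ 2 * n) ≤ 1 / ε ^ 3 := by
      rw [show ε ^ 3 = ε ^ 2 * ε by ring]; gcongr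
    have b3 : 1 / (m * n ^ 2) ≤ 1 / ε ^ 3 := by
      rw [show ε ^ 3 = ε * ε ^ 2 by ring]; gcongr
    have : 3 / ε ^ 3 = 1 / ε ^ 3 + 1 / ε ^ 3 + 1 / ε ^ 3 := by ring
    linarith
  calc _ ≤ _ := abs_add_le _ _
    _ ≤ d / ε ^ 3 + d * (3 / ε ^ 3) := add_le_add a1 (a2.trans (by gcongr))
    _ = 4 / ε ^ 3 * d := by ring

theorem norm_add_smul_axis (y : Space) (t : ℝ) :
    ‖y + t • axis‖ = √(‖y‖ ^ 2 + 2 * t * y 2 + t ^ 2) := by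
  have h : ‖y + t • axis‖ ^ 2 = ‖y‖ ^ 2 + 2 * t * y 2 + t ^ 2 := by
    rw [norm_add_sq_real, inner_smul_right, EuclideanSpace.inner_single_right, norm_smul, norm_axis]
    simp
    ring
  rw [← h, Real.sqrt_sq (norm_nonneg _)]

theorem hasLineDerivAt_regKernel_of_lt {ε : ℝ} {y : Space} (h : ‖y‖ < ε) :
    HasLineDerivAt ℝ (regKernel ε) (ε ^ 3)⁻¹ y axis := by
  have hev : ∀ᶠ z in 𝓝 y, regKernel ε z = z 2 / ε ^ 3 := by
    filter_upwards [continuous_norm.continuousAt.eventually_lt continuousAt_const h] with z hz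
    rw [regKernel, max_eq_right hz.le]
  refine HasLineDerivAt.congr_of_eventuallyEq ?_ hev
  have : HasDerivAt (fun t : ℝ => (y 2 + t) / ε ^ 3) (1 / ε ^ 3) 0 :=
    ((hasDerivAt_id 0).const_add _).div_const _
  unfold HasLineDerivAt
  simpa [axis, one_div] using this

/-- The third derivative `∂₃(y₃/|y|³)` equals `(1 - 3 cos² θ)/|y|³`: this is the point where the
shape of the dipole kernel enters. -/
theorem hasLineDerivAt_regKernel_of_gt {ε : ℝ} (hε : 0 < ε) {y : Space} (h : ε < ‖y‖) :
    HasLineDerivAt ℝ (regKernel ε) (dipoleKernel y) y axis := by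
  have hev : ∀ᶠ z in 𝓝 y, regKernel ε z = z 2 / ‖z‖ ^ 3 := by
    filter_upwards [continuousAt_const.eventually_lt continuous_norm.continuousAt h] with z hz
    rw [regKernel, max_eq_left hz.le]
  refine HasLineDerivAt.congr_of_eventuallyEq ?_ hev
  have hy : 0 < ‖y‖ := hε.trans h
  unfold HasLineDerivAt
  simp only [norm_add_smul_axis]
  have h1 : HasDerivAt (fun t : ℝ => ‖y‖ ^ 2 + 2 * t * y 2 + t ^ 2) (2 * y 2) 0 := by
    have := ((((hasDerivAt_id (0 : ℝ)).const_mul 2).mul_const (y 2)).const_add (‖y‖ ^ 2)).add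
      ((hasDerivAt_id (0 : ℝ)).pow 2)
    refine (this.congr_deriv (by simp)).congr_of_eventuallyEq (Eventually.of_forall fun t => ?_)
    simp
  have h2 := h1.sqrt (by simp [hy.ne'])
  have h3 : HasDerivAt (fun t : ℝ => y 2 + t) 1 0 := (hasDerivAt_id 0).const_add _
  have h4 := h3.div (h2.pow 3) (by simp [hy.ne'])
  simp only [mul_zero, zero_mul, add_zero, ne_eq, OfNat.ofNat_ne_zero, not_false_eq_true,
    zero_pow, Real.sqrt_sq hy.le] at h4
  have h5 : (fun t : ℝ => (y + t • axis) 2 / √(‖y‖ ^ 2 + 2 * t * y 2 + t ^ 2) ^ 3)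
      = (fun t : ℝ => y 2 + t) / ((fun t => √(‖y‖ ^ 2 + 2 * t * y 2 + t ^ 2)) ^ 3) := by
    funext t; simp [axis]
  rw [h5]
  refine h4.congr_deriv ?_
  simp only [dipoleKernel, Pi.pow_apply, mul_zero, zero_mul, add_zero, ne_eq,
    OfNat.ofNat_ne_zero, not_false_eq_true, zero_pow, Real.sqrt_sq hy.le]
  field_simp
  norm_num
  ring


theorem abs_dipoleKernel_le (y : Space) : |dipoleKernel y| ≤ 2 / ‖y‖ ^ 3 := by
  rw [dipoleKernel, abs_div, abs_of_nonneg (by positivity : 0 ≤ ‖y‖ ^ 3)]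
  gcongr
  have h : |y 2 / ‖y‖| ≤ 1 := by
    rw [abs_div, abs_norm]
    exact div_le_one_of_le₀ (abs_coord_le y 2) (norm_nonneg _)
  have h2 : (y 2 / ‖y‖) ^ 2 ≤ 1 := (sq_le_one_iff_abs_le_one _).2 h
  rw [abs_le]
  constructor <;> nlinarith [sq_nonneg (y 2 / ‖y‖)]

theorem measurable_dipoleKernel : Measurable dipoleKernel := by
  unfold dipoleKernel
  fun_prop

theorem measurable_gradKernel : Measurable gradKernel := by
  unfold gradKernel
  fun_prop

theorem abs_regKernel_le (ε : ℝ) (y : Space) : |regKernel ε y| ≤ (‖y‖ ^ 2)⁻¹ := by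
  rcases eq_or_ne y 0 with rfl | hy
  · simp [regKernel]
  · have hy : 0 < ‖y‖ := norm_pos_iff.2 hy
    rw [regKernel, abs_div, abs_of_nonneg (by positivity : 0 ≤ max ‖y‖ ε ^ 3)]
    calc |y 2| / max ‖y‖ ε ^ 3 ≤ ‖y‖ / ‖y‖ ^ 3 := by
          gcongr
          · exact abs_coord_le y 2
          · exact le_max_left _ _
      _ = _ := by field_simp

theorem abs_regKernel_le_const {ε : ℝ} (hε : 0 < ε) (y : Space) :
    |regKernel ε y| ≤ (ε ^ 2)⁻¹ := by
  have hm : 0 < max ‖y‖ ε := hε.trans_le (le_max_right _ _)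
  rw [regKernel, abs_div, abs_of_nonneg (by positivity : 0 ≤ max ‖y‖ ε ^ 3)]
  calc |y 2| / max ‖y‖ ε ^ 3 ≤ max ‖y‖ ε / max ‖y‖ ε ^ 3 := by
        gcongr
        exact (abs_coord_le y 2).trans (le_max_left _ _)
    _ = (max ‖y‖ ε ^ 2)⁻¹ := by field_simp
    _ ≤ _ := by gcongr; exact le_max_right _ _

/-! ### Integration by parts in the truncated convolution -/

/-- `f` is approximated in `L¹`, together with its third partial derivative `γ`, by the test
functions `F n`. -/
structure L1Approx (F : ℕ → Space → ℝ) (f γ : Space → ℝ) : Prop where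
  isTest : ∀ n, IsTest (F n)
  integrable : Integrable f volume
  integrable_deriv : Integrable γ volume
  tendsto : Tendsto (fun n => ∫⁻ x, ‖F n x - f x‖ₑ) atTop (𝓝 0)
  tendsto_deriv : Tendsto (fun n => ∫⁻ x, ‖partialDeriv 2 (F n) x - γ x‖ₑ) atTop (𝓝 0)

theorem integrable_bdd_mul_comp_sub {k f : Space → ℝ} (hk : Measurable k) {C : ℝ}
    (hC : ∀ y, |k y| ≤ C) (hf : Integrable f volume) (x : Space) :
    Integrable (fun y => k y * f (x - y)) volume :=
  (hf.comp_sub_left x).bdd_mul hk.aestronglyMeasurable (Eventually.of_forall hC)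

theorem tendsto_integral_bdd_mul_comp_sub {k f : Space → ℝ} (hk : Measurable k) {C : ℝ}
    (hC : ∀ y, |k y| ≤ C) {F : ℕ → Space → ℝ} (hF : ∀ n, Integrable (F n) volume)
    (hf : Integrable f volume) (h : Tendsto (fun n => ∫⁻ x, ‖F n x - f x‖ₑ) atTop (𝓝 0))
    (x : Space) :
    Tendsto (fun n => ∫ y, k y * F n (x - y)) atTop (𝓝 (∫ y, k y * f (x - y))) := by
  refine tendsto_integral_of_L1 _ (integrable_bdd_mul_comp_sub hk hC hf x).1
    (Eventually.of_forall fun n => integrable_bdd_mul_comp_sub hk hC (hF n) x) ?_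
  have h1 := ENNReal.Tendsto.const_mul (a := ENNReal.ofReal C) h (Or.inr ENNReal.ofReal_ne_top)
  rw [mul_zero] at h1
  refine tendsto_of_tendsto_of_tendsto_of_le_of_le tendsto_const_nhds h1 (fun _ => zero_le)
    fun n => ?_
  simp only
  rw [← lintegral_sub_left_eq_self (fun y => ‖F n y - f y‖ₑ) x,
    ← lintegral_const_mul' _ _ ENNReal.ofReal_ne_top]
  refine lintegral_mono fun y => ?_
  rw [← mul_sub, enorm_mul]
  gcongr
  rw [Real.enorm_eq_ofReal_abs]
  exact ENNReal.ofReal_le_ofReal (hC y)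

theorem ae_norm_ne (ε : ℝ) : ∀ᵐ y : Space, ‖y‖ ≠ ε := by
  have := Measure.addHaar_sphere (volume : Measure Space) 0 ε
  filter_upwards [compl_mem_ae_iff.2 this] with y hy
  simpa using hy

/-- Integration by parts for the Lipschitz function `regKernel ε`. Its derivative along the axis is
the dipole kernel outside the ball and `ε⁻³` inside; the sphere in between is a null set. -/
theorem truncated_integral_test {ε : ℝ} (hε : 0 < ε) {f : Space → ℝ} (hf : IsTest f) (x : Space) :
    ∫ y in {y : Space | ε < ‖y‖}, dipoleKernel y * f (x - y)
      = (∫ y, regKernel ε y * partialDeriv 2 f (x - y))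
        - (ε ^ 3)⁻¹ * ∫ y in Metric.closedBall (0 : Space) ε, f (x - y) := by
  obtain ⟨L, hL⟩ := (hf.comp_sub_left x).lipschitz
  have h := (regKernel_lipschitz hε).integral_lineDeriv_mul_eq (μ := (volume : Measure Space)) hL
    (hf.comp_sub_left x).2 axis
  have e2 : ∫ y, lineDeriv ℝ (fun y => f (x - y)) y (-axis) * regKernel ε y
      = ∫ y, regKernel ε y * partialDeriv 2 f (x - y) := by
    refine integral_congr_ae (Eventually.of_forall fun y => ?_)
    simp only
    rw [((hf.comp_sub_left x).differentiable y).lineDeriv_eq_fderiv, map_neg]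
    have := partialDeriv_comp_sub_left hf.differentiable x y 2
    simp only [partialDeriv] at this ⊢
    rw [this]; ring
  have hms : MeasurableSet {y : Space | ε < ‖y‖} := measurableSet_lt measurable_const measurable_norm
  have hcomp : {y : Space | ε < ‖y‖}ᶜ = Metric.closedBall (0 : Space) ε := by
    ext y; simp
  have hi : Integrable (fun y => lineDeriv ℝ (regKernel ε) y axis * f (x - y)) volume := by
    refine (hf.comp_sub_left x).integrable.bdd_mul
      (c := ((4 / ε ^ 3).toNNReal : ℝ) * ‖axis‖) ?_ (Eventually.of_forall fun y => ?_)
    · exact (measurable_lineDeriv (regKernel_lipschitz hε).continuous).aestronglyMeasurable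
    · exact norm_lineDeriv_le_of_lipschitz ℝ (regKernel_lipschitz hε)
  rw [← integral_add_compl hms hi, hcomp, e2] at h
  have e3 : ∫ y in {y : Space | ε < ‖y‖}, lineDeriv ℝ (regKernel ε) y axis * f (x - y)
      = ∫ y in {y : Space | ε < ‖y‖}, dipoleKernel y * f (x - y) := by
    refine setIntegral_congr_fun hms fun y hy => ?_
    rw [(hasLineDerivAt_regKernel_of_gt hε hy).lineDeriv]
  have e4 : ∫ y in Metric.closedBall (0 : Space) ε, lineDeriv ℝ (regKernel ε) y axis * f (x - y)
      = (ε ^ 3)⁻¹ * ∫ y in Metric.closedBall (0 : Space) ε, f (x - y) := by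
    rw [← integral_const_mul]
    refine setIntegral_congr_ae measurableSet_closedBall ?_
    filter_upwards [ae_norm_ne ε] with y hy hy2
    rw [mem_closedBall_zero_iff] at hy2
    rw [(hasLineDerivAt_regKernel_of_lt (lt_of_le_of_ne hy2 hy)).lineDeriv]
  rw [e3, e4] at h
  linarith

/-- For fixed `ε` the three kernels involved are bounded, so both sides are continuous in `f` and
`γ` for the `L¹` norm. -/
theorem L1Approx.truncated_integral {F : ℕ → Space → ℝ} {f γ : Space → ℝ} (h : L1Approx F f γ)
    {ε : ℝ} (hε : 0 < ε) (x : Space) :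
    ∫ y in {y : Space | ε < ‖y‖}, dipoleKernel y * f (x - y)
      = (∫ y, regKernel ε y * γ (x - y))
        - (ε ^ 3)⁻¹ * ∫ y in Metric.closedBall (0 : Space) ε, f (x - y) := by
  have hms : MeasurableSet {y : Space | ε < ‖y‖} := measurableSet_lt measurable_const measurable_norm
  have hFi : ∀ n, Integrable (F n) volume := fun n => (h.isTest n).integrable
  have t1 := tendsto_integral_bdd_mul_comp_sub (measurable_dipoleKernel.indicator hms)
    (C := 2 / ε ^ 3) (fun y => by
      by_cases hy : y ∈ {y : Space | ε < ‖y‖}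
      · rw [indicator_of_mem hy]
        refine (abs_dipoleKernel_le y).trans ?_
        have : ε ≤ ‖y‖ := le_of_lt hy
        gcongr
      · rw [indicator_of_notMem hy, abs_zero]; positivity) hFi h.integrable h.tendsto x
  have t2 := tendsto_integral_bdd_mul_comp_sub (regKernel_lipschitz hε).continuous.measurable
    (abs_regKernel_le_const hε) (fun n => ((h.isTest n).partialDeriv 2).integrable)
    h.integrable_deriv h.tendsto_deriv x
  have t3 := tendsto_integral_bdd_mul_comp_sub
    ((measurable_const (a := (1 : ℝ))).indicator
      (measurableSet_closedBall : MeasurableSet (Metric.closedBall (0 : Space) ε)))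
    (C := 1) (fun y => by
      by_cases hy : y ∈ Metric.closedBall (0 : Space) ε <;> simp [indicator, hy])
    hFi h.integrable h.tendsto x
  have c1 : ∀ g : Space → ℝ, ∫ y, {y : Space | ε < ‖y‖}.indicator dipoleKernel y * g (x - y)
      = ∫ y in {y : Space | ε < ‖y‖}, dipoleKernel y * g (x - y) := fun g => by
    rw [← integral_indicator hms]
    refine integral_congr_ae (Eventually.of_forall fun y => ?_)
    simp only [indicator]
    split_ifs <;> simp
  have c3 : ∀ g : Space → ℝ,
      ∫ y, (Metric.closedBall (0 : Space) ε).indicator (fun _ => (1 : ℝ)) y * g (x - y)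
      = ∫ y in Metric.closedBall (0 : Space) ε, g (x - y) := fun g => by
    rw [← integral_indicator measurableSet_closedBall]
    refine integral_congr_ae (Eventually.of_forall fun y => ?_)
    simp only [indicator]
    split_ifs <;> simp
  simp only [c1] at t1
  simp only [c3] at t3
  refine tendsto_nhds_unique t1 ?_
  simp only [truncated_integral_test hε (h.isTest _)]
  exact t2.sub (t3.const_mul _)

/-! ### The principal value -/

/-- The integrable singular part `|y|⁻² 1_{|y| < 1}` of `|y|⁻²`. -/
def localKernel (y : Space) : ℝ := (Metric.ball (0 : Space) 1).indicator (fun y => (‖y‖ ^ 2)⁻¹) y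

theorem localKernel_nonneg (y : Space) : 0 ≤ localKernel y :=
  indicator_nonneg (fun _ _ => by positivity) y

theorem integrable_localKernel : Integrable localKernel volume := by
  refine IntegrableOn.integrable_indicator ?_ measurableSet_ball
  refine integrableOn_ball_of_norm_le_rpow (C := 1) (α := 2) (by simp) (by simp; norm_num)
    (Eventually.of_forall fun y => ?_) (by fun_prop : Measurable _).aestronglyMeasurable
  rw [norm_inv, norm_pow, norm_norm, one_mul, Real.rpow_neg (norm_nonneg _), Real.rpow_two]

theorem inv_norm_sq_le (y : Space) : (‖y‖ ^ 2)⁻¹ ≤ localKernel y + 1 := by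
  by_cases hy : y ∈ Metric.ball (0 : Space) 1
  · rw [localKernel, indicator_of_mem hy]; linarith
  · rw [localKernel, indicator_of_notMem hy, zero_add]
    rw [mem_ball_zero_iff, not_lt] at hy
    exact inv_le_one_of_one_le₀ (one_le_pow₀ hy)

/-- The singular part of `|y|⁻²` is integrable, so its convolution with an `L¹` function exists
almost everywhere; the other part is bounded. This is the majorant for the limit `ε → 0`. -/
theorem ae_integrable_localKernel_mul {γ : Space → ℝ} (hγ : Integrable γ volume) :
    ∀ᵐ x : Space, Integrable (fun y => (localKernel y + 1) * |γ (x - y)|) volume := by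
  have := integrable_localKernel.ae_convolution_exists (ContinuousLinearMap.mul ℝ ℝ) hγ.abs
  filter_upwards [this] with x hx
  have h1 : Integrable (fun y => localKernel y * |γ (x - y)|) volume := hx
  have h2 : Integrable (fun y => |γ (x - y)|) volume := hγ.abs.comp_sub_left x
  refine (h1.add h2).congr (Eventually.of_forall fun y => ?_)
  simp only [Pi.add_apply]
  ring

theorem tendsto_regKernel (y : Space) :
    Tendsto (fun ε => regKernel ε y) (𝓝[>] 0) (𝓝 (gradKernel y)) := by
  rcases eq_or_ne y 0 with rfl | hy
  · simp [regKernel, gradKernel]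
  · refine tendsto_const_nhds.congr' ?_
    have : ∀ᶠ ε : ℝ in 𝓝[>] 0, ε < ‖y‖ :=
      nhdsWithin_le_nhds (eventually_lt_nhds (norm_pos_iff.2 hy))
    filter_upwards [this] with ε hε
    rw [regKernel, gradKernel, max_eq_left hε.le]

/-- The convolution with `y₃ / |y|³`. -/
def gradConv (γ : Space → ℝ) (x : Space) : ℝ := ∫ y, gradKernel y * γ (x - y)

/-- Lebesgue differentiation on balls. The volume `4π/3` of the unit ball becomes the coefficient of
the local term of the principal value. -/
theorem ae_tendsto_ball_average {f : Space → ℝ} (hf : Integrable f volume) :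
    ∀ᵐ x : Space, Tendsto (fun ε : ℝ => (ε ^ 3)⁻¹ *
      ∫ y in Metric.closedBall (0 : Space) ε, f (x - y)) (𝓝[>] 0)
      (𝓝 (4 * Real.pi / 3 * f x)) := by
  filter_upwards [IsUnifLocDoublingMeasure.ae_tendsto_average (μ := (volume : Measure Space))
    hf.locallyIntegrable 1] with x hx
  have h1 := hx (fun _ : ℝ => x) (fun ε : ℝ => ε) tendsto_id (by
    filter_upwards [self_mem_nhdsWithin] with ε hε
    exact Metric.mem_closedBall_self (by simpa using (le_of_lt hε)))
  refine (h1.const_mul (4 * Real.pi / 3)).congr' ?_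
  filter_upwards [self_mem_nhdsWithin] with ε hε
  have hε : 0 < ε := hε
  have e : ∫ y in Metric.closedBall (0 : Space) ε, f (x - y)
      = ∫ y in Metric.closedBall x ε, f y := by
    rw [← integral_indicator measurableSet_closedBall, ← integral_indicator measurableSet_closedBall,
      ← integral_sub_left_eq_self _ volume x]
    refine integral_congr_ae (Eventually.of_forall fun y => ?_)
    simp [indicator, dist_eq_norm, norm_sub_rev]
  rw [e, setAverage_eq, measureReal_def, EuclideanSpace.volume_closedBall_fin_three]
  simp only [ENNReal.toReal_mul, ENNReal.toReal_pow, ENNReal.toReal_ofReal hε.le, smul_eq_mul,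
    ENNReal.toReal_ofReal (by positivity : 0 ≤ Real.pi * 4 / 3)]
  have := Real.pi_pos
  field_simp

/-- The majorant does not depend on `ε`, so the truncated integrals converge at almost every point
and `limUnder` is there a genuine limit. -/
theorem L1Approx.dipoleConv_ae {F : ℕ → Space → ℝ} {f γ : Space → ℝ} (h : L1Approx F f γ) :
    ∀ᵐ x : Space, dipoleConv f x = gradConv γ x - 4 * Real.pi / 3 * f x := by
  filter_upwards [ae_tendsto_ball_average h.integrable,
    ae_integrable_localKernel_mul h.integrable_deriv] with x h1 h2
  refine Tendsto.limUnder_eq ?_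
  have h3 : Tendsto (fun ε => ∫ y, regKernel ε y * γ (x - y)) (𝓝[>] 0) (𝓝 (gradConv γ x)) := by
    refine tendsto_integral_filter_of_dominated_convergence _ ?_ ?_ h2 ?_
    · filter_upwards [self_mem_nhdsWithin] with ε hε
      exact (integrable_bdd_mul_comp_sub (regKernel_lipschitz hε).continuous.measurable
        (abs_regKernel_le_const hε) h.integrable_deriv x).1
    · refine Eventually.of_forall fun ε => Eventually.of_forall fun y => ?_
      rw [norm_mul, Real.norm_eq_abs, Real.norm_eq_abs]
      gcongr
      exact (abs_regKernel_le ε y).trans (inv_norm_sq_le y)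
    · exact Eventually.of_forall fun y => (tendsto_regKernel y).mul_const _
  refine (h3.sub h1).congr' ?_
  filter_upwards [self_mem_nhdsWithin] with ε hε
  exact (h.truncated_integral hε x).symm

/-! ### The square of an `H¹` function -/

/-- The weak derivative `2 Re(ū ∂₃u)` of `|u|²`. -/
def sqDeriv (u : Space → ℂ) (G : Space → EuclideanSpace ℂ (Fin 3)) (x : Space) : ℝ :=
  2 * inner ℝ (u x) (G x 2)

theorem tendsto_lintegral_inner_sub {E : Type*} [NormedAddCommGroup E] [InnerProductSpace ℝ E]
    {a b : ℕ → Space → E} {a₀ b₀ : Space → E}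
    (ha : ∀ n, MemLp (a n) 2 volume) (ha₀ : MemLp a₀ 2 volume)
    (hb : ∀ n, MemLp (b n) 2 volume) (hb₀ : MemLp b₀ 2 volume)
    (hta : Tendsto (fun n => eLpNorm (fun x => a n x - a₀ x) 2 volume) atTop (𝓝 0))
    (htb : Tendsto (fun n => eLpNorm (fun x => b n x - b₀ x) 2 volume) atTop (𝓝 0)) :
    Tendsto (fun n => ∫⁻ x, ‖inner ℝ (a n x) (b n x) - inner ℝ (a₀ x) (b₀ x)‖ₑ) atTop (𝓝 0) := by
  have hbn : ∀ n, eLpNorm (b n) 2 volume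
      ≤ eLpNorm (fun x => b n x - b₀ x) 2 volume + eLpNorm b₀ 2 volume := fun n => by
    have e : b n = (fun x => b n x - b₀ x) + b₀ := by funext x; simp
    conv_lhs => rw [e]
    exact eLpNorm_add_le ((hb n).1.sub hb₀.1) hb₀.1 (by norm_num)
  have hH : ∀ f g : Space → E, AEStronglyMeasurable f volume → AEStronglyMeasurable g volume →
      ∫⁻ x, ‖f x‖ₑ * ‖g x‖ₑ ≤ eLpNorm f 2 volume * eLpNorm g 2 volume := by
    intro f g hf hg
    rw [← ENNReal.pow_le_pow_left_iff two_ne_zero, mul_pow, eLpNorm_two_sq, eLpNorm_two_sq]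
    exact lintegral_mul_sq_le hf.enorm hg.enorm
  have hlim : Tendsto (fun n => eLpNorm (fun x => a n x - a₀ x) 2 volume
      * (eLpNorm (fun x => b n x - b₀ x) 2 volume + eLpNorm b₀ 2 volume)
      + eLpNorm a₀ 2 volume * eLpNorm (fun x => b n x - b₀ x) 2 volume) atTop (𝓝 0) := by
    have h1 := ENNReal.Tendsto.mul hta (Or.inr (by simpa using hb₀.2.ne))
      (htb.add_const (eLpNorm b₀ 2 volume)) (Or.inr (by simp))
    have h2 := ENNReal.Tendsto.const_mul (a := eLpNorm a₀ 2 volume) htb (Or.inr ha₀.2.ne)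
    simpa using h1.add h2
  refine tendsto_of_tendsto_of_tendsto_of_le_of_le tendsto_const_nhds hlim (fun _ => zero_le)
    fun n => ?_
  calc ∫⁻ x, ‖inner ℝ (a n x) (b n x) - inner ℝ (a₀ x) (b₀ x)‖ₑ
      ≤ ∫⁻ x, (‖a n x - a₀ x‖ₑ * ‖b n x‖ₑ + ‖a₀ x‖ₑ * ‖b n x - b₀ x‖ₑ) := by
        refine lintegral_mono fun x => ?_
        have e : inner ℝ (a n x) (b n x) - inner ℝ (a₀ x) (b₀ x)
            = inner ℝ (a n x - a₀ x) (b n x) + inner ℝ (a₀ x) (b n x - b₀ x) := by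
          rw [inner_sub_left, inner_sub_right]; ring
        rw [e]
        refine (enorm_add_le _ _).trans ?_
        have hi : ∀ v w : E, ‖inner ℝ v w‖ₑ ≤ ‖v‖ₑ * ‖w‖ₑ := fun v w => by
          rw [← ofReal_norm, ← ofReal_norm, ← ofReal_norm, ← ENNReal.ofReal_mul (norm_nonneg _)]
          exact ENNReal.ofReal_le_ofReal (norm_inner_le_norm v w)
        exact add_le_add (hi _ _) (hi _ _)
    _ = (∫⁻ x, ‖a n x - a₀ x‖ₑ * ‖b n x‖ₑ) + ∫⁻ x, ‖a₀ x‖ₑ * ‖b n x - b₀ x‖ₑ := by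
        refine lintegral_add_left' ?_ _
        exact ((ha n).1.sub ha₀.1).enorm.mul (hb n).1.enorm
    _ ≤ _ := by
        refine add_le_add ((hH _ _ ((ha n).1.sub ha₀.1) (hb n).1).trans ?_)
          (hH _ _ ha₀.1 ((hb n).1.sub hb₀.1))
        exact mul_le_mul' le_rfl (hbn n)

theorem integrable_inner_of_memLp {E : Type*} [NormedAddCommGroup E] [InnerProductSpace ℝ E]
    {f g : Space → E} (hf : MemLp f 2 volume) (hg : MemLp g 2 volume) :
    Integrable (fun x => inner ℝ (f x) (g x)) volume :=
  (hf.norm.integrable_mul hg.norm).mono' (hf.1.inner hg.1)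
    (Eventually.of_forall fun _ => norm_inner_le_norm _ _)

theorem isTest_norm_sq {v : Space → ℂ} (hv : ContDiff ℝ ∞ v) (hc : HasCompactSupport v) :
    IsTest (fun x => ‖v x‖ ^ 2) := by
  refine ⟨hv.norm_sq ℝ, ?_⟩
  refine hc.mono fun x hx => ?_
  simp only [Function.mem_support, ne_eq] at hx ⊢
  intro h0
  simp [h0] at hx

theorem partialDeriv_norm_sq {v : Space → ℂ} (hv : ContDiff ℝ ∞ v) (i : Fin 3) (x : Space) :
    partialDeriv i (fun x => ‖v x‖ ^ 2) x = 2 * inner ℝ (v x) (cpartial i v x) := by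
  have h := ((hv.differentiable (by simp) x).hasFDerivAt).norm_sq
  rw [partialDeriv, h.fderiv]
  simp [cpartial]
  ring

theorem TestApprox.l1Approx {v : ℕ → Space → ℂ} {u : Space → ℂ}
    {G : Space → EuclideanSpace ℂ (Fin 3)} (hv : TestApprox v u G) (h : H1Pair u G) :
    L1Approx (fun n x => ‖v n x‖ ^ 2) (fun x => ‖u x‖ ^ 2) (sqDeriv u G) where
  isTest n := isTest_norm_sq (hv.contDiff n) (hv.hasCompactSupport n)
  integrable := h.integrable_sq
  integrable_deriv := (integrable_inner_of_memLp h.memLp (h.comp_memLp 2)).const_mul 2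
  tendsto := by
    have := tendsto_lintegral_inner_sub (fun n => hv.memLp n 2) h.memLp (fun n => hv.memLp n 2)
      h.memLp hv.tendsto hv.tendsto
    simpa only [real_inner_self_eq_norm_sq] using this
  tendsto_deriv := by
    have := tendsto_lintegral_inner_sub (fun n => hv.memLp n 2) h.memLp
      (fun n => memLp_cpartial (hv.contDiff n) (hv.hasCompactSupport n) 2 2) (h.comp_memLp 2)
      hv.tendsto (hv.tendsto_grad 2)
    have h2 := ENNReal.Tendsto.const_mul (a := 2) this (Or.inr (by simp))
    rw [mul_zero] at h2
    refine h2.congr fun n => ?_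
    rw [← lintegral_const_mul' _ _ (by simp)]
    refine lintegral_congr fun x => ?_
    rw [partialDeriv_norm_sq (hv.contDiff n), sqDeriv, ← mul_sub, enorm_mul]
    congr 1
    rw [Real.enorm_eq_ofReal (by norm_num)]
    simp

theorem H1Pair.dipoleConv_ae {u : Space → ℂ} {G : Space → EuclideanSpace ℂ (Fin 3)}
    (h : H1Pair u G) : ∀ᵐ x : Space, dipoleConv (fun y => ‖u y‖ ^ 2) x
      = gradConv (sqDeriv u G) x - 4 * Real.pi / 3 * ‖u x‖ ^ 2 := by
  obtain ⟨v, hv⟩ := h.exists_testApprox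
  exact (hv.l1Approx h).dipoleConv_ae

/-! ### Gaussian subordination -/

/-- A Gamma integral. It writes `|z|⁻³` as a superposition of Gaussians, whose Fourier transforms
are explicit. -/
theorem integral_sqrt_mul_exp {z : Space} (hz : z ≠ 0) :
    ∫ t in Ioi (0 : ℝ), √t * Real.exp (-(t * ‖z‖ ^ 2)) = √Real.pi / 2 * (‖z‖ ^ 3)⁻¹ := by
  have h0 : 0 < ‖z‖ := norm_pos_iff.2 hz
  have h := Real.integral_rpow_mul_exp_neg_mul_Ioi (a := 3 / 2) (r := ‖z‖ ^ 2) (by norm_num)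
    (by positivity)
  have hG : Real.Gamma (3 / 2) = √Real.pi / 2 := by
    have := Real.Gamma_add_one (s := 1 / 2) (by norm_num)
    rw [Real.Gamma_one_half_eq] at this
    rw [show (3 / 2 : ℝ) = 1 / 2 + 1 by norm_num, this]; ring
  have hp : (1 / ‖z‖ ^ 2) ^ (3 / 2 : ℝ) = 1 / ‖z‖ ^ 3 := by
    rw [Real.div_rpow zero_le_one (by positivity), Real.one_rpow, ← Real.rpow_natCast,
      ← Real.rpow_mul h0.le]
    norm_num
  rw [hG, hp] at h
  have e : ∀ t : ℝ, √t * Real.exp (-(t * ‖z‖ ^ 2))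
      = t ^ ((3 / 2 : ℝ) - 1) * Real.exp (-(‖z‖ ^ 2 * t)) := fun t => by
    rw [show (3 / 2 : ℝ) - 1 = 1 / 2 by norm_num, ← Real.sqrt_eq_rpow, mul_comm t]
  simp only [e]
  rw [h]
  ring

/-- Substitution `t ↦ 1/t`. With `c = π²|ξ|²` this sums the Gaussians on the Fourier side to a
multiple of `|ξ|⁻²`. -/
theorem integral_inv_sq_mul_exp {c : ℝ} (hc : 0 < c) :
    ∫ t in Ioi (0 : ℝ), (t ^ 2)⁻¹ * Real.exp (-(c / t)) = c⁻¹ := by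
  have h := integral_comp_rpow_Ioi (fun y => Real.exp (-(c * y))) (p := -1) (by norm_num)
  have h2 := Real.integral_rpow_mul_exp_neg_mul_Ioi (a := 1) (r := c) (by norm_num) hc
  simp only [sub_self, Real.rpow_zero, one_mul, Real.rpow_one, Real.Gamma_one, mul_one] at h2
  rw [h2, one_div] at h
  rw [← h]
  refine setIntegral_congr_fun measurableSet_Ioi fun t ht => ?_
  have ht : (0 : ℝ) < t := ht
  simp only [smul_eq_mul]
  rw [show (-1 : ℝ) - 1 = -(2 : ℕ) by norm_num, Real.rpow_neg ht.le, Real.rpow_natCast,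
    Real.rpow_neg_one]
  norm_num [div_eq_mul_inv]

/-- A Gaussian centred at `y` is the Fourier transform of a modulated Gaussian; the transform is
then shifted onto `b`. -/
theorem gaussian_integral_eq (b : 𝓢(Space, ℂ)) {t : ℝ} (ht : 0 < t) (y : Space) :
    ∫ x, (Real.exp (-(t * ‖x - y‖ ^ 2)) : ℂ) * b x
      = ((√(Real.pi / t) ^ 3 : ℝ) : ℂ) *
        ∫ ξ, Complex.exp (-((Real.pi ^ 2 / t : ℝ) : ℂ) * ‖ξ‖ ^ 2
          + 2 * Real.pi * Complex.I * (inner ℝ y ξ : ℝ)) * 𝓕 b ξ := by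
  have hb : 0 < ((Real.pi ^ 2 / t : ℝ) : ℂ).re := by
    rw [Complex.ofReal_re]; positivity
  have hi : Integrable (fun ξ : Space => Complex.exp (-((Real.pi ^ 2 / t : ℝ) : ℂ) * ‖ξ‖ ^ 2
          + 2 * Real.pi * Complex.I * (inner ℝ y ξ : ℝ))) :=
    GaussianFourier.integrable_cexp_neg_mul_sq_norm_add hb _ y
  have hF := fourier_gaussian_innerProductSpace' hb y
  have hs := VectorFourier.integral_fourierIntegral_smul_eq_flip (L := innerₗ Space)
    (μ := volume) (ν := volume) (f := fun ξ : Space => Complex.exp (-((Real.pi ^ 2 / t : ℝ) : ℂ) * ‖ξ‖ ^ 2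
          + 2 * Real.pi * Complex.I * (inner ℝ y ξ : ℝ))) (g := b)
    Real.continuous_fourierChar continuous_inner hi b.integrable
  have hflip : (innerₗ Space).flip = innerₗ Space := by
    ext x z; simp
  rw [hflip] at hs
  simp only [smul_eq_mul] at hs
  have hs' : ∫ ξ : Space, (𝓕 (fun ξ : Space => Complex.exp (-((Real.pi ^ 2 / t : ℝ) : ℂ) * ‖ξ‖ ^ 2
          + 2 * Real.pi * Complex.I * (inner ℝ y ξ : ℝ)))) ξ * b ξ
      = ∫ ξ, Complex.exp (-((Real.pi ^ 2 / t : ℝ) : ℂ) * ‖ξ‖ ^ 2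
          + 2 * Real.pi * Complex.I * (inner ℝ y ξ : ℝ)) * 𝓕 b ξ := hs
  rw [← hs', ← integral_const_mul]
  refine integral_congr_ae (Eventually.of_forall fun x => ?_)
  simp only
  rw [hF]
  have e1 : ((Real.pi : ℂ) / ((Real.pi ^ 2 / t : ℝ) : ℂ)) ^ ((Module.finrank ℝ Space : ℂ) / 2)
      = ((√(t / Real.pi) ^ 3 : ℝ) : ℂ) := by
    have : (Real.pi : ℂ) / ((Real.pi ^ 2 / t : ℝ) : ℂ) = ((t / Real.pi : ℝ) : ℂ) := by
      push_cast
      have := Real.pi_ne_zero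
      field_simp
    rw [this, finrank_euclideanSpace_fin, show ((3 : ℕ) : ℂ) / 2 = ((3 / 2 : ℝ) : ℂ) by push_cast; rfl,
      ← Complex.ofReal_cpow (by positivity), Real.sqrt_eq_rpow, ← Real.rpow_natCast,
      ← Real.rpow_mul (by positivity)]
    norm_num
  have e2 : -(Real.pi : ℂ) ^ 2 * (‖y - x‖ : ℂ) ^ 2 / ((Real.pi ^ 2 / t : ℝ) : ℂ)
      = ((-(t * ‖x - y‖ ^ 2) : ℝ) : ℂ) := by
    rw [norm_sub_rev]
    push_cast
    have := Real.pi_ne_zero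
    field_simp
  rw [e1, e2, ← Complex.ofReal_exp, ← mul_assoc, ← mul_assoc, ← Complex.ofReal_mul, ← mul_pow,
    ← Real.sqrt_mul (by positivity), show Real.pi / t * (t / Real.pi) = 1 by
      have := Real.pi_ne_zero
      field_simp]
  simp

/-- Fubini collects the phases `e^(2πi⟨y, ξ⟩)` into the transform of `a` at `-ξ`. -/
theorem gaussian_pairing (a b : 𝓢(Space, ℂ)) {t : ℝ} (ht : 0 < t) :
    ∫ y, a y * ∫ x, (Real.exp (-(t * ‖x - y‖ ^ 2)) : ℂ) * b x
      = ((√(Real.pi / t) ^ 3 : ℝ) : ℂ) *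
        ∫ ξ, (Real.exp (-(Real.pi ^ 2 * ‖ξ‖ ^ 2 / t)) : ℂ) * (𝓕 b ξ * 𝓕 a (-ξ)) := by
  have hint : Integrable (fun p : Space × Space => a p.1 * (Complex.exp (-((Real.pi ^ 2 / t : ℝ) : ℂ) * ‖p.2‖ ^ 2
          + 2 * Real.pi * Complex.I * (inner ℝ p.1 p.2 : ℝ)) * 𝓕 b p.2)) (volume.prod volume) := by
    have h1 : Integrable (fun p : Space × Space => a p.1 * 𝓕 b p.2) (volume.prod volume) :=
      a.integrable.mul_prod (𝓕 b).integrable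
    have h2 := h1.bdd_mul (f := fun p : Space × Space => Complex.exp (-((Real.pi ^ 2 / t : ℝ) : ℂ) * ‖p.2‖ ^ 2
          + 2 * Real.pi * Complex.I * (inner ℝ p.1 p.2 : ℝ))) (c := 1)
      (by fun_prop) (Eventually.of_forall fun p => ?_)
    · refine h2.congr (Eventually.of_forall fun p => ?_)
      simp only; ring
    · rw [Complex.norm_exp]
      refine Real.exp_le_one_iff.2 ?_
      have : (-((Real.pi ^ 2 / t : ℝ) : ℂ) * ‖p.2‖ ^ 2
          + 2 * Real.pi * Complex.I * (inner ℝ p.1 p.2 : ℝ))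
          = ((-(Real.pi ^ 2 / t * ‖p.2‖ ^ 2) : ℝ) : ℂ)
            + ((2 * Real.pi * inner ℝ p.1 p.2 : ℝ) : ℂ) * Complex.I := by push_cast; ring
      rw [this, Complex.add_re, Complex.ofReal_re, Complex.re_ofReal_mul, Complex.I_re, mul_zero,
        add_zero, neg_nonpos]
      positivity
  simp only [gaussian_integral_eq b ht]
  calc _ = ((√(Real.pi / t) ^ 3 : ℝ) : ℂ) * ∫ y, ∫ ξ, a y * (Complex.exp (-((Real.pi ^ 2 / t : ℝ) : ℂ) * ‖ξ‖ ^ 2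
          + 2 * Real.pi * Complex.I * (inner ℝ y ξ : ℝ)) * 𝓕 b ξ) := by
        rw [← integral_const_mul]
        refine integral_congr_ae (Eventually.of_forall fun y => ?_)
        simp only
        rw [integral_const_mul]; ring
    _ = _ := by
        rw [integral_integral_swap hint]
        congr 1
        refine integral_congr_ae (Eventually.of_forall fun ξ => ?_)
        simp only
        rw [SchwartzMap.fourier_coe a, Real.fourier_eq', ← integral_const_mul, ← integral_const_mul]
        refine integral_congr_ae (Eventually.of_forall fun y => ?_)
        simp only [inner_neg_right, smul_eq_mul]
        rw [Complex.exp_add, Complex.ofReal_exp]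
        have : -((Real.pi ^ 2 / t : ℝ) : ℂ) * ‖ξ‖ ^ 2 = ((-(Real.pi ^ 2 * ‖ξ‖ ^ 2 / t) : ℝ) : ℂ) := by
          push_cast; ring
        rw [this]
        have e3 : (2 * Real.pi * Complex.I * (inner ℝ y ξ : ℝ) : ℂ)
          = ((-2 * Real.pi * -(inner ℝ y ξ) : ℝ) : ℂ) * Complex.I := by push_cast; ring
        rw [e3]
        ring
theorem integrable_sqrt_mul_exp {z : Space} (hz : z ≠ 0) :
    IntegrableOn (fun t => √t * Real.exp (-(t * ‖z‖ ^ 2))) (Ioi 0) := by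
  have h0 : 0 < ‖z‖ := norm_pos_iff.2 hz
  refine .of_integral_ne_zero ?_
  rw [integral_sqrt_mul_exp hz]
  have := Real.pi_pos
  positivity

theorem integrable_inv_sq_mul_exp {c : ℝ} (hc : 0 < c) :
    IntegrableOn (fun t => (t ^ 2)⁻¹ * Real.exp (-(c / t))) (Ioi 0) := by
  refine .of_integral_ne_zero ?_
  rw [integral_inv_sq_mul_exp hc]
  positivity

theorem IsTest.exists_abs_le {f : Space → ℝ} (hf : IsTest f) : ∃ C, ∀ x, |f x| ≤ C := by
  obtain ⟨C, hC⟩ := hf.2.exists_bound_of_continuous hf.continuous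
  exact ⟨C, hC⟩

theorem abs_gradKernel_le (y : Space) : |gradKernel y| ≤ (‖y‖ ^ 2)⁻¹ :=
  le_of_tendsto (tendsto_regKernel y).abs (Eventually.of_forall fun ε => abs_regKernel_le ε y)

theorem integrable_kernel_prod {γ ψ : Space → ℝ} (hγ : Integrable γ volume)
    (hψ : IsTest ψ) :
    Integrable (fun p : Space × Space => (localKernel p.2 + 1) * (γ (p.1 - p.2) * ψ p.1))
      (volume.prod volume) := by
  obtain ⟨C, hC⟩ := hψ.exists_abs_le
  have h1 := integrable_localKernel.convolution_integrand (ContinuousLinearMap.mul ℝ ℝ)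
    (μ := volume) hγ
  have h2 := h1.bdd_mul (f := fun p : Space × Space => ψ p.1) (c := C)
    (hψ.continuous.comp continuous_fst).aestronglyMeasurable (Eventually.of_forall fun p => hC p.1)
  have h3 := (hψ.integrable.convolution_integrand (ContinuousLinearMap.mul ℝ ℝ)
    (μ := volume) hγ.comp_neg).swap
  refine (h2.add h3).congr (Eventually.of_forall fun p => ?_)
  simp [Function.comp]
  ring

theorem integrable_gradKernel_prod {γ ψ : Space → ℝ} (hγ : Integrable γ volume)
    (hψ : IsTest ψ) :
    Integrable (fun p : Space × Space => gradKernel p.2 * (γ (p.1 - p.2) * ψ p.1))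
      (volume.prod volume) := by
  have h := integrable_kernel_prod hγ hψ
  have h3 := (hψ.integrable.convolution_integrand (ContinuousLinearMap.mul ℝ ℝ)
    (μ := volume) hγ.comp_neg).swap
  have hm : AEStronglyMeasurable (fun p : Space × Space => γ (p.1 - p.2) * ψ p.1)
      (volume.prod volume) := by
    refine h3.1.congr (Eventually.of_forall fun p => ?_)
    simp [Function.comp]; ring
  refine h.mono ((measurable_gradKernel.comp measurable_snd).aestronglyMeasurable.mul hm)
    (Eventually.of_forall fun p => ?_)
  rw [norm_mul (gradKernel _), norm_mul (localKernel _ + 1)]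
  refine mul_le_mul_of_nonneg_right ?_ (norm_nonneg (γ (p.1 - p.2) * ψ p.1))
  rw [Real.norm_eq_abs, Real.norm_of_nonneg (add_nonneg (localKernel_nonneg _) zero_le_one)]
  exact (abs_gradKernel_le _).trans (inv_norm_sq_le _)

theorem integral_gradConv_mul_eq_prod {γ ψ : Space → ℝ} (hγ : Integrable γ volume)
    (hψ : IsTest ψ) :
    ∫ x, gradConv γ x * ψ x
      = ∫ p : Space × Space, gradKernel p.2 * (γ (p.1 - p.2) * ψ p.1) ∂(volume.prod volume) := by
  rw [integral_prod _ (integrable_gradKernel_prod hγ hψ)]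
  refine integral_congr_ae (Eventually.of_forall fun x => ?_)
  simp only [gradConv]
  rw [← integral_mul_const]
  refine integral_congr_ae (Eventually.of_forall fun y => ?_)
  simp only; ring

theorem ae_snd_ne_zero : ∀ᵐ p : Space × Space ∂(volume.prod volume), p.2 ≠ 0 := by
  have : ∀ᵐ y : Space, y ≠ 0 := by
    filter_upwards [ae_norm_ne 0] with y hy
    simpa using hy
  exact Measure.quasiMeasurePreserving_snd.ae this

/-- Insert the Gaussian superposition for `|y|⁻³` and exchange integrals. As the `t`-dependent
factor is nonnegative, integrating absolute values over `t` returns the kernel `|y₃|/|y|³`, already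
known to be integrable here. -/
theorem integral_prod_gradKernel_eq {γ ψ : Space → ℝ} (hγ : IsTest γ) (hψ : IsTest ψ) :
    √Real.pi / 2 * ∫ p : Space × Space, gradKernel p.2 * (γ (p.1 - p.2) * ψ p.1) ∂(volume.prod volume)
      = ∫ t in Ioi (0 : ℝ), √t * ∫ p : Space × Space,
          p.2 2 * Real.exp (-(t * ‖p.2‖ ^ 2)) * (γ (p.1 - p.2) * ψ p.1) ∂(volume.prod volume) := by
  have hcγ := hγ.continuous
  have hcψ := hψ.continuous
  have hint : Integrable (fun q : ℝ × (Space × Space) =>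
      √q.1 * (q.2.2 2 * Real.exp (-(q.1 * ‖q.2.2‖ ^ 2)) * (γ (q.2.1 - q.2.2) * ψ q.2.1)))
      ((volume.restrict (Ioi 0)).prod (volume.prod volume)) := by
    rw [integrable_prod_iff' (by
      refine Continuous.aestronglyMeasurable ?_
      fun_prop)]
    constructor
    · filter_upwards [ae_snd_ne_zero] with p hp
      refine ((integrable_sqrt_mul_exp hp).const_mul (p.2 2 * (γ (p.1 - p.2) * ψ p.1))).congr
        (Eventually.of_forall fun t => ?_)
      simp only; ring
    · refine ((integrable_gradKernel_prod hγ.integrable hψ).norm.const_mul (√Real.pi / 2)).congr ?_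
      filter_upwards [ae_snd_ne_zero] with p hp
      have e : ∀ t : ℝ, ‖√t * (p.2 2 * Real.exp (-(t * ‖p.2‖ ^ 2)) * (γ (p.1 - p.2) * ψ p.1))‖
        = √t * Real.exp (-(t * ‖p.2‖ ^ 2)) * |p.2 2 * (γ (p.1 - p.2) * ψ p.1)| := fun t => by
          rw [Real.norm_eq_abs, abs_mul, abs_mul, abs_mul, abs_mul (p.2 2), Real.abs_exp,
            abs_of_nonneg (Real.sqrt_nonneg t)]
          ring
      simp only [e]
      rw [integral_mul_const, integral_sqrt_mul_exp hp, gradKernel, Real.norm_eq_abs, abs_mul, abs_mul (p.2 2),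
        abs_div, abs_of_nonneg (by positivity : 0 ≤ ‖p.2‖ ^ 3)]
      ring
  have := integral_integral_swap (f := fun (t : ℝ) (p : Space × Space) =>
    √t * (p.2 2 * Real.exp (-(t * ‖p.2‖ ^ 2)) * (γ (p.1 - p.2) * ψ p.1))) hint
  simp only [integral_const_mul] at this
  rw [this, ← integral_const_mul]
  refine integral_congr_ae ?_
  filter_upwards [ae_snd_ne_zero] with p hp
  have e : ∀ t : ℝ, √t * (p.2 2 * Real.exp (-(t * ‖p.2‖ ^ 2)) * (γ (p.1 - p.2) * ψ p.1))
        = √t * Real.exp (-(t * ‖p.2‖ ^ 2)) * (p.2 2 * (γ (p.1 - p.2) * ψ p.1)) := fun t => by ring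
  simp only [e]
  rw [integral_mul_const, integral_sqrt_mul_exp hp, gradKernel]
  ring

theorem partialDeriv_exp_neg_sq (t : ℝ) (y x : Space) :
    partialDeriv 2 (fun x => Real.exp (-(t * ‖x - y‖ ^ 2))) x
      = -(2 * t) * ((x - y) 2 * Real.exp (-(t * ‖x - y‖ ^ 2))) := by
  have h1 : HasFDerivAt (fun x : Space => x - y) (ContinuousLinearMap.id ℝ Space) x :=
    (hasFDerivAt_id x).sub_const y
  have h := ((h1.norm_sq.const_mul t).neg).exp
  have h2 : HasFDerivAt (fun x : Space => Real.exp (-(t * ‖x - y‖ ^ 2))) _ x := h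
  rw [partialDeriv, h2.fderiv]
  simp [EuclideanSpace.inner_single_right]
  ring

/-- Up to the factor `-2t`, the coordinate times the Gaussian is the derivative of the Gaussian
along the axis. -/
theorem integral_coord_mul_exp_mul {ψ : Space → ℝ} (hψ : IsTest ψ) {t : ℝ} (ht : 0 < t) (y : Space) :
    ∫ x, (x - y) 2 * Real.exp (-(t * ‖x - y‖ ^ 2)) * ψ x
      = (2 * t)⁻¹ * ∫ x, Real.exp (-(t * ‖x - y‖ ^ 2)) * partialDeriv 2 ψ x := by
  have hd : Differentiable ℝ (fun x : Space => Real.exp (-(t * ‖x - y‖ ^ 2))) :=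
    (((differentiable_id.sub_const y).norm_sq ℝ).const_mul t).neg.exp
  have hl : ∀ {f : Space → ℝ}, Continuous f → LocallyIntegrable f volume := fun h => h.locallyIntegrable
  have h := integral_mul_fderiv_eq_neg_fderiv_mul_of_integrable (μ := (volume : Measure Space)) (𝕜 := ℝ)
    (f := ψ) (g := fun x : Space => Real.exp (-(t * ‖x - y‖ ^ 2))) (v := axis) ?_ ?_ ?_
    (fun x _ => hψ.differentiable x) (fun x _ => hd x)
  · have e : ∀ x, fderiv ℝ (fun x : Space => Real.exp (-(t * ‖x - y‖ ^ 2))) x axis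
      = -(2 * t) * ((x - y) 2 * Real.exp (-(t * ‖x - y‖ ^ 2))) := partialDeriv_exp_neg_sq t y
    simp only [e] at h
    have e1 : ∫ x, (x - y) 2 * Real.exp (-(t * ‖x - y‖ ^ 2)) * ψ x
        = -(2 * t)⁻¹ * ∫ x, ψ x * (-(2 * t) * ((x - y) 2 * Real.exp (-(t * ‖x - y‖ ^ 2)))) := by
      rw [← integral_const_mul]
      refine integral_congr_ae (Eventually.of_forall fun x => ?_)
      simp only
      field_simp
    rw [e1, h, neg_mul_neg]
    congr 1
    refine integral_congr_ae (Eventually.of_forall fun x => ?_)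
    simp only [partialDeriv]
    ring
  · exact (hψ.partialDeriv 2).integrable_smul (hl hd.continuous)
  · refine hψ.integrable_smul (hl ?_)
    have : (fun x => fderiv ℝ (fun x : Space => Real.exp (-(t * ‖x - y‖ ^ 2))) x axis)
      = fun x => -(2 * t) * ((x - y) 2 * Real.exp (-(t * ‖x - y‖ ^ 2))) := funext fun x =>
        partialDeriv_exp_neg_sq t y x
    rw [this]
    fun_prop
  · exact hψ.integrable_smul (hl hd.continuous)

theorem integral_prod_gaussian_eq {γ ψ : Space → ℝ} (hγ : IsTest γ) (hψ : IsTest ψ) {t : ℝ}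
    (ht : 0 < t) :
    ∫ p : Space × Space, p.2 2 * Real.exp (-(t * ‖p.2‖ ^ 2)) * (γ (p.1 - p.2) * ψ p.1)
        ∂(volume.prod volume)
      = (2 * t)⁻¹ * ∫ y, γ y * ∫ x, Real.exp (-(t * ‖x - y‖ ^ 2)) * partialDeriv 2 ψ x := by
  have hcγ := hγ.continuous
  have hcψ := hψ.continuous
  -- From `exp(-s) ≤ 1/(1 + s)`. Any bound uniform in `y` would do: it only serves integrability.
  have hb : ∀ y : Space, |y 2 * Real.exp (-(t * ‖y‖ ^ 2))| ≤ 1 + t⁻¹ := fun y => by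
    rw [abs_mul, Real.abs_exp]
    have h1 := Real.add_one_le_exp (t * ‖y‖ ^ 2)
    have h2 : Real.exp (-(t * ‖y‖ ^ 2)) ≤ (t * ‖y‖ ^ 2 + 1)⁻¹ := by
      rw [Real.exp_neg]; gcongr
    calc |y 2| * Real.exp (-(t * ‖y‖ ^ 2)) ≤ ‖y‖ * (t * ‖y‖ ^ 2 + 1)⁻¹ :=
          mul_le_mul (abs_coord_le y 2) h2 (Real.exp_pos _).le (norm_nonneg _)
      _ ≤ 1 + t⁻¹ := by
          rw [← div_eq_mul_inv, div_le_iff₀ (by positivity)]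
          have : (1 + t⁻¹) * (t * ‖y‖ ^ 2 + 1) = t * ‖y‖ ^ 2 + ‖y‖ ^ 2 + 1 + t⁻¹ := by
            field_simp; ring
          rw [this]
          have : 0 < t⁻¹ := by positivity
          nlinarith [sq_nonneg (‖y‖ - 1), mul_nonneg ht.le (sq_nonneg ‖y‖)]
  have hprod : Integrable (fun p : Space × Space => γ p.2 * ψ p.1) (volume.prod volume) :=
    (hψ.integrable.mul_prod hγ.integrable).congr (Eventually.of_forall fun p => by ring)
  have hint : Integrable (fun p : Space × Space =>
      (p.1 - p.2) 2 * Real.exp (-(t * ‖p.1 - p.2‖ ^ 2)) * (γ p.2 * ψ p.1)) (volume.prod volume) :=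
    hprod.bdd_mul (c := 1 + t⁻¹) (by
      refine Continuous.aestronglyMeasurable ?_
      fun_prop) (Eventually.of_forall fun p => hb (p.1 - p.2))
  have hint0 : Integrable (fun p : Space × Space =>
      p.2 2 * Real.exp (-(t * ‖p.2‖ ^ 2)) * (γ (p.1 - p.2) * ψ p.1)) (volume.prod volume) := by
    have h3 := (hψ.integrable.convolution_integrand (ContinuousLinearMap.mul ℝ ℝ)
      (μ := volume) hγ.integrable.comp_neg).swap
    refine Integrable.bdd_mul (c := 1 + t⁻¹) (h3.congr (Eventually.of_forall fun p => ?_)) (by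
      refine Continuous.aestronglyMeasurable ?_
      fun_prop) (Eventually.of_forall fun p => hb p.2)
    simp [Function.comp]; ring
  calc ∫ p : Space × Space, p.2 2 * Real.exp (-(t * ‖p.2‖ ^ 2)) * (γ (p.1 - p.2) * ψ p.1)
        ∂(volume.prod volume)
      = ∫ x, ∫ y, y 2 * Real.exp (-(t * ‖y‖ ^ 2)) * (γ (x - y) * ψ x) := integral_prod _ hint0
    _ = ∫ x, ∫ y, (x - y) 2 * Real.exp (-(t * ‖x - y‖ ^ 2)) * (γ y * ψ x) := by
        refine integral_congr_ae (Eventually.of_forall fun x => ?_)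
        simp only
        rw [← integral_sub_left_eq_self _ volume x]
        simp only [sub_sub_cancel]
    _ = ∫ y, ∫ x, (x - y) 2 * Real.exp (-(t * ‖x - y‖ ^ 2)) * (γ y * ψ x) :=
        integral_integral_swap (f := fun x y =>
          (x - y) 2 * Real.exp (-(t * ‖x - y‖ ^ 2)) * (γ y * ψ x)) hint
    _ = _ := by
        rw [← integral_const_mul]
        refine integral_congr_ae (Eventually.of_forall fun y => ?_)
        simp only
        rw [mul_left_comm, ← integral_coord_mul_exp_mul hψ ht, ← integral_const_mul]
        refine integral_congr_ae (Eventually.of_forall fun x => ?_)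
        simp only; ring
/-- A test function as a complex valued Schwartz function. -/
def IsTest.schwartz {f : Space → ℝ} (hf : IsTest f) : 𝓢(Space, ℂ) :=
  HasCompactSupport.toSchwartzMap (f := fun x => (f x : ℂ))
    (hf.2.comp_left (g := fun r : ℝ => (r : ℂ)) Complex.ofReal_zero)
    (Complex.ofRealCLM.contDiff.comp hf.1)

theorem IsTest.schwartz_apply {f : Space → ℝ} (hf : IsTest f) (x : Space) :
    hf.schwartz x = (f x : ℂ) := rfl

theorem IsTest.lineDerivOp_schwartz {f : Space → ℝ} (hf : IsTest f) :
    ∂_{axis} hf.schwartz = (hf.partialDeriv 2).schwartz := by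
  ext x
  rw [SchwartzMap.lineDerivOp_apply_eq_fderiv, IsTest.schwartz_apply]
  have h : HasFDerivAt (fun x => (f x : ℂ)) (Complex.ofRealCLM.comp (fderiv ℝ f x)) x :=
    Complex.ofRealCLM.hasFDerivAt.comp x (hf.differentiable x).hasFDerivAt
  have h2 : HasFDerivAt hf.schwartz (Complex.ofRealCLM.comp (fderiv ℝ f x)) x := h
  rw [h2.fderiv]
  rfl

theorem IsTest.fourier_partialDeriv {f : Space → ℝ} (hf : IsTest f) (ξ : Space) :
    𝓕 (hf.partialDeriv 2).schwartz ξ = 2 * Real.pi * Complex.I * (ξ 2 : ℝ) * 𝓕 hf.schwartz ξ := by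
  rw [← hf.lineDerivOp_schwartz, SchwartzMap.fourier_lineDerivOp_eq, smul_apply,
    SchwartzMap.smulLeftCLM_apply_apply (by fun_prop)]
  simp [axis, EuclideanSpace.inner_single_right]
  ring

theorem IsTest.fourier_neg {f : Space → ℝ} (hf : IsTest f) (ξ : Space) :
    𝓕 hf.schwartz (-ξ) = starRingEnd ℂ (𝓕 hf.schwartz ξ) := by
  rw [SchwartzMap.fourier_coe, Real.fourier_eq', Real.fourier_eq', ← integral_conj]
  refine integral_congr_ae (Eventually.of_forall fun x => ?_)
  simp only [smul_eq_mul, map_mul, IsTest.schwartz_apply, Complex.conj_ofReal, ← Complex.exp_conj,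
    Complex.conj_I, inner_neg_right]
  congr 2
  push_cast
  ring

/-- The Fourier symbol `ξ₃² / |ξ|²`. -/
def symbol (ξ : Space) : ℝ := ξ 2 ^ 2 / ‖ξ‖ ^ 2

theorem symbol_nonneg (ξ : Space) : 0 ≤ symbol ξ := by unfold symbol; positivity

theorem symbol_le_one (ξ : Space) : symbol ξ ≤ 1 := by
  refine div_le_one_of_le₀ ?_ (by positivity)
  rw [← sq_abs (ξ 2)]
  gcongr
  exact abs_coord_le ξ 2

theorem measurable_symbol : Measurable symbol := by unfold symbol; fun_prop

/-- The two derivatives `∂₃` contribute `2πi ξ₃` each, one of them conjugated, hence `4π² ξ₃²`; the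
`t`-integral contributes `(π²|ξ|²)⁻¹`. After division by the subordination constant `√π/2` the
symbol is `4π ξ₃²/|ξ|²`. -/
theorem integral_gradConv_mul {f ψ : Space → ℝ} (hf : IsTest f) (hψ : IsTest ψ) :
    ((∫ x, gradConv (partialDeriv 2 f) x * ψ x : ℝ) : ℂ)
      = ∫ ξ, ((4 * Real.pi * symbol ξ : ℝ) : ℂ) *
        (starRingEnd ℂ (𝓕 hf.schwartz ξ) * 𝓕 hψ.schwartz ξ) := by
  have hpi := Real.pi_pos
  set F : Space → ℂ := fun ξ => starRingEnd ℂ (𝓕 hf.schwartz ξ) * 𝓕 hψ.schwartz ξ with hF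
  have hFi : Integrable F volume :=
    SchwartzMap.integrable (𝓕 hψ.schwartz) |>.bdd_mul
      (c := (SchwartzMap.toBoundedContinuousFunction (𝓕 hf.schwartz) |> norm)) 
      ((Complex.continuous_conj.comp (𝓕 hf.schwartz).continuous).aestronglyMeasurable)
      (Eventually.of_forall fun x => by
        rw [RCLike.norm_conj]
        exact (SchwartzMap.toBoundedContinuousFunction (𝓕 hf.schwartz)).norm_coe_le_norm x)
  have hFm : AEStronglyMeasurable (fun p : ℝ × Space => F p.2) ((volume.restrict (Ioi 0)).prod volume) :=
    (((Complex.continuous_conj.comp (𝓕 hf.schwartz).continuous).mul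
      (𝓕 hψ.schwartz).continuous).comp continuous_snd).aestronglyMeasurable
  -- the Gaussian identity at a fixed scale
  have hg : ∀ t ∈ Ioi (0 : ℝ), ((√t * ∫ p : Space × Space,
          p.2 2 * Real.exp (-(t * ‖p.2‖ ^ 2)) * (partialDeriv 2 f (p.1 - p.2) * ψ p.1)
            ∂(volume.prod volume) : ℝ) : ℂ)
      = ∫ ξ, (((t ^ 2)⁻¹ * Real.exp (-(Real.pi ^ 2 * ‖ξ‖ ^ 2 / t)) : ℝ) : ℂ)
          * ((√Real.pi ^ 3 / 2 * (4 * Real.pi ^ 2 * ξ 2 ^ 2) : ℝ) * F ξ) := by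
    intro t ht
    have ht : 0 < t := ht
    rw [integral_prod_gaussian_eq (hf.partialDeriv 2) hψ ht]
    have h := gaussian_pairing (hf.partialDeriv 2).schwartz (hψ.partialDeriv 2).schwartz ht
    have e1 : ((∫ y, partialDeriv 2 f y * ∫ x, Real.exp (-(t * ‖x - y‖ ^ 2)) * partialDeriv 2 ψ x : ℝ) : ℂ)
      = ∫ y, (hf.partialDeriv 2).schwartz y * ∫ x, (Real.exp (-(t * ‖x - y‖ ^ 2)) : ℂ) * (hψ.partialDeriv 2).schwartz x := by
      rw [← integral_complex_ofReal]
      refine integral_congr_ae (Eventually.of_forall fun y => ?_)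
      simp only [IsTest.schwartz_apply]
      rw [Complex.ofReal_mul, ← integral_complex_ofReal]
      congr 1
      refine integral_congr_ae (Eventually.of_forall fun x => ?_)
      simp
    rw [Complex.ofReal_mul, Complex.ofReal_mul, e1, h, ← mul_assoc, ← mul_assoc, ← integral_const_mul]
    refine integral_congr_ae (Eventually.of_forall fun ξ => ?_)
    simp only [IsTest.fourier_neg, hF]
    rw [hf.fourier_partialDeriv, hψ.fourier_partialDeriv]
    simp only [map_mul, Complex.conj_ofReal, Complex.conj_I, map_ofNat]
    -- Powers of `t`: `t^(1/2)` from the subordination, `t⁻¹` from the integration by parts and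
    -- `t^(-3/2)` from the Gaussian normalization make `t⁻²`.
    have e2 : √t * (2 * t)⁻¹ * √(Real.pi / t) ^ 3 = (t ^ 2)⁻¹ * (√Real.pi ^ 3 / 2) := by
      rw [Real.sqrt_div hpi.le, div_pow]
      have : t ^ 2 = √t ^ 4 := by
        rw [show √t ^ 4 = (√t ^ 2) ^ 2 by ring, Real.sq_sqrt ht.le]
      rw [this]
      have h2 : t = √t ^ 2 := (Real.sq_sqrt ht.le).symm
      have : 0 < √t := Real.sqrt_pos.2 ht
      nth_rewrite 2 [h2]
      field_simp
    rw [← Complex.ofReal_mul, ← Complex.ofReal_mul, e2]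
    push_cast
    ring_nf
    rw [Complex.I_sq]
    ring
  -- Fubini
  have hint : Integrable (fun q : ℝ × Space =>
      (((q.1 ^ 2)⁻¹ * Real.exp (-(Real.pi ^ 2 * ‖q.2‖ ^ 2 / q.1)) : ℝ) : ℂ)
          * ((√Real.pi ^ 3 / 2 * (4 * Real.pi ^ 2 * q.2 2 ^ 2) : ℝ) * F q.2))
      ((volume.restrict (Ioi 0)).prod volume) := by
    have hne : ∀ᵐ ξ : Space, ξ ≠ 0 := by
      filter_upwards [ae_norm_ne 0] with y hy
      simpa using hy
    rw [integrable_prod_iff' (by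
      refine AEStronglyMeasurable.mul (Measurable.aestronglyMeasurable (by fun_prop))
        (AEStronglyMeasurable.mul (Measurable.aestronglyMeasurable (by fun_prop)) hFm))]
    constructor
    · filter_upwards [hne] with ξ hξ
      have h0 : 0 < ‖ξ‖ := norm_pos_iff.2 hξ
      exact ((integrable_inv_sq_mul_exp (c := Real.pi ^ 2 * ‖ξ‖ ^ 2) (by positivity)).ofReal).mul_const _
    · have hb : Integrable (fun ξ => √Real.pi ^ 3 / 2 * 4 * symbol ξ * ‖F ξ‖) volume :=
        hFi.norm.bdd_mul (c := √Real.pi ^ 3 / 2 * 4) (measurable_symbol.const_mul _).aestronglyMeasurable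
          (Eventually.of_forall fun ξ => by
            rw [Real.norm_of_nonneg (mul_nonneg (by positivity) (symbol_nonneg ξ))]
            exact mul_le_of_le_one_right (by positivity) (symbol_le_one ξ))
      refine hb.congr ?_
      filter_upwards [hne] with ξ hξ
      have h0 : 0 < ‖ξ‖ := norm_pos_iff.2 hξ
      have e : ∀ t : ℝ, ‖(((t ^ 2)⁻¹ * Real.exp (-(Real.pi ^ 2 * ‖ξ‖ ^ 2 / t)) : ℝ) : ℂ)
          * ((√Real.pi ^ 3 / 2 * (4 * Real.pi ^ 2 * ξ 2 ^ 2) : ℝ) * F ξ)‖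
          = (t ^ 2)⁻¹ * Real.exp (-(Real.pi ^ 2 * ‖ξ‖ ^ 2 / t))
            * (√Real.pi ^ 3 / 2 * (4 * Real.pi ^ 2 * ξ 2 ^ 2) * ‖F ξ‖) := fun t => by
        rw [norm_mul, norm_mul, Complex.norm_real, Complex.norm_real,
          Real.norm_of_nonneg (by positivity), Real.norm_of_nonneg (by positivity)]
      simp only [e]
      rw [integral_mul_const, integral_inv_sq_mul_exp (by positivity), symbol]
      field_simp
  have hkey : ((√Real.pi / 2 * ∫ x, gradConv (partialDeriv 2 f) x * ψ x : ℝ) : ℂ)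
      = ∫ ξ, ((√Real.pi ^ 3 / 2 * 4 * symbol ξ : ℝ) : ℂ) * F ξ := by
    rw [integral_gradConv_mul_eq_prod (hf.partialDeriv 2).integrable hψ,
      integral_prod_gradKernel_eq (hf.partialDeriv 2) hψ, ← integral_complex_ofReal]
    rw [setIntegral_congr_fun measurableSet_Ioi hg]
    rw [integral_integral_swap (f := fun (t : ℝ) (ξ : Space) =>
      (((t ^ 2)⁻¹ * Real.exp (-(Real.pi ^ 2 * ‖ξ‖ ^ 2 / t)) : ℝ) : ℂ)
          * ((√Real.pi ^ 3 / 2 * (4 * Real.pi ^ 2 * ξ 2 ^ 2) : ℝ) * F ξ)) hint]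
    refine integral_congr_ae ?_
    filter_upwards [ae_norm_ne 0] with ξ h0
    have h0 : 0 < ‖ξ‖ := lt_of_le_of_ne (norm_nonneg _) h0.symm
    rw [integral_mul_const, integral_complex_ofReal, integral_inv_sq_mul_exp (by positivity), ← mul_assoc,
      ← Complex.ofReal_mul, symbol]
    congr 2
    field_simp
  have hs : 0 < √Real.pi := Real.sqrt_pos.2 hpi
  have hs2 : √Real.pi ^ 2 = Real.pi := Real.sq_sqrt hpi.le
  rw [Complex.ofReal_mul, mul_comm, ← eq_div_iff (by simp [hs.ne'])] at hkey
  rw [hkey, div_eq_mul_inv, ← integral_mul_const]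
  refine integral_congr_ae (Eventually.of_forall fun ξ => ?_)
  simp only
  rw [mul_right_comm, ← Complex.ofReal_inv, ← Complex.ofReal_mul]
  congr 2
  nth_rewrite 3 [← hs2]
  field_simp

/-! ### The Fourier multiplier -/

theorem memLp_symbol : MemLp (fun ξ => ((4 * Real.pi * symbol ξ : ℝ) : ℂ)) ⊤ (volume : Measure Space) := by
  refine memLp_top_of_bound (C := 4 * Real.pi)
    (Complex.measurable_ofReal.comp (measurable_symbol.const_mul _)).aestronglyMeasurable
    (Eventually.of_forall fun ξ => ?_)
  have := Real.pi_pos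
  rw [Complex.norm_real, Real.norm_of_nonneg (mul_nonneg (by positivity) (symbol_nonneg ξ))]
  exact mul_le_of_le_one_right (by positivity) (symbol_le_one ξ)

/-- Multiplication by the symbol `4π ξ₃² / |ξ|²` on `L²(ℝ³; ℂ)`. -/
def symbolMul : Lp ℂ 2 (volume : Measure Space) →L[ℂ] Lp ℂ 2 (volume : Measure Space) :=
  (ContinuousLinearMap.mul ℂ ℂ).holderL volume ⊤ 2 2 (memLp_symbol.toLp _)

theorem coeFn_symbolMul (f : Lp ℂ 2 (volume : Measure Space)) :
    symbolMul f =ᵐ[volume] fun ξ => ((4 * Real.pi * symbol ξ : ℝ) : ℂ) * f ξ := by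
  filter_upwards [(ContinuousLinearMap.mul ℂ ℂ).coeFn_holder (r := 2) (memLp_symbol.toLp _) f, memLp_symbol.coeFn_toLp]
    with ξ h1 h2
  refine Eq.trans h1 ?_
  rw [h2]; rfl

/-- The Fourier multiplier with symbol `4π ξ₃² / |ξ|²` on `L²(ℝ³; ℂ)`. -/
def dipoleOpC : Lp ℂ 2 (volume : Measure Space) →L[ℂ] Lp ℂ 2 (volume : Measure Space) :=
  (Lp.fourierTransformₗᵢ Space ℂ).symm.toContinuousLinearEquiv.toContinuousLinearMap ∘L symbolMul ∘L
    (Lp.fourierTransformₗᵢ Space ℂ).toContinuousLinearEquiv.toContinuousLinearMap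

theorem inner_dipoleOpC (f g : Lp ℂ 2 (volume : Measure Space)) :
    inner ℂ (dipoleOpC f) g = ∫ ξ, ((4 * Real.pi * symbol ξ : ℝ) : ℂ) *
      (starRingEnd ℂ ((𝓕 f : Lp ℂ 2 (volume : Measure Space)) ξ) * (𝓕 g : Lp ℂ 2 (volume : Measure Space)) ξ) := by
  rw [← Lp.inner_fourier_eq]
  have : (𝓕 (dipoleOpC f) : Lp ℂ 2 (volume : Measure Space)) = symbolMul (𝓕 f) :=
    (Lp.fourierTransformₗᵢ Space ℂ).apply_symm_apply _
  rw [this, L2.inner_def]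
  refine integral_congr_ae ?_
  filter_upwards [coeFn_symbolMul (𝓕 f)] with ξ h
  rw [h]
  simp only [RCLike.inner_apply, map_mul, Complex.conj_ofReal]
  ring

theorem inner_dipoleOpC_symm (f g : Lp ℂ 2 (volume : Measure Space)) :
    inner ℂ (dipoleOpC f) g = inner ℂ f (dipoleOpC g) := by
  rw [← inner_conj_symm f, inner_dipoleOpC, inner_dipoleOpC, ← integral_conj]
  refine integral_congr_ae (Eventually.of_forall fun ξ => ?_)
  simp only [map_mul, Complex.conj_ofReal, Complex.conj_conj]
  ring

/-- The real `L²` space. -/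
abbrev L2R : Type := Lp ℝ 2 (volume : Measure Space)

/-- The inclusion of real in complex `L²` functions. -/
def toC : L2R →L[ℝ] Lp ℂ 2 (volume : Measure Space) := Complex.ofRealCLM.compLpL 2 volume

/-- The real part of complex `L²` functions. -/
def toR : Lp ℂ 2 (volume : Measure Space) →L[ℝ] L2R := Complex.reCLM.compLpL 2 volume

/-- The real Fourier multiplier with symbol `4π ξ₃² / |ξ|²`. -/
def dipoleOp : L2R →L[ℝ] L2R := toR ∘L dipoleOpC.restrictScalars ℝ ∘L toC

theorem inner_toR (f : Lp ℂ 2 (volume : Measure Space)) (g : L2R) :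
    inner ℝ (toR f) g = (inner ℂ f (toC g)).re := by
  rw [L2.inner_def, L2.inner_def]
  have hi := L2.integrable_inner (𝕜 := ℂ) f (toC g)
  rw [← RCLike.re_eq_complex_re, ← integral_re hi]
  refine integral_congr_ae ?_
  filter_upwards [Complex.reCLM.coeFn_compLpL (p := 2) (μ := volume) f,
    Complex.ofRealCLM.coeFn_compLpL (p := 2) (μ := volume) g] with x h1 h2
  have h1' : toR f x = _ := h1
  have h2' : toC g x = _ := h2
  rw [h1', h2']
  simp

theorem inner_dipoleOp (f g : L2R) :
    inner ℝ (dipoleOp f) g = (inner ℂ (dipoleOpC (toC f)) (toC g)).re := inner_toR _ _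

theorem inner_dipoleOp_symm (f g : L2R) : inner ℝ (dipoleOp f) g = inner ℝ f (dipoleOp g) := by
  rw [real_inner_comm (dipoleOp g) f, inner_dipoleOp, inner_dipoleOp, inner_dipoleOpC_symm, ← inner_conj_symm,
    Complex.conj_re]

theorem IsTest.memLpR {f : Space → ℝ} (hf : IsTest f) : MemLp f 2 volume :=
  hf.continuous.memLp_of_hasCompactSupport hf.2

theorem IsTest.toC_toLp {f : Space → ℝ} (hf : IsTest f) :
    toC (hf.memLpR.toLp f) = hf.schwartz.toLp 2 := by
  refine Lp.ext ?_
  filter_upwards [Complex.ofRealCLM.coeFn_compLpL (p := 2) (μ := volume) (hf.memLpR.toLp f),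
    hf.memLpR.coeFn_toLp, hf.schwartz.coeFn_toLp 2 volume] with x h1 h2 h3
  refine Eq.trans h1 ?_
  rw [h2, h3]
  rfl

theorem IsTest.inner_dipoleOp {f ψ : Space → ℝ} (hf : IsTest f) (hψ : IsTest ψ) :
    inner ℝ (dipoleOp (hf.memLpR.toLp f)) (hψ.memLpR.toLp ψ)
      = ∫ x, gradConv (DipolarNLS.partialDeriv 2 f) x * ψ x := by
  rw [DipolarNLS.inner_dipoleOp, hf.toC_toLp, hψ.toC_toLp, inner_dipoleOpC,
    SchwartzMap.toLp_fourier_eq, SchwartzMap.toLp_fourier_eq]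
  have h := integral_gradConv_mul hf hψ
  rw [← Complex.ofReal_re (∫ x, gradConv (DipolarNLS.partialDeriv 2 f) x * ψ x), h]
  congr 1
  refine integral_congr_ae ?_
  filter_upwards [(𝓕 hf.schwartz).coeFn_toLp 2 volume, (𝓕 hψ.schwartz).coeFn_toLp 2 volume] with x h1 h2
  rw [h1, h2]


/-! ### The square map from `L⁴` to `L²` -/

theorem memLp_norm_sq {u : Space → ℂ} (hu : MemLp u 4 volume) :
    MemLp (fun x => ‖u x‖ ^ 2) 2 volume := by
  refine (memLp_two_iff_integrable_sq (hu.1.norm.pow 2)).2 ?_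
  simpa [← pow_mul] using MemLp.integrable_pow (n := 4) (by simpa using hu) (by norm_num)

/-- The function `|u|²` in `L²`. -/
def sqLp {u : Space → ℂ} (hu : MemLp u 4 volume) : L2R := (memLp_norm_sq hu).toLp _

theorem norm_sqLp_sq {u : Space → ℂ} (hu : MemLp u 4 volume) : ‖sqLp hu‖ ^ 2 = ∫ x, ‖u x‖ ^ 4 := by
  rw [sqLp, norm_toLp_sq]
  simp [← pow_mul]

theorem integrable_four {u : Space → ℂ} (hu : MemLp u 4 volume) : Integrable (fun x => ‖u x‖ ^ 4) volume :=
  MemLp.integrable_pow (n := 4) (by simpa using hu) (by norm_num)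

theorem integral_sq_sub_sq_le {u v : Space → ℂ} (hu : MemLp u 4 volume) (hv : MemLp v 4 volume) :
    ∫ x, (‖v x‖ ^ 2 - ‖u x‖ ^ 2) ^ 2 ≤ 2 * (∫ x, ‖v x - u x‖ ^ 4)
      + 8 * √((∫ x, ‖v x - u x‖ ^ 4) * ∫ x, ‖u x‖ ^ 4) := by
  have hw : MemLp (fun x => v x - u x) 4 volume := hv.sub hu
  have hX := memLp_norm_sq hw
  have hY := memLp_norm_sq hu
  have hCS := integral_mul_sq_le hX hY
  simp only [← pow_mul] at hCS
  have hi : Integrable (fun x => ‖v x - u x‖ ^ 2 * ‖u x‖ ^ 2) volume := hX.integrable_mul hY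
  have h1 : ∫ x, ‖v x - u x‖ ^ 2 * ‖u x‖ ^ 2 ≤ √((∫ x, ‖v x - u x‖ ^ 4) * ∫ x, ‖u x‖ ^ 4) :=
    Real.le_sqrt_of_sq_le hCS
  calc ∫ x, (‖v x‖ ^ 2 - ‖u x‖ ^ 2) ^ 2
      ≤ ∫ x, (2 * ‖v x - u x‖ ^ 4 + 8 * (‖v x - u x‖ ^ 2 * ‖u x‖ ^ 2)) := by
        refine integral_mono_of_nonneg (Eventually.of_forall fun x => sq_nonneg _)
          (((integrable_four hw).const_mul 2).add (hi.const_mul 8)) (Eventually.of_forall fun x => ?_)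
        simp only
        have a1 : |‖v x‖ - ‖u x‖| ≤ ‖v x - u x‖ := abs_norm_sub_norm_le _ _
        set a := ‖v x - u x‖
        set b := ‖u x‖ with hb
        set c := ‖v x‖ - b with hc
        have hcv : ‖v x‖ = c + b := by rw [hc]; ring
        rw [hcv]
        have a2 : c ^ 2 ≤ a ^ 2 := sq_le_sq' (by linarith [neg_abs_le c]) (by linarith [le_abs_self c])
        -- With `c = |v| - |u|` and `b = |u|`, `|v|² - |u|² = c (c + 2b)`, and `(c + 2b)² ≤ 2c² +
        -- 8b²`.
        have e : ((c + b) ^ 2 - b ^ 2) ^ 2 ≤ 2 * (c ^ 2 * c ^ 2) + 8 * (c ^ 2 * b ^ 2) := by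
          nlinarith [sq_nonneg (c * (c - 2 * b))]
        have h2 : c ^ 2 * c ^ 2 ≤ a ^ 2 * a ^ 2 := by gcongr
        have h3 : c ^ 2 * b ^ 2 ≤ a ^ 2 * b ^ 2 := by gcongr
        nlinarith
    _ = 2 * (∫ x, ‖v x - u x‖ ^ 4) + 8 * ∫ x, ‖v x - u x‖ ^ 2 * ‖u x‖ ^ 2 := by
        rw [integral_add ((integrable_four hw).const_mul 2) (hi.const_mul 8), integral_const_mul,
          integral_const_mul]
    _ ≤ _ := by gcongr

theorem norm_sqLp_sub_sq {u v : Space → ℂ} (hu : MemLp u 4 volume) (hv : MemLp v 4 volume) :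
    ‖sqLp hv - sqLp hu‖ ^ 2 = ∫ x, (‖v x‖ ^ 2 - ‖u x‖ ^ 2) ^ 2 := by
  rw [sqLp, sqLp, ← MemLp.toLp_sub, norm_toLp_sq]
  simp

theorem tendsto_sqLp {u : Space → ℂ} {v : ℕ → Space → ℂ} (hu : MemLp u 4 volume)
    (hv : ∀ n, MemLp (v n) 4 volume)
    (h : Tendsto (fun n => ∫ x, ‖v n x - u x‖ ^ 4) atTop (𝓝 0)) :
    Tendsto (fun n => sqLp (hv n)) atTop (𝓝 (sqLp hu)) := by
  rw [tendsto_iff_norm_sub_tendsto_zero]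
  have h2 : Tendsto (fun n => ‖sqLp (hv n) - sqLp hu‖ ^ 2) atTop (𝓝 0) := by
    refine squeeze_zero (fun n => sq_nonneg _)
      (fun n => (norm_sqLp_sub_sq hu (hv n)).le.trans (integral_sq_sub_sq_le hu (hv n))) ?_
    have := (h.const_mul 2).add (((h.mul_const (∫ x, ‖u x‖ ^ 4)).sqrt).const_mul 8)
    simpa using this
  simpa [Real.sqrt_sq (norm_nonneg _)] using h2.sqrt

/-! ### Test functions belong to `H¹` -/

theorem h1Pair_of_contDiff {v : Space → ℂ} (hv : ContDiff ℝ ∞ v) (hc : HasCompactSupport v) :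
    H1Pair v (fun x => WithLp.toLp 2 fun i => cpartial i v x) where
  memLp := hv.continuous.memLp_of_hasCompactSupport hc
  grad_memLp := memLp_euclidean_iff.2 fun i => memLp_cpartial hv hc i 2
  weak := hasWeakGradient_iff.2 fun i φ hφ => by
    have hvi : ∀ {f : Space → ℂ}, Continuous f → LocallyIntegrable f volume := fun h => h.locallyIntegrable
    have h := integral_smul_fderiv_eq_neg_fderiv_smul_of_integrable (μ := (volume : Measure Space))
      (f := φ) (g := v) (v := EuclideanSpace.single i 1)
      ((hφ.partialDeriv i).integrable_smul (hvi hv.continuous))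
      (hφ.integrable_smul (hvi (continuous_cpartial hv i)))
      (hφ.integrable_smul (hvi hv.continuous)) (fun x _ => hφ.differentiable x)
      (fun x _ => hv.differentiable (by simp) x)
    simp only [partialDeriv, cpartial] at h ⊢
    rw [h, neg_neg]

/-- Interpolation: the `L²` norm of the difference tends to zero, and its `L⁶` norm does so through
the gradient and Sobolev. -/
theorem TestApprox.tendsto_four {v : ℕ → Space → ℂ} {u : Space → ℂ}
    {G : Space → EuclideanSpace ℂ (Fin 3)} (hv : TestApprox v u G) (h : H1Pair u G) :
    Tendsto (fun n => ∫ x, ‖v n x - u x‖ ^ 4) atTop (𝓝 0) := by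
  obtain ⟨S, hS0, hS⟩ := exists_sobolev_const
  have hp : ∀ n, H1Pair _ _ := fun n =>
    (h1Pair_of_contDiff (hv.contDiff n) (hv.hasCompactSupport n)).sub h
  have t1 : Tendsto (fun n => ∫ x, ‖v n x - u x‖ ^ 2) atTop (𝓝 0) := by
    have := (ENNReal.tendsto_toReal (by simp)).comp hv.tendsto
    have h2 := this.pow 2
    simp only [ENNReal.toReal_zero, ne_eq, OfNat.ofNat_ne_zero, not_false_eq_true, zero_pow] at h2
    refine h2.congr fun n => ?_
    simp only [Function.comp]
    rw [toReal_eLpNorm (hp n).memLp.1, lpNorm_two_sq (hp n).memLp.1]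
  have t2 : Tendsto (fun n => gradNorm (fun x => v n x - u x) ^ 2) atTop (𝓝 0) := by
    have h2 : ∀ i, Tendsto (fun n => ∫ x, ‖cpartial i (v n) x - G x i‖ ^ 2) atTop (𝓝 0) := by
      intro i
      have := (ENNReal.tendsto_toReal (by simp)).comp (hv.tendsto_grad i)
      have h2 := this.pow 2
      simp only [ENNReal.toReal_zero, ne_eq, OfNat.ofNat_ne_zero, not_false_eq_true, zero_pow] at h2
      refine h2.congr fun n => ?_
      simp only [Function.comp]
      have hm := ((hp n).comp_memLp i).1
      have hm' : AEStronglyMeasurable (fun x => cpartial i (v n) x - G x i) volume := hm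
      rw [toReal_eLpNorm hm', lpNorm_two_sq hm']
    have h3 := tendsto_finsetSum Finset.univ (fun i _ => h2 i)
    simp only [Finset.sum_const_zero] at h3
    refine h3.congr fun n => ?_
    rw [(hp n).gradNorm_sq, integral_norm_sq_eq_sum (hp n).grad_memLp]
    rfl
  have t3 : Tendsto (fun n => (∫ x, ‖v n x - u x‖ ^ 2) * ((S ^ 2 * gradNorm (fun x => v n x - u x) ^ 2) ^ 3))
      atTop (𝓝 0) := by
    have := t1.mul ((t2.const_mul (S ^ 2)).pow 3)
    simpa using this
  have t4 : Tendsto (fun n => (∫ x, ‖v n x - u x‖ ^ 4) ^ 2) atTop (𝓝 0) := by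
    refine squeeze_zero (fun n => sq_nonneg _) (fun n => ?_) t3
    refine (hp n).four_sq_le.trans ?_
    refine mul_le_mul_of_nonneg_left ?_ (integral_nonneg fun x => by positivity)
    have h1 := (hS _ _ (hp n)).2
    have h6 := lpNorm_six_pow (hp n).memLp.1
    rw [← h6]
    calc _ ≤ (S * gradNorm (fun x => v n x - u x)) ^ 6 := by gcongr; exact lpNorm_nonneg
      _ = _ := by ring
  have t5 := t4.sqrt
  rw [Real.sqrt_zero] at t5
  exact t5.congr fun n => Real.sqrt_sq (integral_nonneg fun x => by positivity)

/-! ### The dipolar convolution as a Fourier multiplier -/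

theorem aestronglyMeasurable_gradConv {γ : Space → ℝ} (hγ : Integrable γ volume) :
    AEStronglyMeasurable (gradConv γ) volume := by
  have h : AEStronglyMeasurable (fun p : Space × Space => gradKernel p.2 * γ (p.1 - p.2))
      (volume.prod volume) :=
    (measurable_gradKernel.comp measurable_snd).aestronglyMeasurable.mul
      (hγ.1.comp_quasiMeasurePreserving (quasiMeasurePreserving_sub volume volume))
  exact h.integral_prod_right'

/-- The singular part of the majorant convolved with `|γ|` is integrable; the bounded part
contributes at most the constant `‖γ‖₁`. -/
theorem locallyIntegrable_gradConv {γ : Space → ℝ} (hγ : Integrable γ volume) :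
    LocallyIntegrable (gradConv γ) volume := by
  have h1 := integrable_localKernel.integrable_convolution (ContinuousLinearMap.mul ℝ ℝ) (μ := volume) hγ.abs
  have h2 : LocallyIntegrable (fun _ : Space => ∫ x, |γ x|) volume := continuous_const.locallyIntegrable
  refine (h1.locallyIntegrable.add h2).mono (aestronglyMeasurable_gradConv hγ) ?_
  have hce := integrable_localKernel.ae_convolution_exists (ContinuousLinearMap.mul ℝ ℝ) (μ := volume) hγ.abs
  filter_upwards [hce, ae_integrable_localKernel_mul hγ] with x hx hx2
  have hx : Integrable (fun y => localKernel y * |γ (x - y)|) volume := hx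
  have h3 : Integrable (fun y => |γ (x - y)|) volume := hγ.abs.comp_sub_left x
  rw [Real.norm_eq_abs, Real.norm_eq_abs]
  refine le_trans ?_ (le_abs_self _)
  calc |gradConv γ x| ≤ ∫ y, (localKernel y + 1) * |γ (x - y)| := by
        refine norm_integral_le_of_norm_le (f := fun y => gradKernel y * γ (x - y)) hx2
          (Eventually.of_forall fun y => ?_)
        rw [norm_mul, Real.norm_eq_abs, Real.norm_eq_abs]
        refine mul_le_mul_of_nonneg_right ?_ (abs_nonneg (γ (x - y)))
        exact (abs_gradKernel_le y).trans (inv_norm_sq_le y)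
    _ = (∫ y, localKernel y * |γ (x - y)|) + ∫ y, |γ (x - y)| := by
        rw [← integral_add hx h3]
        refine integral_congr_ae (Eventually.of_forall fun y => ?_)
        simp only; ring
    _ = _ := by
        rw [integral_sub_left_eq_self (fun y => |γ y|) volume x]
        rfl

theorem lintegral_gradKernel_prod_le {δ ψ : Space → ℝ} (hδ : AEStronglyMeasurable δ volume)
    (hψ : IsTest ψ) {C : ℝ} (hC : ∀ x, |ψ x| ≤ C) :
    ∫⁻ p : Space × Space, ‖gradKernel p.2 * (δ (p.1 - p.2) * ψ p.1)‖ₑ ∂(volume.prod volume)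
      ≤ (ENNReal.ofReal C * (∫⁻ y, ‖localKernel y‖ₑ) + ∫⁻ x, ‖ψ x‖ₑ) * ∫⁻ x, ‖δ x‖ₑ := by
  have hm : AEStronglyMeasurable (fun p : Space × Space => δ (p.1 - p.2)) (volume.prod volume) :=
    hδ.comp_quasiMeasurePreserving (quasiMeasurePreserving_sub volume volume)
  have hl : AEMeasurable (fun p : Space × Space => ‖localKernel p.2‖ₑ) (volume.prod volume) :=
    integrable_localKernel.1.enorm.comp_quasiMeasurePreserving Measure.quasiMeasurePreserving_snd
  have hp : AEMeasurable (fun p : Space × Space => ‖ψ p.1‖ₑ) (volume.prod volume) :=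
    (hψ.continuous.comp continuous_fst).aestronglyMeasurable.enorm
  have hlm : AEMeasurable (fun p : Space × Space => ‖localKernel p.2‖ₑ * ‖δ (p.1 - p.2)‖ₑ)
      (volume.prod volume) := hl.mul hm.enorm
  have hpm : AEMeasurable (fun p : Space × Space => ‖ψ p.1‖ₑ * ‖δ (p.1 - p.2)‖ₑ)
      (volume.prod volume) := hp.mul hm.enorm
  calc _ ≤ ∫⁻ p : Space × Space, (ENNReal.ofReal C * (‖localKernel p.2‖ₑ * ‖δ (p.1 - p.2)‖ₑ)
          + ‖ψ p.1‖ₑ * ‖δ (p.1 - p.2)‖ₑ) ∂(volume.prod volume) := by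
        refine lintegral_mono fun p => ?_
        rw [enorm_mul, enorm_mul]
        have h1 : ‖gradKernel p.2‖ₑ ≤ ‖localKernel p.2‖ₑ + 1 := by
          refine le_trans ?_ ((enorm_add_le (localKernel p.2) 1).trans_eq' rfl |>.trans (by simp))
          rw [Real.enorm_eq_ofReal_abs, Real.enorm_eq_ofReal_abs]
          refine ENNReal.ofReal_le_ofReal ?_
          exact ((abs_gradKernel_le _).trans (inv_norm_sq_le _)).trans (le_abs_self _)
        have h2 : ‖ψ p.1‖ₑ ≤ ENNReal.ofReal C := by
          rw [Real.enorm_eq_ofReal_abs]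
          exact ENNReal.ofReal_le_ofReal (hC _)
        calc _ ≤ (‖localKernel p.2‖ₑ + 1) * (‖δ (p.1 - p.2)‖ₑ * ‖ψ p.1‖ₑ) := mul_le_mul' h1 le_rfl
          _ = ‖ψ p.1‖ₑ * (‖localKernel p.2‖ₑ * ‖δ (p.1 - p.2)‖ₑ) + ‖ψ p.1‖ₑ * ‖δ (p.1 - p.2)‖ₑ := by ring
          _ ≤ _ := by gcongr
    _ = ENNReal.ofReal C * (∫⁻ p : Space × Space, ‖localKernel p.2‖ₑ * ‖δ (p.1 - p.2)‖ₑ ∂(volume.prod volume))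
        + ∫⁻ p : Space × Space, ‖ψ p.1‖ₑ * ‖δ (p.1 - p.2)‖ₑ ∂(volume.prod volume) := by
        rw [lintegral_add_left' (hlm.const_mul _), lintegral_const_mul'' _ hlm]
    _ = ENNReal.ofReal C * ((∫⁻ y, ‖localKernel y‖ₑ) * ∫⁻ x, ‖δ x‖ₑ)
        + (∫⁻ x, ‖ψ x‖ₑ) * ∫⁻ x, ‖δ x‖ₑ := by
        congr 2
        · rw [lintegral_prod_symm _ hlm]
          rw [← lintegral_mul_const'' _ integrable_localKernel.1.enorm]
          refine lintegral_congr fun y => ?_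
          simp only
          rw [lintegral_const_mul' _ _ (by simp), lintegral_sub_right_eq_self (fun x => ‖δ x‖ₑ) y]
        · rw [lintegral_prod _ hpm]
          rw [← lintegral_mul_const'' _ hψ.continuous.aestronglyMeasurable.enorm]
          refine lintegral_congr fun x => ?_
          simp only
          rw [lintegral_const_mul' _ _ (by simp), lintegral_sub_left_eq_self (fun x => ‖δ x‖ₑ) x]
    _ = _ := by ring

theorem tendsto_integral_gradConv_mul {γ : ℕ → Space → ℝ} {γ₀ ψ : Space → ℝ}
    (hγ : ∀ n, Integrable (γ n) volume) (hγ₀ : Integrable γ₀ volume)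
    (h : Tendsto (fun n => ∫⁻ x, ‖γ n x - γ₀ x‖ₑ) atTop (𝓝 0)) (hψ : IsTest ψ) :
    Tendsto (fun n => ∫ x, gradConv (γ n) x * ψ x) atTop (𝓝 (∫ x, gradConv γ₀ x * ψ x)) := by
  obtain ⟨C, hC⟩ := hψ.exists_abs_le
  simp only [integral_gradConv_mul_eq_prod (hγ _) hψ, integral_gradConv_mul_eq_prod hγ₀ hψ]
  refine tendsto_integral_of_L1 _ (integrable_gradKernel_prod hγ₀ hψ).1
    (Eventually.of_forall fun n => integrable_gradKernel_prod (hγ n) hψ) ?_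
  have hfin : ENNReal.ofReal C * (∫⁻ y, ‖localKernel y‖ₑ) + ∫⁻ x, ‖ψ x‖ₑ ≠ ⊤ :=
    ENNReal.add_ne_top.2 ⟨ENNReal.mul_ne_top ENNReal.ofReal_ne_top integrable_localKernel.2.ne,
      hψ.integrable.2.ne⟩
  have h1 := ENNReal.Tendsto.const_mul h (Or.inr hfin)
  rw [mul_zero] at h1
  refine tendsto_of_tendsto_of_tendsto_of_le_of_le tendsto_const_nhds h1 (fun _ => zero_le)
    fun n => ?_
  refine le_trans (le_of_eq ?_) (lintegral_gradKernel_prod_le ((hγ n).1.sub hγ₀.1) hψ hC)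
  refine lintegral_congr fun p => ?_
  simp only [Pi.sub_apply]
  congr 1; ring

theorem inner_toLp {f g : Space → ℝ} (hf : MemLp f 2 volume) (hg : MemLp g 2 volume) :
    inner ℝ (hf.toLp f) (hg.toLp g) = ∫ x, f x * g x := by
  rw [L2.inner_def]
  refine integral_congr_ae ?_
  filter_upwards [hf.coeFn_toLp, hg.coeFn_toLp] with x h1 h2
  rw [h1, h2]
  simp [mul_comm]

theorem inner_toLp_right (f : L2R) {g : Space → ℝ} (hg : MemLp g 2 volume) :
    inner ℝ f (hg.toLp g) = ∫ x, f x * g x := by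
  rw [← inner_toLp (Lp.memLp f) hg, Lp.toLp_coeFn]

/-- The two sides live in different spaces, so they are compared as distributions. Tested against
`ψ`, the left is continuous for `L¹` convergence of the derivative of `|u|²`, the right for `L²`
convergence of `|u|²`, and they agree on test functions. -/
theorem H1Pair.gradConv_ae {u : Space → ℂ} {G : Space → EuclideanSpace ℂ (Fin 3)}
    (h : H1Pair u G) : gradConv (sqDeriv u G) =ᵐ[volume] dipoleOp (sqLp h.memLp_four) := by
  obtain ⟨v, hv⟩ := h.exists_testApprox
  have hL := hv.l1Approx h
  have hl : LocallyIntegrable (fun x => gradConv (sqDeriv u G) x - dipoleOp (sqLp h.memLp_four) x) volume :=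
    (locallyIntegrable_gradConv hL.integrable_deriv).sub
      ((Lp.memLp (dipoleOp (sqLp h.memLp_four))).locallyIntegrable (by norm_num))
  have := ae_eq_zero_of_integral_contDiff_smul_eq_zero hl ?_
  · filter_upwards [this] with x hx
    exact sub_eq_zero.1 hx
  intro ψ hψ1 hψ2
  have hψ : IsTest ψ := ⟨hψ1, hψ2⟩
  have t1 := tendsto_integral_gradConv_mul (fun n => ((hL.isTest n).partialDeriv 2).integrable)
    hL.integrable_deriv hL.tendsto_deriv hψ
  have hv4 : ∀ n, MemLp (v n) 4 volume := fun n => hv.memLp n 4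
  have t2 := (dipoleOp.continuous.tendsto _).comp (tendsto_sqLp h.memLp_four hv4 (hv.tendsto_four h))
  have t3 := Tendsto.inner (𝕜 := ℝ) t2 (tendsto_const_nhds (x := hψ.memLpR.toLp ψ))
  have e : ∀ n, inner ℝ (dipoleOp (sqLp (hv4 n))) (hψ.memLpR.toLp ψ)
      = ∫ x, gradConv (partialDeriv 2 fun x => ‖v n x‖ ^ 2) x * ψ x := fun n =>
    (hL.isTest n).inner_dipoleOp hψ
  simp only [Function.comp, e] at t3
  have key := tendsto_nhds_unique t1 t3
  rw [inner_toLp_right] at key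
  have i1 := hψ.integrable_smul (locallyIntegrable_gradConv hL.integrable_deriv)
  have i2 := hψ.integrable_smul ((Lp.memLp (dipoleOp (sqLp h.memLp_four))).locallyIntegrable (by norm_num))
  simp only [smul_sub]
  rw [integral_sub i1 i2, sub_eq_zero]
  simp only [smul_eq_mul, mul_comm (ψ _)]
  exact key

/-- The operator `g ↦ -λ₁ g - λ₂ K ∗ g` on `L²`. -/
def interOp (l₁ l₂ : ℝ) : L2R →L[ℝ] L2R :=
  (-l₁ + l₂ * (4 * Real.pi / 3)) • ContinuousLinearMap.id ℝ L2R - l₂ • dipoleOp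

theorem inner_interOp_symm (l₁ l₂ : ℝ) (f g : L2R) :
    inner ℝ (interOp l₁ l₂ f) g = inner ℝ f (interOp l₁ l₂ g) := by
  simp only [interOp, sub_apply, smul_apply,
    ContinuousLinearMap.id_apply, inner_sub_left, inner_sub_right, inner_smul_left,
    inner_smul_right, inner_dipoleOp_symm]
  simp

theorem H1Pair.interOp_ae {u : Space → ℂ} {G : Space → EuclideanSpace ℂ (Fin 3)}
    (h : H1Pair u G) (l₁ l₂ : ℝ) : ∀ᵐ x, interOp l₁ l₂ (sqLp h.memLp_four) x
      = -l₁ * ‖u x‖ ^ 2 - l₂ * dipoleConv (fun y => ‖u y‖ ^ 2) x := by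
  filter_upwards [Lp.coeFn_sub ((-l₁ + l₂ * (4 * Real.pi / 3)) • sqLp h.memLp_four)
    (l₂ • dipoleOp (sqLp h.memLp_four)), Lp.coeFn_smul (-l₁ + l₂ * (4 * Real.pi / 3)) (sqLp h.memLp_four),
    Lp.coeFn_smul l₂ (dipoleOp (sqLp h.memLp_four)), h.gradConv_ae, h.dipoleConv_ae,
    (memLp_norm_sq h.memLp_four).coeFn_toLp] with x h1 h2 h3 h4 h5 h6
  have h6 : sqLp h.memLp_four x = ‖u x‖ ^ 2 := h6
  have e : interOp l₁ l₂ (sqLp h.memLp_four) = (-l₁ + l₂ * (4 * Real.pi / 3)) • sqLp h.memLp_four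
    - l₂ • dipoleOp (sqLp h.memLp_four) := rfl
  rw [e, h1, Pi.sub_apply, h2, h3, Pi.smul_apply, Pi.smul_apply, h6, ← h4, h5]
  simp only [smul_eq_mul]
  ring

/-- The interaction is a bounded symmetric quadratic form in `|u|² ∈ L²`. Its bounds, its splitting
along weakly convergent sequences and its derivative all rest on this form. -/
theorem H1Pair.nonlin_eq {u : Space → ℂ} {G : Space → EuclideanSpace ℂ (Fin 3)}
    (h : H1Pair u G) (l₁ l₂ : ℝ) :
    nonlin l₁ l₂ u = inner ℝ (interOp l₁ l₂ (sqLp h.memLp_four)) (sqLp h.memLp_four) := by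
  have hm := memLp_norm_sq h.memLp_four
  rw [show sqLp h.memLp_four = hm.toLp _ from rfl, inner_toLp_right, nonlin, dipoleInt,
    lpNorm_four_pow h.memLp.1]
  have hd : MemLp (fun x => gradConv (sqDeriv u G) x - 4 * Real.pi / 3 * ‖u x‖ ^ 2) 2 volume :=
    ((memLp_congr_ae h.gradConv_ae).2 (Lp.memLp _)).sub (hm.const_mul _)
  have hi : Integrable (fun x => dipoleConv (fun y => ‖u y‖ ^ 2) x * ‖u x‖ ^ 2) volume := by
    refine (hd.integrable_mul hm).congr ?_
    filter_upwards [h.dipoleConv_ae] with x hx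
    rw [Pi.mul_apply, hx]
  rw [← integral_const_mul, ← integral_const_mul, ← integral_sub (h.integrable_four.const_mul _) (hi.const_mul _)]
  refine integral_congr_ae ?_
  filter_upwards [h.interOp_ae l₁ l₂] with x hx
  have : interOp l₁ l₂ (hm.toLp _) x = _ := hx
  rw [this]
  ring

/-! ### Functions with positive interaction -/

/-- The symbol of `interOp`. -/
def interSymbol (l₁ l₂ : ℝ) (ξ : Space) : ℝ := -l₁ + l₂ * (4 * Real.pi / 3) - l₂ * (4 * Real.pi * symbol ξ)

theorem measurable_interSymbol (l₁ l₂ : ℝ) : Measurable (interSymbol l₁ l₂) :=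
  ((measurable_symbol.const_mul _).const_mul _).const_sub _

theorem abs_interSymbol_le (l₁ l₂ : ℝ) (ξ : Space) :
    |interSymbol l₁ l₂ ξ| ≤ |-l₁ + l₂ * (4 * Real.pi / 3)| + |l₂| * (4 * Real.pi) := by
  have h0 := Real.pi_pos
  refine (abs_sub _ _).trans (add_le_add le_rfl ?_)
  rw [abs_mul, abs_of_nonneg (mul_nonneg (by positivity) (symbol_nonneg ξ))]
  refine mul_le_mul_of_nonneg_left ?_ (abs_nonneg _)
  exact mul_le_of_le_one_right (by positivity) (symbol_le_one ξ)

theorem IsTest.integrable_fourier_sq {g : Space → ℝ} (hg : IsTest g) :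
    Integrable (fun ξ => ‖𝓕 hg.schwartz ξ‖ ^ 2) volume :=
  MemLp.integrable_pow (n := 2) (by simpa using (𝓕 hg.schwartz).memLp 2 volume) (by norm_num)

theorem IsTest.inner_interOp {g : Space → ℝ} (hg : IsTest g) (l₁ l₂ : ℝ) :
    inner ℝ (interOp l₁ l₂ (hg.memLpR.toLp g)) (hg.memLpR.toLp g)
      = ∫ ξ, interSymbol l₁ l₂ ξ * ‖𝓕 hg.schwartz ξ‖ ^ 2 := by
  have h1 : inner ℝ (dipoleOp (hg.memLpR.toLp g)) (hg.memLpR.toLp g)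
      = ∫ ξ, 4 * Real.pi * symbol ξ * ‖𝓕 hg.schwartz ξ‖ ^ 2 := by
    rw [DipolarNLS.inner_dipoleOp, hg.toC_toLp, inner_dipoleOpC, SchwartzMap.toLp_fourier_eq]
    rw [← Complex.ofReal_re (∫ ξ, 4 * Real.pi * symbol ξ * ‖𝓕 hg.schwartz ξ‖ ^ 2),
      ← integral_complex_ofReal]
    congr 1
    refine integral_congr_ae ?_
    filter_upwards [(𝓕 hg.schwartz).coeFn_toLp 2 volume] with x h1
    rw [h1, Complex.conj_mul']
    push_cast
    rfl
  have h2 : inner ℝ (hg.memLpR.toLp g) (hg.memLpR.toLp g) = ∫ ξ, ‖𝓕 hg.schwartz ξ‖ ^ 2 := by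
    rw [SchwartzMap.integral_norm_sq_fourier, inner_toLp]
    refine integral_congr_ae (Eventually.of_forall fun x => ?_)
    simp [IsTest.schwartz_apply, sq]
  have i1 : Integrable (fun ξ => 4 * Real.pi * symbol ξ * ‖𝓕 hg.schwartz ξ‖ ^ 2) volume := by
    have h0 := Real.pi_pos
    refine hg.integrable_fourier_sq.bdd_mul (c := 4 * Real.pi)
      (measurable_symbol.const_mul _).aestronglyMeasurable (Eventually.of_forall fun ξ => ?_)
    rw [Real.norm_of_nonneg (mul_nonneg (by positivity) (symbol_nonneg ξ))]
    exact mul_le_of_le_one_right (by positivity) (symbol_le_one ξ)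
  simp only [interOp, sub_apply, smul_apply, ContinuousLinearMap.id_apply, inner_sub_left, real_inner_smul_left]
  rw [h1, h2, ← integral_const_mul, ← integral_const_mul,
    ← integral_sub (hg.integrable_fourier_sq.const_mul _) (i1.const_mul _)]
  refine integral_congr_ae (Eventually.of_forall fun ξ => ?_)
  simp only [interSymbol]
  ring

/-- Dilation of the `i`-th coordinate by the factor `L`. -/
def stretch (i : Fin 3) (L : ℝ) : Space →ₗ[ℝ] Space :=
  LinearMap.id + (L - 1) • (LinearMap.toSpanSingleton ℝ Space (EuclideanSpace.single i 1) ∘ₗ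
    (EuclideanSpace.proj (𝕜 := ℝ) i).toLinearMap)

theorem stretch_apply (i : Fin 3) (L : ℝ) (x : Space) :
    stretch i L x = x + ((L - 1) * x i) • EuclideanSpace.single i 1 := by
  simp [stretch, smul_smul]

theorem stretch_coord_self (i : Fin 3) (L : ℝ) (x : Space) : stretch i L x i = L * x i := by
  rw [stretch_apply]; simp; ring

theorem stretch_coord_of_ne {i j : Fin 3} (h : j ≠ i) (L : ℝ) (x : Space) : stretch i L x j = x j := by
  rw [stretch_apply]; simp [h]

theorem stretch_stretch (i : Fin 3) (L K : ℝ) (x : Space) :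
    stretch i L (stretch i K x) = stretch i (L * K) x := by
  ext j
  rcases eq_or_ne j i with rfl | h
  · simp only [stretch_coord_self]; ring
  · simp only [stretch_coord_of_ne h]

theorem stretch_one (i : Fin 3) (x : Space) : stretch i 1 x = x := by
  simp [stretch_apply]

theorem inner_stretch (i : Fin 3) (L : ℝ) (x y : Space) :
    inner ℝ (stretch i L x) y = inner ℝ x (stretch i L y) := by
  simp only [stretch_apply, inner_add_left, inner_add_right, inner_smul_left, inner_smul_right,
    EuclideanSpace.inner_single_left, EuclideanSpace.inner_single_right]
  simp; ring

theorem norm_stretch_sq (i : Fin 3) (L : ℝ) (x : Space) :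
    ‖stretch i L x‖ ^ 2 = ‖x‖ ^ 2 + (L ^ 2 - 1) * x i ^ 2 := by
  rw [← real_inner_self_eq_norm_sq, inner_stretch, stretch_stretch, stretch_apply, inner_add_right,
    real_inner_self_eq_norm_sq, inner_smul_right, EuclideanSpace.inner_single_right]
  simp; ring

/-- Only the positivity of the Jacobian factor matters. Quantifying over `E` after `c` lets one
constant serve complex and real integrands. -/
theorem exists_integral_comp_stretch (i : Fin 3) {L : ℝ} (hL : 0 < L) : ∃ c : ℝ, 0 < c ∧
    ∀ {E : Type} [NormedAddCommGroup E] [NormedSpace ℝ E] (f : Space → E),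
      ∫ x, f (stretch i L x) = c • ∫ x, f x := by
  have hinv : ∀ x, stretch i L⁻¹ (stretch i L x) = x := fun x => by
    rw [stretch_stretch, inv_mul_cancel₀ hL.ne', stretch_one]
  have hinv' : ∀ x, stretch i L (stretch i L⁻¹ x) = x := fun x => by
    rw [stretch_stretch, mul_inv_cancel₀ hL.ne', stretch_one]
  let e : Space ≃ₗ[ℝ] Space := LinearEquiv.ofLinearMap (stretch i L) (stretch i L⁻¹)
    (LinearMap.ext hinv') (LinearMap.ext hinv)
  have hdet : LinearMap.det (stretch i L) ≠ 0 := (LinearEquiv.isUnit_det' e).ne_zero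
  have hme : MeasurableEmbedding (stretch i L) :=
    (e.toContinuousLinearEquiv.toHomeomorph).measurableEmbedding
  refine ⟨|(LinearMap.det (stretch i L))⁻¹|, by positivity, fun f => ?_⟩
  rw [← hme.integral_map, Measure.map_linearMap_addHaar_eq_smul_addHaar volume hdet,
    integral_smul_measure, ENNReal.toReal_ofReal (abs_nonneg _)]

theorem IsTest.comp_stretch {g : Space → ℝ} (hg : IsTest g) (i : Fin 3) {L : ℝ} (hL : 0 < L) :
    IsTest (fun x => g (stretch i L x)) := by
  refine ⟨hg.1.comp (stretch i L).toContinuousLinearMap.contDiff, ?_⟩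
  have hinv : ∀ x, stretch i L⁻¹ (stretch i L x) = x := fun x => by
    rw [stretch_stretch, inv_mul_cancel₀ hL.ne', stretch_one]
  refine HasCompactSupport.intro (hg.2.isCompact.image (stretch i L⁻¹).continuous_of_finiteDimensional)
    fun x hx => ?_
  by_contra h
  exact hx ⟨stretch i L x, subset_tsupport _ h, hinv x⟩

/-- Since the stretch is symmetric, the transform of `g ∘ stretch` at the stretched frequency is `c
𝓕g(ξ)`. Squaring gives `c²`, and the change of variables takes one factor back. -/
theorem IsTest.integral_stretch {g : Space → ℝ} (hg : IsTest g) (i : Fin 3) {L : ℝ} (hL : 0 < L) :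
    ∃ c : ℝ, 0 < c ∧ ∀ l₁ l₂ : ℝ,
      ∫ ξ, interSymbol l₁ l₂ ξ * ‖𝓕 (hg.comp_stretch i hL).schwartz ξ‖ ^ 2
      = c * ∫ ξ, interSymbol l₁ l₂ (stretch i L ξ) * ‖𝓕 hg.schwartz ξ‖ ^ 2 := by
  obtain ⟨c, hc, h⟩ := exists_integral_comp_stretch i hL
  have hinv : ∀ x, stretch i L⁻¹ (stretch i L x) = x := fun x => by
    rw [stretch_stretch, inv_mul_cancel₀ hL.ne', stretch_one]
  refine ⟨c, hc, fun l₁ l₂ => ?_⟩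
  have hF : ∀ ξ, 𝓕 (hg.comp_stretch i hL).schwartz (stretch i L ξ) = c • 𝓕 hg.schwartz ξ := fun ξ => by
    rw [SchwartzMap.fourier_coe, SchwartzMap.fourier_coe, Real.fourier_eq, Real.fourier_eq, ← h]
    refine integral_congr_ae (Eventually.of_forall fun x => ?_)
    simp only [← inner_stretch, IsTest.schwartz_apply]
  have h2 := h fun ξ => interSymbol l₁ l₂ ξ * ‖𝓕 (hg.comp_stretch i hL).schwartz ξ‖ ^ 2
  simp only [hF, norm_smul, mul_pow, Real.norm_eq_abs, sq_abs, smul_eq_mul] at h2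
  have h3 : ∫ ξ, interSymbol l₁ l₂ (stretch i L ξ) * (c ^ 2 * ‖𝓕 hg.schwartz ξ‖ ^ 2)
    = c ^ 2 * ∫ ξ, interSymbol l₁ l₂ (stretch i L ξ) * ‖𝓕 hg.schwartz ξ‖ ^ 2 := by
    rw [← integral_const_mul]
    refine integral_congr_ae (Eventually.of_forall fun x => ?_)
    simp only; ring
  rw [h3] at h2
  have := mul_left_cancel₀ hc.ne' (h2.symm.trans (by ring : _ = c * (c * ∫ ξ, interSymbol l₁ l₂ (stretch i L ξ) * ‖𝓕 hg.schwartz ξ‖ ^ 2)))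
  exact this

theorem ae_coord_ne_zero (i : Fin 3) : ∀ᵐ ξ : Space, ξ i ≠ 0 := by
  have hne : LinearMap.ker (EuclideanSpace.proj (𝕜 := ℝ) i : Space →L[ℝ] ℝ).toLinearMap ≠ ⊤ := by
    intro h
    have : (EuclideanSpace.single i (1 : ℝ) : Space) ∈ LinearMap.ker (EuclideanSpace.proj (𝕜 := ℝ) i : Space →L[ℝ] ℝ).toLinearMap := by
      rw [h]; trivial
    simp at this
  filter_upwards [compl_mem_ae_iff.2 (Measure.addHaar_submodule (volume : Measure Space) _ hne)] with ξ hξ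
  simpa using hξ

/-- The symbol is `-λ₁ + (4π/3)λ₂` on the plane `ξ₃ = 0` and `-λ₁ - (8π/3)λ₂` on the dipole axis.
The regime makes the first value positive if `λ₂ ≥ 0` and the second if `λ₂ < 0`; stretching the
first or the third coordinate drives almost every frequency to the good direction. -/
theorem exists_interSymbol_limit {l₁ l₂ : ℝ} (hreg : UnstableRegime l₁ l₂) : ∃ (i : Fin 3) (c : ℝ),
    0 < c ∧ ∀ ξ : Space, ξ i ≠ 0 →
      Tendsto (fun n : ℕ => interSymbol l₁ l₂ (stretch i ((n : ℝ) + 1) ξ)) atTop (𝓝 c) := by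
  have hinvlim : Tendsto (fun n : ℕ => (((n : ℝ) + 1) ^ 2)⁻¹) atTop (𝓝 0) := by
    have h1 : Tendsto (fun n : ℕ => (n : ℝ) + 1) atTop atTop :=
      tendsto_atTop_add_const_right _ _ tendsto_natCast_atTop_atTop
    exact ((tendsto_pow_atTop two_ne_zero).comp h1).inv_tendsto_atTop
  by_cases hl : l₂ < 0
  · refine ⟨2, -l₁ + l₂ * (4 * Real.pi / 3) - l₂ * (4 * Real.pi * 1), ?_, fun ξ hξ => ?_⟩
    · have := hreg.2.1 hl; linarith
    · refine ((Tendsto.const_mul _ ?_).const_mul _).const_sub _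
      have e : ∀ n : ℕ, symbol (stretch 2 ((n : ℝ) + 1) ξ)
          = ξ 2 ^ 2 / ((‖ξ‖ ^ 2 - ξ 2 ^ 2) * (((n : ℝ) + 1) ^ 2)⁻¹ + ξ 2 ^ 2) := fun n => by
        rw [symbol, norm_stretch_sq, stretch_coord_self]
        have h0 : (n : ℝ) + 1 ≠ 0 := by positivity
        rw [← mul_div_mul_left (ξ 2 ^ 2) _ (pow_ne_zero 2 h0)]
        congr 1
        · ring
        · field_simp
          ring
      simp only [e]
      have h := (tendsto_const_nhds (x := ξ 2 ^ 2)).div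
        ((hinvlim.const_mul (‖ξ‖ ^ 2 - ξ 2 ^ 2)).add_const (ξ 2 ^ 2)) (by simpa using hξ)
      simpa [div_self (pow_ne_zero 2 hξ), Pi.div_def] using h
  · refine ⟨0, -l₁ + l₂ * (4 * Real.pi / 3) - l₂ * (4 * Real.pi * 0), ?_, fun ξ hξ => ?_⟩
    · rcases (not_lt.1 hl).eq_or_lt with h | h
      · have := hreg.2.2 h.symm
        rw [← h]; linarith
      · have := hreg.1 h; linarith
    · refine ((Tendsto.const_mul _ ?_).const_mul _).const_sub _
      have e : ∀ n : ℕ, symbol (stretch 0 ((n : ℝ) + 1) ξ)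
          = (ξ 2 ^ 2 * (((n : ℝ) + 1) ^ 2)⁻¹) / ((‖ξ‖ ^ 2 - ξ 0 ^ 2) * (((n : ℝ) + 1) ^ 2)⁻¹ + ξ 0 ^ 2) := fun n => by
        rw [symbol, norm_stretch_sq, stretch_coord_of_ne (by decide)]
        have h0 : (n : ℝ) + 1 ≠ 0 := by positivity
        rw [← mul_div_mul_left (ξ 2 ^ 2 * _) _ (pow_ne_zero 2 h0)]
        congr 1
        · field_simp
        · field_simp
          ring
      simp only [e]
      have h := (hinvlim.const_mul (ξ 2 ^ 2)).div
        ((hinvlim.const_mul (‖ξ‖ ^ 2 - ξ 0 ^ 2)).add_const (ξ 0 ^ 2)) (by simpa using hξ)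
      simpa [Pi.div_def] using h

/-- As the stretch grows, the quadratic form evaluated on the stretched density approaches, up to a
positive Jacobian factor, a positive multiple of `‖𝓕g‖²`. -/
theorem exists_nonlin_pos {l₁ l₂ : ℝ} (hreg : UnstableRegime l₁ l₂) :
    ∃ u : Space → ℂ, MemH1 u ∧ 0 < nonlin l₁ l₂ u := by
  obtain ⟨i, c, hc, hlim⟩ := exists_interSymbol_limit hreg
  obtain ⟨ρ, hρ, -⟩ := exists_isMollifier (ε := 1) one_pos
  -- A square, so that the stretched density is `|u|²` for the smooth function `u = ρ ∘ stretch`.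
  have hg : IsTest (fun x => ρ x ^ 2) := ⟨hρ.1.1.pow 2, by
    refine hρ.1.2.mono fun x hx => ?_
    simpa using hx⟩
  have hpos : 0 < ∫ ξ, ‖𝓕 hg.schwartz ξ‖ ^ 2 := by
    rw [SchwartzMap.integral_norm_sq_fourier]
    refine lt_of_le_of_ne (integral_nonneg fun x => by positivity) fun h0 => ?_
    have hi : Integrable (fun x => ‖hg.schwartz x‖ ^ 2) volume :=
      MemLp.integrable_pow (n := 2) (by simpa using hg.schwartz.memLp 2 volume) (by norm_num)
    rw [eq_comm, integral_eq_zero_iff_of_nonneg (fun x => by positivity) hi] at h0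
    have h1 : ∫ x, ρ x = 0 := by
      refine integral_eq_zero_of_ae ?_
      filter_upwards [h0] with x hx
      simpa [IsTest.schwartz_apply] using hx
    rw [hρ.integral_eq] at h1
    exact one_ne_zero h1
  have ht : Tendsto (fun n : ℕ => ∫ ξ, interSymbol l₁ l₂ (stretch i ((n : ℝ) + 1) ξ)
      * ‖𝓕 hg.schwartz ξ‖ ^ 2) atTop (𝓝 (∫ ξ, c * ‖𝓕 hg.schwartz ξ‖ ^ 2)) := by
    refine tendsto_integral_of_dominated_convergence
      (fun ξ => (|-l₁ + l₂ * (4 * Real.pi / 3)| + |l₂| * (4 * Real.pi)) * ‖𝓕 hg.schwartz ξ‖ ^ 2)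
      (fun n => ?_) (hg.integrable_fourier_sq.const_mul _) (fun n => Eventually.of_forall fun ξ => ?_) ?_
    · exact (((measurable_interSymbol l₁ l₂).comp
        (stretch i _).continuous_of_finiteDimensional.measurable).aestronglyMeasurable).mul hg.integrable_fourier_sq.1
    · rw [norm_mul, norm_pow, norm_norm]
      gcongr
      exact abs_interSymbol_le _ _ _
    · filter_upwards [ae_coord_ne_zero i] with ξ hξ
      exact (hlim ξ hξ).mul_const _
  rw [integral_const_mul] at ht
  obtain ⟨n, hn⟩ := (ht.eventually (lt_mem_nhds (mul_pos hc hpos))).exists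
  have hL : (0 : ℝ) < n + 1 := by positivity
  have hρn := hρ.1.comp_stretch i hL
  have hv : ContDiff ℝ ∞ (fun x => (ρ (stretch i ((n : ℝ) + 1) x) : ℂ)) := Complex.ofRealCLM.contDiff.comp hρn.1
  have hvc : HasCompactSupport (fun x => (ρ (stretch i ((n : ℝ) + 1) x) : ℂ)) :=
    hρn.2.comp_left (g := fun r : ℝ => (r : ℂ)) Complex.ofReal_zero
  have hp := h1Pair_of_contDiff hv hvc
  refine ⟨_, hp.memH1, ?_⟩
  rw [hp.nonlin_eq]
  have hgn := hg.comp_stretch i hL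
  have e : sqLp hp.memLp_four = hgn.memLpR.toLp _ := by
    refine MemLp.toLp_congr _ _ (Eventually.of_forall fun x => ?_)
    simp
  obtain ⟨k, hk, hint⟩ := hg.integral_stretch i hL
  rw [e, hgn.inner_interOp, hint]
  exact mul_pos hk hn

/-! ### Scaling and translation -/

theorem dipoleKernel_smul {s : ℝ} (hs : 0 < s) (y : Space) :
    dipoleKernel (s • y) = (s ^ 3)⁻¹ * dipoleKernel y := by
  simp only [dipoleKernel, PiLp.smul_apply, smul_eq_mul, norm_smul, Real.norm_of_nonneg hs.le]
  rw [mul_div_mul_left _ _ hs.ne', mul_pow]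
  field_simp

theorem map_inv_mul_nhdsGT {s : ℝ} (hs : 0 < s) :
    map (fun ε : ℝ => s⁻¹ * ε) (𝓝[>] 0) = 𝓝[>] 0 := by
  refine le_antisymm ?_ ?_
  · refine tendsto_nhdsWithin_iff.2 ⟨?_, ?_⟩
    · have : Tendsto (fun ε : ℝ => s⁻¹ * ε) (𝓝 0) (𝓝 (s⁻¹ * 0)) := (continuous_const_mul s⁻¹).tendsto 0
      rw [mul_zero] at this
      exact this.mono_left nhdsWithin_le_nhds
    · filter_upwards [self_mem_nhdsWithin] with ε hε
      exact mul_pos (inv_pos.2 hs) hε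
  · have h : Tendsto (fun ε : ℝ => s * ε) (𝓝[>] 0) (𝓝[>] 0) := by
      refine tendsto_nhdsWithin_iff.2 ⟨?_, ?_⟩
      · have : Tendsto (fun ε : ℝ => s * ε) (𝓝 0) (𝓝 (s * 0)) := (continuous_const_mul s).tendsto 0
        rw [mul_zero] at this
        exact this.mono_left nhdsWithin_le_nhds
      · filter_upwards [self_mem_nhdsWithin] with ε hε
        exact mul_pos hs hε
    have h2 := Filter.map_mono (m := fun ε : ℝ => s⁻¹ * ε) h
    rw [Filter.map_map] at h2
    have e : (fun ε : ℝ => s⁻¹ * ε) ∘ (fun ε => s * ε) = id := by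
      funext ε; simp [hs.ne']
    rwa [e, Filter.map_id] at h2

/-- The kernel is homogeneous of degree `-3`, which the Jacobian compensates, so a dilation only
rescales the truncation radius. The filter `𝓝[>] 0` is invariant under this, hence no convergence is
needed. -/
theorem dipoleConv_dilate (g : Space → ℝ) {s : ℝ} (hs : 0 < s) (x : Space) :
    dipoleConv (fun y => g (s⁻¹ • y)) x = dipoleConv g (s⁻¹ • x) := by
  unfold dipoleConv limUnder
  have e : (fun ε : ℝ => ∫ y in {y : Space | ε < ‖y‖}, dipoleKernel y * g (s⁻¹ • (x - y)))
      = (fun ε : ℝ => ∫ y in {y : Space | ε < ‖y‖}, dipoleKernel y * g (s⁻¹ • x - y)) ∘ fun ε => s⁻¹ * ε := by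
    funext ε
    simp only [Function.comp]
    have hm : ∀ ε : ℝ, MeasurableSet {y : Space | ε < ‖y‖} := fun ε =>
      measurableSet_lt measurable_const measurable_norm
    rw [← integral_indicator (hm _), ← integral_indicator (hm _)]
    have h := integral_comp_inv_smul (fun y => {y : Space | s⁻¹ * ε < ‖y‖}.indicator
      (fun y => dipoleKernel y * g (s⁻¹ • x - y)) y) hs
    have e2 : ∀ y : Space, {y : Space | ε < ‖y‖}.indicator (fun y => dipoleKernel y * g (s⁻¹ • (x - y))) y
        = (s ^ 3)⁻¹ * {y : Space | s⁻¹ * ε < ‖y‖}.indicator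
      (fun y => dipoleKernel y * g (s⁻¹ • x - y)) (s⁻¹ • y) := fun y => by
      have hiff : s⁻¹ • y ∈ {y : Space | s⁻¹ * ε < ‖y‖} ↔ y ∈ {y : Space | ε < ‖y‖} := by
        simp only [mem_ofPred_eq, norm_smul, norm_inv, Real.norm_of_nonneg hs.le]
        exact mul_lt_mul_iff_right₀ (inv_pos.2 hs)
      by_cases hy : y ∈ {y : Space | ε < ‖y‖}
      · rw [indicator_of_mem hy, indicator_of_mem (hiff.2 hy), dipoleKernel_smul (inv_pos.2 hs), smul_sub]
        have : s ≠ 0 := hs.ne'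
        field_simp
      · rw [indicator_of_notMem hy, indicator_of_notMem (fun h => hy (hiff.1 h)), mul_zero]
    simp only [e2]
    rw [integral_const_mul, h, smul_eq_mul, ← mul_assoc, inv_mul_cancel₀ (by positivity), one_mul]
  rw [e, ← Filter.map_map, map_inv_mul_nhdsGT hs]

theorem dipoleConv_comp_add (g : Space → ℝ) (a x : Space) :
    dipoleConv (fun y => g (y + a)) x = dipoleConv g (x + a) := by
  unfold dipoleConv
  congr 1
  funext ε
  refine integral_congr_ae (Eventually.of_forall fun y => ?_)
  simp only
  congr 2; abel

theorem H1Pair.sixth_eq {u : Space → ℂ} {G : Space → EuclideanSpace ℂ (Fin 3)} (h : H1Pair u G) :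
    lpNorm u 6 volume ^ 6 = ∫ x, ‖u x‖ ^ 6 := lpNorm_six_pow h.memLp.1

section Scaling

variable {u : Space → ℂ} {G : Space → EuclideanSpace ℂ (Fin 3)}

theorem H1Pair.mass_dilate (h : H1Pair u G) {s : ℝ} (hs : 0 < s) :
    mass (fun x => u (s⁻¹ • x)) = s ^ 3 * mass u := by
  rw [(h.dilate hs).mass_eq, h.mass_eq, integral_comp_inv_smul (fun x => ‖u x‖ ^ 2) hs, smul_eq_mul]

theorem H1Pair.gradNorm_dilate (h : H1Pair u G) {s : ℝ} (hs : 0 < s) :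
    gradNorm (fun x => u (s⁻¹ • x)) ^ 2 = s * gradNorm u ^ 2 := by
  rw [(h.dilate hs).gradNorm_sq, h.gradNorm_sq]
  simp only [norm_smul, mul_pow, integral_const_mul]
  rw [integral_comp_inv_smul (fun x => ‖G x‖ ^ 2) hs, smul_eq_mul, norm_inv, Real.norm_of_nonneg hs.le]
  field_simp

theorem H1Pair.sixth_dilate (h : H1Pair u G) {s : ℝ} (hs : 0 < s) :
    lpNorm (fun x => u (s⁻¹ • x)) 6 volume ^ 6 = s ^ 3 * lpNorm u 6 volume ^ 6 := by
  rw [(h.dilate hs).sixth_eq, h.sixth_eq, integral_comp_inv_smul (fun x => ‖u x‖ ^ 6) hs, smul_eq_mul]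

theorem H1Pair.nonlin_dilate (h : H1Pair u G) {s : ℝ} (hs : 0 < s) (l₁ l₂ : ℝ) :
    nonlin l₁ l₂ (fun x => u (s⁻¹ • x)) = s ^ 3 * nonlin l₁ l₂ u := by
  have e : dipoleInt (fun x => u (s⁻¹ • x)) = s ^ 3 * dipoleInt u := by
    unfold dipoleInt
    have e2 : ∀ x, dipoleConv (fun y => ‖u (s⁻¹ • y)‖ ^ 2) x = dipoleConv (fun y => ‖u y‖ ^ 2) (s⁻¹ • x) :=
      fun x => dipoleConv_dilate (fun y => ‖u y‖ ^ 2) hs x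
    simp only [e2]
    rw [integral_comp_inv_smul (fun x => dipoleConv (fun y => ‖u y‖ ^ 2) x * ‖u x‖ ^ 2) hs, smul_eq_mul]
  unfold nonlin
  rw [e, lpNorm_four_pow (h.dilate hs).memLp.1, lpNorm_four_pow h.memLp.1,
    integral_comp_inv_smul (fun x => ‖u x‖ ^ 4) hs, smul_eq_mul]
  ring

theorem H1Pair.mass_const_mul (h : H1Pair u G) (c : ℂ) :
    mass (fun x => c * u x) = ‖c‖ ^ 2 * mass u := by
  rw [(h.const_mul c).mass_eq, h.mass_eq]
  simp only [norm_mul, mul_pow, integral_const_mul]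

theorem H1Pair.gradNorm_const_mul (h : H1Pair u G) (c : ℂ) :
    gradNorm (fun x => c * u x) ^ 2 = ‖c‖ ^ 2 * gradNorm u ^ 2 := by
  rw [(h.const_mul c).gradNorm_sq, h.gradNorm_sq]
  simp only [norm_smul, mul_pow, integral_const_mul]

theorem H1Pair.sixth_const_mul (h : H1Pair u G) (c : ℂ) :
    lpNorm (fun x => c * u x) 6 volume ^ 6 = ‖c‖ ^ 6 * lpNorm u 6 volume ^ 6 := by
  rw [(h.const_mul c).sixth_eq, h.sixth_eq]
  simp only [norm_mul, mul_pow, integral_const_mul]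

theorem H1Pair.nonlin_const_mul (h : H1Pair u G) (c : ℂ) (l₁ l₂ : ℝ) :
    nonlin l₁ l₂ (fun x => c * u x) = ‖c‖ ^ 4 * nonlin l₁ l₂ u := by
  have e : sqLp (h.const_mul c).memLp_four = ‖c‖ ^ 2 • sqLp h.memLp_four := by
    rw [sqLp, sqLp, ← MemLp.toLp_const_smul]
    refine MemLp.toLp_congr _ _ (Eventually.of_forall fun x => ?_)
    simp [mul_pow]
  rw [(h.const_mul c).nonlin_eq, h.nonlin_eq, e, map_smul, inner_smul_left, inner_smul_right]
  simp
  ring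

theorem H1Pair.mass_comp_add (h : H1Pair u G) (a : Space) : mass (fun x => u (x + a)) = mass u := by
  rw [(h.comp_add a).mass_eq, h.mass_eq, integral_add_right_eq_self (fun x => ‖u x‖ ^ 2) a]

theorem H1Pair.gradNorm_comp_add (h : H1Pair u G) (a : Space) :
    gradNorm (fun x => u (x + a)) ^ 2 = gradNorm u ^ 2 := by
  rw [(h.comp_add a).gradNorm_sq, h.gradNorm_sq, integral_add_right_eq_self (fun x => ‖G x‖ ^ 2) a]

theorem H1Pair.sixth_comp_add (h : H1Pair u G) (a : Space) :
    lpNorm (fun x => u (x + a)) 6 volume ^ 6 = lpNorm u 6 volume ^ 6 := by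
  rw [(h.comp_add a).sixth_eq, h.sixth_eq, integral_add_right_eq_self (fun x => ‖u x‖ ^ 6) a]

theorem H1Pair.nonlin_comp_add (h : H1Pair u G) (a : Space) (l₁ l₂ : ℝ) :
    nonlin l₁ l₂ (fun x => u (x + a)) = nonlin l₁ l₂ u := by
  have e : dipoleInt (fun x => u (x + a)) = dipoleInt u := by
    unfold dipoleInt
    have e2 : ∀ x, dipoleConv (fun y => ‖u (y + a)‖ ^ 2) x = dipoleConv (fun y => ‖u y‖ ^ 2) (x + a) :=
      fun x => dipoleConv_comp_add (fun y => ‖u y‖ ^ 2) a x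
    simp only [e2]
    rw [integral_add_right_eq_self (fun x => dipoleConv (fun y => ‖u y‖ ^ 2) x * ‖u x‖ ^ 2) a]
  unfold nonlin
  rw [e, lpNorm_four_pow (h.comp_add a).memLp.1, lpNorm_four_pow h.memLp.1,
    integral_add_right_eq_self (fun x => ‖u x‖ ^ 4) a]

theorem energy_eq (l₁ l₂ : ℝ) (u : Space → ℂ) : energy l₁ l₂ u
    = gradNorm u ^ 2 / 2 + lpNorm u 6 volume ^ 6 / 6 - nonlin l₁ l₂ u / 4 := by
  unfold energy nonlin; ring

theorem virial_eq (l₁ l₂ : ℝ) (u : Space → ℂ) : virial l₁ l₂ u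
    = gradNorm u ^ 2 + lpNorm u 6 volume ^ 6 - 3 / 4 * nonlin l₁ l₂ u := by
  unfold virial nonlin; ring

theorem H1Pair.energy_comp_add (h : H1Pair u G) (a : Space) (l₁ l₂ : ℝ) :
    energy l₁ l₂ (fun x => u (x + a)) = energy l₁ l₂ u := by
  rw [energy_eq, energy_eq, h.gradNorm_comp_add, h.sixth_comp_add, h.nonlin_comp_add]

/-- All functionals of `c u(·/s)`. -/
theorem MemH1.exists_scale {u : Space → ℂ} (hu : MemH1 u) {c s : ℝ} (hc : 0 ≤ c) (hs : 0 < s) (l₁ l₂ : ℝ) :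
    ∃ v, MemH1 v ∧ mass v = c ^ 2 * s ^ 3 * mass u ∧ gradNorm v ^ 2 = c ^ 2 * s * gradNorm u ^ 2 ∧
      lpNorm v 6 volume ^ 6 = c ^ 6 * s ^ 3 * lpNorm u 6 volume ^ 6 ∧
      nonlin l₁ l₂ v = c ^ 4 * s ^ 3 * nonlin l₁ l₂ u := by
  have h := hu.h1Pair
  have h1 := h.dilate hs
  have hn : ‖(c : ℂ)‖ = c := by rw [Complex.norm_real, Real.norm_of_nonneg hc]
  refine ⟨_, (h1.const_mul c).memH1, ?_, ?_, ?_, ?_⟩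
  · rw [h1.mass_const_mul, h.mass_dilate hs, hn]; ring
  · rw [h1.gradNorm_const_mul, h.gradNorm_dilate hs, hn]; ring
  · rw [h1.sixth_const_mul, h.sixth_dilate hs, hn]; ring
  · rw [h1.nonlin_const_mul, h.nonlin_dilate hs, hn]; ring

/-! ### Basic inequalities -/

theorem gradNorm_nonneg (u : Space → ℂ) : 0 ≤ gradNorm u := lpNorm_nonneg

theorem mass_nonneg (u : Space → ℂ) : 0 ≤ mass u := sq_nonneg _

theorem H1Pair.nonlin_le (h : H1Pair u G) (l₁ l₂ : ℝ) :
    |nonlin l₁ l₂ u| ≤ ‖interOp l₁ l₂‖ * ∫ x, ‖u x‖ ^ 4 := by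
  rw [h.nonlin_eq, ← norm_sqLp_sq h.memLp_four]
  calc _ ≤ ‖interOp l₁ l₂ (sqLp h.memLp_four)‖ * ‖sqLp h.memLp_four‖ := abs_real_inner_le_norm _ _
    _ ≤ ‖interOp l₁ l₂‖ * ‖sqLp h.memLp_four‖ * ‖sqLp h.memLp_four‖ := by
        gcongr; exact ContinuousLinearMap.le_opNorm _ _
    _ = _ := by ring

theorem H1Pair.ae_eq_zero_of_mass (h : H1Pair u G) (h0 : mass u = 0) : u =ᵐ[volume] 0 := by
  rw [h.mass_eq, integral_eq_zero_iff_of_nonneg (fun x => by positivity) h.integrable_sq] at h0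
  filter_upwards [h0] with x hx
  simpa using hx

end Scaling

/-! ### Nonvanishing -/

theorem H1Pair.eLpNorm_translate_sub_le' {u : Space → ℂ} {G : Space → EuclideanSpace ℂ (Fin 3)}
    (h : H1Pair u G) (y : Space) :
    eLpNorm (fun x => u (x + y) - u x) 2 volume ≤ ENNReal.ofReal (3 * ‖y‖) * ENNReal.ofReal (gradNorm u) := by
  refine (h.eLpNorm_translate_sub_le y).trans ?_
  have e : ENNReal.ofReal (gradNorm u) = eLpNorm G 2 volume := by
    rw [h.gradNorm_eq, ← toReal_eLpNorm h.grad_memLp.1, ENNReal.ofReal_toReal h.grad_memLp.2.ne]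
  rw [e]
  refine eLpNorm_le_mul_eLpNorm_of_ae_le_mul (Eventually.of_forall fun x => ?_) 2
  calc ‖∑ i, (y i : ℝ) • G x i‖ ≤ ∑ i : Fin 3, ‖y‖ * ‖G x‖ := by
        refine (norm_sum_le _ _).trans (Finset.sum_le_sum fun i _ => ?_)
        rw [norm_smul]
        exact mul_le_mul (abs_coord_le y i) (PiLp.norm_apply_le (G x) i) (norm_nonneg _) (norm_nonneg _)
    _ = 3 * ‖y‖ * ‖G x‖ := by
        simp; ring

theorem H1Pair.eLpNorm_mollify_sub_le_gradNorm {u : Space → ℂ} {G : Space → EuclideanSpace ℂ (Fin 3)}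
    (h : H1Pair u G) {ρ : Space → ℝ} (hρ : IsMollifier ρ) {ε : ℝ} (hε : ∀ x, ρ x ≠ 0 → ‖x‖ < ε) :
    eLpNorm (fun x => mollify ρ u x - u x) 2 volume
      ≤ ENNReal.ofReal (3 * ε) * ENNReal.ofReal (gradNorm u) := by
  refine eLpNorm_mollify_sub_le hρ h.memLp fun y hy => ?_
  have := h.eLpNorm_translate_sub_le' (-y)
  simp only [← sub_eq_add_neg, norm_neg] at this
  refine this.trans ?_
  gcongr
  exact (hε y hy).le


theorem H1Pair.integral_mollify_sub_sq_le {u : Space → ℂ} {G : Space → EuclideanSpace ℂ (Fin 3)}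
    (h : H1Pair u G) {ρ : Space → ℝ} (hρ : IsMollifier ρ) {ε : ℝ} (hε0 : 0 ≤ ε)
    (hε : ∀ x, ρ x ≠ 0 → ‖x‖ < ε) :
    MemLp (fun x => mollify ρ u x - u x) 2 volume ∧
      ∫ x, ‖mollify ρ u x - u x‖ ^ 2 ≤ 9 * ε ^ 2 * gradNorm u ^ 2 := by
  have h1 := h.eLpNorm_mollify_sub_le_gradNorm hρ hε
  have hm : AEStronglyMeasurable (fun x => mollify ρ u x - u x) volume :=
    (contDiff_mollify hρ.toIsTest h.locInt).continuous.aestronglyMeasurable.sub h.memLp.1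
  refine ⟨⟨hm, h1.trans_lt (by finiteness)⟩, ?_⟩
  have h2 := ENNReal.toReal_mono (by finiteness) h1
  rw [toReal_eLpNorm hm, ENNReal.toReal_mul, ENNReal.toReal_ofReal (by positivity),
    ENNReal.toReal_ofReal (gradNorm_nonneg u)] at h2
  rw [← lpNorm_two_sq hm]
  calc _ ≤ (3 * ε * gradNorm u) ^ 2 := by gcongr; exact lpNorm_nonneg
    _ = _ := by ring

/-- If `|ρ ∗ u| ≤ η` everywhere, then `|u|⁴ ≤ |u|³ |u - ρ ∗ u| + η |u|³`. The radius `ε` is chosen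
so that the first term integrates to at most `c/4`, by Cauchy-Schwarz and the gradient bound, and
`η` so that the second does; but `∫ |u|⁴ ≥ c`. -/
theorem exists_mollify_ge {B c : ℝ} (hB : 0 ≤ B) (hc : 0 < c) : ∃ (ρ : Space → ℝ) (η : ℝ), IsMollifier ρ ∧ 0 < η ∧
    ∀ u G, H1Pair u G → mass u ≤ B → gradNorm u ^ 2 ≤ B → c ≤ ∫ x, ‖u x‖ ^ 4 →
      ∃ x, η < ‖mollify ρ u x‖ := by
  obtain ⟨S, hS0, hS⟩ := exists_sobolev_const
  set D : ℝ := S ^ 6 * B ^ 3 with hD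
  have hD0 : 0 ≤ D := by positivity
  set ε : ℝ := c / (12 * (√(D * B) + 1)) with hεdef
  have hε0 : 0 < ε := by positivity
  obtain ⟨ρ, hρ, hρε⟩ := exists_isMollifier hε0
  refine ⟨ρ, c / (4 * (B + √(B * D) + 1)), hρ, by positivity, fun u G h hM hA h4 => ?_⟩
  by_contra! hcon
  set η := c / (4 * (B + √(B * D) + 1)) with hη
  have hη0 : 0 < η := by positivity
  have h6 : ∫ x, ‖u x‖ ^ 6 ≤ D := by
    rw [← h.sixth_eq]
    calc lpNorm u 6 volume ^ 6 ≤ (S * gradNorm u) ^ 6 := by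
          gcongr
          · exact lpNorm_nonneg
          · exact (hS u G h).2
      _ = S ^ 6 * (gradNorm u ^ 2) ^ 3 := by ring
      _ ≤ _ := by rw [hD]; gcongr
  have h2 : ∫ x, ‖u x‖ ^ 2 ≤ B := h.mass_eq ▸ hM
  have hX : ∫ x, ‖u x‖ ^ 4 ≤ √(B * D) := by
    refine Real.le_sqrt_of_sq_le (h.four_sq_le.trans ?_)
    gcongr
  obtain ⟨hm, hmol⟩ := h.integral_mollify_sub_sq_le hρ hε0.le hρε
  have h3 : MemLp (fun x => ‖u x‖ ^ 3) 2 volume := by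
    refine (memLp_two_iff_integrable_sq (h.memLp.1.norm.pow 3)).2 ?_
    simpa [← pow_mul] using h.integrable_six
  have hCS := integral_mul_sq_le h3 hm.norm
  simp only [← pow_mul] at hCS
  have hT1 : ∫ x, ‖u x‖ ^ 3 * ‖mollify ρ u x - u x‖ ≤ c / 4 := by
    have : (∫ x, ‖u x‖ ^ 3 * ‖mollify ρ u x - u x‖) ≤ √(D * (9 * ε ^ 2 * B)) := by
      refine Real.le_sqrt_of_sq_le (hCS.trans ?_)
      refine mul_le_mul h6 (hmol.trans ?_) (integral_nonneg fun x => by positivity) hD0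
      gcongr
    refine this.trans ?_
    rw [show D * (9 * ε ^ 2 * B) = (D * B) * (3 * ε) ^ 2 by ring, Real.sqrt_mul (by positivity),
      Real.sqrt_sq (by positivity)]
    calc √(D * B) * (3 * ε) ≤ (√(D * B) + 1) * (3 * ε) := by gcongr; linarith
      _ = c / 4 := by rw [hεdef]; field_simp; norm_num
  have hi1 : Integrable (fun x => ‖u x‖ ^ 3 * ‖mollify ρ u x - u x‖) volume := h3.integrable_mul hm.norm
  have hi2 : Integrable (fun x => η * (‖u x‖ ^ 2 + ‖u x‖ ^ 4)) volume :=
    (h.integrable_sq.add h.integrable_four).const_mul η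
  have hle : ∫ x, ‖u x‖ ^ 4 ≤ ∫ x, (‖u x‖ ^ 3 * ‖mollify ρ u x - u x‖ + η * (‖u x‖ ^ 2 + ‖u x‖ ^ 4)) := by
    refine integral_mono h.integrable_four (hi1.add hi2) fun x => ?_
    simp only
    have a1 : ‖u x‖ ≤ ‖mollify ρ u x - u x‖ + ‖mollify ρ u x‖ := by
      have := norm_sub_le (mollify ρ u x) (mollify ρ u x - u x)
      rw [sub_sub_cancel] at this
      linarith
    have a2 := hcon x
    have a3 : 0 ≤ ‖u x‖ := norm_nonneg _
    have a4 : ‖u x‖ ^ 3 ≤ ‖u x‖ ^ 2 + ‖u x‖ ^ 4 := by nlinarith [sq_nonneg (‖u x‖ * (‖u x‖ - 1)), sq_nonneg (‖u x‖)]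
    calc ‖u x‖ ^ 4 = ‖u x‖ ^ 3 * ‖u x‖ := by ring
      _ ≤ ‖u x‖ ^ 3 * (‖mollify ρ u x - u x‖ + η) := by gcongr; linarith
      _ = ‖u x‖ ^ 3 * ‖mollify ρ u x - u x‖ + η * ‖u x‖ ^ 3 := by ring
      _ ≤ _ := by gcongr
  rw [integral_add hi1 hi2, integral_const_mul, integral_add h.integrable_sq h.integrable_four] at hle
  have hlast : η * ((∫ x, ‖u x‖ ^ 2) + ∫ x, ‖u x‖ ^ 4) ≤ c / 4 := by
    calc _ ≤ η * (B + √(B * D) + 1) := mul_le_mul_of_nonneg_left (by linarith) hη0.le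
      _ = c / 4 := by rw [hη]; field_simp
  linarith

/-! ### Weak limits -/

/-- Weak convergence in `L²`, tested against `L²` functions. -/
def WeakTendsto {E : Type*} [NormedAddCommGroup E] [InnerProductSpace ℂ E] (f : ℕ → Space → E) (g : Space → E) : Prop :=
  ∀ k : Space → E, MemLp k 2 volume →
    Tendsto (fun n => ∫ x, inner ℂ (f n x) (k x)) atTop (𝓝 (∫ x, inner ℂ (g x) (k x)))

theorem inner_toLp_complex {E : Type*} [NormedAddCommGroup E] [InnerProductSpace ℂ E] {f g : Space → E}
    (hf : MemLp f 2 volume) (hg : MemLp g 2 volume) :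
    inner ℂ (hf.toLp f) (hg.toLp g) = ∫ x, inner ℂ (f x) (g x) := by
  rw [L2.inner_def]
  refine integral_congr_ae ?_
  filter_upwards [hf.coeFn_toLp, hg.coeFn_toLp] with x h1 h2
  rw [h1, h2]

theorem exists_subseq_weakTendsto {E : Type*} [NormedAddCommGroup E] [InnerProductSpace ℂ E] [CompleteSpace E]
    [TopologicalSpace.SeparableSpace (Lp E 2 (volume : Measure Space))]
    {f : ℕ → Space → E} (hf : ∀ n, MemLp (f n) 2 volume) {B : ℝ} (hB : ∀ n, ∫ x, ‖f n x‖ ^ 2 ≤ B) :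
    ∃ g, MemLp g 2 volume ∧ ∃ φ : ℕ → ℕ, StrictMono φ ∧ WeakTendsto (fun n => f (φ n)) g := by
  obtain ⟨a, φ, hφ, h⟩ := exists_subseq_tendsto_inner (fun n => (hf n).toLp (f n)) (√B) fun n =>
    Real.le_sqrt_of_sq_le (by rw [norm_toLp_sq]; exact hB n)
  refine ⟨a, Lp.memLp a, φ, hφ, fun k hk => ?_⟩
  have := h (hk.toLp k)
  simp only [inner_toLp_complex] at this
  rw [← inner_toLp_complex (Lp.memLp a) hk, Lp.toLp_coeFn]
  exact this

theorem WeakTendsto.comp {E : Type*} [NormedAddCommGroup E] [InnerProductSpace ℂ E] {f : ℕ → Space → E}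
    {g : Space → E} (h : WeakTendsto f g) {φ : ℕ → ℕ} (hφ : StrictMono φ) : WeakTendsto (fun n => f (φ n)) g :=
  fun k hk => (h k hk).comp hφ.tendsto_atTop

theorem WeakTendsto.integral_smul {f : ℕ → Space → ℂ} {g : Space → ℂ} (h : WeakTendsto f g)
    {ψ : Space → ℝ} (hψ : IsTest ψ) :
    Tendsto (fun n => ∫ x, ψ x • f n x) atTop (𝓝 (∫ x, ψ x • g x)) := by
  have hk : MemLp (fun x => (ψ x : ℂ)) 2 volume := hψ.memLpR.ofReal
  have e : ∀ f : Space → ℂ, (starRingEnd ℂ) (∫ x, inner ℂ (f x) ((ψ x : ℝ) : ℂ)) = ∫ x, ψ x • f x := fun f => by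
    rw [← integral_conj]
    refine integral_congr_ae (Eventually.of_forall fun x => ?_)
    simp
  have := (Complex.continuous_conj.tendsto _).comp (h _ hk)
  simpa only [Function.comp_def, e] using this

theorem WeakTendsto.comp_coord {f : ℕ → Space → EuclideanSpace ℂ (Fin 3)} {g : Space → EuclideanSpace ℂ (Fin 3)}
    (h : WeakTendsto f g) (i : Fin 3) : WeakTendsto (fun n x => f n x i) (fun x => g x i) := by
  intro k hk
  have := h (fun x => EuclideanSpace.single i (k x)) (memLp_euclidean_iff.2 fun j => by
    rcases eq_or_ne j i with rfl | hj
    · simpa using hk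
    · simp [hj])
  simpa only [EuclideanSpace.inner_single_right] using! this

theorem WeakTendsto.h1Pair {u : ℕ → Space → ℂ} {G : ℕ → Space → EuclideanSpace ℂ (Fin 3)}
    (h : ∀ n, H1Pair (u n) (G n)) {v : Space → ℂ} {H : Space → EuclideanSpace ℂ (Fin 3)}
    (hv : MemLp v 2 volume) (hH : MemLp H 2 volume) (hu : WeakTendsto u v) (hG : WeakTendsto G H) : H1Pair v H := by
  refine ⟨hv, hH, fun φ h1 h2 i => ?_⟩
  have hφ : IsTest φ := ⟨h1, h2⟩
  refine tendsto_nhds_unique (hu.integral_smul (hφ.partialDeriv i)) ?_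
  have := ((hG.comp_coord i).integral_smul hφ).neg
  refine this.congr fun n => ?_
  exact ((h n).weak φ h1 h2 i).symm

/-- Expand the square in the Hilbert space: only the cross term depends on `n`, and it converges
weakly. -/
theorem WeakTendsto.tendsto_norm_sq_sub {E : Type*} [NormedAddCommGroup E] [InnerProductSpace ℂ E]
    {f : ℕ → Space → E} {g : Space → E} (hf : ∀ n, MemLp (f n) 2 volume) (hg : MemLp g 2 volume) (h : WeakTendsto f g) :
    Tendsto (fun n => (∫ x, ‖f n x‖ ^ 2) - ∫ x, ‖f n x - g x‖ ^ 2) atTop (𝓝 (∫ x, ‖g x‖ ^ 2)) := by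
  have h1 := (Complex.continuous_re.tendsto _).comp (h g hg)
  have e : ∀ n, (∫ x, ‖f n x‖ ^ 2) - ∫ x, ‖f n x - g x‖ ^ 2
      = 2 * (∫ x, inner ℂ (f n x) (g x)).re - ∫ x, ‖g x‖ ^ 2 := fun n => by
    have a := norm_sub_sq (𝕜 := ℂ) ((hf n).toLp (f n)) (hg.toLp g)
    rw [inner_toLp_complex, ← MemLp.toLp_sub, norm_toLp_sq, norm_toLp_sq, norm_toLp_sq] at a
    simp only [Pi.sub_apply, RCLike.re_eq_complex_re] at a
    linarith
  have e2 : (∫ x, inner ℂ (g x) (g x)).re = ∫ x, ‖g x‖ ^ 2 := by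
    rw [← inner_toLp_complex hg hg, ← norm_toLp_sq hg, ← RCLike.re_eq_complex_re, inner_self_eq_norm_sq]
  simp only [e]
  have := (h1.const_mul 2).sub_const (∫ x, ‖g x‖ ^ 2)
  rw [e2] at this
  simpa [two_mul] using this

/-! ### Local strong convergence -/

/-- A positive bounded weight in `L²`. -/
def decayWeight (x : Space) : ℝ := (1 + ‖x‖) ^ (-2 : ℝ)

theorem decayWeight_pos (x : Space) : 0 < decayWeight x := Real.rpow_pos_of_pos (by positivity) _

theorem decayWeight_le_one (x : Space) : decayWeight x ≤ 1 :=
  Real.rpow_le_one_of_one_le_of_nonpos (by linarith [norm_nonneg x]) (by norm_num)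

theorem continuous_decayWeight : Continuous decayWeight :=
  Continuous.rpow_const (by fun_prop) fun x => Or.inl (by positivity)

theorem memLp_decayWeight : MemLp decayWeight 2 volume := by
  refine (memLp_two_iff_integrable_sq continuous_decayWeight.aestronglyMeasurable).2 ?_
  have := integrable_one_add_norm (E := Space) (μ := volume) (r := 4) (by simp; norm_num)
  refine this.congr (Eventually.of_forall fun x => ?_)
  simp only [decayWeight]
  rw [← Real.rpow_natCast, ← Real.rpow_mul (by positivity)]
  norm_num

theorem norm_mollify_le {ρ : Space → ℝ} (hρ : IsTest ρ) {u : Space → ℂ} (hu : MemLp u 2 volume) (x : Space) :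
    ‖mollify ρ u x‖ ≤ √(∫ y, ρ y ^ 2) * √(∫ y, ‖u y‖ ^ 2) := by
  have hk := hρ.comp_sub_left x
  rw [mollify_eq, ← Real.sqrt_mul (integral_nonneg fun y => by positivity)]
  refine (norm_integral_le_integral_norm _).trans (Real.le_sqrt_of_sq_le ?_)
  have := integral_mul_sq_le hk.memLpR.norm hu.norm
  simp only [Real.norm_eq_abs, sq_abs] at this
  simp only [norm_smul, Real.norm_eq_abs]
  rwa [integral_sub_left_eq_self (fun y => ρ y ^ 2) volume x] at this

/-- A Rellich argument. Mollifications of `e n` tend to zero pointwise and boundedly, and are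
uniformly `L²`-close to `e n` by the gradient bound. The square integrable weight replaces the
restriction to balls, so a single extraction covers the whole space. -/
theorem exists_subseq_ae_tendsto_zero {e : ℕ → Space → ℂ} {G : ℕ → Space → EuclideanSpace ℂ (Fin 3)}
    (h : ∀ n, H1Pair (e n) (G n)) {K : ℝ} (hM : ∀ n, ∫ x, ‖e n x‖ ^ 2 ≤ K) (hA : ∀ n, gradNorm (e n) ≤ K)
    (hw : WeakTendsto e fun _ => 0) :
    ∃ φ : ℕ → ℕ, StrictMono φ ∧ ∀ᵐ x, Tendsto (fun n => e (φ n) x) atTop (𝓝 0) := by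
  have hK : 0 ≤ K := (gradNorm_nonneg _).trans (hA 0)
  have hme : ∀ n, AEStronglyMeasurable (fun x => decayWeight x • e n x) volume := fun n =>
    continuous_decayWeight.aestronglyMeasurable.smul (h n).memLp.1
  have key : Tendsto (fun n => eLpNorm (fun x => decayWeight x • e n x) 2 volume) atTop (𝓝 0) := by
    rw [ENNReal.tendsto_nhds_zero]
    intro δ hδ
    obtain ⟨δ', hδ', hδδ⟩ : ∃ δ' : ℝ, 0 < δ' ∧ ENNReal.ofReal δ' ≤ δ / 2 := by
      rcases eq_or_ne δ ⊤ with rfl | ht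
      · exact ⟨1, one_pos, by simp [ENNReal.top_div]⟩
      · refine ⟨(δ / 2).toReal, ENNReal.toReal_pos (by simpa using hδ.ne') (by finiteness), ?_⟩
        rw [ENNReal.ofReal_toReal (by finiteness)]
    have hε : 0 < δ' / (3 * (K + 1)) := by positivity
    obtain ⟨ρ, hρ, hρε⟩ := exists_isMollifier hε
    have t1 : Tendsto (fun n => eLpNorm (fun x => decayWeight x • mollify ρ (e n) x) 2 volume) atTop (𝓝 0) := by
      refine tendsto_eLpNorm_of_dominated (b := fun x => (√(∫ y, ρ y ^ 2) * √K) * decayWeight x)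
        (by norm_num) (by norm_num) (fun n => ?_) (memLp_decayWeight.const_mul _)
        (fun n => Eventually.of_forall fun x => ?_) (Eventually.of_forall fun x => ?_)
      · exact continuous_decayWeight.aestronglyMeasurable.smul
          (contDiff_mollify hρ.toIsTest (h n).locInt).continuous.aestronglyMeasurable
      · rw [norm_smul, Real.norm_of_nonneg (decayWeight_pos x).le, mul_comm]
        refine mul_le_mul_of_nonneg_right ((norm_mollify_le hρ.toIsTest (h n).memLp x).trans ?_) (decayWeight_pos x).le
        gcongr
        exact hM n
      · have := hw.integral_smul (hρ.toIsTest.comp_sub_left x)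
        simp only [smul_zero, integral_zero] at this
        simp only [mollify_eq]
        simpa using this.const_smul (decayWeight x)
    filter_upwards [(ENNReal.tendsto_nhds_zero.1 t1) (δ / 2) (ENNReal.half_pos hδ.ne')] with n hn
    have e1 : (fun x => decayWeight x • e n x) = fun x => decayWeight x • mollify ρ (e n) x
        - decayWeight x • (mollify ρ (e n) x - e n x) := by
      funext x; rw [smul_sub]; abel
    have m1 : AEStronglyMeasurable (fun x => decayWeight x • mollify ρ (e n) x) volume :=
      continuous_decayWeight.aestronglyMeasurable.smul
          (contDiff_mollify hρ.toIsTest (h n).locInt).continuous.aestronglyMeasurable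
    have m2 : AEStronglyMeasurable (fun x => decayWeight x • (mollify ρ (e n) x - e n x)) volume :=
      continuous_decayWeight.aestronglyMeasurable.smul
          ((contDiff_mollify hρ.toIsTest (h n).locInt).continuous.aestronglyMeasurable.sub (h n).memLp.1)
    rw [e1]
    refine (eLpNorm_sub_le m1 m2 (by norm_num)).trans ?_
    rw [← ENNReal.add_halves δ]
    refine add_le_add hn ?_
    calc eLpNorm (fun x => decayWeight x • (mollify ρ (e n) x - e n x)) 2 volume
        ≤ eLpNorm (fun x => mollify ρ (e n) x - e n x) 2 volume := by
          refine eLpNorm_mono fun x => ?_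
          rw [norm_smul, Real.norm_of_nonneg (decayWeight_pos x).le]
          exact mul_le_of_le_one_left (norm_nonneg _) (decayWeight_le_one x)
      _ ≤ _ := (h n).eLpNorm_mollify_sub_le_gradNorm hρ hρε
      _ ≤ ENNReal.ofReal δ' := by
          rw [← ENNReal.ofReal_mul (by positivity)]
          refine ENNReal.ofReal_le_ofReal ?_
          calc 3 * (δ' / (3 * (K + 1))) * gradNorm (e n) ≤ 3 * (δ' / (3 * (K + 1))) * (K + 1) := by
                gcongr; linarith [hA n]
            _ = δ' := by field_simp
      _ ≤ δ / 2 := hδδ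
  have hm := tendstoInMeasure_of_tendsto_eLpNorm (p := 2) (g := fun _ => (0 : ℂ)) (by norm_num) hme
    aestronglyMeasurable_const (by simpa [Pi.sub_def] using key)
  obtain ⟨φ, hφ, hae⟩ := hm.exists_seq_tendsto_ae
  refine ⟨φ, hφ, hae.mono fun x hx => ?_⟩
  have := hx.const_smul (decayWeight x)⁻¹
  simpa [smul_smul, (decayWeight_pos x).ne'] using this

/-! ### The Brezis–Lieb lemma -/

/-- The core of Brezis-Lieb: `min (X n) (K Z)` is handled by dominated convergence, and the excess
of `X n` over it is at most `ε Y n`, with uniformly small integral. -/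
theorem tendsto_integral_of_le_add {X Y : ℕ → Space → ℝ} {Z : Space → ℝ} {B : ℝ}
    (hX0 : ∀ n x, 0 ≤ X n x) (hX : ∀ n, AEStronglyMeasurable (X n) volume)
    (hY0 : ∀ n x, 0 ≤ Y n x) (hY : ∀ n, Integrable (Y n) volume) (hYB : ∀ n, ∫ x, Y n x ≤ B)
    (hZ0 : ∀ x, 0 ≤ Z x) (hZ : Integrable Z volume)
    (hlim : ∀ᵐ x, Tendsto (fun n => X n x) atTop (𝓝 0))
    (hle : ∀ ε : ℝ, 0 < ε → ∃ K : ℝ, 0 ≤ K ∧ ∀ n x, X n x ≤ ε * Y n x + K * Z x) :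
    Tendsto (fun n => ∫ x, X n x) atTop (𝓝 0) := by
  have hB : 0 ≤ B := (integral_nonneg (hY0 0)).trans (hYB 0)
  rw [Metric.tendsto_atTop]
  intro δ hδ
  obtain ⟨K, hK, hle⟩ := hle (δ / (2 * (B + 1))) (by positivity)
  have t : Tendsto (fun n => ∫ x, min (X n x) (K * Z x)) atTop (𝓝 (∫ _ : Space, (0 : ℝ))) := by
    refine tendsto_integral_of_dominated_convergence (fun x => K * Z x)
      (fun n => (hX n).inf (hZ.1.const_mul K)) (hZ.const_mul K) (fun n => Eventually.of_forall fun x => ?_) ?_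
    · rw [Real.norm_of_nonneg (le_min (hX0 n x) (mul_nonneg hK (hZ0 x)))]
      exact min_le_right _ _
    · filter_upwards [hlim] with x hx
      refine squeeze_zero (fun n => le_min (hX0 n x) (mul_nonneg hK (hZ0 x))) (fun n => min_le_left _ _) hx
  rw [integral_zero] at t
  obtain ⟨N, hN⟩ := (Metric.tendsto_atTop.1 t) (δ / 2) (by positivity)
  refine ⟨N, fun n hn => ?_⟩
  have h1 := hN n hn
  rw [Real.dist_eq, sub_zero] at h1 ⊢
  rw [abs_of_nonneg (integral_nonneg (hX0 n))]
  have hi : Integrable (fun x => min (X n x) (K * Z x)) volume := by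
    refine (hZ.const_mul K).mono' ((hX n).inf (hZ.1.const_mul K)) (Eventually.of_forall fun x => ?_)
    rw [Real.norm_of_nonneg (le_min (hX0 n x) (mul_nonneg hK (hZ0 x)))]
    exact min_le_right _ _
  calc ∫ x, X n x ≤ ∫ x, (δ / (2 * (B + 1)) * Y n x + min (X n x) (K * Z x)) := by
        refine integral_mono_of_nonneg (Eventually.of_forall (hX0 n)) (((hY n).const_mul _).add hi)
          (Eventually.of_forall fun x => ?_)
        simp only
        rcases min_cases (X n x) (K * Z x) with ⟨h, -⟩ | ⟨h, -⟩
        · rw [h]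
          have := mul_nonneg (by positivity : 0 ≤ δ / (2 * (B + 1))) (hY0 n x)
          linarith
        · rw [h]; exact hle n x
    _ = δ / (2 * (B + 1)) * (∫ x, Y n x) + ∫ x, min (X n x) (K * Z x) := by
        rw [integral_add ((hY n).const_mul _) hi, integral_const_mul]
    _ < δ / 2 + δ / 2 := by
        refine add_lt_add_of_le_of_lt ?_ ((le_abs_self _).trans_lt h1)
        calc δ / (2 * (B + 1)) * (∫ x, Y n x) ≤ δ / (2 * (B + 1)) * (B + 1) := by
              gcongr; linarith [hYB n]
          _ = δ / 2 := by field_simp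
    _ = δ := by ring

/-- Young's inequality in the form needed for the splitting of powers. -/
theorem mul_le_eps_add (s t : ℝ) {ε : ℝ} (hε : 0 < ε) :
    s * t ≤ ε * s ^ 2 + ε⁻¹ * t ^ 2 := by
  have : ε * s ^ 2 + ε⁻¹ * t ^ 2 - s * t = ε * (s - t / (2 * ε)) ^ 2 + 3 / 4 * (ε⁻¹ * t ^ 2) := by
    field_simp; ring
  have h2 : 0 ≤ ε * (s - t / (2 * ε)) ^ 2 + 3 / 4 * (ε⁻¹ * t ^ 2) := by positivity
  linarith

theorem mul_pow_five_le {s t ε : ℝ} (hs : 0 ≤ s) (ht : 0 ≤ t) (hε : 0 < ε) (hε1 : ε ≤ 1) :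
    s ^ 5 * t + s * t ^ 5 ≤ 2 * ε * s ^ 6 + 2 * (ε⁻¹) ^ 5 * t ^ 6 := by
  have hi : 1 ≤ ε⁻¹ := (one_le_inv₀ hε).2 hε1
  have b1 : s ^ 5 * t ≤ ε * s ^ 6 + (ε⁻¹) ^ 5 * t ^ 6 := by
    rcases le_total t (ε * s) with h | h
    · calc s ^ 5 * t ≤ s ^ 5 * (ε * s) := by gcongr
        _ = ε * s ^ 6 := by ring
        _ ≤ _ := by linarith [show 0 ≤ (ε⁻¹) ^ 5 * t ^ 6 by positivity]
    · have : s ≤ ε⁻¹ * t := by rwa [inv_mul_eq_div, le_div_iff₀ hε, mul_comm]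
      calc s ^ 5 * t ≤ (ε⁻¹ * t) ^ 5 * t := by gcongr
        _ = (ε⁻¹) ^ 5 * t ^ 6 := by ring
        _ ≤ _ := by linarith [show 0 ≤ ε * s ^ 6 by positivity]
  have b2 : s * t ^ 5 ≤ ε * s ^ 6 + (ε⁻¹) ^ 5 * t ^ 6 := by
    rcases le_total t (ε * s) with h | h
    · calc s * t ^ 5 ≤ s * (ε * s) ^ 5 := by gcongr
        _ = ε ^ 5 * s ^ 6 := by ring
        _ ≤ ε ^ 1 * s ^ 6 := mul_le_mul_of_nonneg_right (pow_le_pow_of_le_one hε.le hε1 (by norm_num)) (by positivity)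
        _ ≤ _ := by rw [pow_one]; linarith [show 0 ≤ (ε⁻¹) ^ 5 * t ^ 6 by positivity]
    · have : s ≤ ε⁻¹ * t := by rwa [inv_mul_eq_div, le_div_iff₀ hε, mul_comm]
      calc s * t ^ 5 ≤ (ε⁻¹ * t) * t ^ 5 := by gcongr
        _ = (ε⁻¹) ^ 1 * t ^ 6 := by ring
        _ ≤ (ε⁻¹) ^ 5 * t ^ 6 := mul_le_mul_of_nonneg_right (pow_le_pow_right₀ hi (by norm_num)) (by positivity)
        _ ≤ _ := by linarith [show 0 ≤ ε * s ^ 6 by positivity]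
  linarith

/-- The constant `62 = 2⁶ - 2` is the sum of the inner binomial coefficients of `(s + t)⁶`, and
every inner monomial is at most `s⁵t + st⁵`. -/
theorem abs_norm_add_pow_six_sub_le (e v : ℂ) :
    |‖e + v‖ ^ 6 - ‖e‖ ^ 6 - ‖v‖ ^ 6| ≤ 62 * (‖e‖ ^ 5 * ‖v‖ + ‖e‖ * ‖v‖ ^ 5) := by
  have hs := norm_nonneg e
  have ht := norm_nonneg v
  have h1 := norm_add_le e v
  have h2 : |‖e‖ - ‖v‖| ≤ ‖e + v‖ := by
    have := abs_norm_sub_norm_le e (-v)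
    simpa using this
  set s := ‖e‖
  set t := ‖v‖
  set r := ‖e + v‖ with hr
  have hr0 : 0 ≤ r := norm_nonneg _
  have m1 : s ^ 4 * t ^ 2 ≤ s ^ 5 * t + s * t ^ 5 := by
    rcases le_total s t with h | h
    · calc s ^ 4 * t ^ 2 = s * (s ^ 3 * t ^ 2) := by ring
        _ ≤ s * (t ^ 3 * t ^ 2) := by gcongr
        _ = s * t ^ 5 := by ring
        _ ≤ _ := by linarith [show 0 ≤ s ^ 5 * t by positivity]
    · calc s ^ 4 * t ^ 2 = s ^ 4 * t * t := by ring
        _ ≤ s ^ 4 * t * s := by gcongr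
        _ = s ^ 5 * t := by ring
        _ ≤ _ := by linarith [show 0 ≤ s * t ^ 5 by positivity]
  have m2 : s ^ 2 * t ^ 4 ≤ s ^ 5 * t + s * t ^ 5 := by
    rcases le_total s t with h | h
    · calc s ^ 2 * t ^ 4 = s * s * t ^ 4 := by ring
        _ ≤ s * t * t ^ 4 := by gcongr
        _ = s * t ^ 5 := by ring
        _ ≤ _ := by linarith [show 0 ≤ s ^ 5 * t by positivity]
    · calc s ^ 2 * t ^ 4 = s ^ 2 * t ^ 3 * t := by ring
        _ ≤ s ^ 2 * s ^ 3 * t := by gcongr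
        _ = s ^ 5 * t := by ring
        _ ≤ _ := by linarith [show 0 ≤ s * t ^ 5 by positivity]
  have m3 : s ^ 3 * t ^ 3 ≤ s ^ 5 * t + s * t ^ 5 := by
    have : 2 * (s ^ 3 * t ^ 3) ≤ s ^ 4 * t ^ 2 + s ^ 2 * t ^ 4 := by
      have := mul_nonneg (sq_nonneg (s * t)) (sq_nonneg (s - t))
      nlinarith
    linarith
  have up : r ^ 6 ≤ (s + t) ^ 6 := by gcongr
  have lo : (s - t) ^ 6 ≤ r ^ 6 := by
    have : |s - t| ^ 6 ≤ r ^ 6 := by gcongr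
    rwa [Even.pow_abs (by decide)] at this
  have p1 : 0 ≤ s ^ 5 * t := by positivity
  have p2 : 0 ≤ s * t ^ 5 := by positivity
  have p3 : 0 ≤ s ^ 4 * t ^ 2 := by positivity
  have p4 : 0 ≤ s ^ 2 * t ^ 4 := by positivity
  rw [abs_le]
  constructor
  · nlinarith
  · nlinarith

/-! ### Profile extraction -/

theorem WeakTendsto.sub_const {E : Type*} [NormedAddCommGroup E] [InnerProductSpace ℂ E]
    {f : ℕ → Space → E} {g : Space → E} (hf : ∀ n, MemLp (f n) 2 volume) (hg : MemLp g 2 volume)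
    (h : WeakTendsto f g) : WeakTendsto (fun n x => f n x - g x) (fun _ => 0) := by
  intro k hk
  have e : ∀ n, ∫ x, inner ℂ (f n x - g x) (k x) = (∫ x, inner ℂ (f n x) (k x)) - ∫ x, inner ℂ (g x) (k x) := fun n => by
    rw [← inner_toLp_complex (hf n) hk, ← inner_toLp_complex hg hk, ← inner_sub_left, ← MemLp.toLp_sub,
      inner_toLp_complex ((hf n).sub hg) hk]
    rfl
  simp only [e, inner_zero_left, integral_zero]
  simpa using (h k hk).sub_const (∫ x, inner ℂ (g x) (k x))

theorem integral_norm_sub_sq_le {E : Type*} [NormedAddCommGroup E]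
    {f g : Space → E} (hf : MemLp f 2 volume) (hg : MemLp g 2 volume) :
    ∫ x, ‖f x - g x‖ ^ 2 ≤ 2 * (∫ x, ‖f x‖ ^ 2) + 2 * ∫ x, ‖g x‖ ^ 2 := by
  have i1 : Integrable (fun x => ‖f x‖ ^ 2) volume :=
    MemLp.integrable_pow (n := 2) (by simpa using hf) (by norm_num)
  have i2 : Integrable (fun x => ‖g x‖ ^ 2) volume :=
    MemLp.integrable_pow (n := 2) (by simpa using hg) (by norm_num)
  rw [← integral_const_mul, ← integral_const_mul, ← integral_add (i1.const_mul 2) (i2.const_mul 2)]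
  refine integral_mono_of_nonneg (Eventually.of_forall fun x => by positivity)
    ((i1.const_mul 2).add (i2.const_mul 2)) (Eventually.of_forall fun x => ?_)
  simp only
  have := norm_sub_le (f x) (g x)
  calc ‖f x - g x‖ ^ 2 ≤ (‖f x‖ + ‖g x‖) ^ 2 := by gcongr
    _ ≤ _ := by nlinarith [sq_nonneg (‖f x‖ - ‖g x‖)]

theorem H1Pair.four_le {u : Space → ℂ} {G : Space → EuclideanSpace ℂ (Fin 3)} (h : H1Pair u G) :
    ∫ x, ‖u x‖ ^ 4 ≤ (∫ x, ‖u x‖ ^ 2) + ∫ x, ‖u x‖ ^ 6 := by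
  rw [← integral_add h.integrable_sq h.integrable_six]
  refine integral_mono h.integrable_four (h.integrable_sq.add h.integrable_six) fun x => ?_
  simp only
  nlinarith [mul_nonneg (sq_nonneg ‖u x‖) (sq_nonneg (‖u x‖ ^ 2 - 1)), sq_nonneg (‖u x‖)]

/-- Every cross term contains the vanishing vector `r n` against a bounded one, except `2⟨S g, h
n⟩`, which tends to zero by assumption. -/
theorem tendsto_quadratic_split {E : Type*} [NormedAddCommGroup E] [InnerProductSpace ℝ E] (S : E →L[ℝ] E)
    (hS : ∀ x y, inner ℝ (S x) y = inner ℝ x (S y)) {g : E} {h r : ℕ → E} {K : ℝ} (hh : ∀ n, ‖h n‖ ≤ K)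
    (tr : Tendsto (fun n => ‖r n‖) atTop (𝓝 0)) (tgh : Tendsto (fun n => inner ℝ (S g) (h n)) atTop (𝓝 0)) :
    Tendsto (fun n => inner ℝ (S (h n + g + r n)) (h n + g + r n) - inner ℝ (S (h n)) (h n)) atTop
      (𝓝 (inner ℝ (S g) g)) := by
  have thr : Tendsto (fun n => inner ℝ (S (h n)) (r n)) atTop (𝓝 0) := by
    refine squeeze_zero_norm (fun n => ?_) (by simpa using tr.const_mul (‖S‖ * K))
    calc _ ≤ ‖S (h n)‖ * ‖r n‖ := norm_inner_le_norm _ _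
      _ ≤ (‖S‖ * K) * ‖r n‖ := by
        gcongr
        exact (S.le_opNorm _).trans (by gcongr; exact hh n)
  have tgr : Tendsto (fun n => inner ℝ (S g) (r n)) atTop (𝓝 0) :=
    squeeze_zero_norm (fun n => norm_inner_le_norm _ _) (by simpa using tr.const_mul ‖S g‖)
  have trr : Tendsto (fun n => inner ℝ (S (r n)) (r n)) atTop (𝓝 0) := by
    refine squeeze_zero_norm (fun n => ?_) (by simpa using (tr.mul tr).const_mul ‖S‖)
    calc _ ≤ ‖S (r n)‖ * ‖r n‖ := norm_inner_le_norm _ _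
      _ ≤ ‖S‖ * ‖r n‖ * ‖r n‖ := by gcongr; exact S.le_opNorm _
      _ = _ := by ring
  have e : ∀ n, inner ℝ (S (h n + g + r n)) (h n + g + r n) - inner ℝ (S (h n)) (h n)
      = inner ℝ (S g) g + (2 * inner ℝ (S g) (h n) + 2 * inner ℝ (S (h n)) (r n)
        + 2 * inner ℝ (S g) (r n) + inner ℝ (S (r n)) (r n)) := fun n => by
    have s : ∀ x y, inner ℝ (S x) y = inner ℝ (S y) x := fun x y => by rw [hS, real_inner_comm]
    simp only [map_add, inner_add_left, inner_add_right]
    rw [s (r n) (h n), s (r n) g, s (h n) g]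
    ring
  simp only [e]
  have := ((((tgh.const_mul 2).add (thr.const_mul 2)).add (tgr.const_mul 2)).add trr).const_add (inner ℝ (S g) g)
  simpa using this

section Splitting

variable {U : ℕ → Space → ℂ} {G : ℕ → Space → EuclideanSpace ℂ (Fin 3)} {v : Space → ℂ}
  {H : Space → EuclideanSpace ℂ (Fin 3)} {K : ℝ}

theorem tendsto_sixth_split (hU : ∀ n, H1Pair (U n) (G n)) (hv : H1Pair v H)
    (hK : ∀ n, ∫ x, ‖U n x - v x‖ ^ 6 ≤ K)
    (hae : ∀ᵐ x, Tendsto (fun n => U n x - v x) atTop (𝓝 0)) :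
    Tendsto (fun n => (∫ x, ‖U n x‖ ^ 6) - ∫ x, ‖U n x - v x‖ ^ 6) atTop (𝓝 (∫ x, ‖v x‖ ^ 6)) := by
  have he := fun n => (hU n).sub hv
  have hme := fun n => (he n).memLp.1.norm
  have hmv := hv.memLp.1.norm
  have t := tendsto_integral_of_le_add
    (X := fun n x => ‖U n x - v x‖ ^ 5 * ‖v x‖ + ‖U n x - v x‖ * ‖v x‖ ^ 5)
    (Y := fun n x => ‖U n x - v x‖ ^ 6) (Z := fun x => ‖v x‖ ^ 6) (B := K)
    (fun n x => by positivity) (fun n => (((hme n).pow 5).mul hmv).add ((hme n).mul (hmv.pow 5)))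
    (fun n x => by positivity) (fun n => (he n).integrable_six) hK (fun x => by positivity)
    hv.integrable_six (hae.mono fun x hx => by
      have h1 : Tendsto (fun n => ‖U n x - v x‖) atTop (𝓝 0) := by simpa using hx.norm
      have := ((h1.pow 5).mul_const ‖v x‖).add (h1.mul_const (‖v x‖ ^ 5))
      simpa using this)
    (fun ε hε => by
      have hε' : 0 < min (ε / 2) 1 := by positivity
      refine ⟨2 * ((min (ε / 2) 1)⁻¹) ^ 5, by positivity, fun n x => ?_⟩
      refine (mul_pow_five_le (norm_nonneg _) (norm_nonneg _) hε' (min_le_right _ _)).trans ?_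
      have : 2 * min (ε / 2) 1 ≤ ε := by linarith [min_le_left (ε / 2) 1]
      gcongr)
  have t2 : Tendsto (fun n => (∫ x, ‖U n x‖ ^ 6) - (∫ x, ‖U n x - v x‖ ^ 6) - ∫ x, ‖v x‖ ^ 6) atTop (𝓝 0) := by
    refine squeeze_zero_norm (fun n => ?_) (by simpa using t.const_mul 62)
    have hi : Integrable (fun x => ‖U n x‖ ^ 6 - ‖U n x - v x‖ ^ 6) volume :=
      (hU n).integrable_six.sub (he n).integrable_six
    rw [← integral_sub (hU n).integrable_six (he n).integrable_six,
      ← integral_sub hi hv.integrable_six, ← integral_const_mul]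
    refine norm_integral_le_of_norm_le ?_ (Eventually.of_forall fun x => ?_)
    · have hi : Integrable (fun x => 2 * 1 * ‖U n x - v x‖ ^ 6 + 2 * ((1 : ℝ)⁻¹) ^ 5 * ‖v x‖ ^ 6) volume :=
        ((he n).integrable_six.const_mul _).add (hv.integrable_six.const_mul _)
      refine (hi.mono' ((((hme n).pow 5).mul hmv).add ((hme n).mul (hmv.pow 5)))
        (Eventually.of_forall fun x => ?_)).const_mul 62
      have hx := mul_pow_five_le (norm_nonneg (U n x - v x)) (norm_nonneg (v x)) one_pos le_rfl
      refine le_trans (le_of_eq (Real.norm_of_nonneg ?_)) hx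
      simp only [Pi.add_apply, Pi.mul_apply, Pi.pow_apply]
      positivity
    · have := abs_norm_add_pow_six_sub_le (U n x - v x) (v x)
      rw [sub_add_cancel] at this
      exact this
  have t3 := t2.add_const (∫ x, ‖v x‖ ^ 6)
  simp only [sub_add_cancel, zero_add] at t3
  exact t3

/-- With `e = U - v`, the remainder `|U|² - |e|² - |v|²` is twice the real inner product of `e` and
`v`, so its `L²` norm is governed by `∫ |e|² |v|²`. -/
theorem tendsto_norm_sqLp_remainder (hU : ∀ n, H1Pair (U n) (G n)) (hv : H1Pair v H)
    (he : ∀ n, MemLp (fun x => U n x - v x) 4 volume)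
    (hK : ∀ n, ∫ x, ‖U n x - v x‖ ^ 4 ≤ K)
    (hae : ∀ᵐ x, Tendsto (fun n => U n x - v x) atTop (𝓝 0)) :
    Tendsto (fun n => ‖sqLp (hU n).memLp_four - sqLp (he n) - sqLp hv.memLp_four‖) atTop (𝓝 0) := by
  have hme := fun n => (he n).1.norm
  have hmv := hv.memLp.1.norm
  have t1 := tendsto_integral_of_le_add
    (X := fun n x => ‖U n x - v x‖ ^ 2 * ‖v x‖ ^ 2)
    (Y := fun n x => ‖U n x - v x‖ ^ 4) (Z := fun x => ‖v x‖ ^ 4) (B := K)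
    (fun n x => by positivity) (fun n => ((hme n).pow 2).mul (hmv.pow 2))
    (fun n x => by positivity) (fun n => integrable_four (he n)) hK (fun x => by positivity)
    hv.integrable_four (hae.mono fun x hx => by simpa using (hx.norm.pow 2).mul_const (‖v x‖ ^ 2))
    (fun ε hε => ⟨ε⁻¹, by positivity, fun n x => by
      have := mul_le_eps_add (‖U n x - v x‖ ^ 2) (‖v x‖ ^ 2) hε
      simpa only [← pow_mul] using this⟩)
  have h2 : Tendsto (fun n => ‖sqLp (hU n).memLp_four - sqLp (he n) - sqLp hv.memLp_four‖ ^ 2) atTop (𝓝 0) := by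
    refine squeeze_zero (fun n => sq_nonneg _) (fun n => ?_) (by simpa using t1.const_mul 4)
    have e : sqLp (hU n).memLp_four - sqLp (he n) - sqLp hv.memLp_four
        = (((memLp_norm_sq (hU n).memLp_four).sub (memLp_norm_sq (he n))).sub
          (memLp_norm_sq hv.memLp_four)).toLp _ := rfl
    rw [e, norm_toLp_sq, ← integral_const_mul]
    refine integral_mono_of_nonneg (Eventually.of_forall fun x => by positivity)
      (((memLp_norm_sq (he n)).integrable_mul (memLp_norm_sq hv.memLp_four)).const_mul 4)
      (Eventually.of_forall fun x => ?_)
    simp only [Pi.sub_apply, Real.norm_eq_abs, sq_abs]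
    have e1 : ‖U n x‖ ^ 2 - ‖U n x - v x‖ ^ 2 - ‖v x‖ ^ 2 = 2 * inner ℝ (U n x - v x) (v x) := by
      have := norm_add_sq_real (U n x - v x) (v x)
      rw [sub_add_cancel] at this
      linarith
    rw [e1]
    have := abs_real_inner_le_norm (U n x - v x) (v x)
    calc (2 * inner ℝ (U n x - v x) (v x)) ^ 2 = 4 * |inner ℝ (U n x - v x) (v x)| ^ 2 := by
          rw [sq_abs]; ring
      _ ≤ 4 * (‖U n x - v x‖ * ‖v x‖) ^ 2 := by gcongr
      _ = 4 * (‖U n x - v x‖ ^ 2 * ‖v x‖ ^ 2) := by rw [mul_pow]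
  simpa [Real.sqrt_sq (norm_nonneg _)] using h2.sqrt

theorem tendsto_integral_mul_norm_sq {e : ℕ → Space → ℂ} (he : ∀ n, MemLp (e n) 4 volume)
    (hK : ∀ n, ∫ x, ‖e n x‖ ^ 4 ≤ K)
    (hae : ∀ᵐ x, Tendsto (fun n => e n x) atTop (𝓝 0)) {k : Space → ℝ} (hk : MemLp k 2 volume) :
    Tendsto (fun n => ∫ x, ‖e n x‖ ^ 2 * |k x|) atTop (𝓝 0) := by
  have hki : Integrable (fun x => |k x| ^ 2) volume := by
    simpa only [sq_abs] using hk.integrable_sq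
  have hka : AEStronglyMeasurable (fun x => |k x|) volume := hk.1.norm
  refine tendsto_integral_of_le_add
    (X := fun n x => ‖e n x‖ ^ 2 * |k x|)
    (Y := fun n x => ‖e n x‖ ^ 4) (Z := fun x => |k x| ^ 2) (B := K)
    (fun n x => by positivity) (fun n => ((he n).1.norm.pow 2).mul hka)
    (fun n x => by positivity) (fun n => integrable_four (he n)) hK (fun x => by positivity)
    hki (hae.mono fun x hx => by simpa using (hx.norm.pow 2).mul_const |k x|)
    (fun ε hε => ⟨ε⁻¹, by positivity, fun n x => ?_⟩)
  have := mul_le_eps_add (‖e n x‖ ^ 2) |k x| hε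
  simpa only [← pow_mul] using this

/-- Bounded in `L²` and tending to zero almost everywhere, the densities `|e n|²` tend weakly to
zero. -/
theorem tendsto_inner_sqLp {e : ℕ → Space → ℂ} (he : ∀ n, MemLp (e n) 4 volume)
    (hK : ∀ n, ∫ x, ‖e n x‖ ^ 4 ≤ K)
    (hae : ∀ᵐ x, Tendsto (fun n => e n x) atTop (𝓝 0)) (k : L2R) :
    Tendsto (fun n => inner ℝ k (sqLp (he n))) atTop (𝓝 0) := by
  have t2 := tendsto_integral_mul_norm_sq he hK hae (Lp.memLp k)
  have e1 : ∀ n, inner ℝ k (sqLp (he n)) = ∫ x, k x * ‖e n x‖ ^ 2 :=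
    fun n => inner_toLp_right k (memLp_norm_sq (he n))
  refine squeeze_zero_norm (fun n => ?_) t2
  rw [e1]
  refine (norm_integral_le_integral_norm _).trans (le_of_eq (integral_congr_ae
    (Eventually.of_forall fun x => ?_)))
  show ‖k x * ‖e n x‖ ^ 2‖ = _
  rw [norm_mul, Real.norm_of_nonneg (sq_nonneg ‖e n x‖), Real.norm_eq_abs, mul_comm]

/-- The nonlocality is harmless: `|U|² = |U - v|² + |v|² + o(1)` in `L²`, and the remaining cross
term is the fixed vector `S|v|²` against a weakly null sequence. -/
theorem tendsto_nonlin_split (hU : ∀ n, H1Pair (U n) (G n)) (hv : H1Pair v H)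
    (hK : ∀ n, ∫ x, ‖U n x - v x‖ ^ 4 ≤ K)
    (hae : ∀ᵐ x, Tendsto (fun n => U n x - v x) atTop (𝓝 0)) (l₁ l₂ : ℝ) :
    Tendsto (fun n => nonlin l₁ l₂ (U n) - nonlin l₁ l₂ (fun x => U n x - v x)) atTop
      (𝓝 (nonlin l₁ l₂ v)) := by
  have he := fun n => (hU n).sub hv
  have he4 : ∀ n, MemLp (fun x => U n x - v x) 4 volume := fun n => (he n).memLp_four
  have t := tendsto_quadratic_split (interOp l₁ l₂) (inner_interOp_symm l₁ l₂) (g := sqLp hv.memLp_four)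
    (h := fun n => sqLp (he4 n))
    (r := fun n => sqLp (hU n).memLp_four - sqLp (he4 n) - sqLp hv.memLp_four) (K := √K)
    (fun n => Real.le_sqrt_of_sq_le (by rw [norm_sqLp_sq]; exact hK n))
    (tendsto_norm_sqLp_remainder hU hv he4 hK hae) (tendsto_inner_sqLp he4 hK hae _)
  rw [hv.nonlin_eq]
  refine t.congr fun n => ?_
  rw [(hU n).nonlin_eq, (he n).nonlin_eq]
  have e1 : ∀ a b c : L2R, b + c + (a - b - c) = a := fun a b c => by abel
  rw [e1]

end Splitting

/-- Translating by the points where a mollification is bounded below prevents vanishing. The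
remainder `e` is the translated function minus its weak limit; mass and gradient split by weak
convergence, the other two terms by Brezis-Lieb arguments. -/
theorem exists_profile (l₁ l₂ : ℝ) {u : ℕ → Space → ℂ} (hu : ∀ n, MemH1 (u n)) {B c : ℝ} (hc : 0 < c)
    (hM : ∀ n, mass (u n) ≤ B) (hA : ∀ n, gradNorm (u n) ^ 2 ≤ B) (h4 : ∀ n, c ≤ ∫ x, ‖u n x‖ ^ 4) :
    ∃ (φ : ℕ → ℕ) (v : Space → ℂ) (e : ℕ → Space → ℂ), StrictMono φ ∧ MemH1 v ∧ 0 < mass v ∧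
      (∀ n, MemH1 (e n)) ∧
      Tendsto (fun n => mass (u (φ n)) - mass (e n)) atTop (𝓝 (mass v)) ∧
      Tendsto (fun n => energy l₁ l₂ (u (φ n)) - energy l₁ l₂ (e n)) atTop (𝓝 (energy l₁ l₂ v)) := by
  have hB : 0 ≤ B := (mass_nonneg _).trans (hM 0)
  obtain ⟨ρ, η, hρ, hη, hge⟩ := exists_mollify_ge hB hc
  choose a ha using fun n => hge _ _ (hu n).h1Pair (hM n) (hA n) (h4 n)
  have hp := fun n => (hu n).h1Pair.comp_add (a n)
  obtain ⟨v, hv, φ₁, hφ₁, hw₁⟩ := exists_subseq_weakTendsto (fun n => (hp n).memLp) (B := B) fun n => by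
    rw [← (hp n).mass_eq, (hu n).h1Pair.mass_comp_add]; exact hM n
  obtain ⟨H, hH, φ₂, hφ₂, hw₂⟩ := exists_subseq_weakTendsto (fun n => (hp (φ₁ n)).grad_memLp) (B := B) fun n => by
    rw [← (hp (φ₁ n)).gradNorm_sq, (hu _).h1Pair.gradNorm_comp_add]; exact hA _
  have hw₁' := hw₁.comp hφ₂
  have hvH : H1Pair v H := WeakTendsto.h1Pair (fun n => hp (φ₁ (φ₂ n))) hv hH hw₁' hw₂
  obtain ⟨S, hS0, hS⟩ := exists_sobolev_const
  have he := fun n => (hp (φ₁ (φ₂ n))).sub hvH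
  set K₀ : ℝ := 2 * B + 2 * ∫ x, ‖v x‖ ^ 2 with hK₀
  set K₁ : ℝ := 2 * B + 2 * ∫ x, ‖H x‖ ^ 2 with hK₁
  have hb0 : ∀ n, ∫ x, ‖u (φ₁ (φ₂ n)) (x + a (φ₁ (φ₂ n))) - v x‖ ^ 2 ≤ K₀ := fun n => by
    refine (integral_norm_sub_sq_le (hp _).memLp hv).trans ?_
    rw [← (hp _).mass_eq, (hu _).h1Pair.mass_comp_add]
    linarith [hM (φ₁ (φ₂ n))]
  have hb1 : ∀ n, gradNorm (fun x => u (φ₁ (φ₂ n)) (x + a (φ₁ (φ₂ n))) - v x) ^ 2 ≤ K₁ := fun n => by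
    rw [(he n).gradNorm_sq]
    refine (integral_norm_sub_sq_le (hp _).grad_memLp hH).trans ?_
    rw [← (hp _).gradNorm_sq, (hu _).h1Pair.gradNorm_comp_add]
    linarith [hA (φ₁ (φ₂ n))]
  have hb1' : ∀ n, gradNorm (fun x => u (φ₁ (φ₂ n)) (x + a (φ₁ (φ₂ n))) - v x) ≤ √K₁ := fun n =>
    Real.le_sqrt_of_sq_le (hb1 n)
  have hb6 : ∀ n, ∫ x, ‖u (φ₁ (φ₂ n)) (x + a (φ₁ (φ₂ n))) - v x‖ ^ 6 ≤ (S * √K₁) ^ 6 := fun n => by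
    rw [← (he n).sixth_eq]
    have h1 := (hS _ _ (he n)).2
    have h2 : S * gradNorm (fun x => u (φ₁ (φ₂ n)) (x + a (φ₁ (φ₂ n))) - v x) ≤ S * √K₁ := by
      gcongr; exact hb1' n
    exact pow_le_pow_left₀ lpNorm_nonneg (h1.trans h2) 6
  have hb4 : ∀ n, ∫ x, ‖u (φ₁ (φ₂ n)) (x + a (φ₁ (φ₂ n))) - v x‖ ^ 4 ≤ K₀ + (S * √K₁) ^ 6 := fun n =>
    (he n).four_le.trans (add_le_add (hb0 n) (hb6 n))
  obtain ⟨φ₃, hφ₃, hae⟩ := exists_subseq_ae_tendsto_zero he (K := max K₀ (√K₁))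
    (fun n => (hb0 n).trans (le_max_left _ _)) (fun n => (hb1' n).trans (le_max_right _ _))
    (WeakTendsto.sub_const (fun n => (hp (φ₁ (φ₂ n))).memLp) hv hw₁')
  have t6 := tendsto_sixth_split (fun n => hp (φ₁ (φ₂ (φ₃ n)))) hvH (fun n => hb6 (φ₃ n)) hae
  have tN := tendsto_nonlin_split (fun n => hp (φ₁ (φ₂ (φ₃ n)))) hvH (fun n => hb4 (φ₃ n)) hae l₁ l₂
  have tM := (hw₁'.comp hφ₃).tendsto_norm_sq_sub (fun n => (hp (φ₁ (φ₂ (φ₃ n)))).memLp) hv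
  have tA := (hw₂.comp hφ₃).tendsto_norm_sq_sub (fun n => (hp (φ₁ (φ₂ (φ₃ n)))).grad_memLp) hH
  have hmol : ∀ n, η ≤ ‖mollify ρ (fun x => u n (x + a n)) 0‖ := fun n => by
    have : mollify ρ (fun x => u n (x + a n)) 0 = mollify ρ (u n) (a n) := by
      simp only [mollify]
      refine integral_congr_ae (Eventually.of_forall fun y => ?_)
      simp only
      congr 2; abel
    rw [this]; exact (ha n).le
  -- The functional `u ↦ (ρ ∗ u)(0)` is weakly continuous, so the lower bound `η` survives in the
  -- limit.
  have hvpos : 0 < mass v := by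
    refine lt_of_le_of_ne (mass_nonneg v) fun h0 => ?_
    have hz := hvH.ae_eq_zero_of_mass h0.symm
    have t := (hw₁.integral_smul (hρ.toIsTest.comp_sub_left 0)).norm
    have h1 : η ≤ ‖∫ x, ρ (0 - x) • v x‖ := by
      refine ge_of_tendsto t (Eventually.of_forall fun n => ?_)
      have := hmol (φ₁ n)
      rwa [mollify_eq] at this
    have h2 : ∫ x, ρ (0 - x) • v x = 0 := integral_eq_zero_of_ae (hz.mono fun x hx => by simp [hx])
    rw [h2, norm_zero] at h1
    linarith
  refine ⟨fun n => φ₁ (φ₂ (φ₃ n)), v, fun n x => u (φ₁ (φ₂ (φ₃ n))) (x + a (φ₁ (φ₂ (φ₃ n)))) - v x,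
    hφ₁.comp (hφ₂.comp hφ₃), hvH.memH1, hvpos, fun n => (he (φ₃ n)).memH1, ?_, ?_⟩
  · rw [hvH.mass_eq]
    refine tM.congr fun n => ?_
    rw [(he (φ₃ n)).mass_eq, ← (hp _).mass_eq, (hu _).h1Pair.mass_comp_add]
  · have := ((tA.div_const 2).add (t6.div_const 6)).sub (tN.div_const 4)
    rw [energy_eq, hvH.gradNorm_sq, hvH.sixth_eq]
    refine this.congr fun n => ?_
    rw [← (hu (φ₁ (φ₂ (φ₃ n)))).h1Pair.energy_comp_add (a (φ₁ (φ₂ (φ₃ n)))), energy_eq, energy_eq,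
      (he (φ₃ n)).gradNorm_sq, (he (φ₃ n)).sixth_eq, (hp _).gradNorm_sq, (hp _).sixth_eq]
    ring

/-! ### First variation of the functionals along real lines -/

theorem hasDerivAt_zero_of_abs_le {f : ℝ → ℝ} {d K : ℝ}
    (h : ∀ t, |t| ≤ 1 → |f t - f 0 - t * d| ≤ t ^ 2 * K) : HasDerivAt f d 0 := by
  rw [hasDerivAt_iff_isLittleO]
  have h1 : (fun t => f t - f 0 - (t - 0) • d) =O[𝓝 0] fun t : ℝ => t ^ 2 := by
    refine Asymptotics.IsBigO.of_bound K ?_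
    filter_upwards [Metric.closedBall_mem_nhds (0 : ℝ) one_pos] with t ht
    rw [mem_closedBall_zero_iff, Real.norm_eq_abs] at ht
    simpa [mul_comm] using h t ht
  refine h1.trans_isLittleO ?_
  simpa using Asymptotics.isLittleO_pow_pow (𝕜 := ℝ) (m := 1) (n := 2) (by norm_num)

/-- Taylor expansion in the increment `y` of the squared norm, where `|y| ≤ |t| (s + r)²`. The
constant is `224 = 7 · 32`, with `32 = 2⁵` from the convexity of the sixth power. -/
theorem abs_add_pow_six_sub_le {s r q t : ℝ} (hs : 0 ≤ s) (hr : 0 ≤ r) (hq : |q| ≤ s * r) (ht : |t| ≤ 1) :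
    |(s ^ 2 + 2 * t * q + t ^ 2 * r ^ 2) ^ 3 - s ^ 6 - t * (6 * (s ^ 4 * q))|
      ≤ t ^ 2 * (224 * (s ^ 6 + r ^ 6)) := by
  set T := s + r with hT
  have hT0 : 0 ≤ T := by positivity
  set y := 2 * t * q + t ^ 2 * r ^ 2 with hy
  have ht2 : t ^ 2 ≤ |t| := by rw [← sq_abs]; nlinarith [abs_nonneg t]
  have hyb : |y| ≤ |t| * T ^ 2 := by
    calc |y| ≤ |2 * t * q| + |t ^ 2 * r ^ 2| := abs_add_le _ _
      _ = 2 * |t| * |q| + t ^ 2 * r ^ 2 := by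
        rw [abs_mul, abs_mul, abs_of_pos (by norm_num : (0 : ℝ) < 2), abs_of_nonneg (by positivity : 0 ≤ t ^ 2 * r ^ 2)]
      _ ≤ 2 * |t| * (s * r) + |t| * r ^ 2 := by gcongr
      _ ≤ |t| * T ^ 2 := by rw [hT]; nlinarith [mul_nonneg (abs_nonneg t) (sq_nonneg s)]
  have hy2 : y ^ 2 ≤ t ^ 2 * T ^ 4 := by
    calc y ^ 2 = |y| ^ 2 := (sq_abs y).symm
      _ ≤ (|t| * T ^ 2) ^ 2 := by gcongr
      _ = t ^ 2 * T ^ 4 := by rw [mul_pow, sq_abs]; ring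
  have hy3 : |y ^ 3| ≤ t ^ 2 * T ^ 6 := by
    calc |y ^ 3| = y ^ 2 * |y| := by rw [abs_pow, ← sq_abs y]; ring
      _ ≤ (t ^ 2 * T ^ 4) * (1 * T ^ 2) := by
        gcongr
        exact hyb.trans (by gcongr)
      _ = _ := by ring
  have hsT : s ≤ T := by linarith
  have hrT : r ≤ T := by linarith
  have e : (s ^ 2 + 2 * t * q + t ^ 2 * r ^ 2) ^ 3 - s ^ 6 - t * (6 * (s ^ 4 * q))
      = t ^ 2 * (3 * s ^ 4 * r ^ 2) + 3 * s ^ 2 * y ^ 2 + y ^ 3 := by rw [hy]; ring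
  have h6 : T ^ 6 ≤ 32 * (s ^ 6 + r ^ 6) := by
    have := add_pow_le hs hr 6
    norm_num at this
    exact this
  rw [e]
  calc _ ≤ |t ^ 2 * (3 * s ^ 4 * r ^ 2)| + |3 * s ^ 2 * y ^ 2| + |y ^ 3| := abs_add_three _ _ _
    _ ≤ t ^ 2 * (3 * T ^ 4 * T ^ 2) + 3 * T ^ 2 * (t ^ 2 * T ^ 4) + t ^ 2 * T ^ 6 := by
      rw [abs_of_nonneg (by positivity : 0 ≤ t ^ 2 * (3 * s ^ 4 * r ^ 2)),
        abs_of_nonneg (by positivity : 0 ≤ 3 * s ^ 2 * y ^ 2)]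
      gcongr
    _ = t ^ 2 * (7 * T ^ 6) := by ring
    _ ≤ t ^ 2 * (7 * (32 * (s ^ 6 + r ^ 6))) := by gcongr
    _ = _ := by ring

theorem integral_quadratic {f g k : Space → ℝ} (hf : Integrable f volume) (hg : Integrable g volume)
    (hk : Integrable k volume) (t : ℝ) :
    ∫ x, (f x + 2 * t * g x + t ^ 2 * k x) = (∫ x, f x) + 2 * t * (∫ x, g x) + t ^ 2 * ∫ x, k x := by
  have h1 : Integrable (fun x => f x + 2 * t * g x) volume := hf.add (hg.const_mul _)
  rw [integral_add h1 (hk.const_mul _), integral_add hf (hg.const_mul _), integral_const_mul,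
    integral_const_mul]

section Variation

variable {u w : Space → ℂ} {G Φ : Space → EuclideanSpace ℂ (Fin 3)}

theorem H1Pair.line (h : H1Pair u G) (h' : H1Pair w Φ) (t : ℝ) :
    H1Pair (fun x => u x + (t : ℂ) * w x) (fun x => G x + (t : ℂ) • Φ x) :=
  h.add (h'.const_mul t)

theorem norm_add_mul_sq (a b : ℂ) (t : ℝ) :
    ‖a + (t : ℂ) * b‖ ^ 2 = ‖a‖ ^ 2 + 2 * t * inner ℝ a b + t ^ 2 * ‖b‖ ^ 2 := by
  have e : (t : ℂ) * b = t • b := by rw [Complex.real_smul]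
  rw [e, norm_add_sq_real, inner_smul_right, norm_smul, mul_pow, Real.norm_eq_abs, sq_abs]
  ring

theorem H1Pair.memLp_inner (h : H1Pair u G) (h' : H1Pair w Φ) :
    MemLp (fun x => inner ℝ (u x) (w x)) 2 volume := by
  refine ((memLp_norm_sq h.memLp_four).add (memLp_norm_sq h'.memLp_four)).mono'
    (h.memLp.1.inner h'.memLp.1) (Eventually.of_forall fun x => ?_)
  have := abs_real_inner_le_norm (u x) (w x)
  simp only [Pi.add_apply, Real.norm_eq_abs]
  nlinarith [sq_nonneg (‖u x‖ - ‖w x‖), sq_nonneg ‖u x‖, sq_nonneg ‖w x‖]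

theorem H1Pair.integrable_inner (h : H1Pair u G) (h' : H1Pair w Φ) :
    Integrable (fun x => inner ℝ (u x) (w x)) volume := by
  refine (h.integrable_sq.add h'.integrable_sq).mono'
    (h.memLp.1.inner h'.memLp.1) (Eventually.of_forall fun x => ?_)
  have := abs_real_inner_le_norm (u x) (w x)
  simp only [Pi.add_apply, Real.norm_eq_abs]
  nlinarith [sq_nonneg (‖u x‖ - ‖w x‖), sq_nonneg ‖u x‖, sq_nonneg ‖w x‖]

theorem H1Pair.integrable_four_mul_inner (h : H1Pair u G) (h' : H1Pair w Φ) :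
    Integrable (fun x => ‖u x‖ ^ 4 * inner ℝ (u x) (w x)) volume := by
  refine (h.integrable_six.add h'.integrable_six).mono'
    ((h.memLp.1.norm.pow 4).mul (h.memLp.1.inner h'.memLp.1)) (Eventually.of_forall fun x => ?_)
  have h1 := abs_real_inner_le_norm (u x) (w x)
  simp only [Pi.add_apply, Real.norm_eq_abs]
  rw [abs_mul, abs_of_nonneg (pow_nonneg (norm_nonneg (u x)) 4)]
  have h2 : ‖u x‖ ^ 5 * ‖w x‖ ≤ ‖u x‖ ^ 6 + ‖w x‖ ^ 6 := by
    rcases le_total ‖u x‖ ‖w x‖ with hle | hle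
    · calc _ ≤ ‖w x‖ ^ 5 * ‖w x‖ := by gcongr
        _ ≤ _ := by nlinarith [pow_nonneg (norm_nonneg (u x)) 6]
    · calc _ ≤ ‖u x‖ ^ 5 * ‖u x‖ := by gcongr
        _ ≤ _ := by nlinarith [pow_nonneg (norm_nonneg (w x)) 6]
  calc _ ≤ ‖u x‖ ^ 4 * (‖u x‖ * ‖w x‖) := by gcongr
    _ = ‖u x‖ ^ 5 * ‖w x‖ := by ring
    _ ≤ _ := h2

theorem H1Pair.hasDerivAt_mass (h : H1Pair u G) (h' : H1Pair w Φ) :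
    HasDerivAt (fun t : ℝ => mass (fun x => u x + (t : ℂ) * w x)) (2 * ∫ x, inner ℝ (u x) (w x)) 0 := by
  refine hasDerivAt_zero_of_abs_le (K := mass w) fun t _ => ?_
  have e : ∀ t : ℝ, mass (fun x => u x + (t : ℂ) * w x)
      = mass u + 2 * t * (∫ x, inner ℝ (u x) (w x)) + t ^ 2 * mass w := fun t => by
    rw [(h.line h' t).mass_eq, h.mass_eq, h'.mass_eq,
      ← integral_quadratic h.integrable_sq (h.integrable_inner h') h'.integrable_sq]
    exact integral_congr_ae (Eventually.of_forall fun x => norm_add_mul_sq _ _ _)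
  rw [e, e]
  refine le_of_eq ?_
  ring_nf
  exact abs_of_nonneg (mul_nonneg (sq_nonneg t) (mass_nonneg w))

theorem H1Pair.integrable_inner_grad (h : H1Pair u G) (h' : H1Pair w Φ) :
    Integrable (fun x => (inner ℂ (G x) (Φ x)).re) volume := by
  have h1 := h.grad_memLp.integrable_norm_pow (p := 2) (by norm_num)
  have h2 := h'.grad_memLp.integrable_norm_pow (p := 2) (by norm_num)
  refine (h1.add h2).mono'
    (Complex.continuous_re.comp_aestronglyMeasurable (h.grad_memLp.1.inner h'.grad_memLp.1))
    (Eventually.of_forall fun x => ?_)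
  have := (Complex.abs_re_le_norm _).trans (norm_inner_le_norm (𝕜 := ℂ) (G x) (Φ x))
  simp only [Pi.add_apply, Real.norm_eq_abs]
  nlinarith [sq_nonneg (‖G x‖ - ‖Φ x‖), sq_nonneg ‖G x‖, sq_nonneg ‖Φ x‖]

theorem H1Pair.hasDerivAt_gradNorm_sq (h : H1Pair u G) (h' : H1Pair w Φ) :
    HasDerivAt (fun t : ℝ => gradNorm (fun x => u x + (t : ℂ) * w x) ^ 2)
      (2 * ∫ x, (inner ℂ (G x) (Φ x)).re) 0 := by
  have h1 := h.grad_memLp.integrable_norm_pow (p := 2) (by norm_num)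
  have h2 := h'.grad_memLp.integrable_norm_pow (p := 2) (by norm_num)
  refine hasDerivAt_zero_of_abs_le (K := gradNorm w ^ 2) fun t _ => ?_
  have e : ∀ t : ℝ, gradNorm (fun x => u x + (t : ℂ) * w x) ^ 2
      = gradNorm u ^ 2 + 2 * t * (∫ x, (inner ℂ (G x) (Φ x)).re) + t ^ 2 * gradNorm w ^ 2 := fun t => by
    rw [(h.line h' t).gradNorm_sq, h.gradNorm_sq, h'.gradNorm_sq,
      ← integral_quadratic h1 (h.integrable_inner_grad h') h2]
    refine integral_congr_ae (Eventually.of_forall fun x => ?_)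
    simp only
    rw [norm_add_sq (𝕜 := ℂ), inner_smul_right, norm_smul, mul_pow, Complex.norm_real, Real.norm_eq_abs, sq_abs,
      RCLike.re_eq_complex_re, Complex.re_ofReal_mul]
    ring
  rw [e, e]
  refine le_of_eq ?_
  ring_nf
  exact abs_of_nonneg (mul_nonneg (sq_nonneg t) (sq_nonneg (gradNorm w)))

theorem H1Pair.hasDerivAt_sixth (h : H1Pair u G) (h' : H1Pair w Φ) :
    HasDerivAt (fun t : ℝ => lpNorm (fun x => u x + (t : ℂ) * w x) 6 volume ^ 6)
      (6 * ∫ x, ‖u x‖ ^ 4 * inner ℝ (u x) (w x)) 0 := by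
  refine hasDerivAt_zero_of_abs_le (K := ∫ x, 224 * (‖u x‖ ^ 6 + ‖w x‖ ^ 6)) fun t ht => ?_
  have e0 : lpNorm (fun x => u x + ((0 : ℝ) : ℂ) * w x) 6 volume ^ 6 = ∫ x, ‖u x‖ ^ 6 := by
    simp only [Complex.ofReal_zero, zero_mul, add_zero]
    exact h.sixth_eq
  have hi := ((h.integrable_four_mul_inner h').const_mul 6).const_mul t
  have hd : Integrable (fun x => ‖u x + (t : ℂ) * w x‖ ^ 6 - ‖u x‖ ^ 6) volume :=
    (h.line h' t).integrable_six.sub h.integrable_six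
  rw [e0, (h.line h' t).sixth_eq, ← integral_const_mul, ← integral_const_mul,
    ← integral_sub (h.line h' t).integrable_six h.integrable_six, ← integral_sub hd hi, ← integral_const_mul]
  refine (norm_integral_le_integral_norm _).trans (integral_mono (hd.sub hi).norm
    (((h.integrable_six.add h'.integrable_six).const_mul _).const_mul _) fun x => ?_)
  have e : ‖u x + (t : ℂ) * w x‖ ^ 6
      = (‖u x‖ ^ 2 + 2 * t * inner ℝ (u x) (w x) + t ^ 2 * ‖w x‖ ^ 2) ^ 3 := by
    rw [← norm_add_mul_sq, ← pow_mul]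
  simp only [Pi.sub_apply, Pi.add_apply, Real.norm_eq_abs]
  rw [e]
  exact abs_add_pow_six_sub_le (norm_nonneg _) (norm_nonneg _) (abs_real_inner_le_norm _ _) ht

/-- The density `|u + tw|²` is a quadratic polynomial in `t` with values in `L²`, so the chain rule
for the quadratic form applies. The factor `4` is `2` from the density times `2` from symmetry. -/
theorem H1Pair.hasDerivAt_nonlin (h : H1Pair u G) (h' : H1Pair w Φ) (l₁ l₂ : ℝ) :
    HasDerivAt (fun t : ℝ => nonlin l₁ l₂ (fun x => u x + (t : ℂ) * w x))
      (4 * ∫ x, interOp l₁ l₂ (sqLp h.memLp_four) x * inner ℝ (u x) (w x)) 0 := by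
  have hq := h.memLp_inner h'
  have e : ∀ t : ℝ, sqLp (h.line h' t).memLp_four
      = sqLp h.memLp_four + (2 * t) • hq.toLp _ + t ^ 2 • sqLp h'.memLp_four := fun t => by
    rw [sqLp, sqLp, sqLp, ← MemLp.toLp_const_smul, ← MemLp.toLp_const_smul, ← MemLp.toLp_add, ← MemLp.toLp_add]
    refine MemLp.toLp_congr _ _ (Eventually.of_forall fun x => ?_)
    simp only [Pi.add_apply, Pi.smul_apply, smul_eq_mul]
    exact norm_add_mul_sq _ _ _
  have hg : HasDerivAt (fun t : ℝ => sqLp (h.line h' t).memLp_four) ((2 : ℝ) • hq.toLp _) 0 := by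
    simp only [e]
    have d1 : HasDerivAt (fun t : ℝ => 2 * t) 2 0 := by simpa using (hasDerivAt_id (0 : ℝ)).const_mul 2
    have d2 : HasDerivAt (fun t : ℝ => t ^ 2) 0 0 := by simpa using hasDerivAt_pow 2 (0 : ℝ)
    refine (((d1.smul_const (hq.toLp _)).const_add (sqLp h.memLp_four)).add
      (d2.smul_const (sqLp h'.memLp_four))).congr_deriv ?_
    rw [zero_smul, add_zero]
  have hSg := (interOp l₁ l₂).hasFDerivAt.comp_hasDerivAt (0 : ℝ) hg
  have hd := hSg.inner ℝ hg
  have e1 : (fun t : ℝ => nonlin l₁ l₂ (fun x => u x + (t : ℂ) * w x))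
      = fun t => inner ℝ ((interOp l₁ l₂ ∘ fun t : ℝ => sqLp (h.line h' t).memLp_four) t)
        (sqLp (h.line h' t).memLp_four) := funext fun t => (h.line h' t).nonlin_eq l₁ l₂
  rw [e1]
  refine hd.congr_deriv ?_
  have e0 : sqLp (h.line h' 0).memLp_four = sqLp h.memLp_four := by rw [e]; simp
  simp only [Function.comp, e0]
  rw [← inner_toLp_right _ hq]
  generalize hq.toLp _ = a
  generalize sqLp h.memLp_four = b
  rw [map_smul, inner_smul_left, inner_smul_right, inner_interOp_symm l₁ l₂ a b, real_inner_comm _ a,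
    conj_trivial]
  ring

end Variation

/-! ### Minimizers of the Weinstein functional and their Euler-Lagrange equation -/

theorem weinstein_pow_four (l₁ l₂ : ℝ) (f : Space → ℂ) : weinstein l₁ l₂ 1 f ^ 4
    = mass f ^ 2 * (gradNorm f ^ 2) ^ 3 * lpNorm f 6 volume ^ 6 / nonlin l₁ l₂ f ^ 4 := by
  have h : ∀ a : ℝ, 0 ≤ a → (a ^ (3 / 2 : ℝ)) ^ 4 = a ^ 6 := fun a ha => by
    rw [← Real.rpow_natCast, ← Real.rpow_mul ha, ← Real.rpow_natCast]
    norm_num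
  have e1 : (3 : ℝ) / (1 + 1) = 3 / 2 := by norm_num
  have e2 : (3 : ℝ) * 1 / (1 + 1) = 3 / 2 := by norm_num
  rw [weinstein, e1, e2, div_pow, mul_pow, mul_pow, h _ (gradNorm_nonneg f), h _ lpNorm_nonneg, mass]
  ring

theorem weinstein_nonneg {l₁ l₂ : ℝ} {f : Space → ℂ} (hf : 0 ≤ nonlin l₁ l₂ f) :
    0 ≤ weinstein l₁ l₂ 1 f :=
  div_nonneg (mul_nonneg (mul_nonneg lpNorm_nonneg (Real.rpow_nonneg (gradNorm_nonneg f) _))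
    (Real.rpow_nonneg lpNorm_nonneg _)) hf

section

variable {u w : Space → ℂ} {G Φ : Space → EuclideanSpace ℂ (Fin 3)} {l₁ l₂ : ℝ}

theorem H1Pair.nonlin_sq_le (h : H1Pair u G) (l₁ l₂ : ℝ) :
    nonlin l₁ l₂ u ^ 2 ≤ ‖interOp l₁ l₂‖ ^ 2 * (mass u * lpNorm u 6 volume ^ 6) := by
  rw [h.mass_eq, h.sixth_eq]
  calc nonlin l₁ l₂ u ^ 2 = |nonlin l₁ l₂ u| ^ 2 := (sq_abs _).symm
    _ ≤ (‖interOp l₁ l₂‖ * ∫ x, ‖u x‖ ^ 4) ^ 2 := by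
      gcongr; exact h.nonlin_le l₁ l₂
    _ = ‖interOp l₁ l₂‖ ^ 2 * (∫ x, ‖u x‖ ^ 4) ^ 2 := mul_pow _ _ _
    _ ≤ _ := by gcongr; exact h.four_sq_le

theorem exists_sixth_le : ∃ S : ℝ, 0 < S ∧ ∀ u, MemH1 u →
    lpNorm u 6 volume ^ 6 ≤ S * (gradNorm u ^ 2) ^ 3 := by
  obtain ⟨S, hS, h⟩ := exists_sobolev_const
  refine ⟨S ^ 6, by positivity, fun u hu => ?_⟩
  calc lpNorm u 6 volume ^ 6 ≤ (S * gradNorm u) ^ 6 :=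
        pow_le_pow_left₀ lpNorm_nonneg (h u _ hu.h1Pair).2 6
    _ = _ := by ring

/-- The bound `N² ≤ ‖S‖² M C` forces `M` and `C` to be positive; Sobolev then does so for `A`. -/
theorem MemH1.pos_of_nonlin_pos (hu : MemH1 u) (hF : 0 < nonlin l₁ l₂ u) :
    0 < mass u ∧ 0 < gradNorm u ^ 2 ∧ 0 < lpNorm u 6 volume ^ 6 := by
  have h1 := hu.h1Pair.nonlin_sq_le l₁ l₂
  have h2 : 0 < mass u * lpNorm u 6 volume ^ 6 := by
    by_contra hc
    have : 0 < nonlin l₁ l₂ u ^ 2 := by positivity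
    nlinarith [mul_nonneg (sq_nonneg ‖interOp l₁ l₂‖) (neg_nonneg.2 (not_lt.1 hc))]
  have hM : 0 < mass u := pos_of_mul_pos_left h2 (pow_nonneg lpNorm_nonneg 6)
  have hC : 0 < lpNorm u 6 volume ^ 6 := pos_of_mul_pos_right h2 hM.le
  refine ⟨hM, ?_, hC⟩
  obtain ⟨S, hS, h⟩ := exists_sixth_le
  have h3 : 0 < S * (gradNorm u ^ 2) ^ 3 := hC.trans_le (h u hu)
  have h4 := pos_of_mul_pos_right h3 hS.le
  refine (sq_nonneg (gradNorm u)).lt_of_ne' fun h0 => ?_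
  simp [h0] at h4

theorem H1Pair.euler_lagrange (h : H1Pair u G) (hF : 0 < nonlin l₁ l₂ u)
    (hmin : IsMinOn (weinstein l₁ l₂ 1) (admissible l₁ l₂) u)
    (hn : lpNorm u 6 volume ^ 6 = gradNorm u ^ 2) (h' : H1Pair w Φ) :
    (∫ x, (inner ℂ (G x) (Φ x)).re) + 2 * gradNorm u ^ 2 / (3 * mass u) * (∫ x, inner ℝ (u x) (w x))
      + (∫ x, ‖u x‖ ^ 4 * inner ℝ (u x) (w x))
      - 8 * gradNorm u ^ 2 / (3 * nonlin l₁ l₂ u)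
        * (∫ x, interOp l₁ l₂ (sqLp h.memLp_four) x * inner ℝ (u x) (w x)) = 0 := by
  obtain ⟨hM0, hA0, hC0⟩ := h.memH1.pos_of_nonlin_pos hF
  have dM := h.hasDerivAt_mass h'
  have dA := h.hasDerivAt_gradNorm_sq h'
  have dC := h.hasDerivAt_sixth h'
  have dF := h.hasDerivAt_nonlin h' l₁ l₂
  have e0 : (fun x => u x + ((0 : ℝ) : ℂ) * w x) = u := by simp
  -- The quotient is avoided: by minimality `M² A³ C - W(u)⁴ N⁴` is nonnegative along the line for
  -- small `t` and vanishes at `t = 0`.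
  have hloc : IsLocalMin (fun t : ℝ => mass (fun x => u x + (t : ℂ) * w x) ^ 2
      * (gradNorm (fun x => u x + (t : ℂ) * w x) ^ 2) ^ 3
      * lpNorm (fun x => u x + (t : ℂ) * w x) 6 volume ^ 6
      - weinstein l₁ l₂ 1 u ^ 4 * nonlin l₁ l₂ (fun x => u x + (t : ℂ) * w x) ^ 4) 0 := by
    have hpos := dF.continuousAt.eventually (lt_mem_nhds (by simpa only [e0] using hF))
    filter_upwards [hpos] with t ht
    have h0 := weinstein_pow_four l₁ l₂ u
    have ht1 := weinstein_pow_four l₁ l₂ (fun x => u x + (t : ℂ) * w x)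
    have hle : weinstein l₁ l₂ 1 u ≤ weinstein l₁ l₂ 1 (fun x => u x + (t : ℂ) * w x) :=
      hmin ⟨(h.line h' t).memH1, ht⟩
    have hle4 := pow_le_pow_left₀ (weinstein_nonneg hF.le) hle 4
    rw [ht1, le_div_iff₀ (by positivity)] at hle4
    simp only [e0]
    rw [h0] at hle4 ⊢
    rw [div_mul_cancel₀ _ (by positivity)]
    linarith
  have hd := hloc.hasDerivAt_eq_zero ((((dM.pow 2).mul (dA.pow 3)).mul dC).sub ((dF.pow 4).const_mul _))
  simp only [e0, weinstein_pow_four, Pi.mul_apply, Pi.pow_apply] at hd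
  rw [hn] at hd
  generalize (∫ x, (inner ℂ (G x) (Φ x)).re) = a at *
  generalize (∫ x, inner ℝ (u x) (w x)) = b at *
  generalize (∫ x, ‖u x‖ ^ 4 * inner ℝ (u x) (w x)) = c at *
  generalize (∫ x, interOp l₁ l₂ (sqLp h.memLp_four) x * inner ℝ (u x) (w x)) = d at *
  generalize gradNorm u ^ 2 = A at *
  generalize mass u = M at *
  generalize nonlin l₁ l₂ u = F at *
  field_simp at hd ⊢
  refine mul_left_cancel₀ (show 2 * M * A ^ 3 * F ^ 3 ≠ 0 by positivity) ?_
  push_cast at hd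
  linear_combination hd

/-- A weak solution of `-Δu + V u = 0` with a real potential `V`, in terms of the weak gradient. -/
def IsWeakPotentialSolution (V : Space → ℝ) (u : Space → ℂ) (G : Space → EuclideanSpace ℂ (Fin 3)) : Prop :=
  ∀ φ : Space → ℝ, IsTest φ →
    (∑ i : Fin 3, ∫ x, partialDeriv i φ x • G x i) + ∫ x, (φ x * V x) • u x = 0

theorem IsTest.h1Pair {φ : Space → ℝ} (hφ : IsTest φ) :
    H1Pair (fun x => (φ x : ℂ)) (fun x => WithLp.toLp 2 fun i => ((DipolarNLS.partialDeriv i φ x : ℝ) : ℂ)) := by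
  have hs : ContDiff ℝ ∞ fun x => (φ x : ℂ) := Complex.ofRealCLM.contDiff.comp hφ.1
  have hc : HasCompactSupport fun x => (φ x : ℂ) := hφ.2.comp_left (g := ((↑) : ℝ → ℂ)) Complex.ofReal_zero
  refine (h1Pair_of_contDiff hs hc).congr ae_eq_rfl (Eventually.of_forall fun x => ?_)
  have := (Complex.ofRealCLM.hasFDerivAt.comp x (hφ.differentiable x).hasFDerivAt).fderiv
  refine congrArg (WithLp.toLp 2) (funext fun i => ?_)
  rw [cpartial, show (fun x => (φ x : ℂ)) = Complex.ofRealCLM ∘ φ from rfl, this]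
  rfl

theorem H1Pair.integrable_four_smul (h : H1Pair u G) : Integrable (fun x => ‖u x‖ ^ 4 • u x) volume := by
  refine (h.integrable_four.add h.integrable_six).mono' ((h.memLp.1.norm.pow 4).smul h.memLp.1)
    (Eventually.of_forall fun x => ?_)
  rw [norm_smul, Real.norm_of_nonneg (by positivity), Pi.add_apply]
  have := norm_nonneg (u x)
  nlinarith [mul_nonneg (pow_nonneg this 4) (sq_nonneg (‖u x‖ - 1)), pow_nonneg this 4, pow_nonneg this 6]

theorem H1Pair.integrable_smul_L2 (h : H1Pair u G) {k : Space → ℝ} (hk : MemLp k 2 volume) :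
    Integrable (fun x => k x • u x) volume := by
  have := h.memLp.smul (r := 1) hk
  exact memLp_one_iff_integrable.1 this

theorem H1Pair.isWeakPotentialSolution (h : H1Pair u G) (hF : 0 < nonlin l₁ l₂ u)
    (hmin : IsMinOn (weinstein l₁ l₂ 1) (admissible l₁ l₂) u)
    (hn : lpNorm u 6 volume ^ 6 = gradNorm u ^ 2) :
    IsWeakPotentialSolution (fun x => 2 * gradNorm u ^ 2 / (3 * mass u) + ‖u x‖ ^ 4
      - 8 * gradNorm u ^ 2 / (3 * nonlin l₁ l₂ u) * interOp l₁ l₂ (sqLp h.memLp_four) x) u G := by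
  intro φ hφ
  have EL := fun c : ℂ => h.euler_lagrange hF hmin hn (hφ.h1Pair.const_mul c)
  have i1 := fun c : ℂ => h.integrable_inner (hφ.h1Pair.const_mul c)
  have i2 := fun c : ℂ => h.integrable_four_mul_inner (hφ.h1Pair.const_mul c)
  have i3 := fun c : ℂ => (Lp.memLp (interOp l₁ l₂ (sqLp h.memLp_four))).integrable_mul
    (h.memLp_inner (hφ.h1Pair.const_mul c))
  generalize 2 * gradNorm u ^ 2 / (3 * mass u) = α at *
  generalize 8 * gradNorm u ^ 2 / (3 * nonlin l₁ l₂ u) = κ at *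
  have hk := Lp.memLp (interOp l₁ l₂ (sqLp h.memLp_four))
  generalize (interOp l₁ l₂ (sqLp h.memLp_four) : Space → ℝ) = k at *
  have hG : ∀ i, Integrable (fun x => DipolarNLS.partialDeriv i φ x • G x i) volume := fun i =>
    (hφ.partialDeriv i).integrable_smul (MemLp.locInt (h.comp_memLp i))
  have hu : Integrable (fun x => (φ x * (α + ‖u x‖ ^ 4 - κ * k x)) • u x) volume := by
    have hl : LocallyIntegrable (fun x => α • u x + ‖u x‖ ^ 4 • u x - κ • k x • u x) volume :=
      ((h.locInt.smul α).add h.integrable_four_smul.locallyIntegrable).sub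
        ((h.integrable_smul_L2 hk).locallyIntegrable.smul κ)
    refine (hφ.integrable_smul hl).congr (Eventually.of_forall fun x => ?_)
    simp only [smul_smul, ← add_smul, ← sub_smul]
  set Z := (∑ i : Fin 3, ∫ x, DipolarNLS.partialDeriv i φ x • G x i)
    + ∫ x, (φ x * (α + ‖u x‖ ^ 4 - κ * k x)) • u x with hZ
  -- The variation formula contains only real inner products; testing with `c φ` for every complex
  -- `c` recovers the complex identity.
  have key : ∀ c : ℂ, inner ℝ c Z = 0 := fun c => by
    have hq : ∀ x, inner ℝ (u x) (c * (φ x : ℂ)) = φ x * inner ℝ c (u x) := fun x => by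
      rw [mul_comm c, ← Complex.real_smul, inner_smul_right, real_inner_comm]
    have hg : ∀ x, (inner ℂ (G x) (c • (WithLp.toLp 2 fun i => ((DipolarNLS.partialDeriv i φ x : ℝ) : ℂ)
        : EuclideanSpace ℂ (Fin 3)))).re = ∑ i, inner ℝ c (DipolarNLS.partialDeriv i φ x • G x i) := fun x => by
      rw [PiLp.inner_apply, Complex.re_sum]
      refine Finset.sum_congr rfl fun i _ => ?_
      simp [Complex.inner]
      ring
    rw [← EL c, hZ, inner_add_right, inner_sum, ← integral_inner hu]
    simp only [hg, ← integral_inner (hG _)]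
    rw [integral_finsetSum _ fun i _ => (hG i).const_inner c]
    have e : ∫ x, inner ℝ c ((φ x * (α + ‖u x‖ ^ 4 - κ * k x)) • u x)
        = ∫ x, (α * inner ℝ (u x) (c * (φ x : ℂ)) + ‖u x‖ ^ 4 * inner ℝ (u x) (c * (φ x : ℂ))
          - κ * (k x * inner ℝ (u x) (c * (φ x : ℂ)))) := by
      refine integral_congr_ae (Eventually.of_forall fun x => ?_)
      simp only [hq, inner_smul_right]
      ring
    have i12 : Integrable (fun x => α * inner ℝ (u x) (c * (φ x : ℂ))
        + ‖u x‖ ^ 4 * inner ℝ (u x) (c * (φ x : ℂ))) volume := ((i1 c).const_mul α).add (i2 c)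
    have i3' : Integrable (fun x => κ * (k x * inner ℝ (u x) (c * (φ x : ℂ)))) volume := (i3 c).const_mul κ
    rw [e, integral_sub i12 i3', integral_add ((i1 c).const_mul α) (i2 c), integral_const_mul, integral_const_mul]
    ring
  exact inner_self_eq_zero.1 (key Z)

end

/-! ### The interaction coefficient in the equation of an optimizer -/

theorem exists_abs_partialDeriv_partialDeriv_cutoff_le :
    ∃ B, 0 ≤ B ∧ ∀ n i x, |partialDeriv i (partialDeriv i (cutoff n)) x| ≤ B * ((n : ℝ) + 1)⁻¹ := by
  choose B hB h using fun i => exists_abs_partialDeriv_le (isTest_cutoffBump.partialDeriv i)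
  refine ⟨∑ i, B i, Finset.sum_nonneg fun i _ => hB i, fun n i x => ?_⟩
  have e : partialDeriv i (cutoff n) = fun x =>
      ((n : ℝ) + 1)⁻¹ * partialDeriv i cutoffBump (((n : ℝ) + 1)⁻¹ • x) :=
    funext (partialDeriv_cutoff n i)
  have hle : B i ≤ ∑ j, B j := Finset.single_le_sum (fun j _ => hB j) (Finset.mem_univ i)
  have ht : IsTest (fun x => partialDeriv i cutoffBump (((n : ℝ) + 1)⁻¹ • x)) :=
    (isTest_cutoffBump.partialDeriv i).comp_smul (by positivity)
  have hn : ((n : ℝ) + 1)⁻¹ ≤ 1 := inv_le_one_of_one_le₀ (by linarith [(Nat.cast_nonneg n : (0 : ℝ) ≤ n)])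
  have hn0 : 0 ≤ ((n : ℝ) + 1)⁻¹ := by positivity
  rw [e, show partialDeriv i (fun x => ((n : ℝ) + 1)⁻¹ * partialDeriv i cutoffBump (((n : ℝ) + 1)⁻¹ • x)) x
      = ((n : ℝ) + 1)⁻¹ * partialDeriv i (fun x => partialDeriv i cutoffBump (((n : ℝ) + 1)⁻¹ • x)) x from ?_,
    partialDeriv_comp_smul (isTest_cutoffBump.partialDeriv i).differentiable, abs_mul, abs_mul, abs_of_nonneg hn0]
  · have h1 := (h i i (((n : ℝ) + 1)⁻¹ • x)).trans hle
    calc _ ≤ ((n : ℝ) + 1)⁻¹ * (1 * ∑ j, B j) := by gcongr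
      _ = _ := by ring
  · rw [partialDeriv, fderiv_const_mul (ht.differentiable x)]
    rfl

variable {w : Space → ℂ} {G : Space → EuclideanSpace ℂ (Fin 3)}

/-- An integrable solution of `-Δw + V w = 0` satisfies `∫ V w = 0`. -/
theorem IsWeakPotentialSolution.integral_eq_zero {V : Space → ℝ} (hs : IsWeakPotentialSolution V w G)
    (h : H1Pair w G) (hw : Integrable w volume) (hV : Integrable (fun x => V x • w x) volume) :
    ∫ x, V x • w x = 0 := by
  obtain ⟨B, hB, hBd⟩ := exists_abs_partialDeriv_partialDeriv_cutoff_le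
  have t0 : Tendsto (fun n : ℕ => ((n : ℝ) + 1)⁻¹) atTop (𝓝 0) := by
    simpa only [one_div] using tendsto_one_div_add_atTop_nhds_zero_nat (𝕜 := ℝ)
  -- A second integration by parts puts both derivatives on the cutoff, where they are `O(1/n)`
  -- uniformly and meet the integrable `w`; the gradient of `w` is only in `L²`.
  have t1 : ∀ i, Tendsto (fun n => ∫ x, partialDeriv i (cutoff n) x • G x i) atTop (𝓝 0) := fun i => by
    have t2 : Tendsto (fun n : ℕ => B * ((n : ℝ) + 1)⁻¹ * ∫ x, ‖w x‖) atTop (𝓝 0) := by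
      simpa using (t0.const_mul B).mul_const (∫ x, ‖w x‖)
    refine squeeze_zero_norm (fun n => ?_) t2
    have e := h.weakDeriv i _ ((isTest_cutoff n).partialDeriv i)
    rw [← norm_neg, ← e, ← integral_const_mul]
    refine norm_integral_le_of_norm_le (hw.norm.const_mul _) (Eventually.of_forall fun x => ?_)
    rw [norm_smul, Real.norm_eq_abs]
    exact mul_le_mul_of_nonneg_right (hBd n i x) (norm_nonneg _)
  have t3 : Tendsto (fun n => ∫ x, (cutoff n x * V x) • w x) atTop (𝓝 (∫ x, V x • w x)) := by
    refine tendsto_integral_of_dominated_convergence (fun x => ‖V x • w x‖) (fun n => ?_) hV.norm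
      (fun n => Eventually.of_forall fun x => ?_) (Eventually.of_forall fun x => ?_)
    · simp only [mul_smul]
      exact (isTest_cutoff n).continuous.aestronglyMeasurable.smul hV.1
    · rw [mul_smul, norm_smul, Real.norm_of_nonneg (cutoff_nonneg n x)]
      exact mul_le_of_le_one_left (norm_nonneg _) (cutoff_le_one n x)
    · refine tendsto_const_nhds.congr' ?_
      filter_upwards [eventually_cutoff_eq_one x] with n hn
      rw [hn, one_mul]
  have t4 := (tendsto_finsetSum Finset.univ fun i _ => t1 i).add t3
  simp only [hs _ (isTest_cutoff _), Finset.sum_const_zero, zero_add] at t4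
  exact (tendsto_nhds_unique t4 tendsto_const_nhds).symm ▸ rfl

/-- The equation for `w = |u|` reads `-Δw + w⁵ = μw`, so `∫ (w⁵ - μw) = 0`. With `μ = k⁴`, the
expression `k⁴s² - s⁶ + k(s⁵ - k⁴s) = -s(k - s)(k⁴ - s⁴)` is nonpositive for `s ≥ 0`; integrated at
`s = w` it gives `μ‖u‖₂² ≤ ‖u‖₆⁶`, against `hA`. No regularity of `w` is required. -/
theorem H1Pair.not_isWeakPotentialSolution_of_integrable {u : Space → ℂ} (h : H1Pair (fun x => ((‖u x‖ : ℝ) : ℂ)) G)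
    (hu1 : Integrable u volume) {V : Space → ℝ}
    {μ : ℝ} (hμ : 0 ≤ μ) (hA : 0 < μ * (∫ x, ‖u x‖ ^ 2) - ∫ x, ‖u x‖ ^ 6)
    (hV : ∀ᵐ x, u x ≠ 0 → V x = ‖u x‖ ^ 4 - μ) :
    ¬ IsWeakPotentialSolution V (fun x => ((‖u x‖ : ℝ) : ℂ)) G := by
  intro hs
  have hw1 : Integrable (fun x => ((‖u x‖ : ℝ) : ℂ)) volume := hu1.norm.ofReal
  have hn : ∀ x, ‖((‖u x‖ : ℝ) : ℂ)‖ = ‖u x‖ := fun x => by simp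
  have i2 : Integrable (fun x => ‖u x‖ ^ 2) volume := by simpa only [hn] using h.integrable_sq
  have i6 : Integrable (fun x => ‖u x‖ ^ 6) volume := by simpa only [hn] using h.integrable_six
  have i5 : Integrable (fun x => ‖u x‖ ^ 5) volume := by
    refine h.integrable_four_smul.norm.congr (Eventually.of_forall fun x => ?_)
    simp only [norm_smul, hn, norm_pow, norm_norm]
    ring
  have hVw : (fun x => V x • ((‖u x‖ : ℝ) : ℂ)) =ᵐ[volume] fun x => ((‖u x‖ ^ 5 - μ * ‖u x‖ : ℝ) : ℂ) := by
    filter_upwards [hV] with x hx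
    by_cases h0 : u x = 0
    · simp [h0]
    · rw [hx h0, Complex.real_smul]
      push_cast
      ring
  have i51 : Integrable (fun x => ‖u x‖ ^ 5 - μ * ‖u x‖) volume := i5.sub (hu1.norm.const_mul μ)
  have hz := hs.integral_eq_zero h hw1 (i51.ofReal.congr hVw.symm)
  rw [integral_congr_ae hVw, integral_complex_ofReal, Complex.ofReal_eq_zero] at hz
  obtain ⟨k, hk, rfl⟩ : ∃ k : ℝ, 0 ≤ k ∧ k ^ 4 = μ := ⟨μ ^ (1 / 4 : ℝ), by positivity, by
    rw [← Real.rpow_natCast, ← Real.rpow_mul hμ]; norm_num⟩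
  have i26 : Integrable (fun x => k ^ 4 * ‖u x‖ ^ 2 - ‖u x‖ ^ 6) volume := (i2.const_mul _).sub i6
  have e : k ^ 4 * (∫ x, ‖u x‖ ^ 2) - (∫ x, ‖u x‖ ^ 6) + k * ∫ x, (‖u x‖ ^ 5 - k ^ 4 * ‖u x‖)
      = ∫ x, (k ^ 4 * ‖u x‖ ^ 2 - ‖u x‖ ^ 6 + k * (‖u x‖ ^ 5 - k ^ 4 * ‖u x‖)) := by
    rw [integral_add i26 (i51.const_mul k), integral_sub (i2.const_mul _) i6, integral_const_mul, integral_const_mul]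
  have hle : ∫ x, (k ^ 4 * ‖u x‖ ^ 2 - ‖u x‖ ^ 6 + k * (‖u x‖ ^ 5 - k ^ 4 * ‖u x‖)) ≤ 0 := by
    refine integral_nonpos fun x => ?_
    have h0 := norm_nonneg (u x)
    show _ ≤ (0 : ℝ)
    have : k ^ 4 * ‖u x‖ ^ 2 - ‖u x‖ ^ 6 + k * (‖u x‖ ^ 5 - k ^ 4 * ‖u x‖)
        = -(‖u x‖ * ((k - ‖u x‖) ^ 2 * ((k + ‖u x‖) * (k ^ 2 + ‖u x‖ ^ 2)))) := by ring
    rw [this]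
    exact neg_nonpos.2 (by positivity)
  rw [hz, mul_zero, add_zero] at e
  linarith

theorem nonlin_norm (l₁ l₂ : ℝ) {u : Space → ℂ} (hu : AEStronglyMeasurable u volume) :
    nonlin l₁ l₂ (fun x => ((‖u x‖ : ℝ) : ℂ)) = nonlin l₁ l₂ u := by
  have hm : AEStronglyMeasurable (fun x => ((‖u x‖ : ℝ) : ℂ)) volume :=
    Complex.continuous_ofReal.comp_aestronglyMeasurable hu.norm
  simp only [nonlin, dipoleInt, lpNorm_four_pow hm, lpNorm_four_pow hu, Complex.norm_real, norm_norm]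

theorem mass_norm {u : Space → ℂ} (hu : AEStronglyMeasurable u volume) :
    mass (fun x => ((‖u x‖ : ℝ) : ℂ)) = mass u := by
  have hm : AEStronglyMeasurable (fun x => ((‖u x‖ : ℝ) : ℂ)) volume :=
    Complex.continuous_ofReal.comp_aestronglyMeasurable hu.norm
  simp only [mass, lpNorm_two_sq hm, lpNorm_two_sq hu, Complex.norm_real, norm_norm]

theorem sixth_norm {u : Space → ℂ} (hu : AEStronglyMeasurable u volume) :
    lpNorm (fun x => ((‖u x‖ : ℝ) : ℂ)) 6 volume ^ 6 = lpNorm u 6 volume ^ 6 := by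
  have hm : AEStronglyMeasurable (fun x => ((‖u x‖ : ℝ) : ℂ)) volume :=
    Complex.continuous_ofReal.comp_aestronglyMeasurable hu.norm
  simp only [lpNorm_six_pow hm, lpNorm_six_pow hu, Complex.norm_real, norm_norm]

theorem sqLp_norm {u : Space → ℂ} (hu : MemLp u 4 volume)
    (hu' : MemLp (fun x => ((‖u x‖ : ℝ) : ℂ)) 4 volume) : sqLp hu' = sqLp hu :=
  MemLp.toLp_congr _ _ (Eventually.of_forall fun x => by simp)

variable {l₁ l₂ : ℝ} {u : Space → ℂ}

/-- Passing to the modulus preserves minimizers of the Weinstein functional. -/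
theorem exists_norm_minimizer (hu : u ∈ admissible l₁ l₂)
    (hmin : IsMinOn (weinstein l₁ l₂ 1) (admissible l₁ l₂) u) :
    ∃ G, H1Pair (fun x => ((‖u x‖ : ℝ) : ℂ)) G ∧
      gradNorm (fun x => ((‖u x‖ : ℝ) : ℂ)) ^ 2 = gradNorm u ^ 2 ∧
      IsMinOn (weinstein l₁ l₂ 1) (admissible l₁ l₂) (fun x => ((‖u x‖ : ℝ) : ℂ)) := by
  have h := hu.1.h1Pair
  obtain ⟨G, hG, hle⟩ := h.exists_abs
  have hF := hu.2
  obtain ⟨hM0, hA0, hC0⟩ := hu.1.pos_of_nonlin_pos hF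
  have ha : (fun x => ((‖u x‖ : ℝ) : ℂ)) ∈ admissible l₁ l₂ :=
    ⟨hG.memH1, by rw [nonlin_norm _ _ h.memLp.1]; exact hF⟩
  have hle' : gradNorm (fun x => ((‖u x‖ : ℝ) : ℂ)) ^ 2 ≤ gradNorm u ^ 2 := by
    rw [hG.gradNorm_sq, h.gradNorm_sq]; exact hle
  have h4 : weinstein l₁ l₂ 1 u ^ 4 ≤ weinstein l₁ l₂ 1 (fun x => ((‖u x‖ : ℝ) : ℂ)) ^ 4 :=
    pow_le_pow_left₀ (weinstein_nonneg hF.le) (hmin ha) 4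
  have hge : gradNorm u ^ 2 ≤ gradNorm (fun x => ((‖u x‖ : ℝ) : ℂ)) ^ 2 := by
    rw [weinstein_pow_four, weinstein_pow_four, nonlin_norm _ _ h.memLp.1, mass_norm h.memLp.1,
      sixth_norm h.memLp.1, div_le_div_iff_of_pos_right (by positivity)] at h4
    have h5 := le_of_mul_le_mul_right h4 hC0
    have h6 := le_of_mul_le_mul_left h5 (by positivity)
    exact le_of_pow_le_pow_left₀ (by norm_num) (sq_nonneg _) h6
  have hA := le_antisymm hle' hge
  refine ⟨G, hG, hA, fun f hf => ?_⟩
  have e4 : weinstein l₁ l₂ 1 (fun x => ((‖u x‖ : ℝ) : ℂ)) ^ 4 = weinstein l₁ l₂ 1 u ^ 4 := by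
    rw [weinstein_pow_four, weinstein_pow_four, nonlin_norm _ _ h.memLp.1, mass_norm h.memLp.1,
      sixth_norm h.memLp.1, hA]
  have e := (pow_left_inj₀ (weinstein_nonneg ha.2.le) (weinstein_nonneg hF.le) (by norm_num)).1 e4
  show weinstein l₁ l₂ 1 _ ≤ weinstein l₁ l₂ 1 f
  rw [e]
  exact hmin hf

/-- Subtracting the two equations for the same `w` leaves `(V - V') w = 0` in the sense of
distributions. -/
theorem IsWeakPotentialSolution.ae_eq {V V' : Space → ℝ} (hs : IsWeakPotentialSolution V w G)
    (hs' : IsWeakPotentialSolution V' w G) (hV : LocallyIntegrable (fun x => V x • w x) volume)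
    (hV' : LocallyIntegrable (fun x => V' x • w x) volume) :
    ∀ᵐ x, w x ≠ 0 → V x = V' x := by
  have h := ae_eq_zero_of_integral_contDiff_smul_eq_zero (hV.sub hV') fun φ h1 h2 => by
    have hφ : IsTest φ := ⟨h1, h2⟩
    have e1 := hs φ hφ
    have e2 := hs' φ hφ
    have i1 : Integrable (fun x => (φ x * V x) • w x) volume := by
      simpa only [mul_smul] using hφ.integrable_smul hV
    have i2 : Integrable (fun x => (φ x * V' x) • w x) volume := by
      simpa only [mul_smul] using hφ.integrable_smul hV'
    simp only [Pi.sub_apply, smul_sub, smul_smul]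
    rw [integral_sub i1 i2, eq_neg_of_add_eq_zero_right e1, eq_neg_of_add_eq_zero_right e2, sub_self]
  filter_upwards [h] with x hx h0
  rw [Pi.sub_apply, ← sub_smul, smul_eq_zero] at hx
  exact sub_eq_zero.1 (hx.resolve_right h0)

theorem H1Pair.locallyIntegrable_potential (h : H1Pair w G) (α κ : ℝ) {k : Space → ℝ} (hk : MemLp k 2 volume) :
    LocallyIntegrable (fun x => (α + ‖w x‖ ^ 4 - κ * k x) • w x) volume := by
  have hl : LocallyIntegrable (fun x => α • w x + ‖w x‖ ^ 4 • w x - κ • k x • w x) volume :=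
    ((h.locInt.smul α).add h.integrable_four_smul.locallyIntegrable).sub
      ((h.integrable_smul_L2 hk).locallyIntegrable.smul κ)
  refine hl.congr (Eventually.of_forall fun x => ?_)
  simp only [smul_smul, ← add_smul, ← sub_smul]

/-- A square integrable `k` that is a nonzero constant on `{w ≠ 0}` forces this set to have finite
measure, and there `|w| ≤ |w|² + 1`. -/
theorem integrable_of_ne_zero_imp_eq (hw : MemLp w 2 volume) {k : Space → ℝ} (hk : MemLp k 2 volume) {c : ℝ}
    (hc : 0 < c) (h : ∀ᵐ x, w x ≠ 0 → k x = c) : Integrable w volume := by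
  refine ((hw.integrable_norm_pow (p := 2) (by norm_num)).add
    ((hk.integrable_norm_pow (p := 2) (by norm_num)).const_mul (c ^ 2)⁻¹)).mono' hw.1 ?_
  filter_upwards [h] with x hx
  simp only [Pi.add_apply]
  by_cases h0 : w x = 0
  · rw [h0, norm_zero]; positivity
  · rw [hx h0, Real.norm_of_nonneg hc.le, inv_mul_cancel₀ (by positivity)]
    nlinarith [sq_nonneg (‖w x‖ - 1)]

/-- The Euler-Lagrange equation has interaction coefficient `κ = 8A/(3N)`, the prescribed one has
`1`. If they differ, `S|u|²` is a constant `c` where `u ≠ 0`, hence `N = cM` and `κc - α = 2A/M`. So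
`μ = κc - α` satisfies `μM = 2A > A = C`, and the nonexistence result applies to `|u|`, which is
again a minimizer and hence solves the same equation. -/
theorem IsOptimizer.eight_mul_gradNorm_sq (hQ : IsOptimizer l₁ l₂ 1 u) :
    8 * gradNorm u ^ 2 = 3 * nonlin l₁ l₂ u := by
  by_contra hne
  have h := hQ.mem.1.h1Pair
  have hF := hQ.mem.2
  obtain ⟨hM0, hA0, hC0⟩ := hQ.mem.1.pos_of_nonlin_pos hF
  have hn : lpNorm u 6 volume ^ 6 = gradNorm u ^ 2 := by simpa using hQ.normalized
  obtain ⟨ν, hfreq⟩ := hQ.stationary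
  have hk := Lp.memLp (interOp l₁ l₂ (sqLp h.memLp_four))
  have s1 := h.isWeakPotentialSolution hF hQ.isMin hn
  have s2 : IsWeakPotentialSolution (fun x => ν + ‖u x‖ ^ 4
      - 1 * interOp l₁ l₂ (sqLp h.memLp_four) x) u (weakGrad u) := fun φ hφ => by
    rw [← hfreq φ hφ.1 hφ.2]
    congr 1
    refine integral_congr_ae ?_
    filter_upwards [h.interOp_ae l₁ l₂] with x hx
    rw [hx]
    congr 2
    ring
  have hV := s1.ae_eq s2 (h.locallyIntegrable_potential _ _ hk) (h.locallyIntegrable_potential _ _ hk)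
  obtain ⟨G, hG, hA, hmin⟩ := exists_norm_minimizer hQ.mem hQ.isMin
  have hFn : nonlin l₁ l₂ (fun x => ((‖u x‖ : ℝ) : ℂ)) = nonlin l₁ l₂ u := nonlin_norm _ _ h.memLp.1
  have s3 := hG.isWeakPotentialSolution (by rw [hFn]; exact hF) hmin
    (by rw [hA, sixth_norm h.memLp.1]; exact hn)
  rw [hA, hFn, mass_norm h.memLp.1, sqLp_norm h.memLp_four hG.memLp_four] at s3
  have hFk : nonlin l₁ l₂ u = ∫ x, interOp l₁ l₂ (sqLp h.memLp_four) x * ‖u x‖ ^ 2 := by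
    rw [h.nonlin_eq]
    exact inner_toLp_right _ (memLp_norm_sq h.memLp_four)
  generalize (interOp l₁ l₂ (sqLp h.memLp_four) : Space → ℝ) = k at *
  generalize hκ : 8 * gradNorm u ^ 2 / (3 * nonlin l₁ l₂ u) = κ at *
  generalize hα : 2 * gradNorm u ^ 2 / (3 * mass u) = α at *
  have hκ1 : κ - 1 ≠ 0 := fun h0 => hne (by
    have : κ = 1 := by linarith
    rw [this, div_eq_one_iff_eq (by positivity)] at hκ
    exact hκ)
  have hkc : ∀ᵐ x, u x ≠ 0 → k x = (α - ν) / (κ - 1) := hV.mono fun x hx h0 => by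
    rw [eq_div_iff hκ1]
    linarith [hx h0]
  generalize (α - ν) / (κ - 1) = c at *
  have hc : nonlin l₁ l₂ u = c * mass u := by
    rw [hFk, h.mass_eq, ← integral_const_mul]
    refine integral_congr_ae (hkc.mono fun x hx => ?_)
    by_cases h0 : u x = 0
    · simp [h0]
    · simp only [hx h0]
  have hc0 : 0 < c := pos_of_mul_pos_left (hc ▸ hF) hM0.le
  have e1 : κ * c - α = 2 * gradNorm u ^ 2 / mass u := by
    rw [← hκ, ← hα, hc]
    field_simp
    ring
  refine hG.not_isWeakPotentialSolution_of_integrable (integrable_of_ne_zero_imp_eq h.memLp hk hc0 hkc)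
    (μ := κ * c - α) (by rw [e1]; positivity) ?_ ?_ s3
  · rw [← h.mass_eq, ← h.sixth_eq, hn, e1, div_mul_cancel₀ _ hM0.ne']
    linarith
  · filter_upwards [hkc] with x hx h0
    rw [hx h0, Complex.norm_real, norm_norm]
    ring

/-- With `C = A` and `N = 8A/3` all powers of `A` cancel in the Weinstein quotient, leaving only the
mass. -/
theorem IsOptimizer.mass_eq (hQ : IsOptimizer l₁ l₂ 1 u) :
    mass u = (8 / 3 * weinstein l₁ l₂ 1 u) ^ 2 := by
  obtain ⟨hM0, hA0, hC0⟩ := hQ.mem.1.pos_of_nonlin_pos hQ.mem.2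
  have h4 := weinstein_pow_four l₁ l₂ u
  have hn : lpNorm u 6 volume ^ 6 = gradNorm u ^ 2 := by simpa using hQ.normalized
  have hF : nonlin l₁ l₂ u = 8 / 3 * gradNorm u ^ 2 := by linarith [hQ.eight_mul_gradNorm_sq]
  rw [hn, hF] at h4
  have : mass u ^ 2 = ((8 / 3 * weinstein l₁ l₂ 1 u) ^ 2) ^ 2 := by
    rw [← pow_mul, mul_pow, h4]
    generalize gradNorm u ^ 2 = A at *
    field_simp
    norm_num
  exact (pow_left_inj₀ hM0.le (sq_nonneg _) (by norm_num)).1 this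

/-! ### The threshold mass and the sign of the energy -/

/-- The best constant of the Gagliardo-Nirenberg-Hölder inequality with `α = 1`. -/
def gnConst (l₁ l₂ : ℝ) : ℝ := sInf (weinstein l₁ l₂ 1 '' admissible l₁ l₂)

/-- The mass of the optimizers. -/
def thresholdMass (l₁ l₂ : ℝ) : ℝ := (8 / 3 * gnConst l₁ l₂) ^ 2

theorem bddBelow_weinstein (l₁ l₂ : ℝ) : BddBelow (weinstein l₁ l₂ 1 '' admissible l₁ l₂) :=
  ⟨0, by rintro _ ⟨f, hf, rfl⟩; exact weinstein_nonneg hf.2.le⟩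

theorem gnConst_nonneg (l₁ l₂ : ℝ) : 0 ≤ gnConst l₁ l₂ :=
  Real.sInf_nonneg (by rintro _ ⟨f, hf, rfl⟩; exact weinstein_nonneg hf.2.le)

theorem gnConst_le (hu : u ∈ admissible l₁ l₂) : gnConst l₁ l₂ ≤ weinstein l₁ l₂ 1 u :=
  csInf_le (bddBelow_weinstein l₁ l₂) ⟨u, hu, rfl⟩

theorem IsMinOn.weinstein_eq (hu : u ∈ admissible l₁ l₂)
    (hmin : IsMinOn (weinstein l₁ l₂ 1) (admissible l₁ l₂) u) : weinstein l₁ l₂ 1 u = gnConst l₁ l₂ :=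
  le_antisymm (le_csInf ⟨_, u, hu, rfl⟩ (by rintro _ ⟨f, hf, rfl⟩; exact hmin hf)) (gnConst_le hu)

theorem IsOptimizer.mass_eq_thresholdMass (hu : IsOptimizer l₁ l₂ 1 u) : mass u = thresholdMass l₁ l₂ := by
  rw [hu.mass_eq, IsMinOn.weinstein_eq hu.mem hu.isMin, thresholdMass]

/-- From `N⁴ ≤ ‖S‖⁴ M² C²`, one factor `C` being traded for `A³` by Sobolev. -/
theorem gnConst_pos (hne : (admissible l₁ l₂).Nonempty) : 0 < gnConst l₁ l₂ := by
  obtain ⟨S, hS, hSb⟩ := exists_sixth_le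
  set K := ‖interOp l₁ l₂‖ + 1 with hK
  have hK0 : 0 < K := by positivity
  have hlow : ∀ f ∈ admissible l₁ l₂, (K * (S + 1))⁻¹ ≤ weinstein l₁ l₂ 1 f := fun f hf => by
    obtain ⟨hM, hA, hC⟩ := hf.1.pos_of_nonlin_pos hf.2
    have h1 := hf.1.h1Pair.nonlin_sq_le l₁ l₂
    have h2 := hSb f hf.1
    have hF := hf.2
    refine le_of_pow_le_pow_left₀ (n := 4) (by norm_num) (weinstein_nonneg hF.le) ?_
    rw [weinstein_pow_four, inv_pow, inv_le_iff_one_le_mul₀ (by positivity), div_mul_eq_mul_div,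
      one_le_div (by positivity)]
    have h3 : ‖interOp l₁ l₂‖ ^ 2 ≤ K ^ 2 := by gcongr; linarith
    have hS1 : S ≤ (S + 1) ^ 4 := by nlinarith [sq_nonneg S, pow_pos hS 3, pow_pos hS 4]
    calc nonlin l₁ l₂ f ^ 4 = (nonlin l₁ l₂ f ^ 2) ^ 2 := by ring
      _ ≤ (‖interOp l₁ l₂‖ ^ 2 * (mass f * lpNorm f 6 volume ^ 6)) ^ 2 := by gcongr
      _ ≤ (K ^ 2 * (mass f * lpNorm f 6 volume ^ 6)) ^ 2 := by gcongr
      _ = K ^ 4 * mass f ^ 2 * lpNorm f 6 volume ^ 6 * lpNorm f 6 volume ^ 6 := by ring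
      _ ≤ K ^ 4 * mass f ^ 2 * lpNorm f 6 volume ^ 6 * ((S + 1) ^ 4 * (gradNorm f ^ 2) ^ 3) := by
        gcongr
        exact h2.trans (by gcongr)
      _ = _ := by ring
  have : (K * (S + 1))⁻¹ ≤ gnConst l₁ l₂ :=
    le_csInf (hne.image _) (by rintro _ ⟨f, hf, rfl⟩; exact hlow f hf)
  exact lt_of_lt_of_le (by positivity) this

theorem gn_inequality (hu : MemH1 u) (hF : 0 < nonlin l₁ l₂ u) : gnConst l₁ l₂ ^ 4 * nonlin l₁ l₂ u ^ 4
    ≤ mass u ^ 2 * ((gradNorm u ^ 2) ^ 3 * lpNorm u 6 volume ^ 6) := by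
  have h := pow_le_pow_left₀ (gnConst_nonneg l₁ l₂) (gnConst_le ⟨hu, hF⟩) 4
  rwa [weinstein_pow_four, le_div_iff₀ (by positivity), mul_assoc (mass u ^ 2)] at h

/-- AM-GM for the four numbers `A, A, A, C` with an explicit remainder, which shows that equality
forces `A = C`. -/
theorem amgm_three_one (A C : ℝ) : A ^ 3 * C + (C - A) ^ 2 * ((C + 7 * A) ^ 2 + 32 * A ^ 2) / 256
    = 81 / 16 * (A / 2 + C / 6) ^ 4 := by ring

theorem cube_mul_le (A C : ℝ) : A ^ 3 * C ≤ 81 / 16 * (A / 2 + C / 6) ^ 4 := by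
  rw [← amgm_three_one]
  have : 0 ≤ (C - A) ^ 2 * ((C + 7 * A) ^ 2 + 32 * A ^ 2) / 256 := by positivity
  linarith

theorem sixth_nonneg (u : Space → ℂ) : 0 ≤ lpNorm u 6 volume ^ 6 := pow_nonneg lpNorm_nonneg 6

/-- The threshold is chosen so that `(81/16) T² = (4c)⁴`; the sharp inequality and AM-GM then give
`N ≤ 4(A/2 + C/6)`. -/
theorem energy_nonneg (hne : (admissible l₁ l₂).Nonempty) (hu : MemH1 u) (hm : mass u ≤ thresholdMass l₁ l₂) :
    0 ≤ energy l₁ l₂ u := by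
  have hA := sq_nonneg (gradNorm u)
  have hC := sixth_nonneg u
  have hc := gnConst_pos hne
  rw [energy_eq]
  rcases le_or_gt (nonlin l₁ l₂ u) 0 with hF | hF
  · linarith
  have h := gn_inequality hu hF
  have h2 := cube_mul_le (gradNorm u ^ 2) (lpNorm u 6 volume ^ 6)
  have h3 : gnConst l₁ l₂ ^ 4 * nonlin l₁ l₂ u ^ 4
      ≤ gnConst l₁ l₂ ^ 4 * (4 * (gradNorm u ^ 2 / 2 + lpNorm u 6 volume ^ 6 / 6)) ^ 4 := by
    refine h.trans ?_
    calc _ ≤ thresholdMass l₁ l₂ ^ 2 * (81 / 16 * (gradNorm u ^ 2 / 2 + lpNorm u 6 volume ^ 6 / 6) ^ 4) := by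
          have := mass_nonneg u
          gcongr
      _ = _ := by rw [thresholdMass]; ring
  have h4 := le_of_mul_le_mul_left h3 (by positivity)
  have h5 := le_of_pow_le_pow_left₀ (by norm_num) (by positivity) h4
  linarith

theorem MemH1.pos_of_mass_pos (hu : MemH1 u) (hM : 0 < mass u) :
    0 < gradNorm u ^ 2 ∧ 0 < lpNorm u 6 volume ^ 6 := by
  have hC : 0 < lpNorm u 6 volume ^ 6 := by
    refine (sixth_nonneg u).lt_of_ne' fun h0 => hM.ne' ?_
    rw [hu.h1Pair.sixth_eq, integral_eq_zero_iff_of_nonneg (fun x => by positivity) hu.h1Pair.integrable_six] at h0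
    rw [hu.h1Pair.mass_eq, integral_eq_zero_iff_of_nonneg (fun x => by positivity) hu.h1Pair.integrable_sq]
    filter_upwards [h0] with x hx
    simp only [Pi.zero_apply] at hx ⊢
    rw [pow_eq_zero_iff (by norm_num)] at hx ⊢
    exact hx
  refine ⟨(sq_nonneg _).lt_of_ne' fun h0 => ?_, hC⟩
  obtain ⟨S, hS, hSb⟩ := exists_sixth_le
  have := hSb u hu
  rw [h0] at this
  linarith

/-- A function of at most the threshold mass with zero energy is a minimizer of the Weinstein functional. -/
theorem MemH1.of_energy_eq_zero (hne : (admissible l₁ l₂).Nonempty) (hu : MemH1 u) (hM : 0 < mass u)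
    (hm : mass u ≤ thresholdMass l₁ l₂) (hE : energy l₁ l₂ u = 0) :
    mass u = thresholdMass l₁ l₂ ∧ lpNorm u 6 volume ^ 6 = gradNorm u ^ 2 ∧
      8 * gradNorm u ^ 2 = 3 * nonlin l₁ l₂ u ∧ 0 < nonlin l₁ l₂ u ∧
      IsMinOn (weinstein l₁ l₂ 1) (admissible l₁ l₂) u := by
  obtain ⟨hA, hC⟩ := hu.pos_of_mass_pos hM
  have hc := gnConst_pos hne
  rw [energy_eq] at hE
  have hFe : nonlin l₁ l₂ u = 4 * (gradNorm u ^ 2 / 2 + lpNorm u 6 volume ^ 6 / 6) := by linarith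
  have hF : 0 < nonlin l₁ l₂ u := by rw [hFe]; positivity
  have h := gn_inequality hu hF
  have hW := weinstein_pow_four l₁ l₂ u
  have h2 := amgm_three_one (gradNorm u ^ 2) (lpNorm u 6 volume ^ 6)
  have hth : thresholdMass l₁ l₂ ^ 2 = (8 / 3) ^ 4 * gnConst l₁ l₂ ^ 4 := by rw [thresholdMass]; ring
  have hthn : 0 ≤ thresholdMass l₁ l₂ := sq_nonneg _
  have hadm : u ∈ admissible l₁ l₂ := ⟨hu, hF⟩
  suffices hs : mass u = thresholdMass l₁ l₂ ∧ lpNorm u 6 volume ^ 6 = gradNorm u ^ 2 by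
    refine ⟨hs.1, hs.2, by rw [hFe, hs.2]; ring, hF, ?_⟩
    have e : weinstein l₁ l₂ 1 u ^ 4 = gnConst l₁ l₂ ^ 4 := by
      rw [hW, hs.1, hth, hFe, hs.2]
      generalize gradNorm u ^ 2 = A at hA ⊢
      field_simp
      norm_num
    have e1 := (pow_left_inj₀ (weinstein_nonneg hF.le) hc.le (by norm_num)).1 e
    intro f hf
    show weinstein l₁ l₂ 1 u ≤ weinstein l₁ l₂ 1 f
    rw [e1]
    exact gnConst_le hf
  generalize gradNorm u ^ 2 = A at *
  generalize lpNorm u 6 volume ^ 6 = C at *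
  generalize mass u = M at *
  generalize thresholdMass l₁ l₂ = T at *
  generalize gnConst l₁ l₂ = c at *
  rw [hFe] at h
  have hX : 0 < A / 2 + C / 6 := by positivity
  generalize A / 2 + C / 6 = X at *
  -- Zero energy means `N = 4X`, so the sharp inequality bounds `M² A³ C` from below by what `M ≤ T`
  -- and AM-GM allow at most: all of these are equalities.
  have h3 : T ^ 2 * (81 / 16 * X ^ 4) ≤ M ^ 2 * (A ^ 3 * C) := by
    refine le_trans (le_of_eq ?_) h
    rw [hth]; ring
  have hD : 0 ≤ (C - A) ^ 2 * ((C + 7 * A) ^ 2 + 32 * A ^ 2) / 256 := by positivity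
  have hle : M ^ 2 ≤ T ^ 2 := by gcongr
  have h4 : M ^ 2 * (A ^ 3 * C) ≤ M ^ 2 * (81 / 16 * X ^ 4) :=
    mul_le_mul_of_nonneg_left (by linarith) (sq_nonneg M)
  have h5 : T ^ 2 ≤ M ^ 2 := le_of_mul_le_mul_right (h3.trans h4) (by positivity)
  have hMT : M = T := le_antisymm hm (le_of_pow_le_pow_left₀ (by norm_num) hM.le h5)
  refine ⟨hMT, ?_⟩
  subst hMT
  have h6 : 81 / 16 * X ^ 4 ≤ A ^ 3 * C := le_of_mul_le_mul_left h3 (by positivity)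
  have h7 : (C - A) ^ 2 * ((C + 7 * A) ^ 2 + 32 * A ^ 2) / 256 = 0 := by linarith
  have h8 : (C - A) ^ 2 = 0 := by
    rcases mul_eq_zero.1 (div_eq_zero_iff.1 h7 |>.resolve_right (by norm_num)) with h8 | h8
    · exact h8
    · exfalso
      have : 0 < (C + 7 * A) ^ 2 + 32 * A ^ 2 := by positivity
      linarith
  exact sub_eq_zero.1 (pow_eq_zero_iff (by norm_num) |>.1 h8)

/-! ### The function `d`: lower bound, scaling, concavity and continuity -/

theorem MemH1.le_energy (hu : MemH1 u) (l₁ l₂ : ℝ) : gradNorm u ^ 2 / 2 + lpNorm u 6 volume ^ 6 / 12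
    - 3 / 16 * ‖interOp l₁ l₂‖ ^ 2 * mass u ≤ energy l₁ l₂ u := by
  have h := hu.h1Pair.nonlin_sq_le l₁ l₂
  have hC := sixth_nonneg u
  have hM := mass_nonneg u
  rw [energy_eq]
  -- Young's inequality for `N² ≤ ‖S‖² M C`, with the constants fixed by `4 · (1/12) · (3/16) =
  -- 1/16`; half of the term `C/6` is spent.
  have h1 : nonlin l₁ l₂ u / 4 ≤ lpNorm u 6 volume ^ 6 / 12 + 3 / 16 * ‖interOp l₁ l₂‖ ^ 2 * mass u := by
    refine le_of_sq_le_sq ?_ (by positivity)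
    nlinarith [sq_nonneg (lpNorm u 6 volume ^ 6 / 12 - 3 / 16 * ‖interOp l₁ l₂‖ ^ 2 * mass u)]
  linarith

theorem bddBelow_energyValues (l₁ l₂ m : ℝ) : BddBelow (energyValues l₁ l₂ m) := by
  refine ⟨-(3 / 16 * ‖interOp l₁ l₂‖ ^ 2 * m), ?_⟩
  rintro _ ⟨u, hu, rfl, rfl⟩
  have := hu.le_energy l₁ l₂
  have hA := sq_nonneg (gradNorm u)
  have hC := sixth_nonneg u
  linarith

theorem minEnergy_le (hu : MemH1 u) : minEnergy l₁ l₂ (mass u) ≤ energy l₁ l₂ u :=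
  csInf_le (bddBelow_energyValues _ _ _) ⟨u, hu, rfl, rfl⟩

theorem exists_mass_eq (hne : (admissible l₁ l₂).Nonempty) {m : ℝ} (hm : 0 ≤ m) : ∃ u, MemH1 u ∧ mass u = m := by
  obtain ⟨u, hu⟩ := hne
  obtain ⟨hM, -, -⟩ := hu.1.pos_of_nonlin_pos hu.2
  obtain ⟨v, hv, h1, -⟩ := hu.1.exists_scale (Real.sqrt_nonneg (m / mass u)) one_pos l₁ l₂
  refine ⟨v, hv, ?_⟩
  rw [h1, Real.sq_sqrt (by positivity)]
  field_simp

theorem energyValues_nonempty (hne : (admissible l₁ l₂).Nonempty) {m : ℝ} (hm : 0 ≤ m) :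
    (energyValues l₁ l₂ m).Nonempty :=
  let ⟨u, hu, h⟩ := exists_mass_eq hne hm
  ⟨_, u, hu, h, rfl⟩

theorem le_minEnergy (hne : (admissible l₁ l₂).Nonempty) {m b : ℝ} (hm : 0 ≤ m)
    (h : ∀ u, MemH1 u → mass u = m → b ≤ energy l₁ l₂ u) : b ≤ minEnergy l₁ l₂ m :=
  le_csInf (energyValues_nonempty hne hm) (by rintro _ ⟨u, hu, hmu, rfl⟩; exact h u hu hmu)

/-- The spread functions `r⁻³ u(r⁻² x)` have the mass of `u`, and all energy terms vanish as `r →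
∞`. -/
theorem minEnergy_nonpos (hne : (admissible l₁ l₂).Nonempty) {m : ℝ} (hm : 0 ≤ m) : minEnergy l₁ l₂ m ≤ 0 := by
  obtain ⟨u, hu, rfl⟩ := exists_mass_eq hne hm
  have hle : ∀ r : ℝ, 0 < r → minEnergy l₁ l₂ (mass u) ≤ r⁻¹ ^ 4 * (gradNorm u ^ 2 / 2)
      + r⁻¹ ^ 12 * (lpNorm u 6 volume ^ 6 / 6) - r⁻¹ ^ 6 * (nonlin l₁ l₂ u / 4) := fun r hr => by
    obtain ⟨v, hv, h1, h2, h3, h4⟩ := hu.exists_scale (c := r⁻¹ ^ 3) (s := r ^ 2) (by positivity) (by positivity) l₁ l₂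
    have e : mass v = mass u := by rw [h1]; field_simp
    rw [← e]
    refine (minEnergy_le hv).trans (le_of_eq ?_)
    rw [energy_eq, h2, h3, h4]
    field_simp
  have t := tendsto_inv_atTop_zero (𝕜 := ℝ)
  have t2 := (((t.pow 4).mul_const (gradNorm u ^ 2 / 2)).add ((t.pow 12).mul_const (lpNorm u 6 volume ^ 6 / 6))).sub
    ((t.pow 6).mul_const (nonlin l₁ l₂ u / 4))
  refine ge_of_tendsto (by simpa using t2) (eventually_gt_atTop 0 |>.mono hle)

theorem minEnergy_eq_zero (hne : (admissible l₁ l₂).Nonempty) {m : ℝ} (hm : 0 ≤ m)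
    (hm' : m ≤ thresholdMass l₁ l₂) : minEnergy l₁ l₂ m = 0 :=
  le_antisymm (minEnergy_nonpos hne hm)
    (le_minEnergy hne hm fun _ hu hmu => energy_nonneg hne hu (hmu.trans_le hm'))

theorem thresholdMass_pos (hne : (admissible l₁ l₂).Nonempty) : 0 < thresholdMass l₁ l₂ := by
  have := gnConst_pos hne
  rw [thresholdMass]; positivity

theorem minEnergy_zero (hne : (admissible l₁ l₂).Nonempty) : minEnergy l₁ l₂ 0 = 0 :=
  minEnergy_eq_zero hne le_rfl (thresholdMass_pos hne).le

/-- Dilation by `θ^(1/3)` at fixed amplitude multiplies volume integrals by `θ` but the gradient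
term only by `θ^(1/3)`. At `θ = 1` the right side is `E(u)`. -/
theorem minEnergy_mul_le (hne : (admissible l₁ l₂).Nonempty) (hu : MemH1 u) {θ : ℝ} (hθ : 0 ≤ θ) :
    minEnergy l₁ l₂ (θ * mass u) ≤ θ ^ (1 / 3 : ℝ) * (gradNorm u ^ 2 / 2)
      + θ * (lpNorm u 6 volume ^ 6 / 6 - nonlin l₁ l₂ u / 4) := by
  rcases hθ.eq_or_lt with rfl | hθ
  · rw [zero_mul, minEnergy_zero hne, Real.zero_rpow (by norm_num)]
    simp
  obtain ⟨v, hv, h1, h2, h3, h4⟩ := hu.exists_scale (c := 1) (s := θ ^ (1 / 3 : ℝ)) zero_le_one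
    (by positivity) l₁ l₂
  have e : (θ ^ (1 / 3 : ℝ)) ^ 3 = θ := by
    rw [← Real.rpow_natCast, ← Real.rpow_mul hθ.le]; norm_num
  rw [e] at h1 h3 h4
  rw [show θ * mass u = mass v by rw [h1]; ring]
  refine (minEnergy_le hv).trans (le_of_eq ?_)
  rw [energy_eq, h2, h3, h4]
  ring

/-- Given `u` of mass `ax + by`, its dilations of masses `x` and `y` are competitors for `d(x)` and
`d(y)`. The volume terms are linear in the mass ratio and the gradient term is concave in it, so the
weighted average of the bounds is at most `E(u)`. -/
theorem concaveOn_minEnergy (hne : (admissible l₁ l₂).Nonempty) : ConcaveOn ℝ (Ici 0) (minEnergy l₁ l₂) := by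
  refine ⟨convex_Ici 0, fun x hx y hy a b ha hb hab => ?_⟩
  simp only [smul_eq_mul, mem_Ici] at *
  have hnn : 0 ≤ a * x + b * y := by positivity
  rcases hnn.eq_or_lt with h0 | hpos
  · have h1 : a * x = 0 := by nlinarith [mul_nonneg ha hx, mul_nonneg hb hy]
    have h2 : b * y = 0 := by nlinarith [mul_nonneg ha hx, mul_nonneg hb hy]
    have hz : ∀ {c z : ℝ}, c * z = 0 → c * minEnergy l₁ l₂ z = 0 := fun {c z} h => by
      rcases mul_eq_zero.1 h with h | h
      · rw [h, zero_mul]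
      · rw [h, minEnergy_zero hne, mul_zero]
    rw [hz h1, hz h2, ← h0, minEnergy_zero hne, add_zero]
  refine le_minEnergy hne hnn fun u hu hm => ?_
  have h1 := minEnergy_mul_le (l₁ := l₁) (l₂ := l₂) hne hu (div_nonneg hx hnn)
  have h2 := minEnergy_mul_le (l₁ := l₁) (l₂ := l₂) hne hu (div_nonneg hy hnn)
  rw [hm, div_mul_cancel₀ _ hpos.ne'] at h1 h2
  have hc := (Real.concaveOn_rpow (p := 1 / 3) (by norm_num) (by norm_num)).2
    (mem_Ici.2 (div_nonneg hx hnn)) (mem_Ici.2 (div_nonneg hy hnn)) ha hb hab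
  have es : a * (x / (a * x + b * y)) + b * (y / (a * x + b * y)) = 1 := by field_simp
  simp only [smul_eq_mul] at hc
  rw [es, Real.one_rpow] at hc
  rw [energy_eq]
  have hA := sq_nonneg (gradNorm u)
  generalize (x / (a * x + b * y)) ^ (1 / 3 : ℝ) = p at *
  generalize (y / (a * x + b * y)) ^ (1 / 3 : ℝ) = q at *
  generalize (x / (a * x + b * y)) = X at *
  generalize (y / (a * x + b * y)) = Y at *
  calc a * minEnergy l₁ l₂ x + b * minEnergy l₁ l₂ y
      ≤ a * (p * (gradNorm u ^ 2 / 2) + X * (lpNorm u 6 volume ^ 6 / 6 - nonlin l₁ l₂ u / 4))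
        + b * (q * (gradNorm u ^ 2 / 2) + Y * (lpNorm u 6 volume ^ 6 / 6 - nonlin l₁ l₂ u / 4)) := by gcongr
    _ = (a * p + b * q) * (gradNorm u ^ 2 / 2)
        + (a * X + b * Y) * (lpNorm u 6 volume ^ 6 / 6 - nonlin l₁ l₂ u / 4) := by ring
    _ ≤ 1 * (gradNorm u ^ 2 / 2) + 1 * (lpNorm u 6 volume ^ 6 / 6 - nonlin l₁ l₂ u / 4) := by
      rw [es]; gcongr
    _ = _ := by ring

/-- The chord from the origin, where `d` vanishes. Together with `d ≤ 0` it also gives monotonicity.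
-/
theorem div_mul_minEnergy_le (hne : (admissible l₁ l₂).Nonempty) {x y : ℝ} (hx : 0 ≤ x) (hxy : x ≤ y) (hy : 0 < y) :
    x / y * minEnergy l₁ l₂ y ≤ minEnergy l₁ l₂ x := by
  have h := (concaveOn_minEnergy hne).2 (mem_Ici.2 hy.le) (mem_Ici.2 le_rfl) (div_nonneg hx hy.le)
    (sub_nonneg.2 ((div_le_one hy).2 hxy)) (add_sub_cancel _ _)
  simpa [minEnergy_zero hne, div_mul_cancel₀ _ hy.ne'] using h

theorem antitoneOn_minEnergy (hne : (admissible l₁ l₂).Nonempty) : AntitoneOn (minEnergy l₁ l₂) (Ici 0) := by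
  intro x hx y hy hxy
  rw [mem_Ici] at hx hy
  rcases hy.eq_or_lt with rfl | hy
  · rw [le_antisymm hxy hx]
  have h1 := div_mul_minEnergy_le (l₁ := l₁) (l₂ := l₂) hne hx hxy hy
  have h2 := minEnergy_nonpos hne hy.le
  have h3 := (div_le_one hy).2 hxy
  nlinarith

/-- Concavity gives continuity only in the interior; near the endpoint `d` is identically zero,
since the threshold is positive. -/
theorem continuousOn_minEnergy (hne : (admissible l₁ l₂).Nonempty) : ContinuousOn (minEnergy l₁ l₂) (Ici 0) := by
  intro x hx
  rcases (mem_Ici.1 hx).eq_or_lt with rfl | hpos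
  · have hev : ∀ᶠ y in 𝓝[Ici 0] (0 : ℝ), minEnergy l₁ l₂ y = 0 := by
      filter_upwards [self_mem_nhdsWithin, mem_nhdsWithin_of_mem_nhds (Iio_mem_nhds (thresholdMass_pos hne))]
        with y h1 h2
      exact minEnergy_eq_zero hne h1 (le_of_lt h2)
    refine (tendsto_const_nhds.congr' (hev.mono fun y hy => hy.symm)).trans_eq ?_
    rw [minEnergy_zero hne]
  · have h := (concaveOn_minEnergy (l₁ := l₁) (l₂ := l₂) hne).continuousOn_interior
    rw [interior_Ici] at h
    exact (h.continuousAt (Ioi_mem_nhds hpos)).continuousWithinAt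

/-! ### Virial identity and existence of minimizers -/

variable {v : Space → ℂ}

/-- The functions `r³ v(r² x)` keep the mass of `v`, so `r⁴A/2 + r¹²C/6 - r⁶N/4` is minimal at `r =
1`; its derivative there is `2 I(v)`. -/
theorem virial_eq_zero (hv : MemH1 v) (hE : energy l₁ l₂ v = minEnergy l₁ l₂ (mass v)) : virial l₁ l₂ v = 0 := by
  have hmin : IsLocalMin (fun r : ℝ => r ^ 4 * (gradNorm v ^ 2 / 2) + r ^ 12 * (lpNorm v 6 volume ^ 6 / 6)
      - r ^ 6 * (nonlin l₁ l₂ v / 4)) 1 := by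
    filter_upwards [Ioi_mem_nhds one_pos] with r hr
    rw [mem_Ioi] at hr
    obtain ⟨f, hf, h1, h2, h3, h4⟩ := hv.exists_scale (c := r ^ 3) (s := r⁻¹ ^ 2) (by positivity) (by positivity) l₁ l₂
    have e : mass f = mass v := by rw [h1]; field_simp
    have h := minEnergy_le (l₁ := l₁) (l₂ := l₂) hf
    rw [e, ← hE, energy_eq, energy_eq, h2, h3, h4] at h
    refine le_trans (by linarith) (h.trans (le_of_eq ?_))
    field_simp
  have hd := hmin.hasDerivAt_eq_zero ((((hasDerivAt_pow 4 (1 : ℝ)).mul_const (gradNorm v ^ 2 / 2)).add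
    ((hasDerivAt_pow 12 (1 : ℝ)).mul_const (lpNorm v 6 volume ^ 6 / 6))).sub
    ((hasDerivAt_pow 6 (1 : ℝ)).mul_const (nonlin l₁ l₂ v / 4)))
  norm_num at hd
  rw [virial_eq]
  linarith

/-- The relation `8A = 3N` makes the interaction coefficient of the Euler-Lagrange equation equal to
`1`; the frequency is `2A/(3M)`. -/
theorem isOptimizer_of_isMinOn (hu : u ∈ admissible l₁ l₂)
    (hmin : IsMinOn (weinstein l₁ l₂ 1) (admissible l₁ l₂) u)
    (hn : lpNorm u 6 volume ^ 6 = gradNorm u ^ 2) (h8 : 8 * gradNorm u ^ 2 = 3 * nonlin l₁ l₂ u) :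
    IsOptimizer l₁ l₂ 1 u where
  mem := hu
  isMin := hmin
  normalized := by rw [hn, one_mul]
  stationary := by
    have h := hu.1.h1Pair
    have hF := hu.2
    refine ⟨2 * gradNorm u ^ 2 / (3 * mass u), fun φ h1 h2 => ?_⟩
    have hs := h.isWeakPotentialSolution hF hmin hn φ ⟨h1, h2⟩
    rw [h8, div_self (by positivity)] at hs
    rw [← hs]
    congr 1
    refine integral_congr_ae ?_
    filter_upwards [h.interOp_ae l₁ l₂] with x hx
    rw [hx]
    congr 2
    ring

/-- The remainder has energy at least `d` of its own mass, and `d` is continuous, so the asymptotic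
splitting of the energy passes to the limit. -/
theorem exists_profile_energy_le (hne : (admissible l₁ l₂).Nonempty) {u : ℕ → Space → ℂ} {m B c : ℝ}
    (hu : ∀ n, MemH1 (u n)) (hm : ∀ n, mass (u n) = m) (hc : 0 < c) (hA : ∀ n, gradNorm (u n) ^ 2 ≤ B)
    (h4 : ∀ n, c ≤ ∫ x, ‖u n x‖ ^ 4)
    (hE : Tendsto (fun n => energy l₁ l₂ (u n)) atTop (𝓝 (minEnergy l₁ l₂ m))) :
    ∃ v, MemH1 v ∧ 0 < mass v ∧ mass v ≤ m ∧
      energy l₁ l₂ v + minEnergy l₁ l₂ (m - mass v) ≤ minEnergy l₁ l₂ m := by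
  obtain ⟨φ, v, e, hφ, hv, hv0, he, t1, t2⟩ := exists_profile l₁ l₂ hu hc
    (fun n => (hm n).trans_le (le_max_left m B)) (fun n => (hA n).trans (le_max_right m B)) h4
  have t3 : Tendsto (fun n => mass (e n)) atTop (𝓝 (m - mass v)) := by
    simpa [hm] using t1.const_sub m
  have hle : 0 ≤ m - mass v := ge_of_tendsto' t3 fun n => mass_nonneg _
  have t4 : Tendsto (fun n => energy l₁ l₂ (e n)) atTop (𝓝 (minEnergy l₁ l₂ m - energy l₁ l₂ v)) := by
    simpa using (hE.comp hφ.tendsto_atTop).sub t2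
  have t5 : Tendsto (fun n => minEnergy l₁ l₂ (mass (e n))) atTop (𝓝 (minEnergy l₁ l₂ (m - mass v))) :=
    (continuousOn_minEnergy hne (m - mass v) hle).tendsto.comp
      (tendsto_nhdsWithin_iff.2 ⟨t3, Eventually.of_forall fun n => mass_nonneg _⟩)
  have h := le_of_tendsto_of_tendsto' t5 t4 fun n => minEnergy_le (he n)
  exact ⟨v, hv, hv0, by linarith, by linarith⟩

/-- Normalization of an admissible function by scaling. -/
theorem exists_normalized (hu : u ∈ admissible l₁ l₂) {m : ℝ} (hm : 0 < m) :
    ∃ v ∈ admissible l₁ l₂, mass v = m ∧ lpNorm v 6 volume ^ 6 = gradNorm v ^ 2 ∧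
      weinstein l₁ l₂ 1 v = weinstein l₁ l₂ 1 u := by
  have hF := hu.2
  obtain ⟨hM, hA, hC⟩ := hu.1.pos_of_nonlin_pos hF
  -- The unknowns decouple through `p = c²s`: balancing `C` against `A` requires `p² = A/C`, and the
  -- mass requires `p s² = m/M`.
  obtain ⟨p, hp, hp2⟩ : ∃ p : ℝ, 0 < p ∧ p ^ 2 = gradNorm u ^ 2 / lpNorm u 6 volume ^ 6 :=
    ⟨√(gradNorm u ^ 2 / lpNorm u 6 volume ^ 6), by positivity, Real.sq_sqrt (by positivity)⟩
  obtain ⟨s, hs, hs2⟩ : ∃ s : ℝ, 0 < s ∧ s ^ 2 = m / mass u / p :=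
    ⟨√(m / mass u / p), by positivity, Real.sq_sqrt (by positivity)⟩
  obtain ⟨c, hc, hc2⟩ : ∃ c : ℝ, 0 < c ∧ c ^ 2 = p / s :=
    ⟨√(p / s), by positivity, Real.sq_sqrt (by positivity)⟩
  obtain ⟨v, hv, h1, h2, h3, h4⟩ := hu.1.exists_scale hc.le hs l₁ l₂
  have hFv : 0 < nonlin l₁ l₂ v := by rw [h4]; positivity
  refine ⟨v, ⟨hv, hFv⟩, ?_, ?_, ?_⟩
  · rw [h1, hc2, show p / s * s ^ 3 * mass u = s ^ 2 * (p * mass u) by field_simp, hs2]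
    field_simp
  · rw [h3, h2, show c ^ 6 * s ^ 3 = p ^ 2 * (c ^ 2 * s) by
      rw [show c ^ 6 = (c ^ 2) ^ 3 by ring, hc2]; field_simp, hp2]
    generalize lpNorm u 6 volume ^ 6 = C at hC ⊢
    field_simp
  · refine (pow_left_inj₀ (weinstein_nonneg hFv.le) (weinstein_nonneg hF.le) (by norm_num : (4 : ℕ) ≠ 0)).1 ?_
    rw [weinstein_pow_four, weinstein_pow_four, h1, h2, h3, h4]
    rw [div_eq_div_iff (by positivity) (by positivity)]
    ring

theorem weinstein_mul_nonlin (hu : u ∈ admissible l₁ l₂) (hn : lpNorm u 6 volume ^ 6 = gradNorm u ^ 2) :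
    weinstein l₁ l₂ 1 u * nonlin l₁ l₂ u = √(mass u) * gradNorm u ^ 2 := by
  have hF := hu.2
  have hW := weinstein_nonneg hF.le
  refine (pow_left_inj₀ (by positivity) (by positivity) (by norm_num : (4 : ℕ) ≠ 0)).1 ?_
  rw [mul_pow, weinstein_pow_four, hn, div_mul_cancel₀ _ (by positivity), mul_pow,
    show √(mass u) ^ 4 = (√(mass u) ^ 2) ^ 2 by ring, Real.sq_sqrt (mass_nonneg u)]
  ring

theorem sqrt_thresholdMass (l₁ l₂ : ℝ) : √(thresholdMass l₁ l₂) = 8 / 3 * gnConst l₁ l₂ :=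
  Real.sqrt_sq (mul_nonneg (by norm_num) (gnConst_nonneg _ _))

/-- A minimizing sequence of the Weinstein functional, normalized to mass `T` and `C = A`, has
energy `N (W/c - 1)/4`, which tends to `0 = d(T)`. Here `A` and `N` are comparable; `N² ≤ ‖S‖² T A`
bounds them above, and `A = C ≤ S A³` with the Sobolev constant `S` bounds them below. For the
profile `v`, both values of `d` in the splitting are zero, so `E(v) ≤ 0`. -/
theorem exists_energy_eq_zero (hne : (admissible l₁ l₂).Nonempty) :
    ∃ v, MemH1 v ∧ 0 < mass v ∧ mass v ≤ thresholdMass l₁ l₂ ∧ energy l₁ l₂ v = 0 := by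
  have hc := gnConst_pos hne
  have hT := thresholdMass_pos hne
  have hseq : ∀ n : ℕ, ∃ f ∈ admissible l₁ l₂, weinstein l₁ l₂ 1 f < gnConst l₁ l₂ + 1 / ((n : ℝ) + 1) :=
    fun n => by
      obtain ⟨_, ⟨f, hf, rfl⟩, h⟩ := exists_lt_of_csInf_lt (hne.image _)
        (lt_add_of_pos_right (gnConst l₁ l₂) (by positivity : (0 : ℝ) < 1 / ((n : ℝ) + 1)))
      exact ⟨f, hf, h⟩
  choose f hf hfW using hseq
  choose u hu hm hn hW using fun n => exists_normalized (hf n) hT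
  simp only [← hW] at hfW
  set W : ℕ → ℝ := fun n => weinstein l₁ l₂ 1 (u n) with hWdef
  have hWc : ∀ n, gnConst l₁ l₂ ≤ W n := fun n => gnConst_le (hu n)
  have hW1 : ∀ n, W n ≤ gnConst l₁ l₂ + 1 := fun n => (hfW n).le.trans (by
    gcongr
    exact (div_le_one (by positivity)).2 (by linarith [(Nat.cast_nonneg n : (0 : ℝ) ≤ n)]))
  have hWt : Tendsto W atTop (𝓝 (gnConst l₁ l₂)) := by
    refine tendsto_of_tendsto_of_tendsto_of_le_of_le tendsto_const_nhds ?_ hWc fun n => (hfW n).le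
    simpa using tendsto_one_div_add_atTop_nhds_zero_nat.const_add (gnConst l₁ l₂)
  have hWF : ∀ n, W n * nonlin l₁ l₂ (u n) = 8 / 3 * gnConst l₁ l₂ * gradNorm (u n) ^ 2 := fun n => by
    rw [hWdef, weinstein_mul_nonlin (hu n) (hn n), hm, sqrt_thresholdMass]
  set c₁ := gnConst l₁ l₂
  set K := ‖interOp l₁ l₂‖
  have hFpos : ∀ n, 0 < nonlin l₁ l₂ (u n) := fun n => (hu n).2
  have hFA : ∀ n, nonlin l₁ l₂ (u n) ≤ 8 / 3 * gradNorm (u n) ^ 2 := fun n => by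
    refine le_of_mul_le_mul_left (a := c₁) ?_ hc
    calc c₁ * nonlin l₁ l₂ (u n) ≤ W n * nonlin l₁ l₂ (u n) :=
          mul_le_mul_of_nonneg_right (hWc n) (hFpos n).le
      _ = _ := by rw [hWF]; ring
  have hAF : ∀ n, gradNorm (u n) ^ 2 ≤ 3 / 8 * ((c₁ + 1) / c₁) * nonlin l₁ l₂ (u n) := fun n => by
    have h := mul_le_mul_of_nonneg_right (hW1 n) (hFpos n).le
    rw [hWF] at h
    rw [show 3 / 8 * ((c₁ + 1) / c₁) * nonlin l₁ l₂ (u n)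
      = ((c₁ + 1) * nonlin l₁ l₂ (u n)) / (8 / 3 * c₁) by field_simp, le_div_iff₀ (by positivity)]
    linarith
  set R := 3 / 8 * ((c₁ + 1) / c₁) with hR
  have hR0 : 0 < R := by positivity
  have hF2 : ∀ n, nonlin l₁ l₂ (u n) ≤ K ^ 2 * thresholdMass l₁ l₂ * R := fun n => by
    have h := (hu n).1.h1Pair.nonlin_sq_le l₁ l₂
    rw [hm, hn] at h
    refine le_of_mul_le_mul_right (a := nonlin l₁ l₂ (u n)) ?_ (hFpos n)
    calc _ = nonlin l₁ l₂ (u n) ^ 2 := by ring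
      _ ≤ K ^ 2 * (thresholdMass l₁ l₂ * gradNorm (u n) ^ 2) := h
      _ ≤ K ^ 2 * (thresholdMass l₁ l₂ * (R * nonlin l₁ l₂ (u n))) := by
        gcongr; exact hAF n
      _ = _ := by ring
  have hAB : ∀ n, gradNorm (u n) ^ 2 ≤ R * (K ^ 2 * thresholdMass l₁ l₂ * R) := fun n =>
    (hAF n).trans (by gcongr; exact hF2 n)
  obtain ⟨S, hS, hSb⟩ := exists_sixth_le
  have hAlow : ∀ n, 1 / (S + 1) ≤ gradNorm (u n) ^ 2 := fun n => by
    obtain ⟨-, hA, -⟩ := (hu n).1.pos_of_nonlin_pos (hFpos n)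
    have h := hSb (u n) (hu n).1
    rw [hn] at h
    rw [div_le_iff₀ (by positivity)]
    by_contra hlt
    generalize gradNorm (u n) ^ 2 = A at *
    have h1 : 1 ≤ S * A ^ 2 := le_of_mul_le_mul_right (a := A) (by linarith) hA
    have h3 : A < 1 := by nlinarith
    nlinarith
  have hF4 : ∀ n, 1 / (S + 1) / R / (K + 1) ≤ ∫ x, ‖u n x‖ ^ 4 := fun n => by
    rw [div_le_iff₀ (by positivity), div_le_iff₀ (by positivity)]
    have h1 := (le_abs_self _).trans ((hu n).1.h1Pair.nonlin_le l₁ l₂)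
    have h2 : 0 ≤ ∫ x, ‖u n x‖ ^ 4 := integral_nonneg fun x => by positivity
    calc _ ≤ R * nonlin l₁ l₂ (u n) := (hAlow n).trans (hAF n)
      _ ≤ R * ((∫ x, ‖u n x‖ ^ 4) * (K + 1)) := by
        gcongr
        calc _ ≤ _ := h1
          _ ≤ _ := by nlinarith
      _ = _ := by ring
  have hEt : Tendsto (fun n => energy l₁ l₂ (u n)) atTop (𝓝 (minEnergy l₁ l₂ (thresholdMass l₁ l₂))) := by
    rw [minEnergy_eq_zero hne hT.le le_rfl]
    have t : Tendsto (fun n => (K ^ 2 * thresholdMass l₁ l₂ * R) * (W n / c₁ - 1) / 4) atTop (𝓝 0) := by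
      have := (((hWt.div_const c₁).sub_const 1).const_mul (K ^ 2 * thresholdMass l₁ l₂ * R)).div_const 4
      rwa [div_self hc.ne', sub_self, mul_zero, zero_div] at this
    refine squeeze_zero (fun n => energy_nonneg hne (hu n).1 (hm n).le) (fun n => ?_) t
    have e : energy l₁ l₂ (u n) = nonlin l₁ l₂ (u n) * (W n / c₁ - 1) / 4 := by
      have h := hWF n
      have h' : gradNorm (u n) ^ 2 = 3 / 8 * (W n * nonlin l₁ l₂ (u n)) / c₁ := by
        rw [h]; field_simp
      rw [energy_eq, hn, h']
      field_simp
      ring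
    rw [e]
    have : 0 ≤ W n / c₁ - 1 := sub_nonneg.2 ((one_le_div hc).2 (hWc n))
    gcongr
    exact hF2 n
  obtain ⟨v, hv, hv0, hvm, hvE⟩ := exists_profile_energy_le hne (fun n => (hu n).1) hm (by positivity) hAB hF4 hEt
  refine ⟨v, hv, hv0, hvm, le_antisymm ?_ (energy_nonneg hne hv hvm)⟩
  rwa [minEnergy_eq_zero hne hT.le le_rfl, minEnergy_eq_zero hne (by linarith) (by linarith), add_zero] at hvE

/-- The ground state at the threshold mass. -/
theorem exists_threshold_minimizer (hne : (admissible l₁ l₂).Nonempty) :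
    ∃ v, IsOptimizer l₁ l₂ 1 v ∧ mass v = thresholdMass l₁ l₂ ∧ energy l₁ l₂ v = 0 := by
  obtain ⟨v, hv, hv0, hvm, hE⟩ := exists_energy_eq_zero hne
  obtain ⟨h1, h2, h3, h4, h5⟩ := hv.of_energy_eq_zero hne hv0 hvm hE
  exact ⟨v, isOptimizer_of_isMinOn ⟨hv, h4⟩ h5 h2 h3, h1, hE⟩

/-- Dilate the threshold optimizer by the mass ratio `θ = m/T > 1`. With `C = A` and `N = 8A/3` the
bound is `(A/2)(θ^(1/3) - θ) < 0`. -/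
theorem minEnergy_neg (hne : (admissible l₁ l₂).Nonempty) {m : ℝ} (hm : thresholdMass l₁ l₂ < m) :
    minEnergy l₁ l₂ m < 0 := by
  obtain ⟨v, hv, hvm, hE⟩ := exists_threshold_minimizer hne
  have hT := thresholdMass_pos hne
  obtain ⟨-, hA, -⟩ := hv.mem.1.pos_of_nonlin_pos hv.mem.2
  have h8 := hv.eight_mul_gradNorm_sq
  have hn : lpNorm v 6 volume ^ 6 = gradNorm v ^ 2 := by simpa using hv.normalized
  have hθ : 1 < m / thresholdMass l₁ l₂ := (one_lt_div hT).2 hm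
  have h := minEnergy_mul_le (l₁ := l₁) (l₂ := l₂) hne hv.mem.1 (zero_le_one.trans hθ.le)
  rw [hvm, div_mul_cancel₀ _ hT.ne', hn] at h
  have hr : (m / thresholdMass l₁ l₂) ^ (1 / 3 : ℝ) < m / thresholdMass l₁ l₂ := by
    conv_rhs => rw [← Real.rpow_one (m / thresholdMass l₁ l₂)]
    exact Real.rpow_lt_rpow_of_exponent_lt hθ (by norm_num)
  nlinarith

/-- Strictness comes from `d(T) = 0`: below the threshold `d` is zero, and beyond it the chord from
`(T, 0)` to `(m, d(m))` lies strictly above the chord from the origin, because `d(m) < 0`. -/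
theorem div_mul_minEnergy_lt (hne : (admissible l₁ l₂).Nonempty) {a m : ℝ} (ha : 0 < a) (ham : a < m)
    (hm : thresholdMass l₁ l₂ < m) : a / m * minEnergy l₁ l₂ m < minEnergy l₁ l₂ a := by
  have hT := thresholdMass_pos hne
  have hd := minEnergy_neg hne hm
  have hm0 := ha.trans ham
  rcases le_or_gt a (thresholdMass l₁ l₂) with h | h
  · rw [minEnergy_eq_zero hne ha.le h]
    exact mul_neg_of_pos_of_neg (by positivity) hd
  have hmT : 0 < m - thresholdMass l₁ l₂ := sub_pos.2 hm
  have hc := (concaveOn_minEnergy hne).2 (mem_Ici.2 hT.le) (mem_Ici.2 hm0.le)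
    (div_nonneg (sub_nonneg.2 ham.le) hmT.le) (div_nonneg (sub_nonneg.2 h.le) hmT.le)
    (by rw [← add_div, div_eq_one_iff_eq hmT.ne']; ring)
  simp only [smul_eq_mul] at hc
  have e : (m - a) / (m - thresholdMass l₁ l₂) * thresholdMass l₁ l₂
      + (a - thresholdMass l₁ l₂) / (m - thresholdMass l₁ l₂) * m = a := by
    field_simp
    ring
  rw [e, minEnergy_eq_zero hne hT.le le_rfl, mul_zero, zero_add] at hc
  refine lt_of_lt_of_le (mul_lt_mul_of_neg_right ?_ hd) hc
  rw [div_lt_div_iff₀ hmT hm0]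
  nlinarith

/-- Negative energy keeps `N`, hence `∫ |u|⁴`, away from zero. If the profile had mass `a < m`, the
strict chord inequality at `a` and the plain one at `m - a` would give `d(a) + d(m - a) > d(m)`,
against the splitting. -/
theorem exists_minimizer (hne : (admissible l₁ l₂).Nonempty) {m : ℝ} (hm : thresholdMass l₁ l₂ < m) :
    ∃ v, MemH1 v ∧ mass v = m ∧ energy l₁ l₂ v = minEnergy l₁ l₂ m := by
  have hT := thresholdMass_pos hne
  have hm0 := hT.trans hm
  have hd := minEnergy_neg hne hm
  -- The error is scaled by `-d(m)/2`, so that the energies stay below `d(m)/2 < 0` for every `n`,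
  -- not only eventually.
  have hseq : ∀ n : ℕ, ∃ f, MemH1 f ∧ mass f = m ∧
      energy l₁ l₂ f < minEnergy l₁ l₂ m + -minEnergy l₁ l₂ m / 2 * (1 / ((n : ℝ) + 1)) := fun n => by
    obtain ⟨_, ⟨f, hf, hfm, rfl⟩, h⟩ := exists_lt_of_csInf_lt (energyValues_nonempty (l₁ := l₁) (l₂ := l₂) hne hm0.le)
      (lt_add_of_pos_right (minEnergy l₁ l₂ m)
        (mul_pos (half_pos (neg_pos.2 hd)) (by positivity : (0 : ℝ) < 1 / ((n : ℝ) + 1))))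
    exact ⟨f, hf, hfm, h⟩
  choose u hu hum huE using hseq
  have hEt : Tendsto (fun n => energy l₁ l₂ (u n)) atTop (𝓝 (minEnergy l₁ l₂ m)) := by
    refine tendsto_of_tendsto_of_tendsto_of_le_of_le tendsto_const_nhds ?_
      (fun n => by rw [← hum n]; exact minEnergy_le (hu n)) fun n => (huE n).le
    simpa using (tendsto_one_div_add_atTop_nhds_zero_nat.const_mul (-minEnergy l₁ l₂ m / 2)).const_add
      (minEnergy l₁ l₂ m)
  have hE2 : ∀ n, energy l₁ l₂ (u n) ≤ minEnergy l₁ l₂ m / 2 := fun n => by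
    have h1 : 1 / ((n : ℝ) + 1) ≤ 1 :=
      (div_le_one (by positivity)).2 (by linarith [(Nat.cast_nonneg n : (0 : ℝ) ≤ n)])
    nlinarith [huE n]
  set K := ‖interOp l₁ l₂‖
  have hAB : ∀ n, gradNorm (u n) ^ 2 ≤ 3 / 8 * K ^ 2 * m := fun n => by
    have h := (hu n).le_energy l₁ l₂
    rw [hum] at h
    linarith [hE2 n, sixth_nonneg (u n)]
  have hF4 : ∀ n, -minEnergy l₁ l₂ m / (K + 1) ≤ ∫ x, ‖u n x‖ ^ 4 := fun n => by
    rw [div_le_iff₀ (by positivity)]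
    have h1 := (le_abs_self _).trans ((hu n).h1Pair.nonlin_le l₁ l₂)
    have h2 : 0 ≤ ∫ x, ‖u n x‖ ^ 4 := integral_nonneg fun x => by positivity
    have h3 := hE2 n
    rw [energy_eq] at h3
    nlinarith [sq_nonneg (gradNorm (u n)), sixth_nonneg (u n)]
  obtain ⟨v, hv, hv0, hvm, hvE⟩ := exists_profile_energy_le hne hu hum
    (div_pos (neg_pos.2 hd) (by positivity)) hAB hF4 hEt
  rcases hvm.eq_or_lt with h | h
  · rw [h, sub_self, minEnergy_zero hne, add_zero] at hvE
    exact ⟨v, hv, h, le_antisymm hvE (h ▸ minEnergy_le hv)⟩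
  · exfalso
    have h1 := div_mul_minEnergy_lt hne hv0 h hm
    have h2 := div_mul_minEnergy_le (l₁ := l₁) (l₂ := l₂) hne (sub_nonneg.2 h.le)
      (sub_le_self m hv0.le) hm0
    have h3 := minEnergy_le (l₁ := l₁) (l₂ := l₂) hv
    have e : mass v / m * minEnergy l₁ l₂ m + (m - mass v) / m * minEnergy l₁ l₂ m = minEnergy l₁ l₂ m := by
      field_simp
      ring
    linarith

theorem criticalMass_eq (hne : (admissible l₁ l₂).Nonempty) : criticalMass l₁ l₂ = thresholdMass l₁ l₂ := by
  have hT := thresholdMass_pos hne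
  refine (IsGreatest.csSup_eq ⟨⟨hT, minEnergy_eq_zero hne hT.le le_rfl⟩, fun m hm => ?_⟩)
  by_contra hlt
  exact (minEnergy_neg hne (not_le.1 hlt)).ne hm.2

end DipolarNLS

end

theorem mainTheorem7 (l₁ l₂ : ℝ) (hreg : DipolarNLS.UnstableRegime l₁ l₂) :
    -- the normalized optimizer `Q₁` exists
    (∃ Q₁ : DipolarNLS.Space → ℂ, DipolarNLS.IsOptimizer l₁ l₂ 1 Q₁) ∧
    -- `d` is a well-defined real function on `[0, ∞)`
    (∀ m : ℝ, 0 ≤ m → (DipolarNLS.energyValues l₁ l₂ m).Nonempty ∧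
      BddBelow (DipolarNLS.energyValues l₁ l₂ m)) ∧
    AntitoneOn (DipolarNLS.minEnergy l₁ l₂) (Set.Ici 0) ∧
    (∀ m : ℝ, 0 ≤ m → DipolarNLS.minEnergy l₁ l₂ m ≤ 0) ∧
    ConcaveOn ℝ (Set.Ici 0) (DipolarNLS.minEnergy l₁ l₂) ∧
    ContinuousOn (DipolarNLS.minEnergy l₁ l₂) (Set.Ici 0) ∧
    -- every such `Q₁` gives the threshold, and minimizers exist from there on
    (∀ Q₁ : DipolarNLS.Space → ℂ, DipolarNLS.IsOptimizer l₁ l₂ 1 Q₁ →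
      (∀ m : ℝ, 0 ≤ m → m ≤ DipolarNLS.mass Q₁ → DipolarNLS.minEnergy l₁ l₂ m = 0) ∧
      (∀ m : ℝ, DipolarNLS.mass Q₁ < m → DipolarNLS.minEnergy l₁ l₂ m < 0) ∧
      DipolarNLS.criticalMass l₁ l₂ = DipolarNLS.mass Q₁ ∧
      (∀ m : ℝ, DipolarNLS.mass Q₁ ≤ m → ∃ v : DipolarNLS.Space → ℂ,
        DipolarNLS.MemH1 v ∧ DipolarNLS.mass v = m ∧
        DipolarNLS.energy l₁ l₂ v = DipolarNLS.minEnergy l₁ l₂ m ∧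
        DipolarNLS.virial l₁ l₂ v = 0)) := by
  have hne : (DipolarNLS.admissible l₁ l₂).Nonempty := DipolarNLS.exists_nonlin_pos hreg
  obtain ⟨Q, hQ, hQm, hQE⟩ := DipolarNLS.exists_threshold_minimizer hne
  refine ⟨⟨Q, hQ⟩, fun m hm => ⟨DipolarNLS.energyValues_nonempty hne hm,
    DipolarNLS.bddBelow_energyValues l₁ l₂ m⟩, DipolarNLS.antitoneOn_minEnergy hne,
    fun m hm => DipolarNLS.minEnergy_nonpos hne hm, DipolarNLS.concaveOn_minEnergy hne,
    DipolarNLS.continuousOn_minEnergy hne, fun Q₁ hQ₁ => ?_⟩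
  -- All optimizers share the mass `T`, so every claim about `M(Q₁)` is one about `T`. The minimizer
  -- at `m = T` is the optimizer already constructed, whose energy is known to vanish.
  rw [hQ₁.mass_eq_thresholdMass]
  refine ⟨fun m hm hle => DipolarNLS.minEnergy_eq_zero hne hm hle, fun m hm => DipolarNLS.minEnergy_neg hne hm,
    DipolarNLS.criticalMass_eq hne, fun m hm => ?_⟩
  have key : ∃ v, DipolarNLS.MemH1 v ∧ DipolarNLS.mass v = m ∧
      DipolarNLS.energy l₁ l₂ v = DipolarNLS.minEnergy l₁ l₂ m := by
    rcases hm.eq_or_lt with rfl | h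
    · exact ⟨Q, hQ.mem.1, hQm, by
        rw [hQE, DipolarNLS.minEnergy_eq_zero hne (DipolarNLS.thresholdMass_pos hne).le le_rfl]⟩
    · exact DipolarNLS.exists_minimizer hne h
  obtain ⟨v, hv, rfl, hE⟩ := key
  exact ⟨v, hv, rfl, hE, DipolarNLS.virial_eq_zero hv hE⟩
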